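/- Let $d\ge 1$, $T>0$, $a>0$, $\gamma>1$, let $\Omega=(-1,1)^d$ be the cube, and put $p(\varrho)=a\varrho^\gamma$, $P(\varrho)=\frac{a}{\gamma-1}\varrho^\gamma$. A pair $\varrho\in C_{\rm weak}([0,T];L^\gamma(\Omega))$, $\varrho\ge 0$, $m\in C_{\rm weak}([0,T];L^{\frac{2\gamma}{\gamma+1}}(\Omega;\mathbb R^d))$ of finite energy, $\int_\Omega\big[\frac{|m|^2}{2\varrho}+P(\varrho)\big]dx\in L^\infty(0,T)$ and finite at $t=0$, is a *dissipative solution* of the compressible Euler system with impermeable boundary if there are turbulent defect measures $\mathfrak R_v\in L^\infty(0,T;\mathcal M^+(\overline\Omega;\mathbb R^{d\times d}_{\rm sym}))$ (matrix-valued measures ranging in symmetric positive semi-definite matrices) and $\mathfrak R_p\in L^\infty(0,T;\mathcal M^+(\overline\Omega))$ such that 1. for all $0<\tau<T$ and $\varphi\in C^1_c([0,T)\times\overline\Omega)$, $$\Big[\int_\Omega\varrho\varphi\,dx\Big]_{t=0}^{t=\tau}=\int_0^\tau\!\!\int_\Omega\big[\varrho\,\partial_t\varphi+m\cdot\nabla_x\varphi\big]dx\,dt;$$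 2. for all $0<\tau<T$ and $\varphi\in C^1_c([0,T)\times\overline\Omega;\mathbb R^d)$ with $\varphi\cdot n|_{\partial\Omega}=0$, $$\Big[\int_\Omega m\cdot\varphi\,dx\Big]_{t=0}^{t=\tau}=\int_0^\tau\!\!\int_\Omega\Big[m\cdot\partial_t\varphi+\frac{m\otimes m}{\varrho}:\nabla_x\varphi+p(\varrho)\,{\rm div}_x\varphi\Big]dx\,dt+\int_0^\tau\!\!\int_{\overline\Omega}\nabla_x\varphi:d\big[\mathfrak R_v+\mathfrak R_p\mathbb I\big]dt;$$ 3. with the total energy $\mathcal E=\int_\Omega\big[\frac12\frac{|m|^2}{\varrho}+P(\varrho)\big]dx+\frac12\int_{\overline\Omega}d\,{\rm trace}[\mathfrak R_v]+\frac1{\gamma-1}\int_{\overline\Omega}d\mathfrak R_p$, defined for a.a. $t\in(0,T)$, the one-sided (essential) limits $\mathcal E(\tau\pm)$ exist, and $$\big[\psi\,\mathcal E\big]_{t=\tau_1-}^{t=\tau_2+}\le\int_{\tau_1}^{\tau_2}\partial_t\psi\,\mathcal E\,dt\qquad\text{for all }0\le\tau_1\le\tau_2<T,\ \psi\in C^1_c[0,T),\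 \psi\ge 0,$$ where $\mathcal E(0-)=\int_\Omega\big[\frac12\frac{|m(0)|^2}{\varrho(0)}+P(\varrho(0))\big]dx$ is the energy of the initial state. It is a *weak solution* if 1 holds and 2 holds with $\mathfrak R_v=\mathfrak R_p=0$. For an open set $Q$ let $B^{\alpha,\infty}_q(Q)$ be the space of functions with finite norm $$\|v\|_{L^q(Q)}+\sup_{\xi\in Q,\,\xi\neq 0}\frac{\|v(\cdot+\xi)-v\|_{L^q(Q\cap(Q-\xi))}}{|\xi|^\alpha}.$$ **Theorem.** Let $[\varrho,m]$ be a dissipative solution in $(0,T)\times\Omega$ such that - $\varrho\in L^\infty((0,T)\times\Omega)$, $\varrho\ge\underline\varrho>0$ a.e. for a constant $\underline\varrho$, and $m\in L^\infty((0,T)\times\Omega;\mathbb R^d)$; - $\varrho$, $m$ and $u\equiv m/\varrho$ belong to $B^{\alpha,\infty}_3((0,T)\times\Omega)$ for some $\alpha>\frac13$; - $\varrho$, $m$ belong to $L^\infty(0,T;B^{\beta,\infty}_q(\Omega))$ for some $\beta>0$, $q>1$. Suppose that there is $D\in L^1(0,T)$ such that $$\int_0^T\!\!\int_\Omega\Big(-\xi\cdot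 u\,(\xi\cdot\nabla_x)\varphi+D\,|\xi|^2\varphi\Big)dx\,dt\ge 0\qquad\text{for all }\xi\in\mathbb R^d,\ \varphi\in C^1_c((0,T)\times\Omega),\ \varphi\ge 0.$$ Then $\mathfrak R_v(t)=0$ and $\mathfrak R_p(t)=0$ for a.a. $t\in(0,T)$, for any turbulent defect measures $\mathfrak R_v,\mathfrak R_p$ associated to $[\varrho,m]$ in the definition above, and consequently $[\varrho,m]$ is a weak solution of the Euler system. -/

import Mathlib

open MeasureTheory Set Filter Topology
open scoped ENNReal NNReal

noncomputable section

namespace Euler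

/-- The Euclidean space `ℝ^d`. -/
abbrev Space (d : ℕ) : Type := EuclideanSpace ℝ (Fin d)

/-- The open cube `Ω = (-1,1)^d`. -/
def cube (d : ℕ) : Set (Space d) := {x | ∀ i, x i ∈ Ioo (-1 : ℝ) 1}

/-- The closed cube `[-1,1]^d`, the closure of `Ω`. -/
def closedCube (d : ℕ) : Set (Space d) := {x | ∀ i, x i ∈ Icc (-1 : ℝ) 1}

/-- The space-time cylinder `(0,T) × Ω`. -/
def cylinder (d : ℕ) (T : ℝ) : Set (ℝ × Space d) := Ioo 0 T ×ˢ cube d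

/-! ### Constitutive relations and the energy -/

/-- The pressure `p(ρ) = a ρ^γ`. -/
def pressure (a γ r : ℝ) : ℝ := a * r ^ γ

/-- The pressure potential `P(ρ) = a / (γ - 1) ρ^γ`. -/
def pressurePotential (a γ r : ℝ) : ℝ := a / (γ - 1) * r ^ γ

/-- The kinetic energy density `|m|² / (2ρ)` as a convex lower semicontinuous function with values
in `[0,∞]`: it is `0` if `m = 0`, and `∞` if `m ≠ 0` and there is vacuum. -/
def kineticDensity {d : ℕ} (r : ℝ) (v : Space d) : ℝ≥0∞ :=
  if v = 0 then 0 else if 0 < r then ENNReal.ofReal (‖v‖ ^ 2 / (2 * r)) else ⊤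

/-- The energy `∫_Ω (|m|² / (2ρ) + P(ρ)) dx` of a state `(ρ, m)`. -/
def fluidEnergy {d : ℕ} (a γ : ℝ) (r : Space d → ℝ) (v : Space d → Space d) : ℝ≥0∞ :=
  ∫⁻ x in cube d, (kineticDensity (r x) (v x) + ENNReal.ofReal (pressurePotential a γ (r x)))

/-- The velocity `u = m / ρ`. -/
def velocity {d : ℕ} (ρ : ℝ → Space d → ℝ) (m : ℝ → Space d → Space d) : ℝ → Space d → Space d :=
  fun t x => (ρ t x)⁻¹ • m t x

/-! ### Function spaces -/

/-- `f ∈ C_weak([0,T]; L^p(Ω; F))`, for `1 < p < ∞`: every `f t` is in `L^p`, and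
`t ↦ ∫_Ω f(t) · g` is continuous on `[0,T]` for every `g` in the dual space `L^{p'}(Ω; F)`.
The function `f` is moreover represented by a measurable function of `(t,x)`. -/
structure MemCWeak {d : ℕ} {F : Type*} [NormedAddCommGroup F] [InnerProductSpace ℝ F]
    (p T : ℝ) (f : ℝ → Space d → F) : Prop where
  aestronglyMeasurable :
    AEStronglyMeasurable (Function.uncurry f) (volume.restrict (cylinder d T))
  memLp : ∀ t ∈ Icc 0 T, MemLp (f t) (ENNReal.ofReal p) (volume.restrict (cube d))
  continuousOn : ∀ g : Space d → F,
    MemLp g (ENNReal.ofReal p.conjExponent) (volume.restrict (cube d)) →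
      ContinuousOn (fun t => ∫ x in cube d, inner ℝ (f t x) (g x)) (Icc 0 T)

/-- The norm of the Besov space `B^{α,∞}_q(Q)`,
`‖v‖_{L^q(Q)} + sup_{ξ ∈ Q} ‖v(· + ξ) - v‖_{L^q(Q ∩ (Q - ξ))} / |ξ|^α`, with values in `[0,∞]`.
The quotient is `0` at `ξ = 0`. On `ℝ × ℝ^d` the norm `‖ξ‖` of Mathlib is
`max |ξ_t| |ξ_x|`, which is equivalent to the Euclidean one and gives an equivalent Besov norm. -/
def besovNorm {V F : Type*} [NormedAddCommGroup V] [MeasureSpace V] [NormedAddCommGroup F]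
    (α : ℝ) (q : ℝ≥0∞) (Q : Set V) (v : V → F) : ℝ≥0∞ :=
  eLpNorm v q (volume.restrict Q) +
    ⨆ ξ ∈ Q, eLpNorm (fun z => v (z + ξ) - v z) q (volume.restrict (Q ∩ {z | z + ξ ∈ Q})) /
      ENNReal.ofReal (‖ξ‖ ^ α)

/-- `v ∈ B^{α,∞}_q(Q)`. -/
def MemBesov {V F : Type*} [NormedAddCommGroup V] [MeasureSpace V] [NormedAddCommGroup F]
    (α : ℝ) (q : ℝ≥0∞) (Q : Set V) (v : V → F) : Prop :=
  AEStronglyMeasurable v (volume.restrict Q) ∧ besovNorm α q Q v < ⊤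

/-- `v ∈ L^∞(0,T; B^{β,∞}_q(Ω))`. -/
def MemLinftyBesov {d : ℕ} {F : Type*} [NormedAddCommGroup F]
    (β : ℝ) (q : ℝ≥0∞) (T : ℝ) (v : ℝ → Space d → F) : Prop :=
  ∃ C : ℝ≥0, ∀ᵐ t ∂(volume.restrict (Ioo 0 T)),
    AEStronglyMeasurable (v t) (volume.restrict (cube d)) ∧ besovNorm β q (cube d) (v t) ≤ C

/-! ### Measure valued functions of time -/

/-- `R ∈ L^∞(0,T; M⁺(Ω̄))`: a weakly-* measurable family of nonnegative Borel measures on the closed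
cube, with essentially bounded total mass. -/
structure MemLinftyMeasure {d : ℕ} (T : ℝ) (R : ℝ → Measure (closedCube d)) : Prop where
  aemeasurable : ∀ g : C(closedCube d, ℝ),
    AEMeasurable (fun t => ∫ x, g x ∂(R t)) (volume.restrict (Ioo 0 T))
  bounded : ∃ C : ℝ≥0, ∀ᵐ t ∂(volume.restrict (Ioo 0 T)), R t univ ≤ C

/-- `R ∈ L^∞(0,T; M⁺(Ω̄; ℝ^{d×d}_sym))`: a weakly-* measurable, essentially bounded family of
matrices of signed Borel measures on the closed cube, which are symmetric and positive
semi-definite, that is, `R : (ξ ⊗ ξ)` is a nonnegative measure for all `ξ`. -/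
structure MemLinftyPSDMeasure {d : ℕ} (T : ℝ)
    (R : ℝ → Fin d → Fin d → SignedMeasure (closedCube d)) : Prop where
  aemeasurable : ∀ i j, ∀ g : C(closedCube d, ℝ),
    AEMeasurable (fun t => ∫ᵛ x, g x ∂•(R t i j)) (volume.restrict (Ioo 0 T))
  bounded : ∃ C : ℝ≥0, ∀ᵐ t ∂(volume.restrict (Ioo 0 T)),
    ∀ i j, (R t i j).variation univ ≤ C
  symm : ∀ᵐ t ∂(volume.restrict (Ioo 0 T)), ∀ i j, R t i j = R t j i
  nonneg : ∀ᵐ t ∂(volume.restrict (Ioo 0 T)), ∀ ξ : Space d, ∀ A : Set (closedCube d),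
    MeasurableSet A → 0 ≤ ∑ i, ∑ j, ξ i * ξ j * R t i j A

/-! ### Test functions -/

/-- `φ ∈ C¹_c([0,T) × Ω̄; F)`. Functions that are `C¹` up to the boundary of the cube are the
restrictions of `C¹` functions on the whole space. -/
structure IsTest {d : ℕ} {F : Type*} [NormedAddCommGroup F] [NormedSpace ℝ F]
    (T : ℝ) (φ : ℝ → Space d → F) : Prop where
  contDiff : ContDiff ℝ 1 (Function.uncurry φ)
  vanish : ∃ T' < T, ∀ t ∈ Ico 0 T, T' ≤ t → ∀ x ∈ closedCube d, φ t x = 0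

/-- `φ · n = 0` on the boundary of the cube: the `i`-th component vanishes on the faces
`x_i = ± 1`. -/
def NormalVanishes {d : ℕ} (T : ℝ) (φ : ℝ → Space d → Space d) : Prop :=
  ∀ t ∈ Ico 0 T, ∀ x ∈ closedCube d, ∀ i, |x i| = 1 → φ t x i = 0

/-- `φ ∈ C¹_c((0,T) × Ω)`. -/
structure IsInteriorTest {d : ℕ} (T : ℝ) (φ : ℝ → Space d → ℝ) : Prop where
  contDiff : ContDiff ℝ 1 (Function.uncurry φ)
  hasCompactSupport : HasCompactSupport (Function.uncurry φ)
  tsupport_subset : tsupport (Function.uncurry φ) ⊆ cylinder d T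

/-- `∂_t φ (t,x)`. -/
def dt {d : ℕ} {F : Type*} [NormedAddCommGroup F] [NormedSpace ℝ F]
    (φ : ℝ → Space d → F) (t : ℝ) (x : Space d) : F := deriv (fun s => φ s x) t

/-- `(v · ∇_x) φ (t,x)`. -/
def dx {d : ℕ} (φ : ℝ → Space d → ℝ) (t : ℝ) (x v : Space d) : ℝ := fderiv ℝ (φ t) x v

/-- The entry `∂_{x_j} φ_i (t,x)` of `∇_x φ`. -/
def grad {d : ℕ} (φ : ℝ → Space d → Space d) (t : ℝ) (x : Space d) (i j : Fin d) : ℝ :=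
  fderiv ℝ (fun y => φ t y i) x (EuclideanSpace.single j 1)

/-- `div_x φ (t,x)`. -/
def div {d : ℕ} (φ : ℝ → Space d → Space d) (t : ℝ) (x : Space d) : ℝ := ∑ i, grad φ t x i i

/-! ### Solutions -/

/-- The state variables of generalized solutions: `ρ ∈ C_weak([0,T]; L^γ(Ω))`, `ρ ≥ 0`,
`m ∈ C_weak([0,T]; L^{2γ/(γ+1)}(Ω; ℝ^d))`, of finite energy. -/
structure IsState {d : ℕ} (a γ T : ℝ) (ρ : ℝ → Space d → ℝ) (m : ℝ → Space d → Space d) :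
    Prop where
  density : MemCWeak γ T ρ
  nonneg : ∀ t ∈ Icc 0 T, ∀ᵐ x ∂(volume.restrict (cube d)), 0 ≤ ρ t x
  momentum : MemCWeak (2 * γ / (γ + 1)) T m
  energy : ∃ C : ℝ≥0, ∀ᵐ t ∂(volume.restrict (Ioo 0 T)), fluidEnergy a γ (ρ t) (m t) ≤ C
  energy_init : fluidEnergy a γ (ρ 0) (m 0) < ⊤

/-- The weak form of the equation of continuity `∂_t ρ + div_x m = 0` with `m · n = 0` on the
boundary. -/
def ContinuityEq {d : ℕ} (T : ℝ) (ρ : ℝ → Space d → ℝ) (m : ℝ → Space d → Space d) : Prop :=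
  ∀ τ ∈ Ioo 0 T, ∀ φ : ℝ → Space d → ℝ, IsTest T φ →
    (∫ x in cube d, ρ τ x * φ τ x) - ∫ x in cube d, ρ 0 x * φ 0 x =
      ∫ t in (0 : ℝ)..τ, ∫ x in cube d, (ρ t x * dt φ t x + dx φ t x (m t x))

/-- `∫_Ω [m · ∂_t φ + (m ⊗ m / ρ) : ∇_x φ + p(ρ) div_x φ] dx` at the time `t`. -/
def momentumFlux {d : ℕ} (a γ : ℝ) (ρ : ℝ → Space d → ℝ) (m : ℝ → Space d → Space d)
    (φ : ℝ → Space d → Space d) (t : ℝ) : ℝ :=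
  ∫ x in cube d, (inner ℝ (m t x) (dt φ t x) +
    (∑ i, ∑ j, m t x i * m t x j / ρ t x * grad φ t x i j) +
    pressure a γ (ρ t x) * div φ t x)

/-- `∫_{Ω̄} ∇_x φ : d[R_v + R_p I]` at the time `t`. -/
def defectFlux {d : ℕ} (Rv : ℝ → Fin d → Fin d → SignedMeasure (closedCube d))
    (Rp : ℝ → Measure (closedCube d)) (φ : ℝ → Space d → Space d) (t : ℝ) : ℝ :=
  (∑ i, ∑ j, ∫ᵛ x : closedCube d, grad φ t x i j ∂•(Rv t i j)) +
    ∫ x : closedCube d, div φ t x ∂(Rp t)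

/-- The weak form of the momentum equation with the turbulent defect measures `R_v`, `R_p`. -/
def DefectMomentumEq {d : ℕ} (a γ T : ℝ) (ρ : ℝ → Space d → ℝ) (m : ℝ → Space d → Space d)
    (Rv : ℝ → Fin d → Fin d → SignedMeasure (closedCube d))
    (Rp : ℝ → Measure (closedCube d)) : Prop :=
  ∀ τ ∈ Ioo 0 T, ∀ φ : ℝ → Space d → Space d, IsTest T φ → NormalVanishes T φ →
    (∫ x in cube d, inner ℝ (m τ x) (φ τ x)) - ∫ x in cube d, inner ℝ (m 0 x) (φ 0 x) =
      (∫ t in (0 : ℝ)..τ, momentumFlux a γ ρ m φ t) + ∫ t in (0 : ℝ)..τ, defectFlux Rv Rp φ t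

/-- The weak form of the momentum equation `∂_t m + div_x (m ⊗ m / ρ) + ∇_x p(ρ) = 0`. -/
def MomentumEq {d : ℕ} (a γ T : ℝ) (ρ : ℝ → Space d → ℝ) (m : ℝ → Space d → Space d) : Prop :=
  ∀ τ ∈ Ioo 0 T, ∀ φ : ℝ → Space d → Space d, IsTest T φ → NormalVanishes T φ →
    (∫ x in cube d, inner ℝ (m τ x) (φ τ x)) - ∫ x in cube d, inner ℝ (m 0 x) (φ 0 x) =
      ∫ t in (0 : ℝ)..τ, momentumFlux a γ ρ m φ t

/-- The total energy
`∫_Ω (|m|² / (2ρ) + P(ρ)) dx + ½ ∫_{Ω̄} d trace R_v + 1/(γ-1) ∫_{Ω̄} dR_p` at the time `t`. -/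
def totalEnergy {d : ℕ} (a γ : ℝ) (ρ : ℝ → Space d → ℝ) (m : ℝ → Space d → Space d)
    (Rv : ℝ → Fin d → Fin d → SignedMeasure (closedCube d))
    (Rp : ℝ → Measure (closedCube d)) (t : ℝ) : ℝ :=
  (fluidEnergy a γ (ρ t) (m t)).toReal + 1 / 2 * ∑ i, Rv t i i univ +
    1 / (γ - 1) * (Rp t univ).toReal

/-- The energy inequality
`[ψ E]_{t = τ₁-}^{t = τ₂+} ≤ ∫_{τ₁}^{τ₂} ∂_t ψ E dt`. The total energy `E` is defined for almost
every time, so its one-sided limits `E(τ-)`, `E(τ+)` are essential limits; `E(0-)` is the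
energy of the initial state, without any defect. -/
def EnergyInequality {d : ℕ} (a γ T : ℝ) (ρ : ℝ → Space d → ℝ) (m : ℝ → Space d → Space d)
    (Rv : ℝ → Fin d → Fin d → SignedMeasure (closedCube d))
    (Rp : ℝ → Measure (closedCube d)) : Prop :=
  ∃ Eminus Eplus : ℝ → ℝ,
    Eminus 0 = (fluidEnergy a γ (ρ 0) (m 0)).toReal ∧
    (∀ τ ∈ Ioo 0 T,
      Tendsto (totalEnergy a γ ρ m Rv Rp) (𝓝[<] τ ⊓ ae volume) (𝓝 (Eminus τ))) ∧
    (∀ τ ∈ Ico 0 T,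
      Tendsto (totalEnergy a γ ρ m Rv Rp) (𝓝[>] τ ⊓ ae volume) (𝓝 (Eplus τ))) ∧
    ∀ τ₁ τ₂ : ℝ, 0 ≤ τ₁ → τ₁ ≤ τ₂ → τ₂ < T → ∀ ψ : ℝ → ℝ, ContDiff ℝ 1 ψ →
      (∃ T' < T, ∀ t ∈ Ico 0 T, T' ≤ t → ψ t = 0) → (∀ t ∈ Ico 0 T, 0 ≤ ψ t) →
        ψ τ₂ * Eplus τ₂ - ψ τ₁ * Eminus τ₁ ≤
          ∫ t in τ₁..τ₂, deriv ψ t * totalEnergy a γ ρ m Rv Rp t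

/-- `(ρ, m)` is a dissipative solution of the Euler system, and `R_v`, `R_p` are turbulent defect
measures associated to it. -/
structure IsDissipativeSolutionWith {d : ℕ} (a γ T : ℝ) (ρ : ℝ → Space d → ℝ)
    (m : ℝ → Space d → Space d) (Rv : ℝ → Fin d → Fin d → SignedMeasure (closedCube d))
    (Rp : ℝ → Measure (closedCube d)) : Prop where
  state : IsState a γ T ρ m
  convectiveDefect : MemLinftyPSDMeasure T Rv
  pressureDefect : MemLinftyMeasure T Rp
  continuityEq : ContinuityEq T ρ m
  momentumEq : DefectMomentumEq a γ T ρ m Rv Rp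
  energyInequality : EnergyInequality a γ T ρ m Rv Rp

/-- `(ρ, m)` is a dissipative solution of the Euler system. -/
def IsDissipativeSolution {d : ℕ} (a γ T : ℝ) (ρ : ℝ → Space d → ℝ)
    (m : ℝ → Space d → Space d) : Prop :=
  ∃ Rv Rp, IsDissipativeSolutionWith a γ T ρ m Rv Rp

/-- `(ρ, m)` is a weak solution of the Euler system, with the impermeability boundary condition. -/
structure IsWeakSolution {d : ℕ} (a γ T : ℝ) (ρ : ℝ → Space d → ℝ)
    (m : ℝ → Space d → Space d) : Prop where
  state : IsState a γ T ρ m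
  continuityEq : ContinuityEq T ρ m
  momentumEq : MomentumEq a γ T ρ m

/-! ### The regularity class and the one-sided Lipschitz condition -/

/-- The regularity class: `ρ`, `m` bounded, `ρ` bounded below away from zero,
`ρ, m, u ∈ B^{α,∞}_3((0,T) × Ω)` for some `α > 1/3`, and
`ρ, m ∈ L^∞(0,T; B^{β,∞}_q(Ω))` for some `β > 0`, `q > 1`. -/
structure InRegularityClass {d : ℕ} (T : ℝ) (ρ : ℝ → Space d → ℝ)
    (m : ℝ → Space d → Space d) : Prop where
  density_bounded : MemLp (Function.uncurry ρ) ⊤ (volume.restrict (cylinder d T))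
  density_pos : ∃ r > 0, ∀ᵐ z ∂(volume.restrict (cylinder d T)), r ≤ ρ z.1 z.2
  momentum_bounded : MemLp (Function.uncurry m) ⊤ (volume.restrict (cylinder d T))
  besov : ∃ α : ℝ, 1 / 3 < α ∧
    MemBesov α 3 (cylinder d T) (Function.uncurry ρ) ∧
    MemBesov α 3 (cylinder d T) (Function.uncurry m) ∧
    MemBesov α 3 (cylinder d T) (Function.uncurry (velocity ρ m))
  besov_space : ∃ (β : ℝ) (q : ℝ≥0∞), 0 < β ∧ 1 < q ∧
    MemLinftyBesov β q T ρ ∧ MemLinftyBesov β q T m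

/-- The one-sided Lipschitz condition `D u + D I ≥ 0`, in the sense of distributions in
`(0,T) × Ω`, with a function `D` of time. -/
def OneSidedLipschitz {d : ℕ} (T : ℝ) (u : ℝ → Space d → Space d) (D : ℝ → ℝ) : Prop :=
  ∀ ξ : Space d, ∀ φ : ℝ → Space d → ℝ, IsInteriorTest T φ → (∀ t x, 0 ≤ φ t x) →
    0 ≤ ∫ t in (0 : ℝ)..T, ∫ x in cube d,
      (-(inner ℝ ξ (u t x) * dx φ t x ξ) + D t * ‖ξ‖ ^ 2 * φ t x)

end Euler

end

/-!
The proof compares the energy of the fluid with the total energy. The momentum equation is tested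
with a mollification of the velocity `u`, and the equation of continuity with a mollification of
`P'(ρ) - |u|² / 2`, the same mollification of the variables dual to `(ρ, m)` with respect to the
energy. Near the boundary of the cube the mollification uses the reflections at the faces, with a
change of sign of the normal component of the velocity, so that the test fields are tangential.

The mollification kernel is symmetric up to the reflections and localized in time by a cutoff `χ`.
After symmetrization of the resulting double integrals (`integral_mul_antisymm`), only the energy,
multiplied by `χ'`, and terms which are cubic in the increments of `(ρ, u)` remain (`totalFlux_eq`);
the Besov regularity of order `α > 1/3` makes the cubic terms vanish in the limit
(`tendsto_totalFlux`, `tendsto_cubicDefect`). For the reflected increments of the velocity this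
requires that the normal velocity tends to zero at the faces in the mean. Besov functions of order
`α > 1/3` have strong traces in the mean (`HasTraceBound.exists_trace`), and the traces of the normal
momentum are identified by the equation of continuity (`tendsto_faceLayer`). The same trace argument
at `t = 0` shows that the initial energy is attained (`tendsto_initial`, `tendsto_average_energy`).

The one-sided Lipschitz condition passes to the mollified velocity up to the boundary of the cube
(`gradient_mollVelocity_ge`), again since the normal velocity vanishes at the faces. Hence the
contribution of the positive semi-definite defect to the momentum equation is bounded below by
`- c |D|` times the energy of the defect (`defectFlux_ge`), and the energy of the fluid can decrease at most by `c ∫ |D| (defect energy)`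
(`integral_deriv_mul_energy_le`). Together with the energy inequality, this gives a Gronwall
inequality for the energy of the defect, which is zero at the initial time and therefore vanishes
(`ae_eq_zero_of_gronwall`). A positive semi-definite matrix of measures with zero trace is zero.
-/

namespace Euler

/-! ### The mollifier on the line -/

/-- A fixed smooth even mollifier on `ℝ` with support in `[-1,1]` and integral one. -/
noncomputable def bump : ℝ → ℝ :=
  (⟨1 / 2, 1, by norm_num, by norm_num⟩ : ContDiffBump (0 : ℝ)).normed volume

theorem contDiff_bump : ContDiff ℝ 2 bump := ContDiffBump.contDiff_normed _

theorem bump_nonneg (s : ℝ) : 0 ≤ bump s := ContDiffBump.nonneg_normed _ s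

theorem bump_neg (s : ℝ) : bump (-s) = bump s := ContDiffBump.normed_neg _ s

theorem bump_eq_zero {s : ℝ} (hs : 1 ≤ |s|) : bump s = 0 := by
  have h : s ∉ Function.support bump := by
    rw [bump, ContDiffBump.support_normed_eq]
    simpa [Real.norm_eq_abs] using hs
  simpa using h

theorem integral_bump : ∫ s, bump s = 1 := ContDiffBump.integral_normed _

/-- The rescaled mollifier `ε⁻¹ bump (s / ε)`. -/
noncomputable def moll (ε s : ℝ) : ℝ := ε⁻¹ * bump (s / ε)

/-- The derivative of `moll ε`. -/
noncomputable def moll' (ε s : ℝ) : ℝ := ε⁻¹ * (deriv bump (s / ε) / ε)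

theorem hasDerivAt_moll (ε s : ℝ) : HasDerivAt (moll ε) (moll' ε s) s := by
  have h1 : HasDerivAt bump (deriv bump (s / ε)) (s / ε) :=
    (contDiff_bump.differentiable (by norm_num) _).hasDerivAt
  have h2 := (h1.comp s ((hasDerivAt_id s).div_const ε)).const_mul ε⁻¹
  have h3 : moll' ε s = ε⁻¹ * (deriv bump (s / ε) * (1 / ε)) := by
    unfold moll'; rw [mul_one_div]
  rw [h3]
  exact h2

theorem continuous_moll (ε : ℝ) : Continuous (moll ε) :=
  continuous_iff_continuousAt.2 fun s => (hasDerivAt_moll ε s).continuousAt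

theorem continuous_moll' (ε : ℝ) : Continuous (moll' ε) := by
  have : Continuous (deriv bump) := contDiff_bump.continuous_deriv (by norm_num)
  unfold moll'
  fun_prop

theorem moll_nonneg {ε : ℝ} (hε : 0 < ε) (s : ℝ) : 0 ≤ moll ε s :=
  mul_nonneg (by positivity) (bump_nonneg _)

theorem moll_neg (ε s : ℝ) : moll ε (-s) = moll ε s := by
  simp [moll, neg_div, bump_neg]

theorem moll'_neg (ε s : ℝ) : moll' ε (-s) = -moll' ε s := by
  have h1 : HasDerivAt (fun x => moll ε (-x)) (moll' ε (-s) * -1) s :=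
    (hasDerivAt_moll ε (-s)).comp s (hasDerivAt_neg s)
  have h2 : (fun x => moll ε (-x)) = moll ε := funext (moll_neg ε)
  rw [h2] at h1
  have := h1.unique (hasDerivAt_moll ε s)
  linarith

theorem moll_eq_zero {ε s : ℝ} (hε : 0 < ε) (hs : ε ≤ |s|) : moll ε s = 0 := by
  rw [moll, bump_eq_zero, mul_zero]
  rwa [abs_div, abs_of_pos hε, le_div_iff₀ hε, one_mul]

/-- The derivative vanishes wherever the mollifier does, since these are minima. -/
theorem moll'_eq_zero {ε s : ℝ} (hε : 0 < ε) (hs : ε ≤ |s|) : moll' ε s = 0 := by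
  have h : IsLocalMin (moll ε) s := Filter.Eventually.of_forall fun x => by
    rw [moll_eq_zero hε hs]; exact moll_nonneg hε x
  rw [← (hasDerivAt_moll ε s).deriv, h.deriv_eq_zero]

theorem exists_bump_bound : ∃ C : ℝ, 1 ≤ C ∧ (∀ s, bump s ≤ C) ∧ ∀ s, |deriv bump s| ≤ C := by
  have hc : HasCompactSupport bump := ContDiffBump.hasCompactSupport_normed _
  obtain ⟨C₁, h₁⟩ := hc.exists_bound_of_continuous contDiff_bump.continuous
  obtain ⟨C₂, h₂⟩ := hc.deriv.exists_bound_of_continuous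
    (contDiff_bump.continuous_deriv (by norm_num))
  refine ⟨max 1 (max C₁ C₂), le_max_left _ _, fun s => ?_, fun s => ?_⟩
  · exact (le_abs_self _).trans ((h₁ s).trans ((le_max_left _ _).trans (le_max_right _ _)))
  · exact (h₂ s).trans ((le_max_right _ _).trans (le_max_right _ _))

/-- A common bound for `bump` and its derivative. -/
noncomputable def bumpBound : ℝ := exists_bump_bound.choose

theorem one_le_bumpBound : 1 ≤ bumpBound := exists_bump_bound.choose_spec.1

theorem bumpBound_nonneg : 0 ≤ bumpBound := zero_le_one.trans one_le_bumpBound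

theorem moll_le {ε : ℝ} (hε : 0 < ε) (s : ℝ) : moll ε s ≤ bumpBound * ε⁻¹ := by
  rw [moll, mul_comm]
  exact mul_le_mul_of_nonneg_right (exists_bump_bound.choose_spec.2.1 _) (by positivity)

theorem abs_moll_le {ε : ℝ} (hε : 0 < ε) (s : ℝ) : |moll ε s| ≤ bumpBound * ε⁻¹ := by
  rw [abs_of_nonneg (moll_nonneg hε s)]; exact moll_le hε s

theorem abs_moll'_le {ε : ℝ} (hε : 0 < ε) (s : ℝ) : |moll' ε s| ≤ bumpBound * ε⁻¹ ^ 2 := by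
  have h := exists_bump_bound.choose_spec.2.2 (s / ε)
  rw [moll', abs_mul, abs_div, abs_of_pos hε, abs_of_pos (inv_pos.2 hε), div_eq_mul_inv]
  calc ε⁻¹ * (|deriv bump (s / ε)| * ε⁻¹) = |deriv bump (s / ε)| * ε⁻¹ ^ 2 := by ring
    _ ≤ _ := mul_le_mul_of_nonneg_right h (by positivity)

theorem integral_moll {ε : ℝ} (hε : 0 < ε) : ∫ s, moll ε s = 1 := by
  simp only [moll]
  rw [integral_const_mul, Measure.integral_comp_div, integral_bump, abs_of_pos hε]
  simp [hε.ne']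

theorem intervalIntegral_moll {ε a b : ℝ} (hε : 0 < ε) (ha : a ≤ -ε) (hb : ε ≤ b) :
    ∫ s in a..b, moll ε s = 1 := by
  rw [intervalIntegral.integral_of_le (by linarith), ← integral_moll hε]
  refine setIntegral_eq_integral_of_forall_compl_eq_zero fun s hs => moll_eq_zero hε ?_
  by_contra! h
  exact hs ⟨by linarith [(abs_lt.1 h).1], by linarith [(abs_lt.1 h).2]⟩

theorem intervalIntegral_moll' {ε a b : ℝ} (hε : 0 < ε) (ha : a ≤ -ε) (hb : ε ≤ b) :
    ∫ s in a..b, moll' ε s = 0 := by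
  rw [intervalIntegral.integral_eq_sub_of_hasDerivAt (fun s _ => hasDerivAt_moll ε s)
    ((continuous_moll' ε).intervalIntegrable _ _), moll_eq_zero hε, moll_eq_zero hε, sub_zero]
  · rw [abs_of_nonpos (by linarith)]; linarith
  · exact hb.trans (le_abs_self _)

/-! ### Reflections of the interval -/

/-- The sign of the derivative of `flip c`. -/
def flipSign (c : Fin 3) : ℝ := if c = 0 then 1 else -1

/-- The identity and the reflections `y ↦ 2 - y`, `y ↦ -2 - y` at the end points of `[-1,1]`. -/
def flip (c : Fin 3) (y : ℝ) : ℝ := flipSign c * y + (if c = 0 then 0 else if c = 1 then 2 else -2)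

@[simp] theorem flip_zero (y : ℝ) : flip 0 y = y := by simp [flip, flipSign]

@[simp] theorem flip_one (y : ℝ) : flip 1 y = 2 - y := by simp [flip, flipSign]; ring

@[simp] theorem flip_two (y : ℝ) : flip 2 y = -2 - y := by simp [flip, flipSign]; ring

@[simp] theorem flipSign_zero : flipSign 0 = 1 := by simp [flipSign]

@[simp] theorem flipSign_one : flipSign 1 = -1 := by simp [flipSign]

@[simp] theorem flipSign_two : flipSign 2 = -1 := by simp [flipSign]

theorem flipSign_mul_self (c : Fin 3) : flipSign c * flipSign c = 1 := by
  fin_cases c <;> simp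

theorem abs_flipSign (c : Fin 3) : |flipSign c| = 1 := by
  fin_cases c <;> simp

theorem sub_flip_comm (c : Fin 3) (x y : ℝ) : y - flip c x = -flipSign c * (x - flip c y) := by
  fin_cases c <;> simp <;> ring

/-- Reflecting a point of the interval moves it away from the points of the interval. -/
theorem abs_sub_le_abs_sub_flip (c : Fin 3) {x y : ℝ} (hx : x ∈ Icc (-1 : ℝ) 1)
    (hy : y ∈ Icc (-1 : ℝ) 1) : |x - y| ≤ |x - flip c y| := by
  obtain ⟨h1, h2⟩ := hx
  obtain ⟨h3, h4⟩ := hy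
  fin_cases c
  · simp
  · simp only [Fin.mk_one, flip_one]
    rw [abs_le, abs_of_nonpos (by linarith : x - (2 - y) ≤ 0)]
    constructor <;> linarith
  · simp only [Fin.reduceFinMk, flip_two]
    rw [abs_le, abs_of_nonneg (by linarith : 0 ≤ x - (-2 - y))]
    constructor <;> linarith

theorem moll_sub_flip_comm (ε : ℝ) (c : Fin 3) (x y : ℝ) :
    moll ε (y - flip c x) = moll ε (x - flip c y) := by
  rw [sub_flip_comm]
  fin_cases c <;> simp
  rw [← moll_neg]; congr 1; ring

theorem moll'_sub_flip_comm (ε : ℝ) (c : Fin 3) (x y : ℝ) :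
    moll' ε (y - flip c x) = -flipSign c * moll' ε (x - flip c y) := by
  rw [sub_flip_comm]
  fin_cases c <;> simp
  rw [← moll'_neg]; congr 1; ring

theorem continuous_flip (c : Fin 3) : Continuous (flip c) := by unfold flip; fun_prop

/-- The interval and its two reflections cover `[-3,3]`. -/
theorem sum_integral_flip {f : ℝ → ℝ} (hf : Continuous f) :
    ∑ c, ∫ y in Ioo (-1 : ℝ) 1, f (flip c y) = ∫ y in (-3 : ℝ)..3, f y := by
  have key : ∀ g : ℝ → ℝ, ∫ y in Ioo (-1 : ℝ) 1, g y = ∫ y in (-1 : ℝ)..1, g y := fun g => by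
    rw [intervalIntegral.integral_of_le (by norm_num), integral_Ioc_eq_integral_Ioo]
  have hi : ∀ a b : ℝ, IntervalIntegrable f volume a b := fun a b => hf.intervalIntegrable a b
  simp only [key, Fin.sum_univ_three, flip_zero, flip_one, flip_two]
  rw [intervalIntegral.integral_comp_sub_left f 2, intervalIntegral.integral_comp_sub_left f (-2)]
  norm_num
  rw [← intervalIntegral.integral_add_adjacent_intervals (hi (-3) (-1)) (hi (-1) 3),
    ← intervalIntegral.integral_add_adjacent_intervals (hi (-1) 1) (hi 1 3)]
  ring

theorem sum_integral_moll_flip {ε x : ℝ} (hε : 0 < ε) (hε1 : ε ≤ 1) (hx : x ∈ Icc (-1 : ℝ) 1) :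
    ∑ c, ∫ y in Ioo (-1 : ℝ) 1, moll ε (x - flip c y) = 1 := by
  rw [sum_integral_flip (f := fun y => moll ε (x - y))
    ((continuous_moll ε).comp (by fun_prop)), intervalIntegral.integral_comp_sub_left (moll ε) x]
  exact intervalIntegral_moll hε (by linarith [hx.2]) (by linarith [hx.1])

theorem sum_integral_moll'_flip {ε x : ℝ} (hε : 0 < ε) (hε1 : ε ≤ 1) (hx : x ∈ Icc (-1 : ℝ) 1) :
    ∑ c, ∫ y in Ioo (-1 : ℝ) 1, moll' ε (x - flip c y) = 0 := by
  rw [sum_integral_flip (f := fun y => moll' ε (x - y))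
    ((continuous_moll' ε).comp (by fun_prop)), intervalIntegral.integral_comp_sub_left (moll' ε) x]
  exact intervalIntegral_moll' hε (by linarith [hx.2]) (by linarith [hx.1])

/-- The odd reflection of the mollifier vanishes at the end points. -/
theorem sum_flipSign_moll_eq_zero {ε x y : ℝ} (hε : 0 < ε) (hε1 : ε ≤ 1)
    (hx : x ∈ Icc (-1 : ℝ) 1) (hy : |y| = 1) :
    ∑ c, flipSign c * moll ε (x - flip c y) = 0 := by
  simp only [Fin.sum_univ_three, flip_zero, flip_one, flip_two, flipSign_zero, flipSign_one,
    flipSign_two]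
  obtain ⟨h1, h2⟩ := hx
  rcases (abs_eq (by norm_num)).1 hy with rfl | rfl
  · rw [moll_eq_zero (s := x - (-2 - 1)) hε (by rw [abs_of_nonneg] <;> linarith)]
    norm_num
  · rw [moll_eq_zero (s := x - (2 - -1)) hε (by rw [abs_of_nonpos] <;> linarith)]
    norm_num

/-- Near an end point, the odd reflection of the mollifier is bounded by the distance. -/
theorem abs_sum_flipSign_moll_le {ε x y : ℝ} (hε : 0 < ε) (hε1 : ε ≤ 1)
    (hx : x ∈ Icc (-1 : ℝ) 1) :
    |∑ c, flipSign c * moll ε (x - flip c y)| ≤ 3 * bumpBound * ε⁻¹ ^ 2 * |(1 - |y|)| := by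
  have hlip : ∀ s s', |moll ε s - moll ε s'| ≤ bumpBound * ε⁻¹ ^ 2 * |s - s'| := fun s s' => by
    have := Convex.norm_image_sub_le_of_norm_hasDerivWithin_le (f := moll ε) (f' := moll' ε)
      (s := univ) (x := s') (y := s) (C := bumpBound * ε⁻¹ ^ 2)
      (fun z _ => (hasDerivAt_moll ε z).hasDerivWithinAt) (fun z _ => abs_moll'_le hε z)
      convex_univ (mem_univ _) (mem_univ _)
    simpa [Real.norm_eq_abs] using this
  obtain ⟨e, he, hye⟩ : ∃ e : ℝ, |e| = 1 ∧ |y - e| = |(1 - |y|)| := by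
    rcases le_total 0 y with h | h
    · exact ⟨1, by norm_num, by rw [abs_of_nonneg h, abs_sub_comm]⟩
    · refine ⟨-1, by norm_num, by rw [abs_of_nonpos h]; congr 1; ring⟩
  have h0 := sum_flipSign_moll_eq_zero hε hε1 hx he
  rw [← hye, ← sub_zero (∑ c, _), ← h0, ← Finset.sum_sub_distrib]
  refine (Finset.abs_sum_le_sum_abs _ _).trans ?_
  have : ∀ c ∈ (Finset.univ : Finset (Fin 3)),
      |flipSign c * moll ε (x - flip c y) - flipSign c * moll ε (x - flip c e)|
        ≤ bumpBound * ε⁻¹ ^ 2 * |y - e| := fun c _ => by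
    rw [← mul_sub, abs_mul, abs_flipSign, one_mul]
    refine (hlip _ _).trans_eq ?_
    congr 1
    rw [flip, flip, show x - (flipSign c * y + _) - (x - (flipSign c * e + _)) =
      -flipSign c * (y - e) by ring, abs_mul, abs_neg, abs_flipSign, one_mul]
  refine (Finset.sum_le_sum this).trans_eq ?_
  simp
  ring

end Euler

namespace Euler

/-! ### The cube -/

variable {d : ℕ}

theorem isOpen_cube (d : ℕ) : IsOpen (cube d) := by
  have : cube d = ⋂ i, (fun x : Space d => x i) ⁻¹' Ioo (-1 : ℝ) 1 := by
    ext x; simp [cube]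
  rw [this]
  exact isOpen_iInter_of_finite fun i => isOpen_Ioo.preimage (by fun_prop)

theorem measurableSet_cube (d : ℕ) : MeasurableSet (cube d) := (isOpen_cube d).measurableSet

theorem cube_subset_closedCube (d : ℕ) : cube d ⊆ closedCube d :=
  fun _ hx i => Ioo_subset_Icc_self (hx i)

theorem isCompact_closedCube (d : ℕ) : IsCompact (closedCube d) := by
  have h : IsCompact (Set.pi univ fun _ : Fin d => Icc (-1 : ℝ) 1) :=
    isCompact_univ_pi fun _ => isCompact_Icc
  have h2 := h.image (PiLp.continuous_toLp 2 (fun _ : Fin d => ℝ))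
  convert h2
  ext x
  constructor
  · intro hx
    exact ⟨x.ofLp, fun i _ => hx i, rfl⟩
  · rintro ⟨y, hy, rfl⟩ i
    exact hy i (mem_univ i)

theorem volume_cube_lt_top (d : ℕ) : volume (cube d) < ⊤ :=
  (measure_mono (cube_subset_closedCube d)).trans_lt (isCompact_closedCube d).measure_lt_top

instance (d : ℕ) : IsFiniteMeasure (volume.restrict (cube d)) :=
  ⟨by simpa using volume_cube_lt_top d⟩

theorem measurableSet_cylinder (d : ℕ) (T : ℝ) : MeasurableSet (cylinder d T) :=
  measurableSet_Ioo.prod (measurableSet_cube d)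

theorem restrict_cylinder (d : ℕ) (T : ℝ) :
    (volume : Measure (ℝ × Space d)).restrict (cylinder d T) =
      (volume.restrict (Ioo 0 T)).prod (volume.restrict (cube d)) := by
  rw [cylinder, Measure.volume_eq_prod, Measure.prod_restrict]

instance (d : ℕ) (T : ℝ) :
    IsFiniteMeasure ((volume : Measure (ℝ × Space d)).restrict (cylinder d T)) := by
  rw [restrict_cylinder]; infer_instance

/-- Fubini's theorem for products of functions of one coordinate on the cube. -/
theorem integral_cube_prod (f : Fin d → ℝ → ℝ) :
    ∫ x in cube d, ∏ i, f i (x i) = ∏ i, ∫ s in Ioo (-1 : ℝ) 1, f i s := by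
  have h1 : cube d = (fun x : Space d => x.ofLp) ⁻¹' Set.pi univ fun _ => Ioo (-1 : ℝ) 1 := by
    ext x; simp [cube]
  have h2 := (PiLp.volume_preserving_ofLp (Fin d)).setIntegral_preimage_emb
    (MeasurableEquiv.toLp 2 (Fin d → ℝ)).symm.measurableEmbedding
    (fun y : Fin d → ℝ => ∏ i, f i (y i)) (Set.pi univ fun _ => Ioo (-1 : ℝ) 1)
  rw [h1, h2, volume_pi, Measure.restrict_pi_pi, integral_fintype_prod_eq_prod]

/-! ### The reflected mollifier on the cube -/

/-- The product mollifier at `x - r y`, where `r` reflects the `i`-th coordinate by `flip (c i)`. -/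
noncomputable def spaceKer (ε : ℝ) (c : Fin d → Fin 3) (x y : Space d) : ℝ :=
  ∏ i, moll ε (x i - flip (c i) (y i))

/-- The derivative of `spaceKer ε c` with respect to the `j`-th coordinate of `x`. -/
noncomputable def spaceKer' (ε : ℝ) (c : Fin d → Fin 3) (j : Fin d) (x y : Space d) : ℝ :=
  ∏ i, if i = j then moll' ε (x i - flip (c i) (y i)) else moll ε (x i - flip (c i) (y i))

theorem spaceKer'_eq (ε : ℝ) (c : Fin d → Fin 3) (j : Fin d) (x y : Space d) :
    spaceKer' ε c j x y = moll' ε (x j - flip (c j) (y j)) *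
      ∏ i ∈ Finset.univ.erase j, moll ε (x i - flip (c i) (y i)) := by
  rw [spaceKer', ← Finset.mul_prod_erase _ _ (Finset.mem_univ j), if_pos rfl]
  congr 1
  exact Finset.prod_congr rfl fun i hi => if_neg (Finset.ne_of_mem_erase hi)

theorem continuous_spaceKer (ε : ℝ) (c : Fin d → Fin 3) :
    Continuous fun q : Space d × Space d => spaceKer ε c q.1 q.2 := by
  unfold spaceKer
  refine continuous_finsetProd _ fun i _ => (continuous_moll ε).comp ?_
  have := continuous_flip (c i)
  fun_prop

theorem continuous_spaceKer' (ε : ℝ) (c : Fin d → Fin 3) (j : Fin d) :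
    Continuous fun q : Space d × Space d => spaceKer' ε c j q.1 q.2 := by
  unfold spaceKer'
  refine continuous_finsetProd _ fun i _ => ?_
  have := continuous_flip (c i)
  split_ifs
  · exact (continuous_moll' ε).comp (by fun_prop)
  · exact (continuous_moll ε).comp (by fun_prop)

theorem spaceKer_nonneg {ε : ℝ} (hε : 0 < ε) (c : Fin d → Fin 3) (x y : Space d) :
    0 ≤ spaceKer ε c x y :=
  Finset.prod_nonneg fun _ _ => moll_nonneg hε _

theorem spaceKer_eq_zero {ε : ℝ} (hε : 0 < ε) {c : Fin d → Fin 3} {x y : Space d} {i : Fin d}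
    (h : ε ≤ |x i - flip (c i) (y i)|) : spaceKer ε c x y = 0 :=
  Finset.prod_eq_zero (Finset.mem_univ i) (moll_eq_zero hε h)

theorem spaceKer'_eq_zero {ε : ℝ} (hε : 0 < ε) {c : Fin d → Fin 3} {j : Fin d} {x y : Space d}
    {i : Fin d} (h : ε ≤ |x i - flip (c i) (y i)|) : spaceKer' ε c j x y = 0 := by
  refine Finset.prod_eq_zero (Finset.mem_univ i) ?_
  split_ifs
  · exact moll'_eq_zero hε h
  · exact moll_eq_zero hε h

theorem abs_spaceKer_le {ε : ℝ} (hε : 0 < ε) (c : Fin d → Fin 3) (x y : Space d) :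
    |spaceKer ε c x y| ≤ (bumpBound * ε⁻¹) ^ d := by
  rw [spaceKer, Finset.abs_prod]
  refine (Finset.prod_le_prod (fun _ _ => abs_nonneg _)
    fun i _ => abs_moll_le hε _).trans_eq ?_
  simp

theorem abs_spaceKer'_le {ε : ℝ} (hε : 0 < ε) (c : Fin d → Fin 3) (j : Fin d) (x y : Space d) :
    |spaceKer' ε c j x y| ≤ (bumpBound * ε⁻¹) ^ d * ε⁻¹ := by
  rw [spaceKer'_eq, abs_mul, Finset.abs_prod]
  have h1 : ∏ i ∈ Finset.univ.erase j, |moll ε (x i - flip (c i) (y i))| ≤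
      ∏ i ∈ Finset.univ.erase j, bumpBound * ε⁻¹ :=
    Finset.prod_le_prod (fun _ _ => abs_nonneg _) fun i _ => abs_moll_le hε _
  have h2 : (bumpBound * ε⁻¹) ^ d = bumpBound * ε⁻¹ *
      ∏ i ∈ Finset.univ.erase j, bumpBound * ε⁻¹ := by
    rw [Finset.mul_prod_erase _ (fun _ => bumpBound * ε⁻¹) (Finset.mem_univ j)]
    simp
  have h3 : 0 ≤ ∏ i ∈ Finset.univ.erase j, |moll ε (x i - flip (c i) (y i))| :=
    Finset.prod_nonneg fun _ _ => abs_nonneg _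
  have hB := bumpBound_nonneg
  calc _ ≤ (bumpBound * ε⁻¹ ^ 2) * ∏ i ∈ Finset.univ.erase j, bumpBound * ε⁻¹ :=
        mul_le_mul (abs_moll'_le hε _) h1 h3 (by positivity)
    _ = _ := by rw [h2]; ring

theorem spaceKer_comm (ε : ℝ) (c : Fin d → Fin 3) (x y : Space d) :
    spaceKer ε c y x = spaceKer ε c x y :=
  Finset.prod_congr rfl fun _ _ => moll_sub_flip_comm _ _ _ _

theorem spaceKer'_comm (ε : ℝ) (c : Fin d → Fin 3) (j : Fin d) (x y : Space d) :
    spaceKer' ε c j y x = -flipSign (c j) * spaceKer' ε c j x y := by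
  rw [spaceKer'_eq, spaceKer'_eq, moll'_sub_flip_comm, mul_assoc]
  congr 2
  exact Finset.prod_congr rfl fun _ _ => moll_sub_flip_comm _ _ _ _

theorem hasFDerivAt_spaceKer (ε : ℝ) (c : Fin d → Fin 3) (x y : Space d) :
    HasFDerivAt (fun x => spaceKer ε c x y)
      (∑ j, spaceKer' ε c j x y • (EuclideanSpace.proj j : Space d →L[ℝ] ℝ)) x := by
  have h : ∀ i ∈ (Finset.univ : Finset (Fin d)),
      HasFDerivAt (fun x : Space d => moll ε (x i - flip (c i) (y i)))
        (moll' ε (x i - flip (c i) (y i)) • (EuclideanSpace.proj i : Space d →L[ℝ] ℝ)) x := fun i _ =>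
    (hasDerivAt_moll ε _).comp_hasFDerivAt x
      ((EuclideanSpace.proj i : Space d →L[ℝ] ℝ).hasFDerivAt.sub_const _)
  have h2 := HasFDerivAt.finsetProd h
  refine h2.congr_fderiv (Finset.sum_congr rfl fun j _ => ?_)
  rw [spaceKer'_eq, mul_comm, mul_smul]

theorem hasFDerivAt_spaceKer_right (ε : ℝ) (c : Fin d → Fin 3) (x y : Space d) :
    HasFDerivAt (fun y => spaceKer ε c x y)
      (∑ j, (-flipSign (c j) * spaceKer' ε c j x y) • (EuclideanSpace.proj j : Space d →L[ℝ] ℝ)) y := by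
  have := hasFDerivAt_spaceKer ε c y x
  simpa only [spaceKer_comm ε c x, spaceKer'_comm ε c _ x] using this

theorem sum_prod_flip (f : Fin d → Fin 3 → ℝ) :
    ∑ c : Fin d → Fin 3, ∏ i, f i (c i) = ∏ i, ∑ c, f i c := by
  rw [Finset.prod_univ_sum, Fintype.piFinset_univ]

theorem sum_integral_spaceKer {ε : ℝ} (hε : 0 < ε) (hε1 : ε ≤ 1) {x : Space d}
    (hx : x ∈ closedCube d) : ∑ c, ∫ y in cube d, spaceKer ε c x y = 1 := by
  have : ∀ c : Fin d → Fin 3, ∫ y in cube d, spaceKer ε c x y =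
      ∏ i, ∫ s in Ioo (-1 : ℝ) 1, moll ε (x i - flip (c i) s) := fun c =>
    integral_cube_prod fun i s => moll ε (x i - flip (c i) s)
  simp only [this]
  rw [sum_prod_flip fun i c => ∫ s in Ioo (-1 : ℝ) 1, moll ε (x i - flip c s)]
  exact Finset.prod_eq_one fun i _ => sum_integral_moll_flip hε hε1 (hx i)

theorem sum_integral_spaceKer' {ε : ℝ} (hε : 0 < ε) (hε1 : ε ≤ 1) {x : Space d} (j : Fin d)
    (hx : x ∈ closedCube d) : ∑ c, ∫ y in cube d, spaceKer' ε c j x y = 0 := by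
  have : ∀ c : Fin d → Fin 3, ∫ y in cube d, spaceKer' ε c j x y =
      ∏ i, ∫ s in Ioo (-1 : ℝ) 1, if i = j then moll' ε (x i - flip (c i) s)
        else moll ε (x i - flip (c i) s) := fun c =>
    integral_cube_prod fun i s => if i = j then moll' ε (x i - flip (c i) s)
        else moll ε (x i - flip (c i) s)
  simp only [this]
  rw [sum_prod_flip fun i c => ∫ s in Ioo (-1 : ℝ) 1, if i = j then moll' ε (x i - flip c s)
        else moll ε (x i - flip c s)]
  refine Finset.prod_eq_zero (Finset.mem_univ j) ?_
  simpa using sum_integral_moll'_flip hε hε1 (hx j)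

/-- The kernel of the reflected mollification of a normal component vanishes on the faces. -/
theorem sum_flipSign_spaceKer_eq_zero {ε : ℝ} (hε : 0 < ε) (hε1 : ε ≤ 1) {x y : Space d}
    {i : Fin d} (hx : |x i| = 1) (hy : y ∈ closedCube d) :
    ∑ c : Fin d → Fin 3, flipSign (c i) * spaceKer ε c x y = 0 := by
  have h : ∀ c : Fin d → Fin 3, flipSign (c i) * spaceKer ε c x y =
      ∏ k, (if k = i then flipSign (c k) else 1) * moll ε (x k - flip (c k) (y k)) := fun c => by
    rw [Finset.prod_mul_distrib, spaceKer]; simp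
  simp only [h]
  rw [sum_prod_flip fun k c => (if k = i then flipSign c else 1) * moll ε (x k - flip c (y k))]
  refine Finset.prod_eq_zero (Finset.mem_univ i) ?_
  have := sum_flipSign_moll_eq_zero hε hε1 (hy i) hx
  simpa only [if_true, moll_sub_flip_comm ε _ (x i)] using this

/-- Off the diagonal, the signed sum of the kernels vanishes on the face `|y i| = 1`, because the
contributions of a point and of its reflection cancel there. -/
theorem abs_sum_flipSign_flipSign_spaceKer_le {ε : ℝ} (hε : 0 < ε) (hε1 : ε ≤ 1) {x : Space d}
    (y : Space d) {i j : Fin d} (hij : i ≠ j) (hx : x ∈ closedCube d) :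
    |∑ c : Fin d → Fin 3, flipSign (c i) * flipSign (c j) * spaceKer ε c x y| ≤
      (3 * bumpBound * ε⁻¹) ^ d * ε⁻¹ * |(1 - |y i|)| := by
  let s : Fin d → Fin 3 → ℝ := fun k c =>
    (if k = i then flipSign c else 1) * (if k = j then flipSign c else 1)
  have hs : ∀ k c, |s k c| ≤ 1 := fun k c => by
    simp only [s]; split_ifs <;> simp [abs_mul, abs_flipSign]
  have h : ∀ c : Fin d → Fin 3, flipSign (c i) * flipSign (c j) * spaceKer ε c x y =
      ∏ k, s k (c k) * moll ε (x k - flip (c k) (y k)) := fun c => by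
    simp only [s]
    rw [Finset.prod_mul_distrib, Finset.prod_mul_distrib, spaceKer]; simp
  have hB := bumpBound_nonneg
  simp only [h]
  rw [sum_prod_flip fun k c => s k c * moll ε (x k - flip c (y k)), Finset.abs_prod,
    ← Finset.mul_prod_erase _ _ (Finset.mem_univ i)]
  have h1 : |∑ c, s i c * moll ε (x i - flip c (y i))| ≤
      3 * bumpBound * ε⁻¹ ^ 2 * |(1 - |y i|)| := by
    have : ∀ c, s i c = flipSign c := fun c => by simp [s, hij]
    simp only [this]
    exact abs_sum_flipSign_moll_le hε hε1 (hx i)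
  have h2 : ∏ k ∈ Finset.univ.erase i, |∑ c, s k c * moll ε (x k - flip c (y k))| ≤
      ∏ k ∈ Finset.univ.erase i, 3 * bumpBound * ε⁻¹ := by
    refine Finset.prod_le_prod (fun _ _ => abs_nonneg _) fun k _ => ?_
    refine (Finset.abs_sum_le_sum_abs _ _).trans ?_
    have : ∀ c ∈ (Finset.univ : Finset (Fin 3)),
        |s k c * moll ε (x k - flip c (y k))| ≤ bumpBound * ε⁻¹ := fun c _ => by
      rw [abs_mul]
      calc _ ≤ 1 * (bumpBound * ε⁻¹) :=
            mul_le_mul (hs k c) (abs_moll_le hε _) (abs_nonneg _) zero_le_one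
        _ = _ := one_mul _
    refine (Finset.sum_le_sum this).trans_eq ?_
    simp; ring
  have h3 : (3 * bumpBound * ε⁻¹) ^ d = 3 * bumpBound * ε⁻¹ *
      ∏ k ∈ Finset.univ.erase i, 3 * bumpBound * ε⁻¹ := by
    rw [Finset.mul_prod_erase _ (fun _ => 3 * bumpBound * ε⁻¹) (Finset.mem_univ i)]
    simp
  calc _ ≤ 3 * bumpBound * ε⁻¹ ^ 2 * |(1 - |y i|)| *
        ∏ k ∈ Finset.univ.erase i, 3 * bumpBound * ε⁻¹ :=
        mul_le_mul h1 h2 (Finset.prod_nonneg fun _ _ => abs_nonneg _) (by positivity)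
    _ = _ := by rw [h3]; ring

/-! ### The kernel in space and time -/

/-- The time factor `χ((t + t') / 2) η_ε(t - t')`. -/
noncomputable def timeKer (χ : ℝ → ℝ) (ε t t' : ℝ) : ℝ := χ ((t + t') / 2) * moll ε (t - t')

/-- The part of `∂_t timeKer` that is antisymmetric in the two times. -/
noncomputable def timeKerAnti (χ : ℝ → ℝ) (ε t t' : ℝ) : ℝ := χ ((t + t') / 2) * moll' ε (t - t')

/-- The part of `∂_t timeKer` that is symmetric in the two times. -/
noncomputable def timeKerSymm (χ : ℝ → ℝ) (ε t t' : ℝ) : ℝ :=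
  deriv χ ((t + t') / 2) / 2 * moll ε (t - t')

theorem timeKer_comm (χ : ℝ → ℝ) (ε t t' : ℝ) : timeKer χ ε t' t = timeKer χ ε t t' := by
  rw [timeKer, timeKer, ← neg_sub t t', moll_neg, add_comm]

theorem timeKerAnti_comm (χ : ℝ → ℝ) (ε t t' : ℝ) :
    timeKerAnti χ ε t' t = -timeKerAnti χ ε t t' := by
  rw [timeKerAnti, timeKerAnti, ← neg_sub t t', moll'_neg, add_comm, mul_neg]

theorem timeKerSymm_comm (χ : ℝ → ℝ) (ε t t' : ℝ) :
    timeKerSymm χ ε t' t = timeKerSymm χ ε t t' := by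
  rw [timeKerSymm, timeKerSymm, ← neg_sub t t', moll_neg, add_comm]

theorem hasDerivAt_timeKer {χ : ℝ → ℝ} (hχ : ContDiff ℝ 1 χ) (ε t t' : ℝ) :
    HasDerivAt (fun t => timeKer χ ε t t') (timeKerAnti χ ε t t' + timeKerSymm χ ε t t') t := by
  have h1 : HasDerivAt χ (deriv χ ((t + t') / 2)) ((t + t') / 2) :=
    (hχ.differentiable (by norm_num) _).hasDerivAt
  have h2 : HasDerivAt (fun t => χ ((t + t') / 2)) (deriv χ ((t + t') / 2) * (1 / 2)) t :=
    h1.comp t (((hasDerivAt_id t).add_const t').div_const 2)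
  have h3 : HasDerivAt (fun t => moll ε (t - t')) (moll' ε (t - t')) t :=
    (hasDerivAt_moll ε (t - t')).comp_sub_const t t'
  refine (h2.mul h3).congr_deriv ?_
  rw [timeKerAnti, timeKerSymm]
  ring

theorem hasDerivAt_timeKer_right {χ : ℝ → ℝ} (hχ : ContDiff ℝ 1 χ) (ε t t' : ℝ) :
    HasDerivAt (fun t' => timeKer χ ε t t') (-timeKerAnti χ ε t t' + timeKerSymm χ ε t t') t' := by
  have := hasDerivAt_timeKer hχ ε t' t
  simpa only [timeKer_comm χ ε t, timeKerAnti_comm χ ε t, timeKerSymm_comm χ ε t] using this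

theorem continuous_timeKer {χ : ℝ → ℝ} (hχ : ContDiff ℝ 1 χ) (ε : ℝ) :
    Continuous fun q : ℝ × ℝ => timeKer χ ε q.1 q.2 := by
  have h1 := hχ.continuous
  have h2 := continuous_moll ε
  unfold timeKer; fun_prop

theorem continuous_timeKerAnti {χ : ℝ → ℝ} (hχ : ContDiff ℝ 1 χ) (ε : ℝ) :
    Continuous fun q : ℝ × ℝ => timeKerAnti χ ε q.1 q.2 := by
  have h1 := hχ.continuous
  have h2 := continuous_moll' ε
  unfold timeKerAnti; fun_prop

theorem continuous_timeKerSymm {χ : ℝ → ℝ} (hχ : ContDiff ℝ 1 χ) (ε : ℝ) :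
    Continuous fun q : ℝ × ℝ => timeKerSymm χ ε q.1 q.2 := by
  have h1 := hχ.continuous_deriv le_rfl
  have h2 := continuous_moll ε
  unfold timeKerSymm; fun_prop

end Euler

namespace Euler

variable {d : ℕ}

/-! ### Cutoffs in time -/

/-- A nonnegative `C¹` function supported in `[2δ, T - 2δ]`. -/
structure IsTimeCutoff (T δ : ℝ) (χ : ℝ → ℝ) : Prop where
  contDiff : ContDiff ℝ 1 χ
  nonneg : ∀ t, 0 ≤ χ t
  eq_zero : ∀ t, t ∉ Ioo (2 * δ) (T - 2 * δ) → χ t = 0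

variable {T δ ε : ℝ} {χ : ℝ → ℝ}

theorem IsTimeCutoff.deriv_eq_zero (hχ : IsTimeCutoff T δ χ) {t : ℝ}
    (ht : t ∉ Ioo (2 * δ) (T - 2 * δ)) : deriv χ t = 0 := by
  have h : IsLocalMin χ t := Filter.Eventually.of_forall fun x => by
    rw [hχ.eq_zero t ht]; exact hχ.nonneg x
  exact h.deriv_eq_zero

theorem IsTimeCutoff.exists_bound (hχ : IsTimeCutoff T δ χ) :
    ∃ C, 0 ≤ C ∧ (∀ t, |χ t| ≤ C) ∧ ∀ t, |deriv χ t| ≤ C := by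
  obtain ⟨C₁, h₁⟩ := isCompact_Icc.exists_bound_of_continuousOn (s := Icc (2 * δ) (T - 2 * δ))
    hχ.contDiff.continuous.continuousOn
  obtain ⟨C₂, h₂⟩ := isCompact_Icc.exists_bound_of_continuousOn (s := Icc (2 * δ) (T - 2 * δ))
    (hχ.contDiff.continuous_deriv le_rfl).continuousOn
  refine ⟨max 0 (max C₁ C₂), le_max_left _ _, fun t => ?_, fun t => ?_⟩ <;>
  by_cases ht : t ∈ Ioo (2 * δ) (T - 2 * δ)
  · exact (h₁ t (Ioo_subset_Icc_self ht)).trans ((le_max_left _ _).trans (le_max_right _ _))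
  · rw [hχ.eq_zero t ht]; simp
  · exact (h₂ t (Ioo_subset_Icc_self ht)).trans ((le_max_right _ _).trans (le_max_right _ _))
  · rw [hχ.deriv_eq_zero ht]; simp

/-- If a kernel at scale `ε` is centred in the support of the cutoff, both times stay away from
`0` and `T`. -/
theorem mem_Ioo_of_average {t t' : ℝ} (hε : ε ≤ δ) (h : |t - t'| < ε)
    (ha : (t + t') / 2 ∈ Ioo (2 * δ) (T - 2 * δ)) : t ∈ Ioo δ (T - δ) ∧ t' ∈ Ioo δ (T - δ) := by
  obtain ⟨h1, h2⟩ := abs_lt.1 h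
  obtain ⟨h3, h4⟩ := ha
  constructor <;> constructor <;> linarith

theorem timeKer_eq_zero_left (hχ : IsTimeCutoff T δ χ) (hε0 : 0 < ε) (hε : ε ≤ δ) {t : ℝ} (t' : ℝ)
    (ht : t ∉ Ioo δ (T - δ)) : timeKer χ ε t t' = 0 := by
  rw [timeKer]
  by_cases h : |t - t'| < ε
  · rw [hχ.eq_zero _ fun ha => ht (mem_Ioo_of_average hε h ha).1, zero_mul]
  · rw [moll_eq_zero hε0 (not_lt.1 h), mul_zero]

theorem timeKer_eq_zero_right (hχ : IsTimeCutoff T δ χ) (hε0 : 0 < ε) (hε : ε ≤ δ) (t : ℝ) {t' : ℝ}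
    (ht : t' ∉ Ioo δ (T - δ)) : timeKer χ ε t t' = 0 := by
  rw [← timeKer_comm, timeKer_eq_zero_left hχ hε0 hε t ht]

theorem timeKer_nonneg (hχ : IsTimeCutoff T δ χ) (hε0 : 0 < ε) (t t' : ℝ) :
    0 ≤ timeKer χ ε t t' := mul_nonneg (hχ.nonneg _) (moll_nonneg hε0 _)

theorem setIntegral_Ioo_eq {a b : ℝ} (hab : a ≤ b) (f : ℝ → ℝ) :
    ∫ t in Ioo a b, f t = ∫ t in a..b, f t := by
  rw [intervalIntegral.integral_of_le hab, integral_Ioc_eq_integral_Ioo]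

theorem integral_timeKerAnti (hχ : IsTimeCutoff T δ χ) (hT : 0 < T) (hε0 : 0 < ε) (hε : ε ≤ δ)
    (t : ℝ) : ∫ t' in Ioo 0 T, timeKerAnti χ ε t t' = ∫ t' in Ioo 0 T, timeKerSymm χ ε t t' := by
  have c1 : Continuous fun t' => timeKerAnti χ ε t t' :=
    (continuous_timeKerAnti hχ.contDiff ε).comp (by fun_prop : Continuous fun t' => (t, t'))
  have c2 : Continuous fun t' => timeKerSymm χ ε t t' :=
    (continuous_timeKerSymm hχ.contDiff ε).comp (by fun_prop : Continuous fun t' => (t, t'))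
  have h := intervalIntegral.integral_eq_sub_of_hasDerivAt (a := 0) (b := T)
    (fun t' _ => hasDerivAt_timeKer_right hχ.contDiff ε t t')
    ((c1.neg.add c2).intervalIntegrable _ _)
  rw [timeKer_eq_zero_right hχ hε0 hε t (t' := T), timeKer_eq_zero_right hχ hε0 hε t (t' := 0),
    intervalIntegral.integral_add (f := fun t' => -timeKerAnti χ ε t t')
      (c1.neg.intervalIntegrable _ _) (c2.intervalIntegrable _ _),
    intervalIntegral.integral_neg] at h
  · rw [setIntegral_Ioo_eq hT.le, setIntegral_Ioo_eq hT.le]; linarith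
  · exact fun h => by linarith [h.1]
  · exact fun h => by linarith [h.2]

/-- Approximation of the identity by the mollifier in time. -/
theorem exists_integral_mul_moll_approx (hδ : 0 < δ) {F : ℝ → ℝ → ℝ}
    (hF : Continuous fun q : ℝ × ℝ => F q.1 q.2)
    (hF0 : ∀ t t', (t + t') / 2 ∉ Ioo (2 * δ) (T - 2 * δ) → F t t' = 0) {η : ℝ} (hη : 0 < η) :
    ∃ ε₀ > 0, ∀ ε, 0 < ε → ε ≤ ε₀ → ∀ t ∈ Ioo 0 T,
      |(∫ t' in Ioo 0 T, F t t' * moll ε (t - t')) - F t t| ≤ η := by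
  have huc := (isCompact_Icc.prod isCompact_Icc :
    IsCompact (Icc (0 : ℝ) T ×ˢ Icc (0 : ℝ) T)).uniformContinuousOn_of_continuous hF.continuousOn
  obtain ⟨ε₀, hε₀, h⟩ := Metric.uniformContinuousOn_iff.1 huc η hη
  refine ⟨min ε₀ δ, lt_min hε₀ hδ, fun ε hε0 hε t ht => ?_⟩
  have hεδ := hε.trans (min_le_right _ _)
  have hc : Continuous fun t' => F t t' * moll ε (t - t') :=
    (hF.comp (by fun_prop : Continuous fun t' => (t, t'))).mul
      ((continuous_moll ε).comp (by fun_prop))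
  have hc2 : Continuous fun t' => F t t * moll ε (t - t') :=
    continuous_const.mul ((continuous_moll ε).comp (by fun_prop))
  have hT : 0 ≤ T := (ht.1.trans ht.2).le
  by_cases ht' : t ∈ Ioo δ (T - δ)
  · have h1 : ∫ t' in Ioo 0 T, moll ε (t - t') = 1 := by
      rw [setIntegral_Ioo_eq hT, intervalIntegral.integral_comp_sub_left (moll ε) t]
      exact intervalIntegral_moll hε0 (by linarith [ht'.2]) (by linarith [ht'.1])
    have h2 : (∫ t' in Ioo 0 T, F t t' * moll ε (t - t')) - F t t =
        ∫ t' in Ioo 0 T, (F t t' - F t t) * moll ε (t - t') := by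
      simp only [sub_mul]
      rw [integral_sub (hc.integrableOn_Icc.mono_set Ioo_subset_Icc_self)
        (hc2.integrableOn_Icc.mono_set Ioo_subset_Icc_self), integral_const_mul, h1, mul_one]
    have h3 : Integrable (fun t' => η * moll ε (t - t')) (volume.restrict (Ioo 0 T)) :=
      (Continuous.integrableOn_Icc (by
        exact continuous_const.mul ((continuous_moll ε).comp (by fun_prop)))).mono_set
        Ioo_subset_Icc_self
    rw [h2, ← Real.norm_eq_abs]
    refine (norm_integral_le_of_norm_le h3 ?_).trans_eq ?_
    · filter_upwards [ae_restrict_mem measurableSet_Ioo] with t' ht2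
      rw [norm_mul, Real.norm_eq_abs, Real.norm_eq_abs, abs_of_nonneg (moll_nonneg hε0 _)]
      by_cases hs : |t - t'| < ε
      · refine mul_le_mul_of_nonneg_right ?_ (moll_nonneg hε0 _)
        have := h (t, t') ⟨Ioo_subset_Icc_self ht, Ioo_subset_Icc_self ht2⟩ (t, t)
          ⟨Ioo_subset_Icc_self ht, Ioo_subset_Icc_self ht⟩ (by
            rw [Prod.dist_eq, dist_self, max_eq_right dist_nonneg, Real.dist_eq, abs_sub_comm]
            exact hs.trans_le (hε.trans (min_le_left _ _)))
        exact this.le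
      · rw [moll_eq_zero hε0 (not_lt.1 hs)]; simp
    · rw [integral_const_mul, h1, mul_one]
  · have h1 : F t t = 0 := hF0 _ _ fun h => ht' (by
      rw [add_self_div_two] at h; exact ⟨by linarith [h.1], by linarith [h.2]⟩)
    have h2 : ∀ t', F t t' * moll ε (t - t') = 0 := fun t' => by
      by_cases hs : |t - t'| < ε
      · rw [hF0 _ _ fun ha => ht' (mem_Ioo_of_average hεδ hs ha).1, zero_mul]
      · rw [moll_eq_zero hε0 (not_lt.1 hs), mul_zero]
    simp [h1, h2, hη.le]

/-- The symmetric part of the time derivative of the kernel tends to `χ' / 2`. -/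
theorem exists_integral_timeKerSymm_approx (hχ : IsTimeCutoff T δ χ) (hδ : 0 < δ)
    {η : ℝ} (hη : 0 < η) : ∃ ε₀ > 0, ∀ ε, 0 < ε → ε ≤ ε₀ → ∀ t ∈ Ioo 0 T,
      |(∫ t' in Ioo 0 T, timeKerSymm χ ε t t') - deriv χ t / 2| ≤ η := by
  have hc := hχ.contDiff.continuous_deriv le_rfl
  obtain ⟨ε₀, h0, h⟩ := exists_integral_mul_moll_approx (T := T) hδ
    (F := fun t t' => deriv χ ((t + t') / 2) / 2) (by fun_prop)
    (fun t t' ht => by rw [hχ.deriv_eq_zero ht, zero_div]) hη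
  refine ⟨ε₀, h0, fun ε h1 h2 t ht => ?_⟩
  have := h ε h1 h2 t ht
  rwa [add_self_div_two] at this

/-! ### Smoothness of integrals depending on a parameter -/

theorem hasFDerivAt_integral_kernel {E α : Type*} [NormedAddCommGroup E] [NormedSpace ℝ E]
    [MeasurableSpace α] {μ : Measure α} [IsFiniteMeasure μ] {k : E → α → ℝ}
    {k' : E → α → E →L[ℝ] ℝ} {v : α → ℝ} {C M : ℝ}
    (hk : ∀ z a, HasFDerivAt (fun z => k z a) (k' z a) z)
    (hkm : ∀ z, AEStronglyMeasurable (k z) μ) (hk'm : ∀ z, AEStronglyMeasurable (k' z) μ)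
    (hkb : ∀ z a, ‖k z a‖ ≤ C) (hk'b : ∀ z a, ‖k' z a‖ ≤ C) (hv : AEStronglyMeasurable v μ)
    (hvb : ∀ a, ‖v a‖ ≤ M) (z : E) :
    HasFDerivAt (fun z => ∫ a, k z a * v a ∂μ) (∫ a, v a • k' z a ∂μ) z := by
  refine hasFDerivAt_integral_of_dominated_of_fderiv_le (s := univ) (bound := fun _ => M * C)
    (F' := fun z a => v a • k' z a) univ_mem (.of_forall fun z => (hkm z).mul hv) ?_ (hv.smul (hk'm z)) ?_ (integrable_const _) ?_
  · refine Integrable.of_bound ((hkm z).mul hv) (C * M) (.of_forall fun a => ?_)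
    rw [norm_mul]
    exact mul_le_mul (hkb z a) (hvb a) (norm_nonneg _) ((norm_nonneg _).trans (hkb z a))
  · refine .of_forall fun a z _ => ?_
    rw [norm_smul]
    exact mul_le_mul (hvb a) (hk'b z a) (norm_nonneg _) ((norm_nonneg _).trans (hvb a))
  · refine .of_forall fun a z _ => ?_
    exact (hk z a).mul_const (v a)

theorem contDiff_integral_kernel {E α : Type*} [NormedAddCommGroup E] [NormedSpace ℝ E]
    [MeasurableSpace α] {μ : Measure α} [IsFiniteMeasure μ] {k : E → α → ℝ}
    {k' : E → α → E →L[ℝ] ℝ} {v : α → ℝ} {C M : ℝ}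
    (hk : ∀ z a, HasFDerivAt (fun z => k z a) (k' z a) z)
    (hkm : ∀ z, AEStronglyMeasurable (k z) μ) (hk'm : ∀ z, AEStronglyMeasurable (k' z) μ)
    (hk'c : ∀ a, Continuous fun z => k' z a)
    (hkb : ∀ z a, ‖k z a‖ ≤ C) (hk'b : ∀ z a, ‖k' z a‖ ≤ C) (hv : AEStronglyMeasurable v μ)
    (hvb : ∀ a, ‖v a‖ ≤ M) :
    ContDiff ℝ 1 (fun z => ∫ a, k z a * v a ∂μ) := by
  have hd := hasFDerivAt_integral_kernel hk hkm hk'm hkb hk'b hv hvb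
  rw [contDiff_one_iff_fderiv]
  refine ⟨fun z => (hd z).differentiableAt, ?_⟩
  rw [show fderiv ℝ (fun z => ∫ a, k z a * v a ∂μ) = fun z => ∫ a, v a • k' z a ∂μ from
    funext fun z => (hd z).fderiv]
  refine continuous_of_dominated (bound := fun _ => M * C) (fun z => hv.smul (hk'm z))
    (fun z => .of_forall fun a => ?_) (integrable_const _) (.of_forall fun a => ?_)
  · rw [norm_smul]
    exact mul_le_mul (hvb a) (hk'b z a) (norm_nonneg _) ((norm_nonneg _).trans (hvb a))
  · exact (hk'c a).const_smul (v a)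

/-! ### The reflected mollification -/

/-- The mollification at scale `ε` of the extension of `v` by reflections of the cube, where the
reflection `c` comes with the factor `s c`, localized in time by `χ`. -/
noncomputable def reflMoll (T : ℝ) (χ : ℝ → ℝ) (ε : ℝ) (s : (Fin d → Fin 3) → ℝ)
    (v : ℝ × Space d → ℝ) (z : ℝ × Space d) : ℝ :=
  ∑ c, s c * ∫ z' in cylinder d T, timeKer χ ε z.1 z'.1 * spaceKer ε c z.2 z'.2 * v z'

/-- The derivative in `z` of the kernel of `reflMoll`. -/
noncomputable def kerDeriv (χ : ℝ → ℝ) (ε : ℝ) (c : Fin d → Fin 3) (z z' : ℝ × Space d) :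
    ℝ × Space d →L[ℝ] ℝ :=
  ((timeKerAnti χ ε z.1 z'.1 + timeKerSymm χ ε z.1 z'.1) * spaceKer ε c z.2 z'.2) •
      ContinuousLinearMap.fst ℝ ℝ (Space d) +
    ∑ j, (timeKer χ ε z.1 z'.1 * spaceKer' ε c j z.2 z'.2) •
      ((EuclideanSpace.proj j : Space d →L[ℝ] ℝ).comp (ContinuousLinearMap.snd ℝ ℝ (Space d)))

theorem hasFDerivAt_kernel (hχ : ContDiff ℝ 1 χ) (ε : ℝ) (c : Fin d → Fin 3)
    (z z' : ℝ × Space d) :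
    HasFDerivAt (fun z : ℝ × Space d => timeKer χ ε z.1 z'.1 * spaceKer ε c z.2 z'.2)
      (kerDeriv χ ε c z z') z := by
  have h1 : HasFDerivAt (fun z : ℝ × Space d => timeKer χ ε z.1 z'.1) _ z :=
    (hasDerivAt_timeKer hχ ε z.1 z'.1).comp_hasFDerivAt z
      (ContinuousLinearMap.fst ℝ ℝ (Space d)).hasFDerivAt
  have h2 : HasFDerivAt (fun z : ℝ × Space d => spaceKer ε c z.2 z'.2) _ z :=
    (hasFDerivAt_spaceKer ε c z.2 z'.2).comp z
      (ContinuousLinearMap.snd ℝ ℝ (Space d)).hasFDerivAt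
  refine (h1.mul h2).congr_fderiv ?_
  ext w
  · simp [kerDeriv]; ring
  · simp [kerDeriv, Finset.mul_sum, mul_assoc]

theorem continuous_kernel (hχ : ContDiff ℝ 1 χ) (ε : ℝ) (c : Fin d → Fin 3) :
    Continuous fun q : (ℝ × Space d) × (ℝ × Space d) =>
      timeKer χ ε q.1.1 q.2.1 * spaceKer ε c q.1.2 q.2.2 := by
  have ht : Continuous fun q : (ℝ × Space d) × (ℝ × Space d) => (q.1.1, q.2.1) := by fun_prop
  have hs : Continuous fun q : (ℝ × Space d) × (ℝ × Space d) => (q.1.2, q.2.2) := by fun_prop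
  have h1 := (continuous_timeKer hχ ε).comp ht
  have h2 := (continuous_spaceKer ε c).comp hs
  exact h1.mul h2

theorem continuous_kerDeriv (hχ : ContDiff ℝ 1 χ) (ε : ℝ) (c : Fin d → Fin 3) :
    Continuous fun q : (ℝ × Space d) × (ℝ × Space d) => kerDeriv χ ε c q.1 q.2 := by
  have ht : Continuous fun q : (ℝ × Space d) × (ℝ × Space d) => (q.1.1, q.2.1) := by fun_prop
  have hs : Continuous fun q : (ℝ × Space d) × (ℝ × Space d) => (q.1.2, q.2.2) := by fun_prop
  have h1 := (continuous_timeKerAnti hχ ε).comp ht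
  have h2 := (continuous_timeKerSymm hχ ε).comp ht
  have h3 := (continuous_timeKer hχ ε).comp ht
  have h4 := (continuous_spaceKer ε c).comp hs
  refine (((h1.add h2).mul h4).smul continuous_const).add
    (continuous_finsetSum _ fun j _ => ?_)
  exact (h3.mul ((continuous_spaceKer' ε c j).comp hs)).smul continuous_const

theorem abs_timeKer_le {C : ℝ} (hC : ∀ t, |χ t| ≤ C) (hε0 : 0 < ε) (t t' : ℝ) :
    |timeKer χ ε t t'| ≤ C * (bumpBound * ε⁻¹) := by
  rw [timeKer, abs_mul]
  exact mul_le_mul (hC _) (abs_moll_le hε0 _) (abs_nonneg _) ((abs_nonneg _).trans (hC 0))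

theorem abs_timeKerAnti_le {C : ℝ} (hC : ∀ t, |χ t| ≤ C) (hε0 : 0 < ε) (t t' : ℝ) :
    |timeKerAnti χ ε t t'| ≤ C * (bumpBound * ε⁻¹ ^ 2) := by
  rw [timeKerAnti, abs_mul]
  exact mul_le_mul (hC _) (abs_moll'_le hε0 _) (abs_nonneg _) ((abs_nonneg _).trans (hC 0))

theorem abs_timeKerSymm_le {C : ℝ} (hC : ∀ t, |deriv χ t| ≤ C) (hε0 : 0 < ε) (t t' : ℝ) :
    |timeKerSymm χ ε t t'| ≤ C * (bumpBound * ε⁻¹) := by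
  rw [timeKerSymm, abs_mul, abs_div, abs_two]
  refine mul_le_mul ?_ (abs_moll_le hε0 _) (abs_nonneg _) ((abs_nonneg _).trans (hC 0))
  have := hC ((t + t') / 2)
  linarith [abs_nonneg (deriv χ ((t + t') / 2))]

theorem exists_kernel_bound (hχ : IsTimeCutoff T δ χ) (hε0 : 0 < ε) (c : Fin d → Fin 3) :
    ∃ C, (∀ z z' : ℝ × Space d, ‖timeKer χ ε z.1 z'.1 * spaceKer ε c z.2 z'.2‖ ≤ C) ∧
      ∀ z z', ‖kerDeriv χ ε c z z'‖ ≤ C := by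
  obtain ⟨C, hC0, hC1, hC2⟩ := hχ.exists_bound
  have hB := bumpBound_nonneg
  set K := C * (bumpBound * ε⁻¹) * (bumpBound * ε⁻¹) ^ d
  set K' := (C * (bumpBound * ε⁻¹ ^ 2) + C * (bumpBound * ε⁻¹)) * (bumpBound * ε⁻¹) ^ d *
    ‖ContinuousLinearMap.fst ℝ ℝ (Space d)‖ +
    ∑ j, C * (bumpBound * ε⁻¹) * ((bumpBound * ε⁻¹) ^ d * ε⁻¹) *
      ‖(EuclideanSpace.proj j : Space d →L[ℝ] ℝ).comp (ContinuousLinearMap.snd ℝ ℝ (Space d))‖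
  refine ⟨max K K', fun z z' => le_max_of_le_left ?_, fun z z' => le_max_of_le_right ?_⟩
  · rw [norm_mul]
    exact mul_le_mul (abs_timeKer_le hC1 hε0 _ _) (abs_spaceKer_le hε0 c _ _) (abs_nonneg _)
      (by positivity)
  · refine (norm_add_le _ _).trans (add_le_add ?_ ((norm_sum_le _ _).trans
      (Finset.sum_le_sum fun j _ => ?_)))
    · rw [norm_smul, norm_mul]
      refine mul_le_mul_of_nonneg_right ?_ (norm_nonneg _)
      refine mul_le_mul ?_ (abs_spaceKer_le hε0 c _ _) (abs_nonneg _) (by positivity)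
      exact (abs_add_le _ _).trans
        (add_le_add (abs_timeKerAnti_le hC1 hε0 _ _) (abs_timeKerSymm_le hC2 hε0 _ _))
    · rw [norm_smul, norm_mul]
      refine mul_le_mul_of_nonneg_right ?_ (norm_nonneg _)
      exact mul_le_mul (abs_timeKer_le hC1 hε0 _ _) (abs_spaceKer'_le hε0 c j _ _) (abs_nonneg _)
        (by positivity)

section

variable {v : ℝ × Space d → ℝ} {M : ℝ}

theorem contDiff_reflMoll (hχ : IsTimeCutoff T δ χ) (hε0 : 0 < ε) (s : (Fin d → Fin 3) → ℝ)
    (hv : Measurable v) (hvb : ∀ z, ‖v z‖ ≤ M) : ContDiff ℝ 1 (reflMoll T χ ε s v) := by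
  refine ContDiff.sum fun c _ => contDiff_const.mul ?_
  obtain ⟨C, hC1, hC2⟩ := exists_kernel_bound hχ hε0 c
  have c1 := continuous_kernel (d := d) hχ.contDiff ε c
  have c2 := continuous_kerDeriv (d := d) hχ.contDiff ε c
  exact contDiff_integral_kernel (hasFDerivAt_kernel hχ.contDiff ε c)
    (fun z => (c1.comp (by fun_prop : Continuous fun z' => (z, z'))).aestronglyMeasurable)
    (fun z => (c2.comp (by fun_prop : Continuous fun z' => (z, z'))).aestronglyMeasurable)
    (fun z' => c2.comp (by fun_prop : Continuous fun z => (z, z'))) hC1 hC2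
    hv.aestronglyMeasurable hvb

theorem hasFDerivAt_reflMoll (hχ : IsTimeCutoff T δ χ) (hε0 : 0 < ε) (s : (Fin d → Fin 3) → ℝ)
    (hv : Measurable v) (hvb : ∀ z, ‖v z‖ ≤ M) (z : ℝ × Space d) :
    HasFDerivAt (reflMoll T χ ε s v)
      (∑ c, s c • ∫ z' in cylinder d T, v z' • kerDeriv χ ε c z z') z := by
  refine HasFDerivAt.fun_sum fun c _ => HasFDerivAt.const_mul ?_ _
  obtain ⟨C, hC1, hC2⟩ := exists_kernel_bound hχ hε0 c
  have c1 := continuous_kernel (d := d) hχ.contDiff ε c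
  have c2 := continuous_kerDeriv (d := d) hχ.contDiff ε c
  exact hasFDerivAt_integral_kernel (hasFDerivAt_kernel hχ.contDiff ε c)
    (fun z => (c1.comp (by fun_prop : Continuous fun z' => (z, z'))).aestronglyMeasurable)
    (fun z => (c2.comp (by fun_prop : Continuous fun z' => (z, z'))).aestronglyMeasurable) hC1 hC2
    hv.aestronglyMeasurable hvb z

theorem fderiv_reflMoll_apply (hχ : IsTimeCutoff T δ χ) (hε0 : 0 < ε)
    (s : (Fin d → Fin 3) → ℝ) (hv : Measurable v) (hvb : ∀ z, ‖v z‖ ≤ M) (z w : ℝ × Space d) :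
    fderiv ℝ (reflMoll T χ ε s v) z w =
      ∑ c, s c * ∫ z' in cylinder d T, kerDeriv χ ε c z z' w * v z' := by
  rw [(hasFDerivAt_reflMoll hχ hε0 s hv hvb z).fderiv, _root_.sum_apply]
  refine Finset.sum_congr rfl fun c _ => ?_
  obtain ⟨C, hC1, hC2⟩ := exists_kernel_bound hχ hε0 c
  have c2 := continuous_kerDeriv (d := d) hχ.contDiff ε c
  have hi : Integrable (fun z' => v z' • kerDeriv χ ε c z z')
      (volume.restrict (cylinder d T)) := by
    refine Integrable.of_bound (hv.aestronglyMeasurable.smul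
      (c2.comp (by fun_prop : Continuous fun z' => (z, z'))).aestronglyMeasurable) (M * C)
      (.of_forall fun z' => ?_)
    rw [norm_smul]
    exact mul_le_mul (hvb _) (hC2 z z') (norm_nonneg _) ((norm_nonneg _).trans (hvb z'))
  rw [_root_.smul_apply, ContinuousLinearMap.integral_apply hi, smul_eq_mul]
  simp [mul_comm]

/-- The time derivative of the reflected mollification. -/
theorem deriv_reflMoll (hχ : IsTimeCutoff T δ χ) (hε0 : 0 < ε)
    (s : (Fin d → Fin 3) → ℝ) (hv : Measurable v) (hvb : ∀ z, ‖v z‖ ≤ M) (t : ℝ) (x : Space d) :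
    deriv (fun t => reflMoll T χ ε s v (t, x)) t =
      ∑ c, s c * ∫ z' in cylinder d T, (timeKerAnti χ ε t z'.1 + timeKerSymm χ ε t z'.1) *
        spaceKer ε c x z'.2 * v z' := by
  have h1 := ((contDiff_reflMoll (T := T) hχ hε0 s hv hvb).differentiable (by norm_num)
    (t, x)).hasFDerivAt
  have h2 : HasDerivAt (fun t : ℝ => (t, x)) ((1 : ℝ), (0 : Space d)) t :=
    (hasDerivAt_id t).prodMk (hasDerivAt_const t x)
  have h3 := h1.comp_hasDerivAt t h2
  rw [show (fun t => reflMoll T χ ε s v (t, x)) = reflMoll T χ ε s v ∘ fun t => (t, x) from rfl,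
    h3.deriv, fderiv_reflMoll_apply hχ hε0 s hv hvb]
  simp [kerDeriv]

/-- The space derivatives of the reflected mollification. -/
theorem fderiv_reflMoll_space (hχ : IsTimeCutoff T δ χ) (hε0 : 0 < ε)
    (s : (Fin d → Fin 3) → ℝ) (hv : Measurable v) (hvb : ∀ z, ‖v z‖ ≤ M) (t : ℝ)
    (x w : Space d) :
    fderiv ℝ (fun x => reflMoll T χ ε s v (t, x)) x w =
      ∑ c, s c * ∫ z' in cylinder d T, timeKer χ ε t z'.1 *
        (∑ j, w j * spaceKer' ε c j x z'.2) * v z' := by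
  have h1 := ((contDiff_reflMoll (T := T) hχ hε0 s hv hvb).differentiable (by norm_num)
    (t, x)).hasFDerivAt
  have h2 : HasFDerivAt (fun x : Space d => (t, x)) (ContinuousLinearMap.inr ℝ ℝ (Space d)) x :=
    hasFDerivAt_prodMk_right t x
  have h3 := h1.comp x h2
  rw [show (fun x => reflMoll T χ ε s v (t, x)) = reflMoll T χ ε s v ∘ fun x => (t, x) from rfl,
    h3.fderiv, ContinuousLinearMap.comp_apply, fderiv_reflMoll_apply hχ hε0 s hv hvb]
  refine Finset.sum_congr rfl fun c _ => ?_
  congr 1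
  refine integral_congr_ae (.of_forall fun z' => ?_)
  simp only [kerDeriv]
  simp [Finset.mul_sum, mul_assoc, mul_comm (w _)]

theorem reflMoll_eq_zero (hχ : IsTimeCutoff T δ χ) (hε0 : 0 < ε) (hε : ε ≤ δ)
    (s : (Fin d → Fin 3) → ℝ) (v : ℝ × Space d → ℝ) {t : ℝ} (ht : t ∉ Ioo δ (T - δ))
    (x : Space d) : reflMoll T χ ε s v (t, x) = 0 := by
  simp [reflMoll, timeKer_eq_zero_left hχ hε0 hε _ ht]

/-- The odd mollification vanishes on the faces. -/
theorem reflMoll_face_eq_zero (hχ : IsTimeCutoff T δ χ) (hε0 : 0 < ε) (hε1 : ε ≤ 1)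
    (hv : Measurable v) (hvb : ∀ z, ‖v z‖ ≤ M) (t : ℝ) {x : Space d} {i : Fin d}
    (hx : |x i| = 1) :
    reflMoll T χ ε (fun c => flipSign (c i)) v (t, x) = 0 := by
  simp only [reflMoll, ← integral_const_mul]
  rw [← integral_finsetSum]
  · refine integral_eq_zero_of_ae ?_
    filter_upwards [ae_restrict_mem (measurableSet_cylinder d T)] with z' hz'
    have := sum_flipSign_spaceKer_eq_zero hε0 hε1 hx (cube_subset_closedCube d hz'.2)
    calc _ = timeKer χ ε t z'.1 * v z' *
          ∑ c : Fin d → Fin 3, flipSign (c i) * spaceKer ε c x z'.2 := by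
          rw [Finset.mul_sum]; exact Finset.sum_congr rfl fun c _ => by ring
      _ = 0 := by rw [this, mul_zero]
  · intro c _
    obtain ⟨C, hC1, -⟩ := exists_kernel_bound hχ hε0 c
    refine Integrable.const_mul (Integrable.of_bound (C := C * M) ?_
      (.of_forall fun z' => ?_)) _
    · exact (((continuous_kernel hχ.contDiff ε c).comp
        (by fun_prop : Continuous fun z' => ((t, x), z'))).aestronglyMeasurable).mul
        hv.aestronglyMeasurable
    · rw [norm_mul]
      exact mul_le_mul (hC1 (t, x) z') (hvb z') (norm_nonneg _)
        ((norm_nonneg _).trans (hC1 (t, x) z'))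

end

end Euler

namespace Euler

variable {d : ℕ}

/-! ### The trapezoidal rule -/

/-- The mean value inequality on the segment between two points of an interval. -/
theorem abs_sub_le_of_hasDerivAt {f f' : ℝ → ℝ} {r R x y C : ℝ} (hx : x ∈ Icc r R)
    (hy : y ∈ Icc r R) (hf : ∀ z ∈ Icc r R, HasDerivAt f (f' z) z)
    (hb : ∀ z ∈ Icc r R, |z - y| ≤ |x - y| → |f' z| ≤ C) : |f x - f y| ≤ C * |x - y| := by
  have hsub : uIcc y x ⊆ Icc r R := (ordConnected_Icc (a := r) (b := R)).uIcc_subset hy hx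
  have := Convex.norm_image_sub_le_of_norm_hasDerivWithin_le (f := f) (f' := f')
    (s := uIcc y x) (x := y) (y := x) (C := C)
    (fun z hz => (hf z (hsub hz)).hasDerivWithinAt)
    (fun z hz => hb z (hsub hz) (abs_sub_left_of_mem_uIcc hz)) (convex_uIcc y x)
    left_mem_uIcc right_mem_uIcc
  simpa [Real.norm_eq_abs] using this

/-- The error of the trapezoidal rule for `f₁ = f'` on `[y, x]` is of third order. -/
theorem abs_trapezoid_le {f f₁ f₂ f₃ : ℝ → ℝ} {r R x y C : ℝ} (hx : x ∈ Icc r R)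
    (hy : y ∈ Icc r R) (h₁ : ∀ z ∈ Icc r R, HasDerivAt f (f₁ z) z)
    (h₂ : ∀ z ∈ Icc r R, HasDerivAt f₁ (f₂ z) z) (h₃ : ∀ z ∈ Icc r R, HasDerivAt f₂ (f₃ z) z)
    (hC : ∀ z ∈ Icc r R, |f₃ z| ≤ C) :
    |(x - y) * (f₁ x + f₁ y) - 2 * (f x - f y)| ≤ C * |x - y| ^ 3 := by
  have hC0 : 0 ≤ C := (abs_nonneg _).trans (hC x hx)
  have g1 : ∀ z ∈ Icc r R, |f₁ y - f₁ z + (z - y) * f₂ z| ≤ C * |z - y| * |z - y| := by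
    intro z hz
    have := abs_sub_le_of_hasDerivAt (f := fun z => f₁ y - f₁ z + (z - y) * f₂ z)
      (f' := fun z => (z - y) * f₃ z) (C := C * |z - y|) hz hy (fun s hs => by
        have := ((h₂ s hs).const_sub (f₁ y)).add (((hasDerivAt_id s).sub_const y).mul (h₃ s hs))
        refine this.congr_deriv ?_
        simp) (fun s hs hsz => by
        rw [abs_mul, mul_comm]
        exact mul_le_mul (hC s hs) hsz (abs_nonneg _) hC0)
    simpa using this
  have := abs_sub_le_of_hasDerivAt (f := fun z => (z - y) * (f₁ z + f₁ y) - 2 * (f z - f y))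
      (f' := fun z => f₁ y - f₁ z + (z - y) * f₂ z) (C := C * |x - y| * |x - y|) hx hy
      (fun s hs => by
        have := (((hasDerivAt_id s).sub_const y).mul ((h₂ s hs).add_const (f₁ y))).sub
          (((h₁ s hs).sub_const (f y)).const_mul 2)
        refine this.congr_deriv ?_
        simp
        ring) (fun s hs hsx => by
        refine (g1 s hs).trans ?_
        gcongr)
  refine (by simpa using this : _ ≤ _).trans_eq ?_
  ring

theorem abs_taylor_le {f f₁ f₂ : ℝ → ℝ} {r R x y C : ℝ} (hx : x ∈ Icc r R)
    (hy : y ∈ Icc r R) (h₁ : ∀ z ∈ Icc r R, HasDerivAt f (f₁ z) z)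
    (h₂ : ∀ z ∈ Icc r R, HasDerivAt f₁ (f₂ z) z) (hC : ∀ z ∈ Icc r R, |f₂ z| ≤ C) :
    |f x - f y - f₁ y * (x - y)| ≤ C * |x - y| ^ 2 := by
  have hC0 : 0 ≤ C := (abs_nonneg _).trans (hC x hx)
  have := abs_sub_le_of_hasDerivAt (f := fun z => f z - f y - f₁ y * (z - y))
      (f' := fun z => f₁ z - f₁ y) (C := C * |x - y|) hx hy
      (fun s hs => by
        have := ((h₁ s hs).sub_const (f y)).sub (((hasDerivAt_id s).sub_const y).const_mul (f₁ y))
        refine this.congr_deriv ?_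
        simp) (fun s hs hsx => by
        refine (abs_sub_le_of_hasDerivAt hs hy h₂ (fun z hz _ => hC z hz)).trans ?_
        gcongr)
  refine (by simpa using this : _ ≤ _).trans_eq ?_
  ring

/-! ### The pressure potential away from vacuum -/

/-- The derivative `P'(r)` of the pressure potential. -/
noncomputable def potential' (a γ r : ℝ) : ℝ := a * γ / (γ - 1) * r ^ (γ - 1)

theorem pressure_eq {a γ r : ℝ} (hγ : 1 < γ) (hr : 0 < r) :
    pressure a γ r = r * potential' a γ r - pressurePotential a γ r := by
  have h : γ - 1 ≠ 0 := by linarith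
  have h2 : r ^ γ = r * r ^ (γ - 1) := by
    rw [Real.rpow_sub_one hr.ne']; field_simp
  rw [pressure, potential', pressurePotential, h2]
  field_simp

/-- Bounds for a pressure potential `P` with derivative `P'` on `[r,R]`. -/
structure PotentialBounds (P P' : ℝ → ℝ) (r R C : ℝ) : Prop where
  measurable : Measurable P
  measurable' : Measurable P'
  nonneg : 0 ≤ C
  bound : ∀ x ∈ Icc r R, |P x| ≤ C
  bound' : ∀ x ∈ Icc r R, |P' x| ≤ C
  lipschitz : ∀ x ∈ Icc r R, ∀ y ∈ Icc r R, |P x - P y| ≤ C * |x - y|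
  lipschitz' : ∀ x ∈ Icc r R, ∀ y ∈ Icc r R, |P' x - P' y| ≤ C * |x - y|
  taylor : ∀ x ∈ Icc r R, ∀ y ∈ Icc r R, |P x - P y - P' y * (x - y)| ≤ C * |x - y| ^ 2
  trapezoid : ∀ x ∈ Icc r R, ∀ y ∈ Icc r R,
    |(x - y) * (P' x + P' y) - 2 * (P x - P y)| ≤ C * |x - y| ^ 3

theorem exists_potentialBounds (a γ : ℝ) {r : ℝ} (hr : 0 < r) (R : ℝ) :
    ∃ C, PotentialBounds (pressurePotential a γ) (potential' a γ) r R C := by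
  let b : ℝ := a * γ / (γ - 1)
  have hb : a / (γ - 1) * γ = b := by simp only [b]; ring
  have h₁ : ∀ z ∈ Icc r R, HasDerivAt (pressurePotential a γ) (potential' a γ z) z := fun z hz => by
    refine ((Real.hasDerivAt_rpow_const (Or.inl (hr.trans_le hz.1).ne')).const_mul
      (a / (γ - 1))).congr_deriv ?_
    rw [potential', ← mul_assoc, hb]
  have h₂ : ∀ z ∈ Icc r R, HasDerivAt (potential' a γ) (b * ((γ - 1) * z ^ (γ - 1 - 1))) z :=
    fun z hz => (Real.hasDerivAt_rpow_const (Or.inl (hr.trans_le hz.1).ne')).const_mul b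
  have h₃ : ∀ z ∈ Icc r R, HasDerivAt (fun z : ℝ => b * ((γ - 1) * z ^ (γ - 1 - 1)))
      (b * ((γ - 1) * ((γ - 1 - 1) * z ^ (γ - 1 - 1 - 1)))) z := fun z hz =>
    ((Real.hasDerivAt_rpow_const (Or.inl (hr.trans_le hz.1).ne')).const_mul _).const_mul b
  have hc : ∀ s : ℝ, ContinuousOn (fun z : ℝ => z ^ s) (Icc r R) := fun s z hz =>
    (Real.continuousAt_rpow_const _ _ (Or.inl (hr.trans_le hz.1).ne')).continuousWithinAt
  have hbd : ∀ c s : ℝ, ∃ K, ∀ z ∈ Icc r R, |c * z ^ s| ≤ K := fun c s =>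
    isCompact_Icc.exists_bound_of_continuousOn (continuousOn_const.mul (hc s))
  obtain ⟨K₀, k₀⟩ := hbd (a / (γ - 1)) γ
  obtain ⟨K₁, k₁⟩ := hbd b (γ - 1)
  obtain ⟨K₂, k₂⟩ := hbd (b * (γ - 1)) (γ - 1 - 1)
  obtain ⟨K₃, k₃⟩ := hbd (b * ((γ - 1) * (γ - 1 - 1))) (γ - 1 - 1 - 1)
  let K := |K₀| + |K₁| + |K₂| + |K₃|
  have e₀ := abs_nonneg K₀
  have e₁ := abs_nonneg K₁
  have e₂ := abs_nonneg K₂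
  have e₃ := abs_nonneg K₃
  have b₀ : ∀ z ∈ Icc r R, |pressurePotential a γ z| ≤ K := fun z hz =>
    ((k₀ z hz).trans (le_abs_self _)).trans (by simp only [K]; linarith)
  have b₁ : ∀ z ∈ Icc r R, |potential' a γ z| ≤ K := fun z hz =>
    ((k₁ z hz).trans (le_abs_self _)).trans (by simp only [K]; linarith)
  have b₂ : ∀ z ∈ Icc r R, |b * ((γ - 1) * z ^ (γ - 1 - 1))| ≤ K := fun z hz => by
    rw [← mul_assoc]
    exact ((k₂ z hz).trans (le_abs_self _)).trans (by simp only [K]; linarith)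
  have b₃ : ∀ z ∈ Icc r R, |b * ((γ - 1) * ((γ - 1 - 1) * z ^ (γ - 1 - 1 - 1)))| ≤ K :=
    fun z hz => by
      rw [← mul_assoc (γ - 1), ← mul_assoc]
      exact ((k₃ z hz).trans (le_abs_self _)).trans (by simp only [K]; linarith)
  refine ⟨K, ?_, ?_, by positivity, b₀, b₁, fun x hx y hy => ?_, fun x hx y hy => ?_,
    fun x hx y hy => ?_, fun x hx y hy => ?_⟩
  · unfold pressurePotential; fun_prop
  · unfold potential'; fun_prop
  · exact abs_sub_le_of_hasDerivAt hx hy h₁ fun z hz _ => b₁ z hz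
  · exact abs_sub_le_of_hasDerivAt hx hy h₂ fun z hz _ => b₂ z hz
  · exact abs_taylor_le hx hy h₁ h₂ b₂
  · exact abs_trapezoid_le hx hy h₁ h₂ h₃ b₃

/-! ### Entropy variables and cubic remainders -/

/-- The pairing of the conserved variables of the state `(r, u)` with the entropy variables
`(P'(r') - |w|²/2, w)` of the state `(r', w)`. -/
noncomputable def pairing (P' : ℝ → ℝ) (r : ℝ) (u : Space d) (r' : ℝ) (w : Space d) : ℝ :=
  r * inner ℝ u w + r * (P' r' - ‖w‖ ^ 2 / 2)

/-- The pairing of the `j`-th component of the flux at the state `(r, u)` with the entropy variables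
of the state `(r', w)`. -/
noncomputable def fluxPairing (P P' : ℝ → ℝ) (j : Fin d) (r : ℝ) (u : Space d) (r' : ℝ)
    (w : Space d) : ℝ :=
  r * u j * inner ℝ u w + (r * P' r - P r) * w j + r * u j * (P' r' - ‖w‖ ^ 2 / 2)

/-- The energy density minus the pressure. -/
noncomputable def energyDiff (P P' : ℝ → ℝ) (r : ℝ) (u : Space d) : ℝ :=
  r * ‖u‖ ^ 2 / 2 + 2 * P r - r * P' r

/-- The `j`-th component of the energy flux without the work of the pressure. -/
noncomputable def energyFlux (P : ℝ → ℝ) (j : Fin d) (r : ℝ) (u : Space d) : ℝ :=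
  (r * ‖u‖ ^ 2 / 2 + P r) * u j

/-- The part of the antisymmetrized pairing that is not a difference of two energies. -/
noncomputable def pairingRem (P P' : ℝ → ℝ) (r : ℝ) (u : Space d) (r' : ℝ) (w : Space d) : ℝ :=
  pairing P' r u r' w - pairing P' r' w r u - (energyDiff P P' r u - energyDiff P P' r' w)

/-- The part of the antisymmetrized flux pairing that is not a difference of two fluxes. -/
noncomputable def fluxPairingRem (P P' : ℝ → ℝ) (j : Fin d) (r : ℝ) (u : Space d) (r' : ℝ)
    (w : Space d) : ℝ :=
  fluxPairing P P' j r u r' w - fluxPairing P P' j r' w r u -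
    (energyFlux P j r u - energyFlux P j r' w)

theorem pairingRem_eq (P P' : ℝ → ℝ) (r : ℝ) (u : Space d) (r' : ℝ) (w : Space d) :
    pairingRem P P' r u r' w = -((r - r') * ‖u - w‖ ^ 2 / 2) +
      ((r - r') * (P' r + P' r') - 2 * (P r - P r')) := by
  rw [pairingRem, pairing, pairing, energyDiff, energyDiff, norm_sub_sq_real,
    real_inner_comm w u]
  ring

theorem fluxPairingRem_eq (P P' : ℝ → ℝ) (j : Fin d) (r : ℝ) (u : Space d) (r' : ℝ)
    (w : Space d) :
    fluxPairingRem P P' j r u r' w = -(‖u - w‖ ^ 2 / 2 * (r * (u j - w j) + (r - r') * w j)) -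
      (u j - w j) * (P r - P r' - P' r' * (r - r')) +
      w j * ((r - r') * (P' r + P' r') - 2 * (P r - P r')) := by
  rw [fluxPairingRem, fluxPairing, fluxPairing, energyFlux, energyFlux, norm_sub_sq_real,
    real_inner_comm w u]
  ring

theorem mul_sq_le_cube_add_cube {x y : ℝ} (hx : 0 ≤ x) (hy : 0 ≤ y) :
    x * y ^ 2 ≤ x ^ 3 + y ^ 3 := by
  rcases le_total x y with h | h
  · have : x * y ^ 2 ≤ y * y ^ 2 := by gcongr
    nlinarith [pow_nonneg hx 3]
  · have : x * y ^ 2 ≤ x * x ^ 2 := by gcongr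
    nlinarith [pow_nonneg hy 3]

theorem abs_apply_le_norm (u : Space d) (j : Fin d) : |u j| ≤ ‖u‖ := by
  simpa [Real.norm_eq_abs] using PiLp.norm_apply_le u j

section

variable {P P' : ℝ → ℝ} {r R C M : ℝ}

theorem abs_pairingRem_le (hP : PotentialBounds P P' r R C) {x y : ℝ} (hx : x ∈ Icc r R)
    (hy : y ∈ Icc r R) (u w : Space d) :
    |pairingRem P P' x u y w| ≤ (C + 1) * (|x - y| ^ 3 + ‖u - w‖ ^ 3) := by
  have hC := hP.nonneg
  have h1 := hP.trapezoid x hx y hy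
  have h2 := mul_sq_le_cube_add_cube (abs_nonneg (x - y)) (norm_nonneg (u - w))
  have h3 : |-((x - y) * ‖u - w‖ ^ 2 / 2)| ≤ |x - y| ^ 3 + ‖u - w‖ ^ 3 := by
    rw [abs_neg, abs_div, abs_mul, abs_of_nonneg (sq_nonneg ‖u - w‖), abs_two]
    have : 0 ≤ |x - y| * ‖u - w‖ ^ 2 := by positivity
    linarith
  rw [pairingRem_eq]
  refine (abs_add_le _ _).trans ((add_le_add h3 h1).trans ?_)
  have : 0 ≤ C * ‖u - w‖ ^ 3 := by positivity
  linarith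

theorem abs_fluxPairingRem_le (hP : PotentialBounds P P' r R C) (hr : 0 ≤ r) {x y : ℝ}
    (hx : x ∈ Icc r R) (hy : y ∈ Icc r R) (j : Fin d) {u w : Space d} (hw : ‖w‖ ≤ M) :
    |fluxPairingRem P P' j x u y w| ≤ (R + M + C + M * C) * (|x - y| ^ 3 + ‖u - w‖ ^ 3) := by
  have hC := hP.nonneg
  have hM : 0 ≤ M := (norm_nonneg _).trans hw
  have hx0 : 0 ≤ x := hr.trans hx.1
  have hR : 0 ≤ R := hx0.trans hx.2
  set α := |x - y| with hα
  set β := ‖u - w‖ with hβ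
  have hα0 : 0 ≤ α := abs_nonneg _
  have hβ0 : 0 ≤ β := norm_nonneg _
  have huw : |u j - w j| ≤ β := abs_apply_le_norm (u - w) j
  have hwj : |w j| ≤ M := (abs_apply_le_norm w j).trans hw
  have h1 := mul_sq_le_cube_add_cube hα0 hβ0
  have h2 := mul_sq_le_cube_add_cube hβ0 hα0
  have k1 : |-(β ^ 2 / 2 * (x * (u j - w j) + (x - y) * w j))| ≤ β ^ 2 * (R * β + α * M) := by
    rw [abs_neg, abs_mul, abs_of_nonneg (by positivity : 0 ≤ β ^ 2 / 2)]
    refine mul_le_mul (by nlinarith [sq_nonneg β]) ((abs_add_le _ _).trans (add_le_add ?_ ?_))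
      (abs_nonneg _) (by positivity)
    · rw [abs_mul, abs_of_nonneg hx0]
      exact mul_le_mul hx.2 huw (abs_nonneg _) hR
    · rw [abs_mul]
      exact mul_le_mul_of_nonneg_left hwj (abs_nonneg _)
  have k2 : |(u j - w j) * (P x - P y - P' y * (x - y))| ≤ β * (C * α ^ 2) := by
    rw [abs_mul]
    exact mul_le_mul huw (hP.taylor x hx y hy) (abs_nonneg _) hβ0
  have k3 : |w j * ((x - y) * (P' x + P' y) - 2 * (P x - P y))| ≤ M * (C * α ^ 3) := by
    rw [abs_mul]
    exact mul_le_mul hwj (hP.trapezoid x hx y hy) (abs_nonneg _) hM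
  rw [fluxPairingRem_eq]
  refine (abs_add_le _ _).trans ((add_le_add ((abs_sub _ _).trans (add_le_add k1 k2)) k3).trans ?_)
  have n1 : M * (α * β ^ 2) ≤ M * (α ^ 3 + β ^ 3) := by gcongr
  have n2 : C * (β * α ^ 2) ≤ C * (β ^ 3 + α ^ 3) := by gcongr
  have n3 : 0 ≤ R * α ^ 3 := by positivity
  have n4 : 0 ≤ M * C * β ^ 3 := by positivity
  linarith

theorem abs_pairing_sub_le (hP : PotentialBounds P P' r R C) (hr : 0 ≤ r) {x y : ℝ}
    (hx : x ∈ Icc r R) (hy : y ∈ Icc r R) {u w : Space d} (hu : ‖u‖ ≤ M) (hw : ‖w‖ ≤ M) :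
    |pairing P' x u y w - pairing P' x u x u| ≤ R * (2 * M + C) * (|x - y| + ‖u - w‖) := by
  have hC := hP.nonneg
  have hM : 0 ≤ M := (norm_nonneg _).trans hw
  have hx0 : 0 ≤ x := hr.trans hx.1
  have hR : 0 ≤ R := hx0.trans hx.2
  have e : pairing P' x u y w - pairing P' x u x u =
      x * (inner ℝ u (w - u) - (P' x - P' y) + (‖u‖ + ‖w‖) * (‖u‖ - ‖w‖) / 2) := by
    rw [pairing, pairing, inner_sub_right]; ring
  have k1 : |inner ℝ u (w - u)| ≤ M * ‖u - w‖ := by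
    refine (abs_real_inner_le_norm _ _).trans ?_
    rw [norm_sub_rev]
    exact mul_le_mul_of_nonneg_right hu (norm_nonneg _)
  have k2 := hP.lipschitz' x hx y hy
  have k3 : |(‖u‖ + ‖w‖) * (‖u‖ - ‖w‖) / 2| ≤ M * ‖u - w‖ := by
    rw [abs_div, abs_mul, abs_two, abs_of_nonneg (by positivity : 0 ≤ ‖u‖ + ‖w‖)]
    have h1 := abs_norm_sub_norm_le u w
    have h2 : (‖u‖ + ‖w‖) * |‖u‖ - ‖w‖| ≤ (M + M) * ‖u - w‖ :=
      mul_le_mul (add_le_add hu hw) h1 (abs_nonneg _) (by positivity)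
    linarith
  rw [e, abs_mul, abs_of_nonneg hx0, mul_assoc]
  refine mul_le_mul hx.2 ?_ (abs_nonneg _) hR
  refine (abs_add_le _ _).trans ((add_le_add ((abs_sub _ _).trans (add_le_add k1 k2)) k3).trans ?_)
  have n1 : 0 ≤ M * |x - y| := by positivity
  have n2 : 0 ≤ C * ‖u - w‖ := by positivity
  linarith

end

end Euler

namespace Euler

variable {d : ℕ}

/-! ### Bounded states and their reflections -/

/-- The linear part of the reflection `c` applied to a vector. -/
noncomputable def reflVec (c : Fin d → Fin 3) (u : Space d) : Space d :=
  WithLp.toLp 2 fun i => flipSign (c i) * u i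

@[simp] theorem reflVec_apply (c : Fin d → Fin 3) (u : Space d) (i : Fin d) :
    reflVec c u i = flipSign (c i) * u i := rfl

theorem inner_eq_sum (u w : Space d) : inner ℝ u w = ∑ i, u i * w i := by
  simp [PiLp.inner_apply, mul_comm]

theorem inner_reflVec_left (c : Fin d → Fin 3) (u w : Space d) :
    inner ℝ (reflVec c u) w = inner ℝ u (reflVec c w) := by
  rw [inner_eq_sum, inner_eq_sum]
  exact Finset.sum_congr rfl fun i _ => by simp; ring

@[simp] theorem reflVec_reflVec (c : Fin d → Fin 3) (u : Space d) :
    reflVec c (reflVec c u) = u := by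
  ext i
  simp [← mul_assoc, flipSign_mul_self]

@[simp] theorem norm_reflVec (c : Fin d → Fin 3) (u : Space d) : ‖reflVec c u‖ = ‖u‖ := by
  have : ‖reflVec c u‖ ^ 2 = ‖u‖ ^ 2 := by
    rw [← real_inner_self_eq_norm_sq, inner_reflVec_left, reflVec_reflVec,
      real_inner_self_eq_norm_sq]
  exact (sq_eq_sq₀ (norm_nonneg _) (norm_nonneg _)).1 this

theorem continuous_reflVec (c : Fin d → Fin 3) : Continuous (reflVec c) := by
  unfold reflVec
  refine (PiLp.continuous_toLp 2 _).comp (continuous_pi fun i => ?_)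
  fun_prop

/-- Measurable fields of densities in `[r,R]` and of velocities of norm at most `M`. -/
structure IsBoundedState (r R M : ℝ) (ρ : ℝ × Space d → ℝ) (u : ℝ × Space d → Space d) :
    Prop where
  measurable_density : Measurable ρ
  measurable_velocity : Measurable u
  density_mem : ∀ z, ρ z ∈ Icc r R
  velocity_le : ∀ z, ‖u z‖ ≤ M

variable {P P' : ℝ → ℝ} {r R C M : ℝ}

theorem abs_pairing_le (hP : PotentialBounds P P' r R C) (hr : 0 ≤ r) {x y : ℝ}
    (hx : x ∈ Icc r R) (hy : y ∈ Icc r R) {u w : Space d} (hu : ‖u‖ ≤ M) (hw : ‖w‖ ≤ M) :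
    |pairing P' x u y w| ≤ R * (M * M) + R * (C + M ^ 2 / 2) := by
  have hM : 0 ≤ M := (norm_nonneg _).trans hw
  have hx0 : 0 ≤ x := hr.trans hx.1
  have hR : 0 ≤ R := hx0.trans hx.2
  rw [pairing]
  refine (abs_add_le _ _).trans (add_le_add ?_ ?_)
  · rw [abs_mul, abs_of_nonneg hx0]
    exact mul_le_mul hx.2 ((abs_real_inner_le_norm _ _).trans
      (mul_le_mul hu hw (norm_nonneg _) hM)) (abs_nonneg _) hR
  · rw [abs_mul, abs_of_nonneg hx0]
    refine mul_le_mul hx.2 ((abs_sub _ _).trans (add_le_add (hP.bound' y hy) ?_)) (abs_nonneg _) hR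
    rw [abs_of_nonneg (by positivity)]
    gcongr

theorem abs_fluxPairing_le (hP : PotentialBounds P P' r R C) (hr : 0 ≤ r) (j : Fin d) {x y : ℝ}
    (hx : x ∈ Icc r R) (hy : y ∈ Icc r R) {u w : Space d} (hu : ‖u‖ ≤ M) (hw : ‖w‖ ≤ M) :
    |fluxPairing P P' j x u y w| ≤
      R * M * (M * M) + (R * C + C) * M + R * M * (C + M ^ 2 / 2) := by
  have hC := hP.nonneg
  have hM : 0 ≤ M := (norm_nonneg _).trans hw
  have hx0 : 0 ≤ x := hr.trans hx.1
  have hR : 0 ≤ R := hx0.trans hx.2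
  have huj : |x * u j| ≤ R * M := by
    rw [abs_mul, abs_of_nonneg hx0]
    exact mul_le_mul hx.2 ((abs_apply_le_norm u j).trans hu) (abs_nonneg _) hR
  rw [fluxPairing]
  refine (abs_add_le _ _).trans (add_le_add ((abs_add_le _ _).trans (add_le_add ?_ ?_)) ?_)
  · rw [abs_mul]
    exact mul_le_mul huj ((abs_real_inner_le_norm _ _).trans
      (mul_le_mul hu hw (norm_nonneg _) hM)) (abs_nonneg _) (by positivity)
  · rw [abs_mul]
    refine mul_le_mul ((abs_sub _ _).trans (add_le_add ?_ (hP.bound x hx)))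
      ((abs_apply_le_norm w j).trans hw) (abs_nonneg _) (by positivity)
    rw [abs_mul, abs_of_nonneg hx0]
    exact mul_le_mul hx.2 (hP.bound' x hx) (abs_nonneg _) hR
  · rw [abs_mul]
    refine mul_le_mul huj ((abs_sub _ _).trans (add_le_add (hP.bound' y hy) ?_)) (abs_nonneg _)
      (by positivity)
    rw [abs_of_nonneg (by positivity)]
    gcongr

theorem abs_energyDiff_le (hP : PotentialBounds P P' r R C) (hr : 0 ≤ r) {x : ℝ}
    (hx : x ∈ Icc r R) {u : Space d} (hu : ‖u‖ ≤ M) :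
    |energyDiff P P' x u| ≤ R * M ^ 2 / 2 + 2 * C + R * C := by
  have hM : 0 ≤ M := (norm_nonneg _).trans hu
  have hx0 : 0 ≤ x := hr.trans hx.1
  have hR : 0 ≤ R := hx0.trans hx.2
  rw [energyDiff]
  refine (abs_sub _ _).trans (add_le_add ((abs_add_le _ _).trans (add_le_add ?_ ?_)) ?_)
  · rw [abs_of_nonneg (by positivity)]
    have := hx.2
    gcongr
  · rw [abs_mul, abs_two]
    linarith [hP.bound x hx]
  · rw [abs_mul, abs_of_nonneg hx0]
    exact mul_le_mul hx.2 (hP.bound' x hx) (abs_nonneg _) hR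

theorem abs_energyFlux_le (hP : PotentialBounds P P' r R C) (hr : 0 ≤ r) (j : Fin d) {x : ℝ}
    (hx : x ∈ Icc r R) {u : Space d} (hu : ‖u‖ ≤ M) :
    |energyFlux P j x u| ≤ (R * M ^ 2 / 2 + C) * M := by
  have hC := hP.nonneg
  have hM : 0 ≤ M := (norm_nonneg _).trans hu
  have hx0 : 0 ≤ x := hr.trans hx.1
  have hR : 0 ≤ R := hx0.trans hx.2
  rw [energyFlux, abs_mul]
  refine mul_le_mul ((abs_add_le _ _).trans (add_le_add ?_ (hP.bound x hx)))
    ((abs_apply_le_norm u j).trans hu) (abs_nonneg _) (by positivity)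
  rw [abs_of_nonneg (by positivity)]
  have := hx.2
  gcongr

theorem pairing_reflVec (P' : ℝ → ℝ) (c : Fin d → Fin 3) (x : ℝ) (u : Space d) (y : ℝ)
    (w : Space d) : pairing P' x u y (reflVec c w) = pairing P' x (reflVec c u) y w := by
  simp [pairing, inner_reflVec_left]

theorem fluxPairing_reflVec (P P' : ℝ → ℝ) (j : Fin d) (c : Fin d → Fin 3) (x : ℝ)
    (u : Space d) (y : ℝ) (w : Space d) : fluxPairing P P' j x u y (reflVec c w) =
      flipSign (c j) * fluxPairing P P' j x (reflVec c u) y w := by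
  simp only [fluxPairing, inner_reflVec_left, reflVec_apply, norm_reflVec]
  linear_combination -(x * u j * inner ℝ u (reflVec c w) + x * u j * (P' y - ‖w‖ ^ 2 / 2)) *
    flipSign_mul_self (c j)

theorem energyDiff_reflVec (P P' : ℝ → ℝ) (c : Fin d → Fin 3) (x : ℝ) (u : Space d) :
    energyDiff P P' x (reflVec c u) = energyDiff P P' x u := by
  simp [energyDiff]

theorem energyFlux_reflVec (P : ℝ → ℝ) (j : Fin d) (c : Fin d → Fin 3) (x : ℝ) (u : Space d) :
    energyFlux P j x (reflVec c u) = flipSign (c j) * energyFlux P j x u := by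
  simp [energyFlux]; ring

section

variable {ρ : ℝ × Space d → ℝ} {u : ℝ × Space d → Space d}

theorem measurable_pairing (hP : PotentialBounds P P' r R C) (h : IsBoundedState r R M ρ u)
    (c : Fin d → Fin 3) : Measurable fun q : (ℝ × Space d) × (ℝ × Space d) =>
      pairing P' (ρ q.1) (u q.1) (ρ q.2) (reflVec c (u q.2)) := by
  have h1 := h.measurable_density
  have h2 := h.measurable_velocity
  have h3 := hP.measurable'
  have h4 := (continuous_reflVec c).measurable
  unfold pairing
  exact ((h1.comp measurable_fst).mul ((h2.comp measurable_fst).inner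
    (h4.comp (h2.comp measurable_snd)))).add ((h1.comp measurable_fst).mul
    ((h3.comp (h1.comp measurable_snd)).sub
    (((h4.comp (h2.comp measurable_snd)).norm.pow_const 2).div_const 2)))

theorem measurable_apply {α : Type*} [MeasurableSpace α] {f : α → Space d} (hf : Measurable f)
    (j : Fin d) : Measurable fun z => f z j :=
  (by fun_prop : Continuous fun x : Space d => x j).measurable.comp hf

theorem measurable_fluxPairing (hP : PotentialBounds P P' r R C) (h : IsBoundedState r R M ρ u)
    (j : Fin d) (c : Fin d → Fin 3) : Measurable fun q : (ℝ × Space d) × (ℝ × Space d) =>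
      fluxPairing P P' j (ρ q.1) (u q.1) (ρ q.2) (reflVec c (u q.2)) := by
  have h1 := h.measurable_density.comp
    (measurable_fst : Measurable (Prod.fst : (ℝ × Space d) × (ℝ × Space d) → _))
  have h2 := h.measurable_velocity.comp
    (measurable_fst : Measurable (Prod.fst : (ℝ × Space d) × (ℝ × Space d) → _))
  have h1' := h.measurable_density.comp
    (measurable_snd : Measurable (Prod.snd : (ℝ × Space d) × (ℝ × Space d) → _))
  have h2' := (continuous_reflVec c).measurable.comp (h.measurable_velocity.comp
    (measurable_snd : Measurable (Prod.snd : (ℝ × Space d) × (ℝ × Space d) → _)))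
  have h3 := hP.measurable
  have h4 := hP.measurable'
  have h5 := measurable_apply h2 j
  have h6 := measurable_apply h2' j
  unfold fluxPairing
  exact (((h1.mul h5).mul (h2.inner h2')).add (((h1.mul (h4.comp h1)).sub (h3.comp h1)).mul
    h6)).add ((h1.mul h5).mul ((h4.comp h1').sub ((h2'.norm.pow_const 2).div_const 2)))

theorem measurable_energyDiff (hP : PotentialBounds P P' r R C) (h : IsBoundedState r R M ρ u) :
    Measurable fun z => energyDiff P P' (ρ z) (u z) := by
  have h1 := h.measurable_density
  have h2 := h.measurable_velocity
  have h3 := hP.measurable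
  have h4 := hP.measurable'
  unfold energyDiff
  fun_prop

theorem measurable_energyFlux (hP : PotentialBounds P P' r R C) (h : IsBoundedState r R M ρ u)
    (j : Fin d) : Measurable fun z => energyFlux P j (ρ z) (u z) := by
  have h1 := h.measurable_density
  have h2 := h.measurable_velocity
  have h3 := hP.measurable
  have h5 := measurable_apply h2 j
  unfold energyFlux
  fun_prop

end

/-! ### Antisymmetrization -/

theorem integrable_of_abs_le {α : Type*} [MeasurableSpace α] {μ : Measure α} [IsFiniteMeasure μ]
    {f : α → ℝ} (hf : Measurable f) {K : ℝ} (hK : ∀ a, |f a| ≤ K) : Integrable f μ :=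
  Integrable.of_bound hf.aestronglyMeasurable K (.of_forall hK)

/-- Pairing a kernel with a function of two variables, only the part of the function whose symmetry
matches that of the kernel contributes. If that part is a difference `f z - σ f z'` up to a
remainder, the pairing reduces to `f` and the remainder. -/
theorem integral_mul_antisymm {α : Type*} [MeasurableSpace α] {μ : Measure α} [IsFiniteMeasure μ]
    {H K rem : α × α → ℝ} {f : α → ℝ} {σ : ℝ} (hσ : σ * σ = 1) {B₁ B₂ B₃ : ℝ}
    (hH : Measurable H) (hK : Measurable K) (hf : Measurable f)
    (hHb : ∀ q, |H q| ≤ B₁) (hKb : ∀ q, |K q| ≤ B₂) (hfb : ∀ z, |f z| ≤ B₃)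
    (hKs : ∀ z z', K (z', z) = -σ * K (z, z'))
    (hHs : ∀ z z', H (z, z') - σ * H (z', z) = rem (z, z') + (f z - σ * f z')) :
    ∫ q, H q * K q ∂(μ.prod μ) =
      1 / 2 * ∫ q, rem q * K q ∂(μ.prod μ) + ∫ q, f q.1 * K q ∂(μ.prod μ) := by
  have mulb : ∀ {F : α × α → ℝ} {B : ℝ}, Measurable F → (∀ q, |F q| ≤ B) →
      Integrable (fun q => F q * K q) (μ.prod μ) := fun {F B} hF hB =>
    integrable_of_abs_le (hF.mul hK) (K := B * B₂) fun q => by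
      rw [abs_mul]
      exact mul_le_mul (hB q) (hKb q) (abs_nonneg _) ((abs_nonneg _).trans (hB q))
  have i1 := mulb hH hHb
  have i2 := mulb (hH.comp measurable_swap) fun q => hHb q.swap
  have i3 := mulb (hf.comp measurable_fst) fun q => hfb q.1
  have i4 := mulb (hf.comp measurable_snd) fun q => hfb q.2
  simp only [Function.comp_apply] at i2 i3 i4
  have s1 : ∫ q, H q * K q ∂(μ.prod μ) = -σ * ∫ q, H q.swap * K q ∂(μ.prod μ) := by
    rw [← integral_prod_swap, ← integral_const_mul]
    refine integral_congr_ae (.of_forall fun q => ?_)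
    have := hKs q.1 q.2
    simp only [Prod.swap] at *
    rw [this]; ring
  have s2 : ∫ q, f q.2 * K q ∂(μ.prod μ) = -σ * ∫ q, f q.1 * K q ∂(μ.prod μ) := by
    rw [← integral_prod_swap, ← integral_const_mul]
    refine integral_congr_ae (.of_forall fun q => ?_)
    have := hKs q.1 q.2
    simp only [Prod.swap] at *
    rw [this]; ring
  have s3 : ∫ q, rem q * K q ∂(μ.prod μ) = ∫ q, H q * K q ∂(μ.prod μ) -
      σ * ∫ q, H q.swap * K q ∂(μ.prod μ) - ∫ q, f q.1 * K q ∂(μ.prod μ) +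
      σ * ∫ q, f q.2 * K q ∂(μ.prod μ) := by
    have j1 : Integrable (fun q => H q * K q - σ * (H q.swap * K q)) (μ.prod μ) :=
      i1.sub (i2.const_mul σ)
    have j2 : Integrable (fun q => H q * K q - σ * (H q.swap * K q) - f q.1 * K q) (μ.prod μ) :=
      j1.sub i3
    rw [← integral_const_mul, ← integral_const_mul, ← integral_sub i1 (i2.const_mul σ),
      ← integral_sub j1 i3, ← integral_add j2 (i4.const_mul σ)]
    refine integral_congr_ae (.of_forall fun q => ?_)
    have := hHs q.1 q.2
    simp only [Prod.swap] at *
    linear_combination (-K q) * this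
  have s4 : σ * ∫ q, f q.2 * K q ∂(μ.prod μ) = -∫ q, f q.1 * K q ∂(μ.prod μ) := by
    rw [s2]; linear_combination (-∫ q, f q.1 * K q ∂(μ.prod μ)) * hσ
  rw [s3, s4]
  linarith [s1]

end Euler

namespace Euler

variable {d : ℕ} {T δ ε : ℝ} {χ : ℝ → ℝ}

/-- Lebesgue measure on the space-time cylinder. -/
noncomputable abbrev cylMeasure (d : ℕ) (T : ℝ) : Measure (ℝ × Space d) :=
  volume.restrict (cylinder d T)

/-! ### Masses of the kernels -/

theorem integral_cylMeasure_mul (T : ℝ) (g : ℝ → ℝ) (h : Space d → ℝ) :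
    ∫ z, g z.1 * h z.2 ∂(cylMeasure d T) = (∫ t in Ioo 0 T, g t) * ∫ x in cube d, h x := by
  rw [cylMeasure, restrict_cylinder, integral_prod_mul]

/-- Integration in the second variable against a family of kernels whose total mass is `m`. -/
theorem sum_integral_fst_mul {f : ℝ × Space d → ℝ} {G : ℝ → ℝ → ℝ}
    {S : (Fin d → Fin 3) → Space d → Space d → ℝ} {B₁ B₂ B₃ m : ℝ}
    (hf : Measurable f) (hG : Continuous fun q : ℝ × ℝ => G q.1 q.2)
    (hS : ∀ c, Continuous fun q : Space d × Space d => S c q.1 q.2)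
    (hfb : ∀ z, |f z| ≤ B₁) (hGb : ∀ t t', |G t t'| ≤ B₂) (hSb : ∀ c x y, |S c x y| ≤ B₃)
    (hm : ∀ x ∈ cube d, ∑ c, ∫ y in cube d, S c x y = m) :
    ∑ c, ∫ q, f q.1 * (G q.1.1 q.2.1 * S c q.1.2 q.2.2)
      ∂((cylMeasure d T).prod (cylMeasure d T)) =
      ∫ z, f z * (m * ∫ t' in Ioo 0 T, G z.1 t') ∂(cylMeasure d T) := by
  have hi : ∀ c, Integrable (fun q : (ℝ × Space d) × (ℝ × Space d) =>
      f q.1 * (G q.1.1 q.2.1 * S c q.1.2 q.2.2))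
      ((cylMeasure d T).prod (cylMeasure d T)) := fun c => by
    have h1 : Measurable fun q : (ℝ × Space d) × (ℝ × Space d) => G q.1.1 q.2.1 :=
      hG.measurable.comp (by fun_prop :
        Measurable fun q : (ℝ × Space d) × (ℝ × Space d) => (q.1.1, q.2.1))
    have h2 : Measurable fun q : (ℝ × Space d) × (ℝ × Space d) => S c q.1.2 q.2.2 :=
      (hS c).measurable.comp (by fun_prop :
        Measurable fun q : (ℝ × Space d) × (ℝ × Space d) => (q.1.2, q.2.2))
    refine integrable_of_abs_le ((hf.comp measurable_fst).mul (h1.mul h2)) (K := B₁ * (B₂ * B₃))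
      fun q => ?_
    have n1 := (abs_nonneg _).trans (hfb q.1)
    have n2 := (abs_nonneg _).trans (hGb q.1.1 q.2.1)
    have n3 := (abs_nonneg _).trans (hSb c q.1.2 q.2.2)
    rw [abs_mul, abs_mul]
    exact mul_le_mul (hfb _) (mul_le_mul (hGb _ _) (hSb _ _ _) (abs_nonneg _) n2)
      (by positivity) n1
  calc _ = ∑ c, ∫ z, ∫ z', f z * (G z.1 z'.1 * S c z.2 z'.2) ∂(cylMeasure d T)
        ∂(cylMeasure d T) := Finset.sum_congr rfl fun c _ => integral_prod _ (hi c)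
    _ = ∫ z, ∑ c, ∫ z', f z * (G z.1 z'.1 * S c z.2 z'.2) ∂(cylMeasure d T)
        ∂(cylMeasure d T) := (integral_finsetSum _ fun c _ => (hi c).integral_prod_left).symm
    _ = _ := by
      refine integral_congr_ae ?_
      filter_upwards [ae_restrict_mem (measurableSet_cylinder d T)] with z hz
      simp only [integral_const_mul, integral_cylMeasure_mul T (G z.1)]
      rw [← Finset.mul_sum, ← Finset.mul_sum, hm z.2 hz.2, mul_comm m]

/-! ### The antisymmetrized fluxes -/

/-- The sum of the momentum equation and of the continuity equation tested with the reflected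
mollifications of the entropy variables, without the defect. -/
noncomputable def totalFlux (T : ℝ) (χ : ℝ → ℝ) (ε : ℝ) (P P' : ℝ → ℝ) (ρ : ℝ × Space d → ℝ)
    (u : ℝ × Space d → Space d) : ℝ :=
  ∑ c, ((∫ q, pairing P' (ρ q.1) (u q.1) (ρ q.2) (reflVec c (u q.2)) *
      (timeKerAnti χ ε q.1.1 q.2.1 * spaceKer ε c q.1.2 q.2.2)
        ∂((cylMeasure d T).prod (cylMeasure d T))) +
    (∫ q, pairing P' (ρ q.1) (u q.1) (ρ q.2) (reflVec c (u q.2)) *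
      (timeKerSymm χ ε q.1.1 q.2.1 * spaceKer ε c q.1.2 q.2.2)
        ∂((cylMeasure d T).prod (cylMeasure d T))) +
    ∑ j, ∫ q, fluxPairing P P' j (ρ q.1) (u q.1) (ρ q.2) (reflVec c (u q.2)) *
      (timeKer χ ε q.1.1 q.2.1 * spaceKer' ε c j q.1.2 q.2.2)
        ∂((cylMeasure d T).prod (cylMeasure d T)))

theorem measurable_prodKer {G : ℝ → ℝ → ℝ} {S : Space d → Space d → ℝ}
    (hG : Continuous fun q : ℝ × ℝ => G q.1 q.2)
    (hS : Continuous fun q : Space d × Space d => S q.1 q.2) :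
    Measurable fun q : (ℝ × Space d) × (ℝ × Space d) => G q.1.1 q.2.1 * S q.1.2 q.2.2 :=
  (hG.measurable.comp (by fun_prop :
      Measurable fun q : (ℝ × Space d) × (ℝ × Space d) => (q.1.1, q.2.1))).mul
    (hS.measurable.comp (by fun_prop :
      Measurable fun q : (ℝ × Space d) × (ℝ × Space d) => (q.1.2, q.2.2)))

theorem abs_prodKer_le {G : ℝ → ℝ → ℝ} {S : Space d → Space d → ℝ} {B₁ B₂ : ℝ}
    (hG : ∀ t t', |G t t'| ≤ B₁) (hS : ∀ x y, |S x y| ≤ B₂)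
    (q : (ℝ × Space d) × (ℝ × Space d)) : |G q.1.1 q.2.1 * S q.1.2 q.2.2| ≤ B₁ * B₂ := by
  rw [abs_mul]
  exact mul_le_mul (hG _ _) (hS _ _) (abs_nonneg _) ((abs_nonneg _).trans (hG 0 0))

variable {P P' : ℝ → ℝ} {r R C M : ℝ} {ρ : ℝ × Space d → ℝ} {u : ℝ × Space d → Space d}

theorem integral_pairing_eq (hP : PotentialBounds P P' r R C) (hr : 0 ≤ r)
    (h : IsBoundedState r R M ρ u) (hχ : IsTimeCutoff T δ χ) (hε0 : 0 < ε) (c : Fin d → Fin 3) :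
    ∫ q, pairing P' (ρ q.1) (u q.1) (ρ q.2) (reflVec c (u q.2)) *
      (timeKerAnti χ ε q.1.1 q.2.1 * spaceKer ε c q.1.2 q.2.2)
        ∂((cylMeasure d T).prod (cylMeasure d T)) =
    1 / 2 * (∫ q, pairingRem P P' (ρ q.1) (u q.1) (ρ q.2) (reflVec c (u q.2)) *
      (timeKerAnti χ ε q.1.1 q.2.1 * spaceKer ε c q.1.2 q.2.2)
        ∂((cylMeasure d T).prod (cylMeasure d T))) +
    ∫ q, energyDiff P P' (ρ q.1) (u q.1) *
      (timeKerAnti χ ε q.1.1 q.2.1 * spaceKer ε c q.1.2 q.2.2)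
        ∂((cylMeasure d T).prod (cylMeasure d T)) := by
  obtain ⟨Cχ, -, hC1, -⟩ := hχ.exists_bound
  refine integral_mul_antisymm (σ := 1) (by norm_num)
    (rem := fun q => pairingRem P P' (ρ q.1) (u q.1) (ρ q.2) (reflVec c (u q.2)))
    (f := fun z => energyDiff P P' (ρ z) (u z))
    (measurable_pairing hP h c)
    (measurable_prodKer (continuous_timeKerAnti hχ.contDiff ε) (continuous_spaceKer ε c))
    (measurable_energyDiff hP h)
    (fun q => abs_pairing_le hP hr (h.density_mem _) (h.density_mem _) (h.velocity_le _)
      ((norm_reflVec _ _).trans_le (h.velocity_le _)))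
    (abs_prodKer_le (abs_timeKerAnti_le hC1 hε0) (abs_spaceKer_le hε0 c))
    (fun z => abs_energyDiff_le hP hr (h.density_mem _) (h.velocity_le _)) ?_ ?_
  · intro z z'
    simp only [timeKerAnti_comm χ ε z.1, spaceKer_comm ε c z.2]
    ring
  · intro z z'
    simp only [pairingRem, energyDiff_reflVec, pairing_reflVec P' c (ρ z') (u z')]
    ring

theorem integral_fluxPairing_eq (hP : PotentialBounds P P' r R C) (hr : 0 ≤ r)
    (h : IsBoundedState r R M ρ u) (hχ : IsTimeCutoff T δ χ) (hε0 : 0 < ε) (c : Fin d → Fin 3)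
    (j : Fin d) :
    ∫ q, fluxPairing P P' j (ρ q.1) (u q.1) (ρ q.2) (reflVec c (u q.2)) *
      (timeKer χ ε q.1.1 q.2.1 * spaceKer' ε c j q.1.2 q.2.2)
        ∂((cylMeasure d T).prod (cylMeasure d T)) =
    1 / 2 * (∫ q, fluxPairingRem P P' j (ρ q.1) (u q.1) (ρ q.2) (reflVec c (u q.2)) *
      (timeKer χ ε q.1.1 q.2.1 * spaceKer' ε c j q.1.2 q.2.2)
        ∂((cylMeasure d T).prod (cylMeasure d T))) +
    ∫ q, energyFlux P j (ρ q.1) (u q.1) *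
      (timeKer χ ε q.1.1 q.2.1 * spaceKer' ε c j q.1.2 q.2.2)
        ∂((cylMeasure d T).prod (cylMeasure d T)) := by
  obtain ⟨Cχ, -, hC1, -⟩ := hχ.exists_bound
  refine integral_mul_antisymm (σ := flipSign (c j)) (flipSign_mul_self _)
    (rem := fun q => fluxPairingRem P P' j (ρ q.1) (u q.1) (ρ q.2) (reflVec c (u q.2)))
    (f := fun z => energyFlux P j (ρ z) (u z))
    (measurable_fluxPairing hP h j c)
    (measurable_prodKer (continuous_timeKer hχ.contDiff ε) (continuous_spaceKer' ε c j))
    (measurable_energyFlux hP h j)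
    (fun q => abs_fluxPairing_le hP hr j (h.density_mem _) (h.density_mem _) (h.velocity_le _)
      ((norm_reflVec _ _).trans_le (h.velocity_le _)))
    (abs_prodKer_le (abs_timeKer_le hC1 hε0) (abs_spaceKer'_le hε0 c j))
    (fun z => abs_energyFlux_le hP hr j (h.density_mem _) (h.velocity_le _)) ?_ ?_
  · intro z z'
    simp only [timeKer_comm χ ε z.1, spaceKer'_comm ε c j z.2]
    ring
  · intro z z'
    simp only [fluxPairingRem, energyFlux_reflVec, fluxPairing_reflVec P P' j c (ρ z') (u z')]
    linear_combination -fluxPairing P P' j (ρ z') (reflVec c (u z')) (ρ z) (u z) *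
      flipSign_mul_self (c j)

/-- The total flux is the sum of the terms with the symmetric kernel and of cubic remainders. -/
theorem totalFlux_eq (hP : PotentialBounds P P' r R C) (hr : 0 ≤ r)
    (h : IsBoundedState r R M ρ u) (hχ : IsTimeCutoff T δ χ) (hT : 0 < T) (hε0 : 0 < ε)
    (hε : ε ≤ δ) (hε1 : ε ≤ 1) :
    totalFlux T χ ε P P' ρ u =
      1 / 2 * (∑ c, ∫ q, pairingRem P P' (ρ q.1) (u q.1) (ρ q.2) (reflVec c (u q.2)) *
        (timeKerAnti χ ε q.1.1 q.2.1 * spaceKer ε c q.1.2 q.2.2)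
          ∂((cylMeasure d T).prod (cylMeasure d T))) +
      1 / 2 * (∑ c, ∑ j, ∫ q, fluxPairingRem P P' j (ρ q.1) (u q.1) (ρ q.2) (reflVec c (u q.2)) *
        (timeKer χ ε q.1.1 q.2.1 * spaceKer' ε c j q.1.2 q.2.2)
          ∂((cylMeasure d T).prod (cylMeasure d T))) +
      (∑ c, ∫ q, pairing P' (ρ q.1) (u q.1) (ρ q.2) (reflVec c (u q.2)) *
        (timeKerSymm χ ε q.1.1 q.2.1 * spaceKer ε c q.1.2 q.2.2)
          ∂((cylMeasure d T).prod (cylMeasure d T))) +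
      ∫ z, energyDiff P P' (ρ z) (u z) * (∫ t' in Ioo 0 T, timeKerSymm χ ε z.1 t')
        ∂(cylMeasure d T) := by
  obtain ⟨Cχ, -, hC1, -⟩ := hχ.exists_bound
  have m1 : ∑ c, ∫ q, energyDiff P P' (ρ q.1) (u q.1) *
      (timeKerAnti χ ε q.1.1 q.2.1 * spaceKer ε c q.1.2 q.2.2)
        ∂((cylMeasure d T).prod (cylMeasure d T)) =
      ∫ z, energyDiff P P' (ρ z) (u z) * (∫ t' in Ioo 0 T, timeKerSymm χ ε z.1 t')
        ∂(cylMeasure d T) := by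
    rw [sum_integral_fst_mul (f := fun z => energyDiff P P' (ρ z) (u z)) (m := 1)
      (measurable_energyDiff hP h)
      (continuous_timeKerAnti hχ.contDiff ε) (continuous_spaceKer ε)
      (fun z => abs_energyDiff_le hP hr (h.density_mem _) (h.velocity_le _))
      (abs_timeKerAnti_le hC1 hε0) (abs_spaceKer_le hε0)
      fun x hx => sum_integral_spaceKer hε0 hε1 (cube_subset_closedCube d hx)]
    simp only [one_mul, integral_timeKerAnti hχ hT hε0 hε]
  have m2 : ∀ j, ∑ c, ∫ q, energyFlux P j (ρ q.1) (u q.1) *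
      (timeKer χ ε q.1.1 q.2.1 * spaceKer' ε c j q.1.2 q.2.2)
        ∂((cylMeasure d T).prod (cylMeasure d T)) = 0 := fun j => by
    rw [sum_integral_fst_mul (f := fun z => energyFlux P j (ρ z) (u z)) (m := 0)
      (measurable_energyFlux hP h j)
      (continuous_timeKer hχ.contDiff ε) (fun c => continuous_spaceKer' ε c j)
      (fun z => abs_energyFlux_le hP hr j (h.density_mem _) (h.velocity_le _))
      (abs_timeKer_le hC1 hε0) (fun c => abs_spaceKer'_le hε0 c j)
      fun x hx => sum_integral_spaceKer' hε0 hε1 j (cube_subset_closedCube d hx)]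
    simp
  rw [totalFlux, Finset.sum_add_distrib, Finset.sum_add_distrib]
  simp only [integral_pairing_eq hP hr h hχ hε0, integral_fluxPairing_eq hP hr h hχ hε0]
  simp only [Finset.sum_add_distrib, ← Finset.mul_sum]
  rw [m1, Finset.sum_comm (f := fun c j => ∫ q, energyFlux P j (ρ q.1) (u q.1) *
      (timeKer χ ε q.1.1 q.2.1 * spaceKer' ε c j q.1.2 q.2.2)
        ∂((cylMeasure d T).prod (cylMeasure d T)))]
  simp only [m2, Finset.sum_const_zero]
  ring

/-! ### Estimates by cubic increments -/

/-- The pairs of points at distance less than `ε` after the reflection `c` of the second one. -/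
def near (ε : ℝ) (c : Fin d → Fin 3) : Set ((ℝ × Space d) × (ℝ × Space d)) :=
  {q | |q.1.1 - q.2.1| < ε ∧ ∀ i, |q.1.2 i - flip (c i) (q.2.2 i)| < ε}

theorem measurableSet_near (ε : ℝ) (c : Fin d → Fin 3) : MeasurableSet (near ε c) := by
  have h : near ε c = {q | |q.1.1 - q.2.1| < ε} ∩
      ⋂ i, {q | |q.1.2 i - flip (c i) (q.2.2 i)| < ε} := by
    ext q; simp [near]
  rw [h]
  refine (isOpen_lt (by fun_prop) continuous_const).measurableSet.inter
    (MeasurableSet.iInter fun i => (isOpen_lt ?_ continuous_const).measurableSet)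
  have := continuous_flip (c i)
  fun_prop

/-- The cubes of the increments of the state, after the reflection `c` of the second point. -/
noncomputable def cubicIncr (ρ : ℝ × Space d → ℝ) (u : ℝ × Space d → Space d)
    (c : Fin d → Fin 3) (q : (ℝ × Space d) × (ℝ × Space d)) : ℝ :=
  |ρ q.1 - ρ q.2| ^ 3 + ‖u q.1 - reflVec c (u q.2)‖ ^ 3

/-- The integral of the cubic increments over the pairs of points at distance `ε`. -/
noncomputable def cubicDefect (T ε : ℝ) (ρ : ℝ × Space d → ℝ) (u : ℝ × Space d → Space d)
    (c : Fin d → Fin 3) : ℝ :=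
  ∫ q in near ε c, cubicIncr ρ u c q ∂((cylMeasure d T).prod (cylMeasure d T))

theorem cubicIncr_nonneg (c : Fin d → Fin 3) (q : (ℝ × Space d) × (ℝ × Space d)) :
    0 ≤ cubicIncr ρ u c q := by unfold cubicIncr; positivity

theorem IsBoundedState.abs_density_sub_le (h : IsBoundedState r R M ρ u) (z z' : ℝ × Space d) :
    |ρ z - ρ z'| ≤ R - r := by
  have h1 := h.density_mem z
  have h2 := h.density_mem z'
  rw [abs_le]
  constructor <;> linarith [h1.1, h1.2, h2.1, h2.2]

theorem cubicIncr_le (h : IsBoundedState r R M ρ u) (c : Fin d → Fin 3)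
    (q : (ℝ × Space d) × (ℝ × Space d)) :
    |cubicIncr ρ u c q| ≤ (R - r) ^ 3 + (M + M) ^ 3 := by
  rw [abs_of_nonneg (cubicIncr_nonneg c q), cubicIncr]
  have h1 := h.abs_density_sub_le q.1 q.2
  have h3 : ‖u q.1 - reflVec c (u q.2)‖ ≤ M + M := (norm_sub_le _ _).trans
    (add_le_add (h.velocity_le _) ((norm_reflVec _ _).trans_le (h.velocity_le _)))
  gcongr

theorem measurable_cubicIncr (h : IsBoundedState r R M ρ u) (c : Fin d → Fin 3) :
    Measurable (cubicIncr ρ u c) := by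
  have h1 := h.measurable_density
  have h2 := h.measurable_velocity
  have h3 := (continuous_reflVec c).measurable
  unfold cubicIncr
  fun_prop

theorem abs_integral_mul_ker_le (h : IsBoundedState r R M ρ u) (c : Fin d → Fin 3)
    {F K : (ℝ × Space d) × (ℝ × Space d) → ℝ} {A B : ℝ}
    (hF : ∀ q, |F q| ≤ A * cubicIncr ρ u c q) (hK : ∀ q, |K q| ≤ B)
    (hK0 : ∀ q, q ∉ near ε c → K q = 0) :
    |∫ q, F q * K q ∂((cylMeasure d T).prod (cylMeasure d T))| ≤
      A * B * cubicDefect T ε ρ u c := by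
  have hi : Integrable ((near ε c).indicator fun q => A * B * cubicIncr ρ u c q)
      ((cylMeasure d T).prod (cylMeasure d T)) :=
    ((integrable_of_abs_le (measurable_cubicIncr h c) (cubicIncr_le h c)).const_mul _).indicator
      (measurableSet_near ε c)
  rw [cubicDefect, ← integral_const_mul, ← integral_indicator (measurableSet_near ε c)]
  rw [← Real.norm_eq_abs]
  refine norm_integral_le_of_norm_le hi (.of_forall fun q => ?_)
  rw [Real.norm_eq_abs, abs_mul]
  by_cases hq : q ∈ near ε c
  · rw [indicator_of_mem hq]
    have := mul_le_mul (hF q) (hK q) (abs_nonneg _) ((abs_nonneg _).trans (hF q))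
    linarith
  · rw [indicator_of_notMem hq, hK0 q hq]; simp

theorem prodKer_eq_zero {c : Fin d → Fin 3} {G : ℝ → ℝ → ℝ}
    {S : Space d → Space d → ℝ} (hG : ∀ t t', ε ≤ |t - t'| → G t t' = 0)
    (hS : ∀ x y i, ε ≤ |x i - flip (c i) (y i)| → S x y = 0)
    {q : (ℝ × Space d) × (ℝ × Space d)} (hq : q ∉ near ε c) :
    G q.1.1 q.2.1 * S q.1.2 q.2.2 = 0 := by
  by_cases h : |q.1.1 - q.2.1| < ε
  · have : ∃ i, ε ≤ |q.1.2 i - flip (c i) (q.2.2 i)| := by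
      by_contra! h2
      exact hq ⟨h, h2⟩
    obtain ⟨i, hi⟩ := this
    rw [hS _ _ i hi, mul_zero]
  · rw [hG _ _ (not_lt.1 h), zero_mul]

theorem le_add_cube_div {a η : ℝ} (ha : 0 ≤ a) (hη : 0 < η) : a ≤ η + a ^ 3 / η ^ 2 := by
  rcases le_total a η with h | h
  · have : 0 ≤ a ^ 3 / η ^ 2 := by positivity
    linarith
  · have : a ≤ a ^ 3 / η ^ 2 := by
      rw [le_div_iff₀ (by positivity)]
      nlinarith [mul_le_mul_of_nonneg_left (pow_le_pow_left₀ hη.le h 2) ha]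
    linarith

/-- Replacing the second state in the terms with the symmetric kernel by the first one. -/
theorem abs_sum_integral_pairing_sub_le (hP : PotentialBounds P P' r R C) (hr : 0 ≤ r)
    (h : IsBoundedState r R M ρ u) {Cχ : ℝ} (hCχ : ∀ t, |deriv χ t| ≤ Cχ)
    (hε0 : 0 < ε) (hε1 : ε ≤ 1) (hM : 0 ≤ M) :
    |∑ c, ∫ q, (pairing P' (ρ q.1) (u q.1) (ρ q.2) (reflVec c (u q.2)) -
        pairing P' (ρ q.1) (u q.1) (ρ q.1) (u q.1)) *
        (timeKerSymm χ ε q.1.1 q.2.1 * spaceKer ε c q.1.2 q.2.2)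
          ∂((cylMeasure d T).prod (cylMeasure d T))| ≤
      R * (2 * M + C) * (2 * √ε * Cχ * (cylMeasure d T).real univ +
        Cχ * bumpBound ^ (d + 1) * (ε⁻¹ ^ (d + 2) * ∑ c, cubicDefect T ε ρ u c)) := by
  have hC := hP.nonneg
  have hR : 0 ≤ R := (hr.trans (h.density_mem 0).1).trans (h.density_mem 0).2
  have hCχ0 : 0 ≤ Cχ := (abs_nonneg _).trans (hCχ 0)
  have hB := bumpBound_nonneg
  set K := R * (2 * M + C) with hK
  have hK0 : 0 ≤ K := by positivity
  set ν := (cylMeasure d T).prod (cylMeasure d T) with hν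
  have cm : Continuous fun q : ℝ × ℝ => moll ε (q.1 - q.2) := by
    have := continuous_moll ε
    fun_prop
  have mm : ∀ t t' : ℝ, |moll ε (t - t')| ≤ bumpBound * ε⁻¹ := fun t t' => abs_moll_le hε0 _
  have hs0 : 0 < √ε := Real.sqrt_pos.2 hε0
  have hs2 : √ε ^ 2 = ε := Real.sq_sqrt hε0.le
  have i1 : ∀ c, Integrable (fun q : (ℝ × Space d) × (ℝ × Space d) =>
      (2 * √ε * K * Cχ) * (moll ε (q.1.1 - q.2.1) * spaceKer ε c q.1.2 q.2.2)) ν := fun c =>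
    (integrable_of_abs_le (measurable_prodKer (G := fun t t' => moll ε (t - t')) cm
      (continuous_spaceKer ε c))
      (abs_prodKer_le (G := fun t t' => moll ε (t - t')) mm (abs_spaceKer_le hε0 c))).const_mul _
  set L := K * ε⁻¹ * (Cχ * (bumpBound * ε⁻¹) * (bumpBound * ε⁻¹) ^ d) with hL
  have i2 : ∀ c, Integrable ((near ε c).indicator fun q => L * cubicIncr ρ u c q) ν := fun c =>
    ((integrable_of_abs_le (measurable_cubicIncr h c) (cubicIncr_le h c)).const_mul _).indicator
      (measurableSet_near ε c)
  have key : ∀ c, |∫ q, (pairing P' (ρ q.1) (u q.1) (ρ q.2) (reflVec c (u q.2)) -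
        pairing P' (ρ q.1) (u q.1) (ρ q.1) (u q.1)) *
        (timeKerSymm χ ε q.1.1 q.2.1 * spaceKer ε c q.1.2 q.2.2) ∂ν| ≤
      (∫ q, (2 * √ε * K * Cχ) * (moll ε (q.1.1 - q.2.1) * spaceKer ε c q.1.2 q.2.2) ∂ν) +
        L * cubicDefect T ε ρ u c := by
    intro c
    rw [cubicDefect, ← integral_const_mul L, ← integral_indicator (measurableSet_near ε c),
      ← integral_add (i1 c) (i2 c), ← Real.norm_eq_abs]
    refine norm_integral_le_of_norm_le ((i1 c).add (i2 c)) (.of_forall fun q => ?_)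
    rw [Real.norm_eq_abs, abs_mul]
    have hm0 := moll_nonneg hε0 (q.1.1 - q.2.1)
    have hk0 := spaceKer_nonneg hε0 c q.1.2 q.2.2
    have hker : |timeKerSymm χ ε q.1.1 q.2.1 * spaceKer ε c q.1.2 q.2.2| ≤
        Cχ * (moll ε (q.1.1 - q.2.1) * spaceKer ε c q.1.2 q.2.2) := by
      rw [timeKerSymm, abs_mul, abs_mul, abs_of_nonneg hm0, abs_of_nonneg hk0, abs_div, abs_two,
        mul_assoc]
      refine mul_le_mul_of_nonneg_right ?_ (by positivity)
      have := hCχ ((q.1.1 + q.2.1) / 2)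
      linarith [abs_nonneg (deriv χ ((q.1.1 + q.2.1) / 2))]
    by_cases hq : q ∈ near ε c
    · simp only [indicator_of_mem hq]
      have p1 := abs_pairing_sub_le hP hr (h.density_mem q.1) (h.density_mem q.2)
        (h.velocity_le q.1) (w := reflVec c (u q.2))
        ((norm_reflVec _ _).trans_le (h.velocity_le q.2))
      have p2 := le_add_cube_div (abs_nonneg (ρ q.1 - ρ q.2)) hs0
      have p3 := le_add_cube_div (norm_nonneg (u q.1 - reflVec c (u q.2))) hs0
      rw [hs2] at p2 p3
      have p4 : |ρ q.1 - ρ q.2| + ‖u q.1 - reflVec c (u q.2)‖ ≤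
          2 * √ε + ε⁻¹ * cubicIncr ρ u c q := by
        rw [cubicIncr, mul_add, inv_mul_eq_div, inv_mul_eq_div]
        linarith
      have p5 := p1.trans (mul_le_mul_of_nonneg_left p4 hK0)
      have hker2 : Cχ * (moll ε (q.1.1 - q.2.1) * spaceKer ε c q.1.2 q.2.2) ≤
          Cχ * (bumpBound * ε⁻¹) * (bumpBound * ε⁻¹) ^ d := by
        rw [mul_assoc]
        refine mul_le_mul_of_nonneg_left ?_ hCχ0
        exact mul_le_mul (moll_le hε0 _) ((le_abs_self _).trans (abs_spaceKer_le hε0 c _ _)) hk0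
          (by positivity)
      have hi0 := cubicIncr_nonneg (ρ := ρ) (u := u) c q
      calc _ ≤ K * (2 * √ε + ε⁻¹ * cubicIncr ρ u c q) *
            (Cχ * (moll ε (q.1.1 - q.2.1) * spaceKer ε c q.1.2 q.2.2)) :=
            mul_le_mul p5 hker (abs_nonneg _) (by positivity)
        _ = 2 * √ε * K * Cχ * (moll ε (q.1.1 - q.2.1) * spaceKer ε c q.1.2 q.2.2) +
            K * ε⁻¹ * cubicIncr ρ u c q *
              (Cχ * (moll ε (q.1.1 - q.2.1) * spaceKer ε c q.1.2 q.2.2)) := by ring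
        _ ≤ 2 * √ε * K * Cχ * (moll ε (q.1.1 - q.2.1) * spaceKer ε c q.1.2 q.2.2) +
            K * ε⁻¹ * cubicIncr ρ u c q *
              (Cχ * (bumpBound * ε⁻¹) * (bumpBound * ε⁻¹) ^ d) := by gcongr
        _ = _ := by rw [hL]; ring
    · have : moll ε (q.1.1 - q.2.1) * spaceKer ε c q.1.2 q.2.2 = 0 :=
        prodKer_eq_zero (G := fun t t' => moll ε (t - t')) (fun t t' ht => moll_eq_zero hε0 ht)
          (fun x y i hi => spaceKer_eq_zero hε0 hi) hq
      rw [this, mul_zero] at hker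
      rw [le_antisymm hker (abs_nonneg _), indicator_of_notMem hq, this]
      simp
  refine (Finset.abs_sum_le_sum_abs _ _).trans ((Finset.sum_le_sum fun c _ => key c).trans ?_)
  rw [Finset.sum_add_distrib, ← Finset.mul_sum]
  have m1 : ∑ c, ∫ q, (2 * √ε * K * Cχ) * (moll ε (q.1.1 - q.2.1) *
      spaceKer ε c q.1.2 q.2.2) ∂ν ≤ 2 * √ε * K * Cχ * (cylMeasure d T).real univ := by
    rw [sum_integral_fst_mul (f := fun _ => 2 * √ε * K * Cχ) (m := 1)
      (G := fun t t' => moll ε (t - t')) (B₁ := |2 * √ε * K * Cχ|)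
      measurable_const cm (continuous_spaceKer ε) (fun z => le_rfl) mm (abs_spaceKer_le hε0)
      fun x hx => sum_integral_spaceKer hε0 hε1 (cube_subset_closedCube d hx)]
    have hle : ∀ t : ℝ, ∫ t' in Ioo 0 T, moll ε (t - t') ≤ 1 := fun t => by
      rw [← integral_moll hε0, ← integral_sub_left_eq_self (moll ε) volume t]
      have hii : Integrable (fun t' => moll ε (t - t')) :=
        (Continuous.integrable_of_hasCompactSupport (by
          have := continuous_moll ε
          fun_prop) (HasCompactSupport.intro (isCompact_Icc (a := t - ε) (b := t + ε))
            fun s hs => moll_eq_zero hε0 (by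
              by_contra! hlt
              rw [abs_lt] at hlt
              exact hs ⟨by linarith [hlt.2], by linarith [hlt.1]⟩)))
      exact setIntegral_le_integral hii (.of_forall fun s => moll_nonneg hε0 _)
    calc _ ≤ ∫ z : ℝ × Space d, 2 * √ε * K * Cχ ∂(cylMeasure d T) := by
          refine integral_mono_of_nonneg (.of_forall fun z => ?_) (integrable_const _)
            (.of_forall fun z => ?_)
          · refine mul_nonneg (by positivity) (mul_nonneg zero_le_one
              (integral_nonneg fun s => moll_nonneg hε0 _))
          · dsimp only
            rw [one_mul]
            exact mul_le_of_le_one_right (by positivity) (hle z.1)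
      _ = _ := by simp; ring
  refine (add_le_add_left m1 _).trans (le_of_eq ?_)
  rw [hL]
  simp only [mul_pow, pow_succ]
  ring

/-- The total flux converges to the weak form of the energy balance. -/
theorem tendsto_totalFlux (hP : PotentialBounds P P' r R C) (hr : 0 ≤ r) (hM : 0 ≤ M)
    (h : IsBoundedState r R M ρ u) (hχ : IsTimeCutoff T δ χ) (hT : 0 < T) (hδ : 0 < δ)
    {e : ℕ → ℝ} (he0 : ∀ n, 0 < e n) (he : Tendsto e atTop (𝓝 0))
    (hΘ : ∀ c, Tendsto (fun n => (e n)⁻¹ ^ (d + 2) * cubicDefect T (e n) ρ u c) atTop (𝓝 0)) :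
    Tendsto (fun n => totalFlux T χ (e n) P P' ρ u) atTop
      (𝓝 (∫ z, deriv χ z.1 * (ρ z * ‖u z‖ ^ 2 / 2 + P (ρ z)) ∂(cylMeasure d T))) := by
  obtain ⟨Cχ, hC0, hC1, hC2⟩ := hχ.exists_bound
  have hB := bumpBound_nonneg
  have hC := hP.nonneg
  have hR : 0 ≤ R := (hr.trans (h.density_mem 0).1).trans (h.density_mem 0).2
  set Θ : ℕ → ℝ := fun n => (e n)⁻¹ ^ (d + 2) * ∑ c, cubicDefect T (e n) ρ u c with hΘdef
  have hΘ0 : Tendsto Θ atTop (𝓝 0) := by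
    have := tendsto_finsetSum (Finset.univ : Finset (Fin d → Fin 3)) fun c _ => hΘ c
    simpa [Θ, Finset.mul_sum] using this
  set V := (cylMeasure d T).real univ with hV
  let A₁ := 1 / 2 * ((C + 1) * (Cχ * bumpBound ^ (d + 1)))
  let A₂ := 1 / 2 * (d * ((R + M + C + M * C) * (Cχ * bumpBound ^ (d + 1))))
  let A₃ := R * (2 * M + C) * (2 * Cχ * V)
  let A₄ := R * (2 * M + C) * (Cχ * bumpBound ^ (d + 1))
  let A₅ := (R * M ^ 2 + 2 * C) * V
  have hEm : Measurable fun z => ρ z * ‖u z‖ ^ 2 / 2 + P (ρ z) := by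
    have h1 := h.measurable_density
    have h2 := h.measurable_velocity
    have h3 := hP.measurable
    fun_prop
  have hEb : ∀ z, |2 * (ρ z * ‖u z‖ ^ 2 / 2 + P (ρ z))| ≤ R * M ^ 2 + 2 * C := fun z => by
    have h0 : 0 ≤ ρ z := hr.trans (h.density_mem z).1
    have h1 := (h.density_mem z).2
    have h2 := h.velocity_le z
    have h3 := hP.bound _ (h.density_mem z)
    have h4 : ρ z * ‖u z‖ ^ 2 ≤ R * M ^ 2 := by gcongr
    have h5 : 0 ≤ ρ z * ‖u z‖ ^ 2 := by positivity
    rw [abs_le] at h3 ⊢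
    constructor <;> linarith [h3.1, h3.2]
  have hpt : ∀ z, pairing P' (ρ z) (u z) (ρ z) (u z) + energyDiff P P' (ρ z) (u z) =
      2 * (ρ z * ‖u z‖ ^ 2 / 2 + P (ρ z)) := fun z => by
    rw [pairing, energyDiff, real_inner_self_eq_norm_sq]; ring
  have cS : ∀ ε, Continuous fun t => ∫ t' in Ioo 0 T, timeKerSymm χ ε t t' := fun ε => by
    have := continuous_timeKerSymm hχ.contDiff ε
    rw [funext fun t => setIntegral_Ioo_eq hT.le fun t' => timeKerSymm χ ε t t']
    exact intervalIntegral.continuous_parametric_intervalIntegral_of_continuous' this 0 T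
  have hmain : ∀ η > 0, ∀ᶠ n in atTop, |totalFlux T χ (e n) P P' ρ u -
      ∫ z, deriv χ z.1 * (ρ z * ‖u z‖ ^ 2 / 2 + P (ρ z)) ∂(cylMeasure d T)| ≤
      A₁ * Θ n + A₂ * Θ n + (A₃ * √(e n) + A₄ * Θ n) + A₅ * η := by
    intro η hη
    obtain ⟨ε₀, hε₀, happ⟩ := exists_integral_timeKerSymm_approx hχ hδ hη
    filter_upwards [he.eventually_lt_const (lt_min (lt_min hε₀ hδ) zero_lt_one)] with n hn
    have hn0 := he0 n
    set ε := e n with hεdef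
    have hε1 : ε ≤ 1 := hn.le.trans (min_le_right _ _)
    have hεδ : ε ≤ δ := hn.le.trans ((min_le_left _ _).trans (min_le_right _ _))
    have hεε : ε ≤ ε₀ := hn.le.trans ((min_le_left _ _).trans (min_le_left _ _))
    have hpow : ∀ B : ℝ, Cχ * (bumpBound * ε⁻¹ ^ 2) * (bumpBound * ε⁻¹) ^ d * B =
        Cχ * bumpBound ^ (d + 1) * (ε⁻¹ ^ (d + 2) * B) := fun B => by
      rw [mul_pow, pow_succ, pow_add]; ring
    have hpow' : ∀ B : ℝ, Cχ * (bumpBound * ε⁻¹) * ((bumpBound * ε⁻¹) ^ d * ε⁻¹) * B =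
        Cχ * bumpBound ^ (d + 1) * (ε⁻¹ ^ (d + 2) * B) := fun B => by
      rw [mul_pow, pow_succ, pow_add]; ring
    have b1 : |1 / 2 * ∑ c, ∫ q, pairingRem P P' (ρ q.1) (u q.1) (ρ q.2) (reflVec c (u q.2)) *
        (timeKerAnti χ ε q.1.1 q.2.1 * spaceKer ε c q.1.2 q.2.2)
          ∂((cylMeasure d T).prod (cylMeasure d T))| ≤ A₁ * Θ n := by
      rw [abs_mul, abs_of_nonneg (by norm_num : (0 : ℝ) ≤ 1 / 2)]
      refine (mul_le_mul_of_nonneg_left ((Finset.abs_sum_le_sum_abs _ _).trans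
        (Finset.sum_le_sum fun c _ => abs_integral_mul_ker_le h c
          (A := C + 1) (B := Cχ * (bumpBound * ε⁻¹ ^ 2) * (bumpBound * ε⁻¹) ^ d)
          (fun q => abs_pairingRem_le hP (h.density_mem _) (h.density_mem _) _ _)
          (abs_prodKer_le (abs_timeKerAnti_le hC1 hn0) (abs_spaceKer_le hn0 c))
          fun q hq => prodKer_eq_zero (fun t t' ht => by
            rw [timeKerAnti, moll'_eq_zero hn0 ht, mul_zero])
            (fun x y i hi => spaceKer_eq_zero hn0 hi) hq)) (by norm_num)).trans_eq ?_
      rw [← Finset.mul_sum, mul_assoc (C + 1), hpow]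
      simp only [A₁, Θ]
      ring
    have b2 : |1 / 2 * ∑ c, ∑ j, ∫ q, fluxPairingRem P P' j (ρ q.1) (u q.1) (ρ q.2)
        (reflVec c (u q.2)) * (timeKer χ ε q.1.1 q.2.1 * spaceKer' ε c j q.1.2 q.2.2)
          ∂((cylMeasure d T).prod (cylMeasure d T))| ≤ A₂ * Θ n := by
      rw [abs_mul, abs_of_nonneg (by norm_num : (0 : ℝ) ≤ 1 / 2)]
      refine (mul_le_mul_of_nonneg_left ((Finset.abs_sum_le_sum_abs _ _).trans
        (Finset.sum_le_sum fun c _ => (Finset.abs_sum_le_sum_abs _ _).trans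
          (Finset.sum_le_sum fun j _ => abs_integral_mul_ker_le h c
          (A := R + M + C + M * C)
          (B := Cχ * (bumpBound * ε⁻¹) * ((bumpBound * ε⁻¹) ^ d * ε⁻¹))
          (fun q => abs_fluxPairingRem_le hP hr (h.density_mem _) (h.density_mem _) j
            ((norm_reflVec _ _).trans_le (h.velocity_le _)))
          (abs_prodKer_le (abs_timeKer_le hC1 hn0) (abs_spaceKer'_le hn0 c j))
          fun q hq => prodKer_eq_zero (fun t t' ht => by
            rw [timeKer, moll_eq_zero hn0 ht, mul_zero])
            (fun x y i hi => spaceKer'_eq_zero hn0 hi) hq))) (by norm_num)).trans_eq ?_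
      simp only [Finset.sum_const, Finset.card_univ, Fintype.card_fin, nsmul_eq_mul]
      rw [← Finset.mul_sum, ← Finset.mul_sum, mul_assoc (R + M + C + M * C), hpow']
      simp only [A₂, Θ]
      ring
    have b3 := abs_sum_integral_pairing_sub_le (T := T) hP hr h hC2 hn0 hε1 hM
    have b3' : R * (2 * M + C) * (2 * √ε * Cχ * V +
        Cχ * bumpBound ^ (d + 1) * (ε⁻¹ ^ (d + 2) * ∑ c, cubicDefect T ε ρ u c)) =
        A₃ * √ε + A₄ * Θ n := by
      simp only [A₃, A₄, Θ]; ring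
    rw [b3'] at b3
    -- the part of the symmetric term in which both states agree
    have mpp : Measurable fun z => pairing P' (ρ z) (u z) (ρ z) (u z) := by
      have h1 := h.measurable_density
      have h2 := h.measurable_velocity
      have h3 := hP.measurable'
      unfold pairing
      fun_prop
    have bpp : ∀ z, |pairing P' (ρ z) (u z) (ρ z) (u z)| ≤ R * (M * M) + R * (C + M ^ 2 / 2) :=
      fun z => abs_pairing_le hP hr (h.density_mem _) (h.density_mem _) (h.velocity_le _)
        (h.velocity_le _)
    have kb : ∀ c, ∀ q : (ℝ × Space d) × (ℝ × Space d),
        |timeKerSymm χ ε q.1.1 q.2.1 * spaceKer ε c q.1.2 q.2.2| ≤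
        Cχ * (bumpBound * ε⁻¹) * (bumpBound * ε⁻¹) ^ d := fun c =>
      abs_prodKer_le (abs_timeKerSymm_le hC2 hn0) (abs_spaceKer_le hn0 c)
    have km : ∀ c, Measurable fun q : (ℝ × Space d) × (ℝ × Space d) =>
        timeKerSymm χ ε q.1.1 q.2.1 * spaceKer ε c q.1.2 q.2.2 := fun c =>
      measurable_prodKer (continuous_timeKerSymm hχ.contDiff ε) (continuous_spaceKer ε c)
    have s1 : ∑ c, ∫ q, pairing P' (ρ q.1) (u q.1) (ρ q.1) (u q.1) *
        (timeKerSymm χ ε q.1.1 q.2.1 * spaceKer ε c q.1.2 q.2.2)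
          ∂((cylMeasure d T).prod (cylMeasure d T)) =
        ∫ z, pairing P' (ρ z) (u z) (ρ z) (u z) * (∫ t' in Ioo 0 T, timeKerSymm χ ε z.1 t')
        ∂(cylMeasure d T) := by
      rw [sum_integral_fst_mul (f := fun z => pairing P' (ρ z) (u z) (ρ z) (u z)) (m := 1) mpp
        (continuous_timeKerSymm hχ.contDiff ε) (continuous_spaceKer ε) bpp
        (abs_timeKerSymm_le hC2 hn0) (abs_spaceKer_le hn0)
        fun x hx => sum_integral_spaceKer hn0 hε1 (cube_subset_closedCube d hx)]
      simp only [one_mul]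
    have s2 : ∑ c, ∫ q, (pairing P' (ρ q.1) (u q.1) (ρ q.2) (reflVec c (u q.2)) -
        pairing P' (ρ q.1) (u q.1) (ρ q.1) (u q.1)) *
        (timeKerSymm χ ε q.1.1 q.2.1 * spaceKer ε c q.1.2 q.2.2)
          ∂((cylMeasure d T).prod (cylMeasure d T)) =
        (∑ c, ∫ q, pairing P' (ρ q.1) (u q.1) (ρ q.2) (reflVec c (u q.2)) *
          (timeKerSymm χ ε q.1.1 q.2.1 * spaceKer ε c q.1.2 q.2.2)
          ∂((cylMeasure d T).prod (cylMeasure d T))) -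
        ∑ c, ∫ q, pairing P' (ρ q.1) (u q.1) (ρ q.1) (u q.1) *
        (timeKerSymm χ ε q.1.1 q.2.1 * spaceKer ε c q.1.2 q.2.2)
          ∂((cylMeasure d T).prod (cylMeasure d T)) := by
      rw [← Finset.sum_sub_distrib]
      refine Finset.sum_congr rfl fun c _ => ?_
      rw [← integral_sub]
      · simp only [sub_mul]
      · refine integrable_of_abs_le ((measurable_pairing hP h c).mul (km c)) (K := (R * (M * M) + R * (C + M ^ 2 / 2)) *
          (Cχ * (bumpBound * ε⁻¹) * (bumpBound * ε⁻¹) ^ d)) fun q => ?_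
        rw [abs_mul]
        exact mul_le_mul (abs_pairing_le hP hr (h.density_mem _) (h.density_mem _)
          (h.velocity_le _) ((norm_reflVec _ _).trans_le (h.velocity_le _))) (kb c q)
          (abs_nonneg _) ((abs_nonneg _).trans (bpp q.1))
      · refine integrable_of_abs_le ((mpp.comp measurable_fst).mul (km c)) (K := (R * (M * M) + R * (C + M ^ 2 / 2)) *
          (Cχ * (bumpBound * ε⁻¹) * (bumpBound * ε⁻¹) ^ d)) fun q => ?_
        rw [abs_mul]
        exact mul_le_mul (bpp q.1) (kb c q) (abs_nonneg _) ((abs_nonneg _).trans (bpp q.1))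
    have bS : ∀ t ∈ Ioo 0 T, |∫ t' in Ioo 0 T, timeKerSymm χ ε t t'| ≤ η + Cχ / 2 := by
      intro t ht
      have h1 := happ ε hn0 hεε t ht
      have h2 := hC2 t
      rw [abs_le] at h1 h2 ⊢
      constructor <;> linarith [h1.1, h1.2, h2.1, h2.2]
    have iS : ∀ {f : ℝ × Space d → ℝ} {B : ℝ}, Measurable f → (∀ z, |f z| ≤ B) →
        Integrable (fun z => f z * ∫ t' in Ioo 0 T, timeKerSymm χ ε z.1 t') (cylMeasure d T) := by
      intro f B hf hB
      refine Integrable.of_bound (C := B * (η + Cχ / 2))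
        (hf.mul ((cS ε).measurable.comp measurable_fst)).aestronglyMeasurable ?_
      filter_upwards [ae_restrict_mem (measurableSet_cylinder d T)] with z hz
      rw [Real.norm_eq_abs, abs_mul]
      exact mul_le_mul (hB z) (bS z.1 hz.1) (abs_nonneg _) ((abs_nonneg _).trans (hB z))
    have s3 : (∫ z, pairing P' (ρ z) (u z) (ρ z) (u z) * (∫ t' in Ioo 0 T, timeKerSymm χ ε z.1 t')
        ∂(cylMeasure d T)) + (∫ z, energyDiff P P' (ρ z) (u z) *
          (∫ t' in Ioo 0 T, timeKerSymm χ ε z.1 t') ∂(cylMeasure d T)) -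
        (∫ z, deriv χ z.1 * (ρ z * ‖u z‖ ^ 2 / 2 + P (ρ z)) ∂(cylMeasure d T)) =
        ∫ z, 2 * (ρ z * ‖u z‖ ^ 2 / 2 + P (ρ z)) *
          ((∫ t' in Ioo 0 T, timeKerSymm χ ε z.1 t') - deriv χ z.1 / 2) ∂(cylMeasure d T) := by
      have i3 : Integrable (fun z : ℝ × Space d =>
          deriv χ z.1 * (ρ z * ‖u z‖ ^ 2 / 2 + P (ρ z))) (cylMeasure d T) := by
        refine integrable_of_abs_le ((((hχ.contDiff.continuous_deriv le_rfl).measurable).comp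
          measurable_fst).mul hEm) (K := Cχ * (R * M ^ 2 + 2 * C)) fun z => ?_
        rw [abs_mul]
        refine mul_le_mul (hC2 _) ?_ (abs_nonneg _) hC0
        refine le_trans ?_ (hEb z)
        rw [abs_mul, abs_two]
        linarith [abs_nonneg (ρ z * ‖u z‖ ^ 2 / 2 + P (ρ z))]
      have i1 := iS mpp bpp
      have i2 := iS (measurable_energyDiff hP h)
        (fun z => abs_energyDiff_le hP hr (h.density_mem z) (h.velocity_le z))
      have i12 : Integrable (fun z => pairing P' (ρ z) (u z) (ρ z) (u z) *
          (∫ t' in Ioo 0 T, timeKerSymm χ ε z.1 t') + energyDiff P P' (ρ z) (u z) *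
          ∫ t' in Ioo 0 T, timeKerSymm χ ε z.1 t') (cylMeasure d T) := i1.add i2
      rw [← integral_add i1 i2, ← integral_sub i12 i3]
      refine integral_congr_ae (.of_forall fun z => ?_)
      dsimp only
      rw [← hpt z]
      linear_combination (deriv χ z.1 / 2) * hpt z
    have b4 : |∫ z, 2 * (ρ z * ‖u z‖ ^ 2 / 2 + P (ρ z)) *
        ((∫ t' in Ioo 0 T, timeKerSymm χ ε z.1 t') - deriv χ z.1 / 2) ∂(cylMeasure d T)| ≤
        A₅ * η := by
      rw [← Real.norm_eq_abs]
      refine (norm_integral_le_of_norm_le (integrable_const ((R * M ^ 2 + 2 * C) * η))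
        ?_).trans_eq ?_
      · filter_upwards [ae_restrict_mem (measurableSet_cylinder d T)] with z hz
        rw [Real.norm_eq_abs, abs_mul]
        exact mul_le_mul (hEb z) (happ ε hn0 hεε z.1 hz.1) (abs_nonneg _)
          ((abs_nonneg _).trans (hEb z))
      · simp only [integral_const, smul_eq_mul, A₅, V]
        ring
    rw [totalFlux_eq hP hr h hχ hT hn0 hεδ hε1]
    rw [← s3] at b4
    rw [s2, s1] at b3
    rw [abs_le] at *
    constructor <;> linarith [b1.1, b1.2, b2.1, b2.2, b3.1, b3.2, b4.1, b4.2]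
  rw [Metric.tendsto_atTop']
  have hsq : Tendsto (fun n => √(e n)) atTop (𝓝 0) := by
    have := (Real.continuous_sqrt.tendsto 0).comp he
    simpa [Function.comp_def] using this
  have hA5 : 0 ≤ A₅ := by positivity
  intro τ hτ
  have hη : 0 < τ / (2 * (A₅ + 1)) := by positivity
  have hA : A₅ * (τ / (2 * (A₅ + 1))) ≤ τ / 2 := by
    rw [mul_div_assoc', div_le_iff₀ (by positivity)]
    nlinarith
  have hlim : Tendsto (fun n => A₁ * Θ n + A₂ * Θ n + (A₃ * √(e n) + A₄ * Θ n)) atTop (𝓝 0) := by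
    have := ((hΘ0.const_mul A₁).add (hΘ0.const_mul A₂)).add
      ((hsq.const_mul A₃).add (hΘ0.const_mul A₄))
    simpa using this
  obtain ⟨N, hN⟩ := eventually_atTop.1
    ((hmain _ hη).and (hlim.eventually_lt_const (half_pos hτ)))
  refine ⟨N, fun n hn => ?_⟩
  obtain ⟨h1, h2⟩ := hN n hn.le
  rw [Real.dist_eq]
  linarith

end Euler

namespace Euler

/-! ### Double integrals and shifts -/

/-- A symmetric function of two points of `Q` is controlled by its integrals along shifts, and it
suffices to know these for one of the shifts `h`, `-h`. -/
theorem lintegral_lintegral_le_of_shift {V : Type*} [NormedAddCommGroup V] [MeasurableSpace V]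
    [BorelSpace V] [SecondCountableTopology V] {μ : Measure V} [SFinite μ] [μ.IsAddLeftInvariant]
    {Q N S : Set V} (hQ : MeasurableSet Q) (hN : MeasurableSet N) (hNs : ∀ h ∈ N, -h ∈ N)
    (hS : ∀ᵐ h ∂μ, h ∈ S ∨ -h ∈ S) {F : V → V → ℝ≥0∞} (hF : Measurable (Function.uncurry F))
    (hsymm : ∀ z z', F z z' = F z' z) {b : ℝ≥0∞}
    (hb : ∀ h ∈ N, h ∈ S → ∫⁻ z in Q ∩ {z | z + h ∈ Q}, F z (z + h) ∂μ ≤ b) :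
    ∫⁻ z in Q, ∫⁻ z' in Q, N.indicator (fun _ => F z z') (z' - z) ∂μ ∂μ ≤ b * μ N := by
  have hFm : Measurable fun q : V × V => F q.1 (q.1 + q.2) :=
    hF.comp (by fun_prop : Measurable fun q : V × V => (q.1, q.1 + q.2))
  have hQm : ∀ h, MeasurableSet {z | z + h ∈ Q} := fun h =>
    (measurable_add_const h) hQ
  -- substitute `z' = z + h` and exchange the integrals
  have e1 : ∀ z, ∫⁻ z' in Q, N.indicator (fun _ => F z z') (z' - z) ∂μ =
      ∫⁻ h, N.indicator (fun h => Q.indicator (fun _ => F z (z + h)) (z + h)) h ∂μ := fun z => by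
    rw [← lintegral_indicator hQ, ← lintegral_add_left_eq_self _ z]
    refine lintegral_congr fun h => ?_
    by_cases h1 : z + h ∈ Q <;> by_cases h2 : h ∈ N <;> simp [h1, h2]
  have hmeas : Measurable fun q : V × V =>
      N.indicator (fun h => Q.indicator (fun _ => F q.1 (q.1 + h)) (q.1 + h)) q.2 := by
    have : (fun q : V × V =>
        N.indicator (fun h => Q.indicator (fun _ => F q.1 (q.1 + h)) (q.1 + h)) q.2) =
        ({q : V × V | q.2 ∈ N} ∩ {q | q.1 + q.2 ∈ Q}).indicator fun q => F q.1 (q.1 + q.2) := by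
      funext q
      by_cases h1 : q.1 + q.2 ∈ Q <;> by_cases h2 : q.2 ∈ N <;> simp [h1, h2]
    rw [this]
    exact hFm.indicator ((measurable_snd hN).inter
      ((by fun_prop : Measurable fun q : V × V => q.1 + q.2) hQ))
  simp only [e1]
  rw [lintegral_lintegral_swap hmeas.aemeasurable]
  have e2 : ∀ h, ∫⁻ z in Q, N.indicator (fun h => Q.indicator (fun _ => F z (z + h)) (z + h)) h ∂μ =
      N.indicator (fun h => ∫⁻ z in Q ∩ {z | z + h ∈ Q}, F z (z + h) ∂μ) h := fun h => by
    by_cases h2 : h ∈ N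
    · simp only [indicator_of_mem h2]
      rw [inter_comm, ← Measure.restrict_restrict (hQm h), ← lintegral_indicator (hQm h)]
      rfl
    · simp [h2]
  simp only [e2]
  have hflip : ∀ h, ∫⁻ z in Q ∩ {z | z + h ∈ Q}, F z (z + h) ∂μ =
      ∫⁻ z in Q ∩ {z | z + -h ∈ Q}, F z (z + -h) ∂μ := fun h => by
    rw [← lintegral_indicator (hQ.inter (hQm h)), ← lintegral_indicator (hQ.inter (hQm (-h))),
      ← lintegral_add_left_eq_self _ (-h)]
    refine lintegral_congr fun z => ?_
    have a1 : -h + z = z + -h := add_comm _ _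
    have a2 : -h + z + h = z := by abel
    have a3 : z + -h + h = z := by abel
    by_cases h1 : z ∈ Q <;> by_cases h2 : z + -h ∈ Q <;> simp [h1, h2, a1, a3, hsymm (z + -h) z]
  calc ∫⁻ h, N.indicator (fun h => ∫⁻ z in Q ∩ {z | z + h ∈ Q}, F z (z + h) ∂μ) h ∂μ
      ≤ ∫⁻ h, N.indicator (fun _ => b) h ∂μ := by
        refine lintegral_mono_ae ?_
        filter_upwards [hS] with h hh
        by_cases hn : h ∈ N
        · rw [indicator_of_mem hn, indicator_of_mem hn]
          rcases hh with hh | hh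
          · exact hb h hn hh
          · rw [hflip]; exact hb (-h) (hNs h hn) hh
        · simp [hn]
    _ = b * μ N := by rw [lintegral_indicator hN, setLIntegral_const]

/-! ### Traces -/

/-- The hypothesis of the trace theorem at the scales `e n`: the increments of `f` in its first
variable are controlled by a geometric sequence. -/
structure HasTraceBound {Z : Type*} [MeasurableSpace Z] (ν : Measure Z) (f : ℝ × Z → ℝ) (ℓ : ℝ)
    (K q : ℝ≥0∞) : Prop where
  measurable : Measurable f
  pos : 0 < ℓ
  ne_top : K ≠ ⊤
  lt_one : q < 1
  shift : ∀ n : ℕ, ∀ h, 0 < h → h < ℓ * (1 / 2) ^ n →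
    ∫⁻ s in Ioo 0 (ℓ * (1 / 2) ^ n - h), ∫⁻ z, ‖f (s + h, z) - f (s, z)‖ₑ ∂ν ≤
      K * q ^ n * ENNReal.ofReal (ℓ * (1 / 2) ^ n)

/-- The average of `f (·, z)` over `(0, δ)`. -/
noncomputable def layerMean {Z : Type*} (f : ℝ × Z → ℝ) (δ : ℝ) (z : Z) : ℝ := δ⁻¹ * ∫ s in Ioo 0 δ, f (s, z)

theorem abs_layerMean_le {Z : Type*} {f : ℝ × Z → ℝ} {M : ℝ} (hM : ∀ p, |f p| ≤ M) {δ : ℝ} (hδ : 0 < δ) (z : Z) :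
    |layerMean f δ z| ≤ M := by
  rw [layerMean, abs_mul, abs_of_pos (inv_pos.2 hδ), inv_mul_le_iff₀ hδ]
  have := norm_setIntegral_le_of_norm_le_const (μ := volume) (s := Ioo 0 δ) (C := M)
    (f := fun s => f (s, z)) (by simp) (fun s _ => hM _)
  simpa [hδ.le, mul_comm] using this

variable {Z : Type*} [MeasurableSpace Z] {ν : Measure Z} [IsFiniteMeasure ν] {f : ℝ × Z → ℝ}
  {ℓ M : ℝ} {K q : ℝ≥0∞}

theorem measurable_layerMean (hf : Measurable f) (δ : ℝ) : Measurable (layerMean f δ) := by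
  have : StronglyMeasurable fun z => ∫ s in Ioo 0 δ, f (s, z) :=
    StronglyMeasurable.integral_prod_right' (f := fun q : Z × ℝ => f (q.2, q.1))
      (hf.comp measurable_swap).stronglyMeasurable
  exact this.measurable.const_mul _

theorem integrableOn_layer (hf : Measurable f) (hM : ∀ p, |f p| ≤ M) (a b : ℝ) (z : Z) :
    IntegrableOn (fun s => f (s, z)) (Ioo a b) := by
  refine Integrable.of_bound (C := M) ?_ (.of_forall fun s => hM _)
  exact (hf.comp (by fun_prop : Measurable fun s : ℝ => (s, z))).aestronglyMeasurable

theorem layerMean_sub (hf : Measurable f) (hM : ∀ p, |f p| ≤ M) {δ : ℝ} (hδ : 0 < δ) (z : Z) :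
    layerMean f (2 * δ) z - layerMean f δ z =
      (2 * δ)⁻¹ * ∫ s in Ioo 0 δ, (f (s + δ, z) - f (s, z)) := by
  have hi : ∀ a b, IntervalIntegrable (fun s => f (s, z)) volume a b := fun a b => by
    have hs : AEStronglyMeasurable (fun s => f (s, z)) :=
      (hf.comp (by fun_prop : Measurable fun s : ℝ => (s, z))).aestronglyMeasurable
    exact ⟨.of_bound measure_Ioc_lt_top hs.restrict M (.of_forall fun s => hM _),
      .of_bound measure_Ioc_lt_top hs.restrict M (.of_forall fun s => hM _)⟩
  rw [layerMean, layerMean, setIntegral_Ioo_eq (by positivity), setIntegral_Ioo_eq hδ.le,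
    setIntegral_Ioo_eq hδ.le, intervalIntegral.integral_sub _ (hi _ _),
    intervalIntegral.integral_comp_add_right (fun s => f (s, z)),
    ← intervalIntegral.integral_add_adjacent_intervals (hi 0 δ) (hi δ (2 * δ)), zero_add,
    ← two_mul]
  · field_simp
    ring
  · have := (hi δ (2 * δ)).comp_add_right δ
    simpa [two_mul] using this

/-- The averages over consecutive dyadic layers are geometrically close in `L¹`. -/
theorem HasTraceBound.lintegral_layerMean_sub_le (hf : HasTraceBound ν f ℓ K q)
    (hM : ∀ p, |f p| ≤ M) (n : ℕ) :
    ∫⁻ z, ‖layerMean f (ℓ * (1 / 2) ^ n) z - layerMean f (ℓ * (1 / 2) ^ (n + 1)) z‖ₑ ∂ν ≤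
      K * q ^ n := by
  set δ := ℓ * (1 / 2) ^ (n + 1) with hδ
  have hδ0 : 0 < δ := by have := hf.pos; positivity
  have h2 : ℓ * (1 / 2) ^ n = 2 * δ := by rw [hδ, pow_succ]; ring
  have hs := hf.shift n δ hδ0 (by rw [h2]; linarith)
  rw [h2] at hs ⊢
  rw [show 2 * δ - δ = δ by ring] at hs
  have hfm : Measurable fun q : ℝ × Z => ‖f (q.1 + δ, q.2) - f (q.1, q.2)‖ₑ := by
    have := hf.measurable
    fun_prop
  have hpt : ∀ z, ‖layerMean f (2 * δ) z - layerMean f δ z‖ₑ ≤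
      ENNReal.ofReal (2 * δ)⁻¹ * ∫⁻ s in Ioo 0 δ, ‖f (s + δ, z) - f (s, z)‖ₑ := fun z => by
    rw [layerMean_sub hf.measurable hM hδ0, enorm_mul, Real.enorm_of_nonneg (by positivity)]
    gcongr
    exact enorm_integral_le_lintegral_enorm _
  calc _ ≤ ∫⁻ z, (ENNReal.ofReal (2 * δ)⁻¹ *
        ∫⁻ s in Ioo 0 δ, ‖f (s + δ, z) - f (s, z)‖ₑ) ∂ν := lintegral_mono hpt
    _ = ENNReal.ofReal (2 * δ)⁻¹ *
        ∫⁻ s in Ioo 0 δ, ∫⁻ z, ‖f (s + δ, z) - f (s, z)‖ₑ ∂ν := by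
      rw [lintegral_const_mul' _ _ ENNReal.ofReal_ne_top, lintegral_lintegral_swap]
      exact (hfm.comp measurable_swap).aemeasurable
    _ ≤ ENNReal.ofReal (2 * δ)⁻¹ * (K * q ^ n * ENNReal.ofReal (2 * δ)) := by gcongr
    _ = K * q ^ n := by
      rw [mul_comm, mul_assoc, ← ENNReal.ofReal_mul (by positivity),
        mul_inv_cancel₀ (by positivity), ENNReal.ofReal_one, mul_one]

/-- In the mean over a layer, `f` is close in `L¹` to its average over the layer. -/
theorem HasTraceBound.lintegral_sub_layerMean_le (hf : HasTraceBound ν f ℓ K q)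
    (hM : ∀ p, |f p| ≤ M) (n : ℕ) :
    ENNReal.ofReal (ℓ * (1 / 2) ^ n)⁻¹ * ∫⁻ s in Ioo 0 (ℓ * (1 / 2) ^ n),
      ∫⁻ z, ‖f (s, z) - layerMean f (ℓ * (1 / 2) ^ n) z‖ₑ ∂ν ≤ 2 * (K * q ^ n) := by
  set δ := ℓ * (1 / 2) ^ n with hδ
  have hδ0 : 0 < δ := by have := hf.pos; positivity
  have hm := hf.measurable
  have hpt : ∀ s z, ‖f (s, z) - layerMean f δ z‖ₑ ≤
      ENNReal.ofReal δ⁻¹ * ∫⁻ s' in Ioo 0 δ, ‖f (s, z) - f (s', z)‖ₑ := fun s z => by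
    have hc : ∫ _ in Ioo 0 δ, f (s, z) = δ * f (s, z) := by simp [hδ0.le]
    have : f (s, z) - layerMean f δ z = δ⁻¹ * ∫ s' in Ioo 0 δ, (f (s, z) - f (s', z)) := by
      rw [integral_sub (by simp) (integrableOn_layer hm hM 0 δ z), hc, mul_sub,
        inv_mul_cancel_left₀ hδ0.ne', layerMean]
    rw [this, enorm_mul, Real.enorm_of_nonneg (by positivity)]
    gcongr
    exact enorm_integral_le_lintegral_enorm _
  let G : ℝ → ℝ → ℝ≥0∞ := fun s s' => ∫⁻ z, ‖f (s, z) - f (s', z)‖ₑ ∂ν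
  have hGm : Measurable (Function.uncurry G) := by
    refine Measurable.lintegral_prod_right' (f := fun p : (ℝ × ℝ) × Z =>
      ‖f (p.1.1, p.2) - f (p.1.2, p.2)‖ₑ) ?_
    fun_prop
  have hGs : ∀ s s', G s s' = G s' s := fun s s' =>
    lintegral_congr fun z => by rw [← enorm_neg, neg_sub]
  have hbound : ∫⁻ s in Ioo 0 δ, ∫⁻ s' in Ioo 0 δ, G s s' ≤
      K * q ^ n * ENNReal.ofReal δ * ENNReal.ofReal (2 * δ) := by
    have := lintegral_lintegral_le_of_shift (μ := (volume : Measure ℝ)) (Q := Ioo 0 δ)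
      (N := Ioo (-δ) δ) (S := Ioi 0) (F := G) (b := K * q ^ n * ENNReal.ofReal δ)
      measurableSet_Ioo measurableSet_Ioo (fun h hh => ⟨by linarith [hh.2], by linarith [hh.1]⟩) ?_
      hGm hGs ?_
    · rw [Real.volume_Ioo, show δ - -δ = 2 * δ by ring] at this
      refine le_trans (le_of_eq ?_) this
      refine setLIntegral_congr_fun measurableSet_Ioo fun s hs => ?_
      refine setLIntegral_congr_fun measurableSet_Ioo fun s' hs' => ?_
      rw [indicator_of_mem]
      exact ⟨by linarith [hs.2, hs'.1], by linarith [hs.1, hs'.2]⟩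
    · have : ∀ᵐ h : ℝ, h ≠ 0 := by simp [ae_iff]
      filter_upwards [this] with h hh
      rcases lt_or_gt_of_ne hh with h1 | h1
      · right; simpa using h1
      · left; exact h1
    · intro h hh hpos
      have hset : Ioo 0 δ ∩ {z | z + h ∈ Ioo 0 δ} = Ioo 0 (δ - h) := by
        ext z
        simp only [mem_inter_iff, mem_Ioo, mem_ofPred_eq]
        have : 0 < h := hpos
        constructor
        · rintro ⟨⟨a, b⟩, c, d⟩; exact ⟨a, by linarith⟩
        · rintro ⟨a, b⟩; exact ⟨⟨a, by linarith⟩, by linarith, by linarith⟩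
      rw [hset]
      simp only [hGs _ (_ + h)]
      exact hf.shift n h hpos hh.2
  calc _ ≤ ENNReal.ofReal δ⁻¹ * ∫⁻ s in Ioo 0 δ, ∫⁻ z, (ENNReal.ofReal δ⁻¹ *
        ∫⁻ s' in Ioo 0 δ, ‖f (s, z) - f (s', z)‖ₑ) ∂ν := by
        gcongr with s z
        exact hpt s z
    _ = ENNReal.ofReal δ⁻¹ * (ENNReal.ofReal δ⁻¹ * ∫⁻ s in Ioo 0 δ, ∫⁻ s' in Ioo 0 δ, G s s') := by
        congr 1
        rw [← lintegral_const_mul' _ _ ENNReal.ofReal_ne_top]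
        refine lintegral_congr fun s => ?_
        rw [lintegral_const_mul' _ _ ENNReal.ofReal_ne_top, lintegral_lintegral_swap]
        have : Measurable fun p : Z × ℝ => ‖f (s, p.1) - f (p.2, p.1)‖ₑ := by fun_prop
        exact this.aemeasurable
    _ ≤ ENNReal.ofReal δ⁻¹ * (ENNReal.ofReal δ⁻¹ *
        (K * q ^ n * ENNReal.ofReal δ * ENNReal.ofReal (2 * δ))) := by gcongr
    _ = 2 * (K * q ^ n) := by
        have h1 : ENNReal.ofReal δ⁻¹ * ENNReal.ofReal δ = 1 := by
          rw [← ENNReal.ofReal_mul (by positivity), inv_mul_cancel₀ hδ0.ne', ENNReal.ofReal_one]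
        rw [ENNReal.ofReal_mul zero_le_two, ENNReal.ofReal_ofNat]
        calc _ = (ENNReal.ofReal δ⁻¹ * ENNReal.ofReal δ) *
              (ENNReal.ofReal δ⁻¹ * ENNReal.ofReal δ) * (2 * (K * q ^ n)) := by ring
          _ = _ := by rw [h1, one_mul, one_mul]

theorem tendsto_const_mul_pow {K q : ℝ≥0∞} (hK : K ≠ ⊤) (hq : q < 1) :
    Tendsto (fun n : ℕ => K * q ^ n) atTop (𝓝 0) := by
  have := ENNReal.Tendsto.const_mul (ENNReal.tendsto_pow_atTop_nhds_zero_of_lt_one hq)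
    (Or.inr hK) (a := K)
  simpa using this

/-- Functions whose increments are controlled have a trace, which is attained strongly. -/
theorem HasTraceBound.exists_trace (hf : HasTraceBound ν f ℓ K q) (hM : ∀ p, |f p| ≤ M) :
    ∃ g : Z → ℝ, Measurable g ∧ Integrable g ν ∧
      Tendsto (fun n : ℕ => ENNReal.ofReal (ℓ * (1 / 2) ^ n)⁻¹ *
        ∫⁻ s in Ioo 0 (ℓ * (1 / 2) ^ n), ∫⁻ z, ‖f (s, z) - g z‖ₑ ∂ν) atTop (𝓝 0) := by
  let e : ℕ → ℝ := fun n => ℓ * (1 / 2) ^ n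
  have he : ∀ n, 0 < e n := fun n => by have := hf.pos; positivity
  have hm := hf.measurable
  have hmem : ∀ n, MemLp (layerMean f (e n)) 1 ν := fun n =>
    memLp_one_iff_integrable.2 (integrable_of_abs_le (measurable_layerMean hm _)
      (abs_layerMean_le hM (he n)))
  let A : ℕ → Lp ℝ 1 ν := fun n => (hmem n).toLp
  have hcau : CauchySeq A := by
    refine cauchySeq_of_edist_le_geometric q K hf.lt_one hf.ne_top fun n => ?_
    rw [Lp.edist_toLp_toLp, eLpNorm_one_eq_lintegral_enorm]
    exact hf.lintegral_layerMean_sub_le hM n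
  obtain ⟨g₀, hg₀⟩ := cauchySeq_tendsto_of_complete hcau
  have hgi : Integrable g₀ ν := memLp_one_iff_integrable.1 (Lp.memLp g₀)
  let g := (Lp.aestronglyMeasurable g₀).mk g₀
  have hgg : g₀ =ᵐ[ν] g := (Lp.aestronglyMeasurable g₀).ae_eq_mk
  have hgm : Measurable g := (Lp.aestronglyMeasurable g₀).stronglyMeasurable_mk.measurable
  refine ⟨g, hgm, hgi.congr hgg, ?_⟩
  have hL : Tendsto (fun n => ∫⁻ z, ‖layerMean f (e n) z - g z‖ₑ ∂ν) atTop (𝓝 0) := by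
    have h1 := tendsto_iff_edist_tendsto_0.1 hg₀
    refine h1.congr fun n => ?_
    rw [Lp.edist_def, eLpNorm_one_eq_lintegral_enorm]
    refine lintegral_congr_ae ?_
    filter_upwards [(hmem n).coeFn_toLp, hgg] with z h1 h2
    simp only [Pi.sub_apply, A]
    rw [h1, h2]
  have hup := (ENNReal.Tendsto.const_mul (tendsto_const_mul_pow hf.ne_top hf.lt_one)
    (Or.inr ENNReal.ofNat_ne_top) (a := 2)).add hL
  rw [mul_zero, zero_add] at hup
  refine tendsto_of_tendsto_of_tendsto_of_le_of_le tendsto_const_nhds hup (fun _ => zero_le)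
    fun n => ?_
  have hmn := measurable_layerMean hm (e n)
  have hone : ENNReal.ofReal (e n)⁻¹ * ENNReal.ofReal (e n) = 1 := by
    rw [← ENNReal.ofReal_mul (by have := he n; positivity), inv_mul_cancel₀ (he n).ne',
      ENNReal.ofReal_one]
  calc ENNReal.ofReal (e n)⁻¹ * ∫⁻ s in Ioo 0 (e n), ∫⁻ z, ‖f (s, z) - g z‖ₑ ∂ν
      ≤ ENNReal.ofReal (e n)⁻¹ * ∫⁻ s in Ioo 0 (e n),
        ((∫⁻ z, ‖f (s, z) - layerMean f (e n) z‖ₑ ∂ν) +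
          ∫⁻ z, ‖layerMean f (e n) z - g z‖ₑ ∂ν) := by
        gcongr with s
        rw [← lintegral_add_left (by fun_prop)]
        refine lintegral_mono fun z => ?_
        rw [← sub_add_sub_cancel (f (s, z)) (layerMean f (e n) z) (g z)]
        exact enorm_add_le _ _
    _ = ENNReal.ofReal (e n)⁻¹ * (∫⁻ s in Ioo 0 (e n),
        ∫⁻ z, ‖f (s, z) - layerMean f (e n) z‖ₑ ∂ν) +
          ∫⁻ z, ‖layerMean f (e n) z - g z‖ₑ ∂ν := by
        rw [lintegral_add_right _ measurable_const, setLIntegral_const, Real.volume_Ioo, sub_zero,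
          mul_add, mul_comm (∫⁻ z, ‖layerMean f (e n) z - g z‖ₑ ∂ν), ← mul_assoc, hone, one_mul]
    _ ≤ _ := by
        exact add_le_add_left (hf.lintegral_sub_layerMean_le hM n) _

/-- Weighted averages of the function converge weakly to its trace. -/
theorem tendsto_weighted_layerMean {e : ℕ → ℝ} (he : ∀ n, 0 < e n) (hm : Measurable f)
    (hM : ∀ p, |f p| ≤ M) {g ψ : Z → ℝ} (hg : Integrable g ν)
    (hlim : Tendsto (fun n : ℕ => ENNReal.ofReal (e n)⁻¹ *
        ∫⁻ s in Ioo 0 (e n), ∫⁻ z, ‖f (s, z) - g z‖ₑ ∂ν) atTop (𝓝 0))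
    (hψ : Measurable ψ) {B : ℝ} (hB : ∀ z, |ψ z| ≤ B) {w : ℝ → ℝ} (hw : Continuous w) {W : ℝ}
    (hW : ∀ s ∈ Ioo (0 : ℝ) 1, |w s| ≤ W) (hw1 : ∫ s in (0 : ℝ)..1, w s = 1) :
    Tendsto (fun n => (e n)⁻¹ * ∫ s in Ioo 0 (e n), ∫ z, w (s / e n) * (f (s, z) * ψ z) ∂ν) atTop
      (𝓝 (∫ z, g z * ψ z ∂ν)) := by
  have hW0 : 0 ≤ W := (abs_nonneg _).trans (hW (1 / 2) (by constructor <;> norm_num))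
  have hB' : ∀ z, |ψ z| ≤ |B| := fun z => (hB z).trans (le_abs_self B)
  have hgψ : Integrable (fun z => g z * ψ z) ν :=
    hg.mul_bdd (c := B) hψ.aestronglyMeasurable (.of_forall fun z => hB z)
  have hfψ : ∀ s, Integrable (fun z => f (s, z) * ψ z) ν := fun s => by
    refine Integrable.mul_bdd (c := B) ?_ hψ.aestronglyMeasurable (.of_forall fun z => hB z)
    exact integrable_of_abs_le (hm.comp (by fun_prop)) fun z => hM (s, z)
  rw [tendsto_iff_norm_sub_tendsto_zero]
  have hlim2 := (ENNReal.tendsto_toReal (by simp)).comp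
    (ENNReal.Tendsto.const_mul hlim (Or.inr ENNReal.ofReal_ne_top) (a := ENNReal.ofReal (W * |B|)))
  simp only [mul_zero, ENNReal.toReal_zero] at hlim2
  have hfin : ∀ᶠ n in atTop, ENNReal.ofReal (e n)⁻¹ *
      ∫⁻ s in Ioo 0 (e n), ∫⁻ z, ‖f (s, z) - g z‖ₑ ∂ν < ⊤ :=
    hlim.eventually_lt_const ENNReal.zero_lt_top
  refine tendsto_of_tendsto_of_tendsto_of_le_of_le' tendsto_const_nhds hlim2
    (.of_forall fun n => norm_nonneg _) ?_
  filter_upwards [hfin] with n hn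
  have hen := he n
  have hweight : (e n)⁻¹ * ∫ s in Ioo 0 (e n), w (s / e n) = 1 := by
    rw [setIntegral_Ioo_eq hen.le, intervalIntegral.integral_comp_div _ hen.ne']
    simp [hen.ne', hw1]
  have hwb : ∀ s ∈ Ioo 0 (e n), |w (s / e n)| ≤ W := fun s hs =>
    hW _ ⟨div_pos hs.1 hen, (div_lt_one hen).2 hs.2⟩
  have hwm : Measurable fun s => w (s / e n) := hw.measurable.comp (by fun_prop)
  have hJm : StronglyMeasurable fun s => ∫ z, f (s, z) * ψ z ∂ν :=
    StronglyMeasurable.integral_prod_right' (f := fun p : ℝ × Z => f p * ψ p.2)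
      (by fun_prop : Measurable fun p : ℝ × Z => f p * ψ p.2).stronglyMeasurable
  have i1 : IntegrableOn (fun s => w (s / e n) * ∫ z, f (s, z) * ψ z ∂ν) (Ioo 0 (e n)) := by
    refine Integrable.of_bound (C := W * (M * |B| * ν.real univ))
      (hwm.mul hJm.measurable).aestronglyMeasurable ?_
    filter_upwards [ae_restrict_mem measurableSet_Ioo] with s hs
    rw [norm_mul]
    refine mul_le_mul (hwb s hs) ?_ (norm_nonneg _) hW0
    refine (norm_integral_le_of_norm_le_const (C := M * |B|) (.of_forall fun z => ?_))
    rw [norm_mul]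
    exact mul_le_mul (hM _) (hB' z) (norm_nonneg _) ((abs_nonneg _).trans (hM (s, z)))
  have i2 : IntegrableOn (fun s => w (s / e n) * ∫ z, g z * ψ z ∂ν) (Ioo 0 (e n)) := by
    refine Integrable.mul_const ?_ _
    refine Integrable.of_bound (C := W) hwm.aestronglyMeasurable ?_
    filter_upwards [ae_restrict_mem measurableSet_Ioo] with s hs using hwb s hs
  have heq : (e n)⁻¹ * (∫ s in Ioo 0 (e n), ∫ z, w (s / e n) * (f (s, z) * ψ z) ∂ν) -
      ∫ z, g z * ψ z ∂ν =
      (e n)⁻¹ * ∫ s in Ioo 0 (e n), w (s / e n) * ∫ z, (f (s, z) - g z) * ψ z ∂ν := by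
    have : ∀ s, w (s / e n) * ∫ z, (f (s, z) - g z) * ψ z ∂ν =
        w (s / e n) * (∫ z, f (s, z) * ψ z ∂ν) - w (s / e n) * ∫ z, g z * ψ z ∂ν := fun s => by
      simp only [sub_mul]
      rw [integral_sub (hfψ s) hgψ, mul_sub]
    simp only [this]
    rw [integral_sub i1 i2, integral_mul_const, mul_sub, ← mul_assoc (e n)⁻¹ (∫ s in _, _),
      hweight, one_mul]
    simp only [integral_const_mul]
  rw [heq]
  simp only [Function.comp_apply]
  have hfin' : ∫⁻ s in Ioo 0 (e n), ∫⁻ z, ‖f (s, z) - g z‖ₑ ∂ν ≠ ⊤ := by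
    intro htop
    rw [htop, ENNReal.mul_top] at hn
    · exact lt_irrefl _ hn
    · exact (ENNReal.ofReal_pos.2 (inv_pos.2 hen)).ne'
  rw [← toReal_enorm]
  refine ENNReal.toReal_mono (ENNReal.mul_ne_top ENNReal.ofReal_ne_top hn.ne) ?_
  rw [enorm_mul, Real.enorm_of_nonneg (inv_pos.2 hen).le, mul_left_comm]
  gcongr
  refine (enorm_integral_le_lintegral_enorm _).trans ?_
  rw [← lintegral_const_mul' _ _ ENNReal.ofReal_ne_top]
  refine setLIntegral_mono' measurableSet_Ioo fun s hs => ?_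
  rw [enorm_mul, ENNReal.ofReal_mul hW0, mul_assoc]
  gcongr
  · rw [Real.enorm_eq_ofReal_abs]
    exact ENNReal.ofReal_le_ofReal (hwb s hs)
  · refine (enorm_integral_le_lintegral_enorm _).trans ?_
    rw [← lintegral_const_mul' _ _ ENNReal.ofReal_ne_top]
    refine lintegral_mono fun z => ?_
    rw [enorm_mul, mul_comm]
    gcongr
    rw [Real.enorm_eq_ofReal_abs]
    exact ENNReal.ofReal_le_ofReal (hB' z)

end Euler

namespace Euler

variable {d : ℕ} {T : ℝ} {F : Type*} [NormedAddCommGroup F]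

/-! ### Increments of Besov functions -/

/-- The increments of `v` in the cylinder are of order `‖h‖ ^ α` in `L³`. -/
def HasCubeIncr (T α : ℝ) (C : ℝ≥0) (v : ℝ × Space d → F) : Prop :=
  ∀ h ∈ cylinder d T, eLpNorm (fun z => v (z + h) - v z) 3
    (volume.restrict (cylinder d T ∩ {z | z + h ∈ cylinder d T})) ≤ C * ENNReal.ofReal (‖h‖ ^ α)

theorem ne_zero_of_mem_cylinder {h : ℝ × Space d} (hh : h ∈ cylinder d T) : h ≠ 0 := by
  rintro rfl
  exact lt_irrefl _ hh.1.1

instance (d : ℕ) : (volume : Measure (ℝ × Space d)).IsAddHaarMeasure :=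
  Measure.prod.instIsAddHaarMeasure volume volume

theorem measurePreserving_add_cyl (h : ℝ × Space d) :
    MeasurePreserving (fun z : ℝ × Space d => z + h) volume volume := by
  simpa only [add_comm] using measurePreserving_add_left volume h

theorem measurableSet_shift (T : ℝ) (h : ℝ × Space d) :
    MeasurableSet (cylinder d T ∩ {z | z + h ∈ cylinder d T}) :=
  (measurableSet_cylinder d T).inter ((measurable_add_const h) (measurableSet_cylinder d T))

theorem hasCubeIncr_of_memBesov {α : ℝ} {v w : ℝ × Space d → F}
    (hv : MemBesov α 3 (cylinder d T) v) (hvw : v =ᵐ[volume.restrict (cylinder d T)] w) :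
    ∃ C, HasCubeIncr T α C w := by
  refine ⟨(besovNorm α 3 (cylinder d T) v).toNNReal, fun h hh => ?_⟩
  rw [ENNReal.coe_toNNReal hv.2.ne]
  have hpos : 0 < ‖h‖ := norm_pos_iff.2 (ne_zero_of_mem_cylinder hh)
  have h1 : eLpNorm (fun z => v (z + h) - v z) 3
      (volume.restrict (cylinder d T ∩ {z | z + h ∈ cylinder d T})) /
      ENNReal.ofReal (‖h‖ ^ α) ≤ besovNorm α 3 (cylinder d T) v :=
    (le_iSup₂ (f := fun ξ (_ : ξ ∈ cylinder d T) => eLpNorm (fun z => v (z + ξ) - v z) 3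
      (volume.restrict (cylinder d T ∩ {z | z + ξ ∈ cylinder d T})) /
      ENNReal.ofReal (‖ξ‖ ^ α)) h hh).trans le_add_self
  rw [ENNReal.div_le_iff (ENNReal.ofReal_pos.2 (Real.rpow_pos_of_pos hpos α)).ne'
    ENNReal.ofReal_ne_top] at h1
  refine le_trans (le_of_eq (eLpNorm_congr_ae ?_)) h1
  have e1 : ∀ᵐ z ∂(volume : Measure (ℝ × Space d)), z ∈ cylinder d T → v z = w z :=
    (ae_restrict_iff' (measurableSet_cylinder d T)).1 hvw
  have e2 : ∀ᵐ z ∂(volume : Measure (ℝ × Space d)), z + h ∈ cylinder d T → v (z + h) = w (z + h) :=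
    (measurePreserving_add_cyl h).quasiMeasurePreserving.ae e1
  rw [EventuallyEq, ae_restrict_iff' (measurableSet_shift T h)]
  filter_upwards [e1, e2] with z h1 h2 hz
  rw [h1 hz.1, h2 hz.2]

variable {α : ℝ} {C : ℝ≥0} {v : ℝ × Space d → F}

theorem HasCubeIncr.lintegral_cube_le (hv : HasCubeIncr T α C v) {h : ℝ × Space d}
    (hh : h ∈ cylinder d T) :
    ∫⁻ z in cylinder d T ∩ {z | z + h ∈ cylinder d T}, ‖v (z + h) - v z‖ₑ ^ 3 ≤
      (C * ENNReal.ofReal (‖h‖ ^ α)) ^ 3 := by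
  have h1 := hv h hh
  have h2 := pow_le_pow_left' h1 3
  refine le_trans (le_of_eq ?_) h2
  rw [eLpNorm_eq_lintegral_rpow_enorm_toReal (by norm_num) (by norm_num), ← ENNReal.rpow_natCast,
    ← ENNReal.rpow_mul]
  simp

variable [MeasurableSpace F] [BorelSpace F] [SecondCountableTopology F]

theorem HasCubeIncr.lintegral_le (hv : HasCubeIncr T α C v) (hvm : Measurable v)
    {h : ℝ × Space d} (hh : h ∈ cylinder d T) {A : Set (ℝ × Space d)}
    (hA : A ⊆ cylinder d T ∩ {z | z + h ∈ cylinder d T}) :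
    ∫⁻ z in A, ‖v (z + h) - v z‖ₑ ≤ C * ENNReal.ofReal (‖h‖ ^ α) * volume A ^ (2 / 3 : ℝ) := by
  have hm : Measurable fun z => v (z + h) - v z := (hvm.comp (measurable_add_const h)).sub hvm
  rw [← eLpNorm_one_eq_lintegral_enorm]
  refine (eLpNorm_le_eLpNorm_mul_rpow_measure_univ (p := 1) (q := 3) (by norm_num)
    hm.aestronglyMeasurable).trans ?_
  have h3 : (1 / (1 : ℝ≥0∞).toReal - 1 / (3 : ℝ≥0∞).toReal : ℝ) = 2 / 3 := by norm_num
  rw [h3, Measure.restrict_apply_univ]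
  gcongr
  exact (eLpNorm_mono_measure _ (Measure.restrict_mono hA le_rfl)).trans (hv h hh)

theorem setLIntegral_add_right (g : ℝ × Space d → ℝ≥0∞) (h : ℝ × Space d)
    (A : Set (ℝ × Space d)) : ∫⁻ z in A, g (z + h) = ∫⁻ z in {z | z - h ∈ A}, g z := by
  have h1 := (measurePreserving_add_cyl h)
    |>.setLIntegral_comp_preimage_emb (measurableEmbedding_addRight h) g {z | z - h ∈ A}
  rw [← h1]
  congr 2
  ext z
  simp

theorem volume_sub_mem (h : ℝ × Space d) (A : Set (ℝ × Space d)) :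
    volume {z | z - h ∈ A} = volume A := by
  have := setLIntegral_add_right (fun _ => 1) h A
  simpa using this.symm

/-- Increments in space. Since the Besov norm controls only the shifts which are positive in time,
a shift in space is a combination of two of these. -/
theorem HasCubeIncr.lintegral_space_le (hv : HasCubeIncr T α C v) (hvm : Measurable v)
    {ξ : Space d} (hξ : ξ ∈ cube d) (hξ0 : 0 < ‖ξ‖) (hξT : ‖ξ‖ < T / 2) {A : Set (ℝ × Space d)}
    (hA : A ⊆ cylinder d T ∩ {z | z + (0, ξ) ∈ cylinder d T}) :
    ∫⁻ z in A, ‖v (z + (0, ξ)) - v z‖ₑ ≤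
      4 * (C * ENNReal.ofReal (‖ξ‖ ^ α)) * volume A ^ (2 / 3 : ℝ) := by
  set s := ‖ξ‖ with hs
  set ζ : ℝ × Space d := (0, ξ)
  set k : ℝ × Space d := (s, 0)
  set h : ℝ × Space d := (s, ξ)
  have hh : h = k + ζ := by simp [h, k, ζ]
  have hhQ : h ∈ cylinder d T := ⟨⟨hξ0, by change s < T; linarith⟩, hξ⟩
  have hkQ : k ∈ cylinder d T := ⟨⟨hξ0, by change s < T; linarith⟩, fun i => by simp [k]⟩
  have nh : ‖h‖ = s := by simp [h, Prod.norm_def, hs]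
  have nk : ‖k‖ = s := by simp [k, Prod.norm_def, hs]
  have hB : MeasurableSet {z : ℝ × Space d | z.1 < T / 2} :=
    measurableSet_lt measurable_fst measurable_const
  have htri : ∀ x y w : F, ‖x - w‖ₑ ≤ ‖x - y‖ₑ + ‖y - w‖ₑ := fun x y w => by
    rw [← sub_add_sub_cancel x y w]; exact enorm_add_le _ _
  have hneg : ∀ x y : F, ‖x - y‖ₑ = ‖y - x‖ₑ := fun x y => by rw [← enorm_neg, neg_sub]
  have hvs : ∀ g : ℝ × Space d, Measurable fun z => v (z + g) := fun g =>
    hvm.comp (measurable_add_const g)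
  set b := C * ENNReal.ofReal (s ^ α) * volume A ^ (2 / 3 : ℝ)
  -- early times: pass through `z + h`
  have e1 : ∫⁻ z in A ∩ {z | z.1 < T / 2}, ‖v (z + ζ) - v z‖ₑ ≤ b + b := by
    set A₁ := A ∩ {z : ℝ × Space d | z.1 < T / 2}
    have hA₁ : ∀ z ∈ A₁, z ∈ cylinder d T ∧ z + ζ ∈ cylinder d T ∧ z + h ∈ cylinder d T := by
      intro z hz
      have hzA := hA hz.1
      refine ⟨hzA.1, hzA.2, ⟨⟨?_, ?_⟩, hzA.2.2⟩⟩
      · have := hzA.1.1.1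
        change 0 < z.1 + s; linarith
      · have : z.1 < T / 2 := hz.2
        change z.1 + s < T; linarith
    calc ∫⁻ z in A₁, ‖v (z + ζ) - v z‖ₑ
        ≤ ∫⁻ z in A₁, (‖v (z + ζ + k) - v (z + ζ)‖ₑ + ‖v (z + h) - v z‖ₑ) := by
          refine lintegral_mono fun z => ?_
          refine (htri _ (v (z + h)) _).trans (le_of_eq ?_)
          rw [hneg, hh, add_assoc, add_comm ζ k]
      _ = (∫⁻ z in A₁, ‖v (z + ζ + k) - v (z + ζ)‖ₑ) + ∫⁻ z in A₁, ‖v (z + h) - v z‖ₑ := by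
          exact lintegral_add_right _ ((hvs h).sub hvm).enorm
      _ ≤ b + b := by
          refine add_le_add ?_ ?_
          · rw [setLIntegral_add_right (fun z => ‖v (z + k) - v z‖ₑ) ζ A₁]
            refine (hv.lintegral_le hvm hkQ fun z hz => ?_).trans ?_
            · have := hA₁ _ hz
              rw [hh] at this
              refine ⟨by simpa using this.2.1, ?_⟩
              have h3 := this.2.2
              rwa [show z - ζ + (k + ζ) = z + k by abel] at h3
            · rw [nk, volume_sub_mem]
              simp only [b]
              gcongr
              exact inter_subset_left
          · refine (hv.lintegral_le hvm hhQ fun z hz => ⟨(hA₁ z hz).1, (hA₁ z hz).2.2⟩).trans ?_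
            rw [nh]
            simp only [b]
            gcongr
            exact inter_subset_left
  -- late times: pass through `z - k`
  have e2 : ∫⁻ z in A ∩ {z | z.1 < T / 2}ᶜ, ‖v (z + ζ) - v z‖ₑ ≤ b + b := by
    set A₂ := A ∩ {z : ℝ × Space d | z.1 < T / 2}ᶜ
    have hA₂ : ∀ z ∈ A₂, z ∈ cylinder d T ∧ z + ζ ∈ cylinder d T ∧ z - k ∈ cylinder d T := by
      intro z hz
      have hzA := hA hz.1
      have hz2 : T / 2 ≤ z.1 := not_lt.1 hz.2
      refine ⟨hzA.1, hzA.2, ⟨⟨?_, ?_⟩, by simpa [k] using hzA.1.2⟩⟩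
      · change 0 < z.1 - s
        linarith
      · have := hzA.1.1.2
        change z.1 - s < T; linarith
    have eq1 : ∫⁻ z in A₂, ‖v (z + ζ) - v z‖ₑ =
        ∫⁻ z in {z | z + k ∈ A₂}, ‖v (z + h) - v (z + k)‖ₑ := by
      have := setLIntegral_add_right (fun z => ‖v (z + h) - v (z + k)‖ₑ) (-k) A₂
      simp only [sub_neg_eq_add, neg_add_cancel_right] at this
      rw [← this]
      refine lintegral_congr fun z => ?_
      rw [hh, show z + -k + (k + ζ) = z + ζ by abel]
    have hvol : volume {z | z + k ∈ A₂} ≤ volume A := by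
      have := volume_sub_mem (-k) A₂
      simp only [sub_neg_eq_add] at this
      rw [this]
      exact measure_mono inter_subset_left
    have hin : ∀ z, z + k ∈ A₂ → z ∈ cylinder d T ∧ z + k ∈ cylinder d T ∧
        z + h ∈ cylinder d T := fun z hz => by
      have := hA₂ _ hz
      refine ⟨by simpa using this.2.2, this.1, ?_⟩
      rw [hh, ← add_assoc]; exact this.2.1
    rw [eq1]
    calc ∫⁻ z in {z | z + k ∈ A₂}, ‖v (z + h) - v (z + k)‖ₑ
        ≤ ∫⁻ z in {z | z + k ∈ A₂}, (‖v (z + h) - v z‖ₑ + ‖v (z + k) - v z‖ₑ) := by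
          refine lintegral_mono fun z => ?_
          exact (htri _ (v z) _).trans (le_of_eq (by rw [hneg (v z)]))
      _ = (∫⁻ z in {z | z + k ∈ A₂}, ‖v (z + h) - v z‖ₑ) +
          ∫⁻ z in {z | z + k ∈ A₂}, ‖v (z + k) - v z‖ₑ :=
          lintegral_add_right _ ((hvs k).sub hvm).enorm
      _ ≤ b + b := by
          refine add_le_add ?_ ?_
          · refine (hv.lintegral_le hvm hhQ fun z hz => ⟨(hin z hz).1, (hin z hz).2.2⟩).trans ?_
            rw [nh]
            exact mul_le_mul_right (ENNReal.rpow_le_rpow hvol (by norm_num)) _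
          · refine (hv.lintegral_le hvm hkQ fun z hz => ⟨(hin z hz).1, (hin z hz).2.1⟩).trans ?_
            rw [nk]
            exact mul_le_mul_right (ENNReal.rpow_le_rpow hvol (by norm_num)) _
  calc ∫⁻ z in A, ‖v (z + ζ) - v z‖ₑ
      = (∫⁻ z in A ∩ {z | z.1 < T / 2}, ‖v (z + ζ) - v z‖ₑ) +
        ∫⁻ z in A ∩ {z | z.1 < T / 2}ᶜ, ‖v (z + ζ) - v z‖ₑ := by
        rw [← sdiff_eq, lintegral_inter_add_sdiff _ _ hB]
    _ ≤ (b + b) + (b + b) := add_le_add e1 e2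
    _ = _ := by simp only [b]; ring

end Euler

namespace Euler

variable {d : ℕ} {T ε α r R M : ℝ} {ρ : ℝ × Space d → ℝ} {u : ℝ × Space d → Space d}

/-! ### The cubic increments of Besov functions -/

/-- The increments of time and space which are less than `ε` in every coordinate. -/
def box (d : ℕ) (ε : ℝ) : Set (ℝ × Space d) := {h | |h.1| < ε ∧ ∀ i, |h.2 i| < ε}

theorem measurableSet_box (d : ℕ) (ε : ℝ) : MeasurableSet (box d ε) := by
  have h : box d ε = {h | |h.1| < ε} ∩ ⋂ i, {h | |h.2 i| < ε} := by
    ext q; simp [box]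
  rw [h]
  exact (isOpen_lt (by fun_prop) continuous_const).measurableSet.inter
    (MeasurableSet.iInter fun i => (isOpen_lt (by fun_prop) continuous_const).measurableSet)

theorem volume_box (d : ℕ) (ε : ℝ) : volume (box d ε) = ENNReal.ofReal (2 * ε) ^ (d + 1) := by
  have h1 : box d ε = Ioo (-ε) ε ×ˢ ((fun x : Space d => x.ofLp) ⁻¹' Set.pi univ
      fun _ => Ioo (-ε) ε) := by
    ext q; simp [box, abs_lt]
  have h2 := (PiLp.volume_preserving_ofLp (Fin d)).measure_preimage_emb
    (MeasurableEquiv.toLp 2 (Fin d → ℝ)).symm.measurableEmbedding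
    (Set.pi univ fun _ => Ioo (-ε) ε)
  rw [h1, Measure.volume_eq_prod, Measure.prod_prod, h2, volume_pi_pi]
  simp only [Real.volume_Ioo, Finset.prod_const, Finset.card_univ, Fintype.card_fin]
  rw [show ε - -ε = 2 * ε by ring, pow_succ']

theorem norm_le_sum_abs (x : Space d) : ‖x‖ ≤ ∑ i, |x i| := by
  have h : x = ∑ i, EuclideanSpace.single i (x i) := by
    ext j; simp [Pi.single_apply]
  calc ‖x‖ = ‖∑ i, EuclideanSpace.single i (x i)‖ := by rw [← h]
    _ ≤ ∑ i, ‖EuclideanSpace.single i (x i)‖ := norm_sum_le _ _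
    _ = _ := by simp

theorem norm_le_of_mem_box {h : ℝ × Space d} (hh : h ∈ box d ε) : ‖h‖ ≤ (d + 1) * ε := by
  have hε : 0 < ε := (abs_nonneg _).trans_lt hh.1
  have h2 : ‖h.2‖ ≤ d * ε := by
    refine (norm_le_sum_abs _).trans ((Finset.sum_le_sum fun i _ => (hh.2 i).le).trans ?_)
    simp
  refine max_le ?_ (by linarith)
  have := hh.1.le
  have h3 : (0 : ℝ) ≤ d * ε := by positivity
  rw [Real.norm_eq_abs]
  linarith

theorem mem_near_zero_iff {z z' : ℝ × Space d} :
    (z, z') ∈ near ε (fun _ => 0) ↔ z' - z ∈ box d ε := by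
  simp [near, box, abs_sub_comm]

theorem near_subset_near_zero {c : Fin d → Fin 3} {z z' : ℝ × Space d} (hz : z ∈ cylinder d T)
    (hz' : z' ∈ cylinder d T) (h : (z, z') ∈ near ε c) : (z, z') ∈ near ε (fun _ => 0) :=
  ⟨h.1, fun i => by
    rw [flip_zero]
    exact (abs_sub_le_abs_sub_flip (c i) (cube_subset_closedCube d hz.2 i)
      (cube_subset_closedCube d hz'.2 i)).trans_lt (h.2 i)⟩

theorem ofReal_cubicDefect (h : IsBoundedState r R M ρ u) (T ε : ℝ) (c : Fin d → Fin 3) :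
    ENNReal.ofReal (cubicDefect T ε ρ u c) = ∫⁻ z in cylinder d T, ∫⁻ z' in cylinder d T,
      (near ε c).indicator (fun q => ENNReal.ofReal (cubicIncr ρ u c q)) (z, z') := by
  have hm : Measurable ((near ε c).indicator fun q => ENNReal.ofReal (cubicIncr ρ u c q)) :=
    (measurable_cubicIncr h c).ennreal_ofReal.indicator (measurableSet_near ε c)
  rw [cubicDefect, ofReal_integral_eq_lintegral_ofReal
    (integrable_of_abs_le (measurable_cubicIncr h c) (cubicIncr_le h c)).integrableOn
    (.of_forall fun q => cubicIncr_nonneg c q), ← lintegral_indicator (measurableSet_near ε c),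
    lintegral_prod _ hm.aemeasurable]

theorem reflVec_zero (v : Space d) : reflVec (fun _ => 0) v = v := by
  ext i; simp

theorem exists_cubicDefect_zero_le (h : IsBoundedState r R M ρ u) (hα : 0 < α) {C₁ C₂ : ℝ≥0}
    (h1 : HasCubeIncr T α C₁ ρ) (h2 : HasCubeIncr T α C₂ u) :
    ∃ K, 0 ≤ K ∧ ∀ ε, 0 < ε → ε ≤ 1 → ε ≤ T →
      cubicDefect T ε ρ u (fun _ => 0) ≤ K * ((ε ^ α) ^ 3 * ε ^ (d + 1)) := by
  refine ⟨(C₁ ^ 3 + C₂ ^ 3) * (((d + 1) ^ α) ^ 3 * 2 ^ (d + 1)), by positivity,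
    fun ε hε hε1 hεT => ?_⟩
  let F : ℝ × Space d → ℝ × Space d → ℝ≥0∞ := fun z z' =>
    ENNReal.ofReal (cubicIncr ρ u (fun _ => 0) (z, z'))
  have hF : ∀ z z', F z z' = ‖ρ z' - ρ z‖ₑ ^ 3 + ‖u z' - u z‖ₑ ^ 3 := fun z z' => by
    simp only [F, cubicIncr, reflVec_zero]
    rw [ENNReal.ofReal_add (by positivity) (by positivity), ENNReal.ofReal_pow (abs_nonneg _),
      ENNReal.ofReal_pow (norm_nonneg _), ← Real.enorm_eq_ofReal_abs, ofReal_norm,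
      ← enorm_neg, neg_sub, ← enorm_neg (u z - u z'), neg_sub]
  have hFm : Measurable (Function.uncurry F) := (measurable_cubicIncr h _).ennreal_ofReal
  have key := lintegral_lintegral_le_of_shift (μ := (volume : Measure (ℝ × Space d)))
    (Q := cylinder d T) (N := box d ε) (S := {h | 0 < h.1}) (F := F)
    (b := (C₁ ^ 3 + C₂ ^ 3) * ENNReal.ofReal (((d + 1) * ε) ^ α) ^ 3) (measurableSet_cylinder d T)
    (measurableSet_box d ε) (fun h hh => ⟨by simpa using hh.1, fun i => by simpa using hh.2 i⟩) ?_
    hFm (fun z z' => by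
      rw [hF, hF, ← enorm_neg, neg_sub, ← enorm_neg (u z' - u z), neg_sub]) ?_
  · have heq : ∫⁻ z in cylinder d T, ∫⁻ z' in cylinder d T,
        (box d ε).indicator (fun _ => F z z') (z' - z) =
        ENNReal.ofReal (cubicDefect T ε ρ u fun _ => 0) := by
      rw [ofReal_cubicDefect h]
      refine lintegral_congr fun z => lintegral_congr fun z' => ?_
      by_cases hq : z' - z ∈ box d ε
      · rw [indicator_of_mem hq, indicator_of_mem (mem_near_zero_iff.2 hq)]
      · rw [indicator_of_notMem hq, indicator_of_notMem (mt mem_near_zero_iff.1 hq)]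
    rw [heq, volume_box] at key
    have hconv : ((C₁ : ℝ≥0∞) ^ 3 + C₂ ^ 3) * ENNReal.ofReal (((d + 1) * ε) ^ α) ^ 3 *
        ENNReal.ofReal (2 * ε) ^ (d + 1) = ENNReal.ofReal
        ((C₁ ^ 3 + C₂ ^ 3) * (((d + 1) ^ α) ^ 3 * 2 ^ (d + 1)) * ((ε ^ α) ^ 3 * ε ^ (d + 1))) := by
      have e1 : (C₁ ^ 3 + C₂ ^ 3 : ℝ) * (((d + 1) ^ α) ^ 3 * 2 ^ (d + 1)) *
          ((ε ^ α) ^ 3 * ε ^ (d + 1)) =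
          (C₁ ^ 3 + C₂ ^ 3) * (((d + 1) * ε) ^ α) ^ 3 * (2 * ε) ^ (d + 1) := by
        rw [Real.mul_rpow (by positivity) hε.le]
        ring
      have hX : 0 ≤ ((d + 1) * ε) ^ α := by positivity
      have hY : 0 ≤ 2 * ε := by positivity
      rw [e1]
      generalize ((d + 1) * ε) ^ α = X at hX
      generalize 2 * ε = Y at hY
      rw [ENNReal.ofReal_mul (by positivity), ENNReal.ofReal_mul (by positivity),
        ENNReal.ofReal_pow hX, ENNReal.ofReal_pow hY,
        ENNReal.ofReal_add (by positivity) (by positivity), ENNReal.ofReal_pow (by positivity),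
        ENNReal.ofReal_pow (by positivity), ENNReal.ofReal_coe_nnreal, ENNReal.ofReal_coe_nnreal]
    rw [hconv, ENNReal.ofReal_le_ofReal_iff (by positivity)] at key
    exact key
  · have hae : ∀ᵐ h : ℝ × Space d, h.1 ≠ 0 := by
      have h0 : ∀ᵐ t : ℝ, t ≠ 0 := by simp [ae_iff]
      exact Measure.quasiMeasurePreserving_fst.ae h0
    filter_upwards [hae] with z hz
    rcases lt_or_gt_of_ne hz with hz | hz
    · right; simpa using hz
    · left; exact hz
  · intro z hz hpos
    have hzQ : z ∈ cylinder d T := by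
      refine ⟨⟨hpos, (le_abs_self _).trans_lt (hz.1.trans_le hεT)⟩, fun i => ?_⟩
      have := abs_lt.1 ((hz.2 i).trans_le hε1)
      exact ⟨this.1, this.2⟩
    have hn : ENNReal.ofReal (‖z‖ ^ α) ≤ ENNReal.ofReal (((d + 1) * ε) ^ α) :=
      ENNReal.ofReal_le_ofReal (Real.rpow_le_rpow (norm_nonneg _) (norm_le_of_mem_box hz) hα.le)
    have hm1 : Measurable fun x => ‖ρ (x + z) - ρ x‖ₑ ^ 3 :=
      ((h.measurable_density.comp (measurable_add_const z)).sub h.measurable_density).enorm.pow_const 3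
    simp only [hF]
    rw [lintegral_add_left hm1, add_mul]
    refine add_le_add ((h1.lintegral_cube_le hzQ).trans ?_) ((h2.lintegral_cube_le hzQ).trans ?_) <;>
    · rw [mul_pow]
      gcongr

/-- The part of the cylinder within distance `δ` of the faces `x_i = ± 1`. -/
def faceLayer (d : ℕ) (T : ℝ) (i : Fin d) (δ : ℝ) : Set (ℝ × Space d) :=
  cylinder d T ∩ {z | 1 - δ < |z.2 i|}

theorem measurableSet_faceLayer (d : ℕ) (T : ℝ) (i : Fin d) (δ : ℝ) :
    MeasurableSet (faceLayer d T i δ) :=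
  (measurableSet_cylinder d T).inter
    (isOpen_lt continuous_const (by fun_prop : Continuous fun z : ℝ × Space d => |z.2 i|)).measurableSet

theorem one_sub_lt_abs_of_flip {c : Fin 3} (hc : c ≠ 0) {x y : ℝ} (hx : x ∈ Ioo (-1 : ℝ) 1)
    (h : |x - flip c y| < ε) : 1 - ε < |y| := by
  obtain ⟨h1, h2⟩ := abs_lt.1 h
  fin_cases c
  · exact absurd rfl hc
  · simp only [Fin.mk_one, flip_one] at h1 h2
    exact (by linarith [hx.2] : 1 - ε < y).trans_le (le_abs_self _)
  · simp only [Fin.reduceFinMk, flip_two] at h1 h2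
    exact (by linarith [hx.1] : 1 - ε < -y).trans_le (neg_le_abs _)

/-- Reflected increments are controlled by the increments, and by the normal components of the
velocity next to the faces that are crossed by the reflection. -/
theorem cubicIncr_le_add (h : IsBoundedState r R M ρ u) {c : Fin d → Fin 3} {z z' : ℝ × Space d}
    (hz : z ∈ cylinder d T) (hz' : z' ∈ cylinder d T) (hq : (z, z') ∈ near ε c) :
    cubicIncr ρ u c (z, z') ≤ 4 * cubicIncr ρ u (fun _ => 0) (z, z') +
      32 * M ^ 2 * ∑ i, (faceLayer d T i ε).indicator (fun z => |u z i|) z' := by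
  have hM : 0 ≤ M := (norm_nonneg _).trans (h.velocity_le z)
  set b := ‖u z' - reflVec c (u z')‖
  have hb : b ≤ 2 * ∑ i, (faceLayer d T i ε).indicator (fun z => |u z i|) z' := by
    refine (norm_le_sum_abs _).trans ?_
    rw [Finset.mul_sum]
    refine Finset.sum_le_sum fun i _ => ?_
    by_cases hc : c i = 0
    · have h0 : (u z' - reflVec c (u z')) i = 0 := by simp [hc]
      rw [h0, abs_zero]
      exact mul_nonneg zero_le_two (indicator_nonneg (fun _ _ => abs_nonneg _) _)
    · have hmem : z' ∈ faceLayer d T i ε := ⟨hz', one_sub_lt_abs_of_flip hc (hz.2 i) (hq.2 i)⟩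
      rw [indicator_of_mem hmem, two_mul]
      change |u z' i - reflVec c (u z') i| ≤ _
      refine (abs_sub _ _).trans (le_of_eq ?_)
      rw [reflVec_apply, abs_mul, abs_flipSign, one_mul]
  have hb2 : b ≤ 2 * M := by
    refine (norm_sub_le _ _).trans ?_
    rw [norm_reflVec]
    linarith [h.velocity_le z']
  have hb0 : 0 ≤ b := norm_nonneg _
  have htri : ‖u z - reflVec c (u z')‖ ≤ ‖u z - u z'‖ + b := by
    rw [← sub_add_sub_cancel (u z) (u z') (reflVec c (u z'))]
    exact norm_add_le _ _
  have hcube : ‖u z - reflVec c (u z')‖ ^ 3 ≤ 4 * ‖u z - u z'‖ ^ 3 + 4 * b ^ 3 := by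
    have ha : 0 ≤ ‖u z - u z'‖ := norm_nonneg _
    refine (pow_le_pow_left₀ (norm_nonneg _) htri 3).trans ?_
    nlinarith [mul_nonneg (add_nonneg ha hb0) (sq_nonneg (‖u z - u z'‖ - b))]
  have hb3 : b ^ 3 ≤ (2 * M) ^ 2 * b := by
    rw [pow_succ]
    gcongr
  have hρ : 0 ≤ |ρ z - ρ z'| ^ 3 := by positivity
  have h4 := mul_le_mul_of_nonneg_left hb (sq_nonneg (2 * M))
  simp only [cubicIncr, reflVec_zero]
  nlinarith

theorem cubicDefect_le_add (h : IsBoundedState r R M ρ u) (hε : 0 < ε) (c : Fin d → Fin 3) :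
    cubicDefect T ε ρ u c ≤ 4 * cubicDefect T ε ρ u (fun _ => 0) +
      32 * M ^ 2 * ∑ i, (2 * ε) ^ (d + 1) * ∫ z in faceLayer d T i ε, |u z i| := by
  have hi : ∀ i, Integrable ((faceLayer d T i ε).indicator fun z => |u z i|) (cylMeasure d T) :=
    fun i => (integrable_of_abs_le (measurable_apply h.measurable_velocity i).abs
      fun z => by
        rw [abs_abs]
        exact (abs_apply_le_norm _ i).trans (h.velocity_le z)).indicator
      (measurableSet_faceLayer d T i ε)
  have hI : ∀ i, ∫ z in faceLayer d T i ε, |u z i| =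
      ∫ z, (faceLayer d T i ε).indicator (fun z => |u z i|) z ∂(cylMeasure d T) := fun i => by
    rw [integral_indicator (measurableSet_faceLayer d T i ε), cylMeasure,
      Measure.restrict_restrict (measurableSet_faceLayer d T i ε),
      inter_eq_self_of_subset_left
        (show faceLayer d T i ε ⊆ cylinder d T from inter_subset_left)]
  let N := near ε (fun _ : Fin d => (0 : Fin 3))
  have hNm : MeasurableSet N := measurableSet_near _ _
  let μ := cylMeasure d T
  let g : Fin d → ℝ × Space d → ℝ := fun i => (faceLayer d T i ε).indicator fun z => |u z i|
  have hg0 : ∀ i z, 0 ≤ g i z := fun i z => indicator_nonneg (fun _ _ => abs_nonneg _) _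
  have hgN : ∀ i, Integrable (N.indicator fun q => g i q.2) (μ.prod μ) := fun i =>
    ((hi i).comp_snd μ).indicator hNm
  have hcub : Integrable (N.indicator (cubicIncr ρ u fun _ => 0)) (μ.prod μ) :=
    (integrable_of_abs_le (measurable_cubicIncr h _) (cubicIncr_le h _)).indicator hNm
  have hcubc : Integrable ((near ε c).indicator (cubicIncr ρ u c)) (μ.prod μ) :=
    (integrable_of_abs_le (measurable_cubicIncr h _) (cubicIncr_le h _)).indicator
      (measurableSet_near _ _)
  -- the slices of the set of pairs of near points are contained in translates of the box
  have hterm : ∀ i, ∫ q, N.indicator (fun q => g i q.2) q ∂(μ.prod μ) ≤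
      (2 * ε) ^ (d + 1) * ∫ z in faceLayer d T i ε, |u z i| := fun i => by
    rw [integral_prod_symm _ (hgN i), hI, ← integral_const_mul]
    refine integral_mono (hgN i).swap.integral_prod_left ((hi i).const_mul _) fun z' => ?_
    have e1 : ∀ z, N.indicator (fun q => g i q.2) (z, z') =
        {z | z' - z ∈ box d ε}.indicator (fun _ => g i z') z := fun z => by
      by_cases hq : z' - z ∈ box d ε
      · rw [indicator_of_mem (mem_near_zero_iff.2 hq), indicator_of_mem (by exact hq)]
      · rw [indicator_of_notMem (mt mem_near_zero_iff.1 hq), indicator_of_notMem (by exact hq)]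
    have hsm : MeasurableSet {z | z' - z ∈ box d ε} :=
      (measurable_const.sub measurable_id) (measurableSet_box d ε)
    simp only [e1]
    rw [integral_indicator hsm, setIntegral_const, smul_eq_mul]
    refine mul_le_mul_of_nonneg_right ?_ (hg0 i z')
    have hvol : volume {z | z' - z ∈ box d ε} = volume (box d ε) := by
      rw [← volume_sub_mem z' (box d ε)]
      congr 1
      ext z
      simp [box, abs_sub_comm]
    refine ENNReal.toReal_le_of_le_ofReal (by positivity) ((Measure.restrict_apply_le _ _).trans ?_)
    rw [hvol, volume_box, ENNReal.ofReal_pow (by positivity)]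
  calc cubicDefect T ε ρ u c
      = ∫ q, (near ε c).indicator (cubicIncr ρ u c) q ∂(μ.prod μ) := by
        rw [integral_indicator (measurableSet_near _ _)]; rfl
    _ ≤ ∫ q, (4 * N.indicator (cubicIncr ρ u fun _ => 0) q +
        32 * M ^ 2 * ∑ i, N.indicator (fun q => g i q.2) q) ∂(μ.prod μ) := by
        refine integral_mono_ae hcubc ((hcub.const_mul _).add
          ((integrable_finsetSum _ fun i _ => hgN i).const_mul _)) ?_
        have hae : ∀ᵐ q ∂(μ.prod μ), q.1 ∈ cylinder d T ∧ q.2 ∈ cylinder d T := by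
          have hz : ∀ᵐ z ∂μ, z ∈ cylinder d T := ae_restrict_mem (measurableSet_cylinder d T)
          exact (Measure.quasiMeasurePreserving_fst.ae hz).and
            (Measure.quasiMeasurePreserving_snd.ae hz)
        filter_upwards [hae] with q hq
        by_cases hn : q ∈ near ε c
        · have hN := near_subset_near_zero hq.1 hq.2 hn
          simp only [indicator_of_mem hn, N, indicator_of_mem hN]
          exact cubicIncr_le_add h hq.1 hq.2 hn
        · rw [indicator_of_notMem hn]
          have n1 : 0 ≤ N.indicator (cubicIncr ρ u fun _ => 0) q :=
            indicator_nonneg (fun _ _ => cubicIncr_nonneg _ _) _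
          have n2 : 0 ≤ ∑ i, N.indicator (fun q => g i q.2) q :=
            Finset.sum_nonneg fun i _ => indicator_nonneg (fun _ _ => hg0 i _) _
          positivity
    _ = 4 * cubicDefect T ε ρ u (fun _ => 0) +
        32 * M ^ 2 * ∑ i, ∫ q, N.indicator (fun q => g i q.2) q ∂(μ.prod μ) := by
        rw [integral_add (hcub.const_mul _)
          ((integrable_finsetSum _ fun i _ => hgN i).const_mul _), integral_const_mul,
          integral_const_mul, integral_finsetSum _ fun i _ => hgN i, integral_indicator hNm]
        rfl
    _ ≤ _ := by
        gcongr with i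
        exact hterm i

/-- Besov functions of order greater than `1/3`, with vanishing normal velocity in the mean, have
cubic defects of order less than the volume of the kernels times the gradient of a mollifier. -/
theorem tendsto_cubicDefect (h : IsBoundedState r R M ρ u) (hT : 0 < T) (hα : 1 / 3 < α)
    {C₁ C₂ : ℝ≥0} (h1 : HasCubeIncr T α C₁ ρ) (h2 : HasCubeIncr T α C₂ u) {e : ℕ → ℝ}
    (he0 : ∀ n, 0 < e n) (he : Tendsto e atTop (𝓝 0))
    (hface : ∀ i, Tendsto (fun n => (e n)⁻¹ * ∫ z in faceLayer d T i (e n), |u z i|) atTop (𝓝 0))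
    (c : Fin d → Fin 3) :
    Tendsto (fun n => (e n)⁻¹ ^ (d + 2) * cubicDefect T (e n) ρ u c) atTop (𝓝 0) := by
  obtain ⟨K, hK, hKle⟩ := exists_cubicDefect_zero_le h (by linarith) h1 h2
  have hpow : Tendsto (fun n => (e n) ^ (3 * α - 1)) atTop (𝓝 0) := by
    have h3 := he.rpow_const (p := 3 * α - 1) (Or.inr (by linarith))
    rwa [Real.zero_rpow (by linarith)] at h3
  have hlim : Tendsto (fun n => 4 * K * (e n) ^ (3 * α - 1) + 32 * M ^ 2 * 2 ^ (d + 1) *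
      ∑ i, (e n)⁻¹ * ∫ z in faceLayer d T i (e n), |u z i|) atTop (𝓝 0) := by
    have := (hpow.const_mul (4 * K)).add
      ((tendsto_finsetSum Finset.univ fun i _ => hface i).const_mul (32 * M ^ 2 * 2 ^ (d + 1)))
    simpa using this
  have hev : ∀ᶠ n in atTop, e n ≤ 1 ∧ e n ≤ T :=
    (he.eventually_le_const one_pos).and (he.eventually_le_const hT)
  refine tendsto_of_tendsto_of_tendsto_of_le_of_le' tendsto_const_nhds hlim
    (.of_forall fun n => ?_) ?_
  · have := he0 n
    have h4 : 0 ≤ cubicDefect T (e n) ρ u c := integral_nonneg fun q => cubicIncr_nonneg _ _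
    positivity
  · filter_upwards [hev] with n hn
    have hp := he0 n
    set ε := e n
    have e1 : ε⁻¹ ^ (d + 2) * ((ε ^ α) ^ 3 * ε ^ (d + 1)) = ε ^ (3 * α - 1) := by
      rw [Real.rpow_sub hp, Real.rpow_one, mul_comm 3 α, Real.rpow_mul hp.le, Real.rpow_ofNat,
        inv_pow, pow_succ ε (d + 1)]
      field_simp
    have e2 : ∀ x, ε⁻¹ ^ (d + 2) * ((2 * ε) ^ (d + 1) * x) = 2 ^ (d + 1) * (ε⁻¹ * x) := fun x => by
      rw [inv_pow, pow_succ ε (d + 1), mul_pow]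
      field_simp
    calc ε⁻¹ ^ (d + 2) * cubicDefect T ε ρ u c
        ≤ ε⁻¹ ^ (d + 2) * (4 * (K * ((ε ^ α) ^ 3 * ε ^ (d + 1))) +
          32 * M ^ 2 * ∑ i, (2 * ε) ^ (d + 1) * ∫ z in faceLayer d T i ε, |u z i|) := by
          gcongr
          refine (cubicDefect_le_add h hp c).trans ?_
          gcongr
          exact hKle ε hp hn.1 hn.2
      _ = 4 * K * (ε⁻¹ ^ (d + 2) * ((ε ^ α) ^ 3 * ε ^ (d + 1))) + 32 * M ^ 2 *
          ∑ i, ε⁻¹ ^ (d + 2) * ((2 * ε) ^ (d + 1) * ∫ z in faceLayer d T i ε, |u z i|) := by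
          rw [← Finset.mul_sum Finset.univ (fun i => (2 * ε) ^ (d + 1) *
            ∫ z in faceLayer d T i ε, |u z i|) (ε⁻¹ ^ (d + 2))]
          ring
      _ = _ := by
          simp only [e1, e2]
          rw [← Finset.mul_sum Finset.univ (fun i => ε⁻¹ * ∫ z in faceLayer d T i ε, |u z i|)
            (2 ^ (d + 1))]
          ring

end Euler

namespace Euler

variable {d : ℕ} {T α ℓ σ : ℝ} {C : ℝ≥0}

/-! ### Coordinates next to a face -/

/-- Coordinates next to the face `x_i = σ`: the first one is the distance to the face, and the
`i`-th one is the time. -/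
noncomputable def faceMap (i : Fin d) (σ : ℝ) (p : ℝ × Space d) : ℝ × Space d :=
  (p.2 i, p.2 + EuclideanSpace.single i (σ * (1 - p.1) - p.2 i))

@[simp] theorem faceMap_fst (i : Fin d) (σ : ℝ) (p : ℝ × Space d) : (faceMap i σ p).1 = p.2 i := rfl

theorem faceMap_snd_self (i : Fin d) (σ : ℝ) (p : ℝ × Space d) :
    (faceMap i σ p).2 i = σ * (1 - p.1) := by simp [faceMap]

theorem faceMap_snd_of_ne {i j : Fin d} (h : j ≠ i) (σ : ℝ) (p : ℝ × Space d) :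
    (faceMap i σ p).2 j = p.2 j := by simp [faceMap, h]

/-- The linear part of `faceMap`. -/
noncomputable def faceLin (i : Fin d) (σ : ℝ) : ℝ × Space d →ₗ[ℝ] ℝ × Space d where
  toFun p := (p.2 i, p.2 + EuclideanSpace.single i (-(σ * p.1) - p.2 i))
  map_add' p q := by
    ext j
    · simp
    · by_cases h : j = i
      · subst h; simp; ring
      · simp [h]
  map_smul' c p := by
    ext j
    · simp
    · by_cases h : j = i
      · subst h; simp; ring
      · simp [h]

theorem measurePreserving_faceMap (i : Fin d) (hσ : σ * σ = 1) :
    MeasurePreserving (faceMap i σ : ℝ × Space d → ℝ × Space d) volume volume := by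
  have h4 : (faceLin i σ) ∘ₗ (faceLin i σ) ∘ₗ (faceLin i σ) ∘ₗ (faceLin i σ) = LinearMap.id := by
    refine LinearMap.ext fun p => Prod.ext ?_ ?_
    · simp only [faceLin, LinearMap.comp_apply, LinearMap.coe_mk, AddHom.coe_mk]
      simp
      linear_combination p.1 * hσ
    · ext j
      by_cases h : j = i
      · subst h
        simp only [faceLin, LinearMap.comp_apply, LinearMap.coe_mk, AddHom.coe_mk]
        simp
        linear_combination p.2 j * hσ
      · simp [faceLin, h]
  have hdet : LinearMap.det (faceLin i σ) ^ 4 = 1 := by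
    have := congrArg LinearMap.det h4
    rw [LinearMap.det_comp, LinearMap.det_comp, LinearMap.det_comp, LinearMap.det_id] at this
    rw [← this]; ring
  have hne : LinearMap.det (faceLin i σ) ≠ 0 := fun h => by
    rw [h] at hdet; norm_num at hdet
  have habs : |(LinearMap.det (faceLin i σ))⁻¹| = 1 := by
    rw [abs_inv, inv_eq_one]
    refine (pow_eq_one_iff_of_nonneg (abs_nonneg _) (by norm_num : (4 : ℕ) ≠ 0)).1 ?_
    rw [← abs_pow, hdet, abs_one]
  have hL : MeasurePreserving (faceLin i σ) (volume : Measure (ℝ × Space d)) volume := by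
    refine ⟨(LinearMap.continuous_of_finiteDimensional _).measurable, ?_⟩
    rw [Measure.map_linearMap_addHaar_eq_smul_addHaar _ hne, habs, ENNReal.ofReal_one, one_smul]
  have h := (measurePreserving_add_cyl ((0, EuclideanSpace.single i σ) : ℝ × Space d)).comp hL
  convert h using 1
  funext p
  refine Prod.ext ?_ ?_
  · simp [faceLin]
  · ext j
    by_cases h : j = i
    · subst h; simp [faceLin, faceMap]; ring
    · simp [faceLin, faceMap, h]

/-- The face `x_i = ± 1` of the cylinder, where the `i`-th coordinate is the time. -/
def faceSet (T : ℝ) (i : Fin d) : Set (Space d) :=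
  {y | y i ∈ Ioo 0 T ∧ ∀ j ≠ i, y j ∈ Ioo (-1 : ℝ) 1}

theorem isOpen_faceSet (T : ℝ) (i : Fin d) : IsOpen (faceSet T i) := by
  have : faceSet T i = (fun x : Space d => x i) ⁻¹' Ioo 0 T ∩
      ⋂ j, {x | j ≠ i → x j ∈ Ioo (-1 : ℝ) 1} := by
    ext x; simp [faceSet]
  rw [this]
  refine (isOpen_Ioo.preimage (by fun_prop)).inter (isOpen_iInter_of_finite fun j => ?_)
  by_cases h : j = i
  · simp [h]
  · simp only [ne_eq, h, not_false_eq_true, true_implies]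
    exact isOpen_Ioo.preimage (by fun_prop)

/-- The part of the cylinder within distance `δ` of the face `x_i = σ`. -/
def sideLayer (T : ℝ) (i : Fin d) (σ δ : ℝ) : Set (ℝ × Space d) :=
  cylinder d T ∩ {z | 1 - σ * z.2 i < δ}

theorem measurableSet_sideLayer (T : ℝ) (i : Fin d) (σ δ : ℝ) :
    MeasurableSet (sideLayer T i σ δ) :=
  (measurableSet_cylinder d T).inter
    (isOpen_lt (by fun_prop : Continuous fun z : ℝ × Space d => 1 - σ * z.2 i)
      continuous_const).measurableSet

theorem faceMap_preimage (i : Fin d) (hσ : σ = 1 ∨ σ = -1) {δ : ℝ} (hδ : δ ≤ 2) :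
    faceMap i σ ⁻¹' sideLayer T i σ δ = Ioo 0 δ ×ˢ faceSet T i := by
  ext p
  have hσ2 : σ * σ = 1 := by rcases hσ with rfl | rfl <;> norm_num
  have h1 : 1 - σ * (σ * (1 - p.1)) = p.1 := by linear_combination -(1 - p.1) * hσ2
  simp only [sideLayer, cylinder, mem_preimage, mem_inter_iff, mem_prod, mem_ofPred_eq, faceMap_fst,
    faceMap_snd_self, h1, cube, faceSet]
  constructor
  · rintro ⟨⟨ht, hx⟩, hp⟩
    refine ⟨⟨?_, hp⟩, ht, fun j hj => by simpa [faceMap_snd_of_ne hj] using hx j⟩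
    have := hx i
    rw [faceMap_snd_self] at this
    rcases hσ with rfl | rfl <;> linarith [this.1, this.2]
  · rintro ⟨hp, ht, hx⟩
    refine ⟨⟨ht, fun j => ?_⟩, hp.2⟩
    by_cases hj : j = i
    · subst hj
      rw [faceMap_snd_self]
      rcases hσ with rfl | rfl <;> constructor <;> linarith [hp.1, hp.2]
    · rw [faceMap_snd_of_ne hj]; exact hx j hj

theorem volume_sideLayer (i : Fin d) (hσ : σ = 1 ∨ σ = -1) {δ : ℝ} (hδ : δ ≤ 2) :
    volume (sideLayer T i σ δ) = ENNReal.ofReal δ * volume (faceSet T i) := by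
  have hσ2 : σ * σ = 1 := by rcases hσ with rfl | rfl <;> norm_num
  rw [← (measurePreserving_faceMap i hσ2).measure_preimage
    (measurableSet_sideLayer T i σ δ).nullMeasurableSet, faceMap_preimage i hσ hδ,
    Measure.volume_eq_prod, Measure.prod_prod, Real.volume_Ioo, sub_zero]

theorem volume_cylinder_lt_top (d : ℕ) (T : ℝ) : volume (cylinder d T) < ⊤ := by
  have := measure_lt_top ((volume : Measure (ℝ × Space d)).restrict (cylinder d T)) univ
  rwa [Measure.restrict_apply_univ] at this

theorem volume_faceSet_lt_top (T : ℝ) (i : Fin d) : volume (faceSet T i) < ⊤ := by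
  have h := volume_sideLayer (T := T) i (Or.inl rfl : (1 : ℝ) = 1 ∨ (1 : ℝ) = -1) le_rfl
  have h2 : volume (sideLayer T i 1 2) < ⊤ :=
    (measure_mono inter_subset_left).trans_lt (volume_cylinder_lt_top d T)
  rw [h] at h2
  by_contra h3
  rw [not_lt, top_le_iff] at h3
  rw [h3, ENNReal.mul_top (by simp)] at h2
  exact lt_irrefl _ h2

instance (T : ℝ) (i : Fin d) : IsFiniteMeasure (volume.restrict (faceSet T i)) :=
  ⟨by simpa using volume_faceSet_lt_top T i⟩

theorem restrict_prod_faceSet (T δ : ℝ) (i : Fin d) :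
    (volume : Measure (ℝ × Space d)).restrict (Ioo 0 δ ×ˢ faceSet T i) =
      (volume.restrict (Ioo 0 δ)).prod (volume.restrict (faceSet T i)) := by
  rw [Measure.volume_eq_prod, Measure.prod_restrict]

theorem lintegral_sideLayer (i : Fin d) (hσ : σ = 1 ∨ σ = -1) {δ : ℝ} (hδ : δ ≤ 2)
    {g : ℝ × Space d → ℝ≥0∞} (hg : Measurable g) :
    ∫⁻ z in sideLayer T i σ δ, g z =
      ∫⁻ s in Ioo 0 δ, ∫⁻ y in faceSet T i, g (faceMap i σ (s, y)) := by
  have hσ2 : σ * σ = 1 := by rcases hσ with rfl | rfl <;> norm_num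
  have h := measurePreserving_faceMap i hσ2
  rw [← h.setLIntegral_comp_preimage (measurableSet_sideLayer T i σ δ) hg,
    faceMap_preimage i hσ hδ, restrict_prod_faceSet, lintegral_prod]
  exact (hg.comp h.measurable).aemeasurable

/-- The exponent `α + 2/3` of the integrals of increments over layers of width `δ` is greater
than `1` by `α - 1/3`. -/
theorem scale_le {h : ℝ} (hℓ : 0 < ℓ) (hα : 0 < α) (n : ℕ) (h0 : 0 ≤ h) (hh : h ≤ ℓ * (1 / 2) ^ n)
    (V : ℝ≥0∞) :
    ENNReal.ofReal (h ^ α) * (ENNReal.ofReal (ℓ * (1 / 2) ^ n) * V) ^ (2 / 3 : ℝ) ≤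
      V ^ (2 / 3 : ℝ) * ENNReal.ofReal (ℓ ^ (α - 1 / 3)) *
        ENNReal.ofReal ((1 / 2) ^ (α - 1 / 3)) ^ n * ENNReal.ofReal (ℓ * (1 / 2) ^ n) := by
  set δ := ℓ * (1 / 2) ^ n with hδ
  have hδ0 : 0 < δ := by positivity
  have e1 : ENNReal.ofReal (ℓ ^ (α - 1 / 3)) * ENNReal.ofReal ((1 / 2) ^ (α - 1 / 3)) ^ n *
      ENNReal.ofReal δ = ENNReal.ofReal (δ ^ α * δ ^ (2 / 3 : ℝ)) := by
    rw [← ENNReal.ofReal_pow (by positivity), ← ENNReal.ofReal_mul (by positivity),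
      ← ENNReal.ofReal_mul (by positivity)]
    congr 1
    have e2 : ((1 / 2 : ℝ) ^ (α - 1 / 3)) ^ n = ((1 / 2 : ℝ) ^ n) ^ (α - 1 / 3) := by
      rw [← Real.rpow_natCast, ← Real.rpow_natCast, ← Real.rpow_mul (by norm_num),
        ← Real.rpow_mul (by norm_num), mul_comm]
    rw [e2, ← Real.mul_rpow hℓ.le (by positivity), ← hδ, ← Real.rpow_add hδ0]
    nth_rewrite 2 [← Real.rpow_one δ]
    rw [← Real.rpow_add hδ0]
    congr 1
    ring
  calc _ ≤ ENNReal.ofReal (δ ^ α) * (ENNReal.ofReal δ * V) ^ (2 / 3 : ℝ) := by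
        gcongr
    _ = V ^ (2 / 3 : ℝ) * ENNReal.ofReal (δ ^ α * δ ^ (2 / 3 : ℝ)) := by
        rw [ENNReal.mul_rpow_of_nonneg _ _ (by norm_num), ENNReal.ofReal_rpow_of_pos hδ0,
          ENNReal.ofReal_mul (by positivity)]
        ring
    _ = _ := by rw [← e1]; ring

theorem ratio_lt_one (hα : 1 / 3 < α) : ENNReal.ofReal ((1 / 2) ^ (α - 1 / 3)) < 1 := by
  rw [← ENNReal.ofReal_one, ENNReal.ofReal_lt_ofReal_iff one_pos]
  exact Real.rpow_lt_one (by norm_num) (by norm_num) (by linarith)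

/-- The cubic increments in the direction normal to a face, integrated over a layer of width
`2⁻ⁿ ℓ`, give by Hölder's inequality a trace bound with the ratio `2^(-(α - 1/3))`. -/
theorem hasTraceBound_face {v : ℝ × Space d → ℝ} (hv : HasCubeIncr T α C v) (hvm : Measurable v)
    (hα : 1 / 3 < α) (i : Fin d) (hσ : σ = 1 ∨ σ = -1) (hℓ : 0 < ℓ) (hℓ1 : ℓ ≤ 1)
    (hℓT : ℓ ≤ T / 2) :
    HasTraceBound (volume.restrict (faceSet T i)) (fun p => v (faceMap i σ p)) ℓ
      (4 * C * (volume (faceSet T i) ^ (2 / 3 : ℝ) * ENNReal.ofReal (ℓ ^ (α - 1 / 3))))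
      (ENNReal.ofReal ((1 / 2) ^ (α - 1 / 3))) := by
  have hσ2 : σ * σ = 1 := by rcases hσ with rfl | rfl <;> norm_num
  have hσ1 : |σ| = 1 := by rcases hσ with rfl | rfl <;> norm_num
  have hΦ := measurePreserving_faceMap i hσ2
  refine ⟨hvm.comp hΦ.measurable, hℓ, ?_, ratio_lt_one hα, fun n h h0 hh => ?_⟩
  · exact ENNReal.mul_ne_top (ENNReal.mul_ne_top (by simp) (by simp)) (ENNReal.mul_ne_top
      (ENNReal.rpow_ne_top_of_nonneg (by norm_num) (volume_faceSet_lt_top T i).ne) (by simp))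
  set δ := ℓ * (1 / 2) ^ n
  have hδℓ : δ ≤ ℓ := mul_le_of_le_one_right hℓ.le (pow_le_one₀ (by norm_num) (by norm_num))
  set ξ : Space d := EuclideanSpace.single i (-(σ * h))
  have hξn : ‖ξ‖ = h := by simp [ξ, hσ1, abs_of_pos h0]
  have hξc : ξ ∈ cube d := fun j => by
    by_cases hj : j = i
    · subst hj
      simp only [ξ, PiLp.single_apply, if_true]
      rcases hσ with rfl | rfl <;> constructor <;> linarith
    · simp [ξ, hj]
  have hshift : ∀ s y, faceMap i σ (s + h, y) = faceMap i σ (s, y) + (0, ξ) := fun s y => by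
    refine Prod.ext (by simp) ?_
    ext j
    by_cases hj : j = i
    · subst hj; simp [faceMap, ξ]; ring
    · simp [faceMap, ξ, hj]
  have hm : Measurable fun z => ‖v (z + (0, ξ)) - v z‖ₑ :=
    ((hvm.comp (measurable_add_const _)).sub hvm).enorm
  have hsub : sideLayer T i σ (δ - h) ⊆ cylinder d T ∩ {z | z + (0, ξ) ∈ cylinder d T} := by
    intro z hz
    refine ⟨hz.1, by simpa using hz.1.1, fun j => ?_⟩
    by_cases hj : j = i
    · subst hj
      have h1 := hz.1.2 j
      have h2 : 1 - σ * z.2 j < δ - h := hz.2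
      simp only [Prod.snd_add, PiLp.add_apply, ξ, PiLp.single_apply, if_true]
      rcases hσ with rfl | rfl <;> constructor <;> linarith [h1.1, h1.2]
    · simpa [ξ, hj] using hz.1.2 j
  have key := hv.lintegral_space_le hvm hξc (hξn ▸ h0) (by rw [hξn]; linarith) hsub
  rw [lintegral_sideLayer i hσ (by linarith) hm, hξn, volume_sideLayer i hσ (by linarith)] at key
  simp only [← hshift] at key
  refine key.trans ?_
  calc _ ≤ 4 * (C * ENNReal.ofReal (h ^ α)) *
        (ENNReal.ofReal δ * volume (faceSet T i)) ^ (2 / 3 : ℝ) := by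
        gcongr; linarith
    _ = 4 * C * (ENNReal.ofReal (h ^ α) *
        (ENNReal.ofReal δ * volume (faceSet T i)) ^ (2 / 3 : ℝ)) := by ring
    _ ≤ 4 * C * _ := mul_le_mul_right (scale_le hℓ (by linarith) n h0.le hh.le _) _
    _ = _ := by ring

/-- The increments in time give a trace bound at the initial time in the same way. -/
theorem hasTraceBound_init {v : ℝ × Space d → ℝ} (hv : HasCubeIncr T α C v) (hvm : Measurable v)
    (hα : 1 / 3 < α) (hℓ : 0 < ℓ) (hℓT : ℓ ≤ T) :
    HasTraceBound (volume.restrict (cube d)) v ℓ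
      (C * (volume (cube d) ^ (2 / 3 : ℝ) * ENNReal.ofReal (ℓ ^ (α - 1 / 3))))
      (ENNReal.ofReal ((1 / 2) ^ (α - 1 / 3))) := by
  refine ⟨hvm, hℓ, ?_, ratio_lt_one hα, fun n h h0 hh => ?_⟩
  · exact ENNReal.mul_ne_top (by simp) (ENNReal.mul_ne_top
      (ENNReal.rpow_ne_top_of_nonneg (by norm_num) (volume_cube_lt_top d).ne) (by simp))
  set δ := ℓ * (1 / 2) ^ n
  have hδℓ : δ ≤ ℓ := mul_le_of_le_one_right hℓ.le (pow_le_one₀ (by norm_num) (by norm_num))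
  set k : ℝ × Space d := (h, 0)
  have hk : k ∈ cylinder d T := ⟨⟨h0, by change h < T; linarith⟩, fun i => by simp [k]⟩
  have hkn : ‖k‖ = h := by simp [k, Prod.norm_def, abs_of_pos h0, h0.le]
  have hm : Measurable fun z => ‖v (z + k) - v z‖ₑ :=
    ((hvm.comp (measurable_add_const _)).sub hvm).enorm
  have hsub : Ioo 0 (δ - h) ×ˢ cube d ⊆ cylinder d T ∩ {z | z + k ∈ cylinder d T} := by
    rintro z ⟨hz1, hz2⟩
    refine ⟨⟨⟨hz1.1, by linarith [hz1.2]⟩, hz2⟩, ⟨?_, ?_⟩, by simpa [k] using hz2⟩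
    · change 0 < z.1 + h; linarith [hz1.1]
    · change z.1 + h < T; linarith [hz1.2]
  have key := hv.lintegral_le hvm hk hsub
  rw [hkn, Measure.volume_eq_prod, Measure.prod_prod, ← Measure.prod_restrict,
    lintegral_prod _ hm.aemeasurable, Real.volume_Ioo, sub_zero] at key
  have e1 : ∀ s x, ((s, x) : ℝ × Space d) + k = (s + h, x) := fun s x => by simp [k]
  simp only [e1] at key
  refine key.trans ?_
  calc _ ≤ C * ENNReal.ofReal (h ^ α) *
        (ENNReal.ofReal δ * volume (cube d)) ^ (2 / 3 : ℝ) := by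
        gcongr; linarith
    _ = C * (ENNReal.ofReal (h ^ α) *
        (ENNReal.ofReal δ * volume (cube d)) ^ (2 / 3 : ℝ)) := by ring
    _ ≤ C * _ := mul_le_mul_right (scale_le hℓ (by linarith) n h0.le hh.le _) _
    _ = _ := by ring

end Euler

namespace Euler

variable {d : ℕ} {T α ℓ σ : ℝ} {C : ℝ≥0}

/-! ### The normal trace of the momentum -/

/-- The equation of continuity, tested with functions that vanish near the initial and the final
time, but not at the faces of the cube. -/
def HasWeakContinuity (T : ℝ) (ρ : ℝ × Space d → ℝ) (m : ℝ × Space d → Space d) : Prop :=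
  ∀ φ : ℝ → Space d → ℝ, ContDiff ℝ 1 (Function.uncurry φ) →
    (∃ δ > 0, ∀ t x, t ∉ Ioo δ (T - δ) → φ t x = 0) →
    ∫ z in cylinder d T, (ρ z * dt φ z.1 z.2 + dx φ z.1 z.2 (m z)) = 0

theorem exists_subset_Ioo_of_isCompact {K : Set ℝ} (hK : IsCompact K) (hT : K ⊆ Ioo 0 T) :
    ∃ δ > 0, K ⊆ Ioo δ (T - δ) := by
  rcases K.eq_empty_or_nonempty with rfl | hne
  · exact ⟨1, one_pos, empty_subset _⟩
  · obtain ⟨a, ha, hal⟩ := hK.exists_isLeast hne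
    obtain ⟨b, hb, hbg⟩ := hK.exists_isGreatest hne
    have h1 := hT ha
    have h2 := hT hb
    refine ⟨min a (T - b) / 2, by have : 0 < min a (T - b) := lt_min h1.1 (by linarith [h2.2])
                                  positivity, fun t ht => ?_⟩
    have h3 := hal ht
    have h4 := hbg ht
    have h5 : 0 < min a (T - b) := lt_min h1.1 (by linarith [h2.2])
    have h6 := min_le_left a (T - b)
    have h7 := min_le_right a (T - b)
    constructor <;> linarith

theorem deriv_smoothTransition_of_nonpos {x : ℝ} (hx : x ≤ 0) :
    deriv Real.smoothTransition x = 0 :=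
  IsLocalMin.deriv_eq_zero (.of_forall fun y => by
    rw [Real.smoothTransition.zero_of_nonpos hx]; exact Real.smoothTransition.nonneg y)

theorem continuous_deriv_smoothTransition : Continuous (deriv Real.smoothTransition) :=
  (Real.smoothTransition.contDiff (n := 1)).continuous_deriv le_rfl

theorem hasDerivAt_smoothTransition (x : ℝ) :
    HasDerivAt Real.smoothTransition (deriv Real.smoothTransition x) x :=
  ((Real.smoothTransition.contDiff (n := 1)).differentiable one_ne_zero x).hasDerivAt

theorem integral_deriv_smoothTransition :
    ∫ s in (0 : ℝ)..1, deriv Real.smoothTransition (1 - s) = 1 := by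
  rw [intervalIntegral.integral_comp_sub_left (fun s => deriv Real.smoothTransition s),
    intervalIntegral.integral_eq_sub_of_hasDerivAt (f := Real.smoothTransition)
      (fun x _ => hasDerivAt_smoothTransition x)
      (continuous_deriv_smoothTransition.intervalIntegrable _ _)]
  simp

theorem single_eq_smul (i : Fin d) (r : ℝ) :
    EuclideanSpace.single i r = r • EuclideanSpace.single i (1 : ℝ) := by
  ext j; simp

/-- A test function that is concentrated next to the face `x_i = σ`. -/
noncomputable def faceTest (i : Fin d) (σ δ : ℝ) (ψ : Space d → ℝ) (t : ℝ) (x : Space d) : ℝ :=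
  Real.smoothTransition (1 - (1 - σ * x i) / δ) * ψ (x + EuclideanSpace.single i (t - x i))

theorem contDiff_faceTest (i : Fin d) (σ δ : ℝ) {ψ : Space d → ℝ} (hψ : ContDiff ℝ 1 ψ) :
    ContDiff ℝ 1 (Function.uncurry (faceTest i σ δ ψ)) := by
  have h1 : ContDiff ℝ 1 fun z : ℝ × Space d => z.2 i :=
    (EuclideanSpace.proj i : Space d →L[ℝ] ℝ).contDiff.comp contDiff_snd
  have h2 : ContDiff ℝ 1 fun z : ℝ × Space d =>
      z.2 + EuclideanSpace.single i (z.1 - z.2 i) := by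
    have e : (fun z : ℝ × Space d => z.2 + EuclideanSpace.single i (z.1 - z.2 i)) =
        fun z => z.2 + (z.1 - z.2 i) • EuclideanSpace.single i (1 : ℝ) := by
      funext z; rw [single_eq_smul i (z.1 - z.2 i)]
    rw [e]
    exact contDiff_snd.add ((contDiff_fst.sub h1).smul contDiff_const)
  have h3 : ContDiff ℝ 1 fun z : ℝ × Space d => 1 - (1 - σ * z.2 i) / δ :=
    contDiff_const.sub ((contDiff_const.sub (contDiff_const.mul h1)).div_const δ)
  exact ((Real.smoothTransition.contDiff (n := 1)).comp h3).mul (hψ.comp h2)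

theorem dt_faceTest (i : Fin d) (σ δ : ℝ) {ψ : Space d → ℝ} (hψ : ContDiff ℝ 1 ψ) (t : ℝ)
    (x : Space d) : dt (faceTest i σ δ ψ) t x =
      Real.smoothTransition (1 - (1 - σ * x i) / δ) *
        fderiv ℝ ψ (x + EuclideanSpace.single i (t - x i)) (EuclideanSpace.single i 1) := by
  have e : ∀ s, x + EuclideanSpace.single i (s - x i) =
      x + (s - x i) • EuclideanSpace.single i (1 : ℝ) := fun s => by
    rw [single_eq_smul i (s - x i)]
  have h1 : HasDerivAt (fun s : ℝ => x + (s - x i) • EuclideanSpace.single i (1 : ℝ))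
      (EuclideanSpace.single i (1 : ℝ)) t := by
    have := (((hasDerivAt_id t).sub_const (x i)).smul_const
      (EuclideanSpace.single i (1 : ℝ))).const_add x
    simpa using this
  have h2 := (hψ.differentiable one_ne_zero
    (x + (t - x i) • EuclideanSpace.single i (1 : ℝ))).hasFDerivAt.comp_hasDerivAt t h1
  have h3 := h2.const_mul (Real.smoothTransition (1 - (1 - σ * x i) / δ))
  unfold dt faceTest
  simp only [e]
  exact h3.deriv

theorem dx_faceTest (i : Fin d) (σ δ : ℝ) {ψ : Space d → ℝ} (hψ : ContDiff ℝ 1 ψ) (t : ℝ)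
    (x v : Space d) : dx (faceTest i σ δ ψ) t x v =
      Real.smoothTransition (1 - (1 - σ * x i) / δ) *
        fderiv ℝ ψ (x + EuclideanSpace.single i (t - x i)) (v - EuclideanSpace.single i (v i)) +
      σ * δ⁻¹ * (deriv Real.smoothTransition (1 - (1 - σ * x i) / δ) *
        (v i * ψ (x + EuclideanSpace.single i (t - x i)))) := by
  have hp : HasFDerivAt (fun y : Space d => y i) (EuclideanSpace.proj i : Space d →L[ℝ] ℝ) x :=
    (EuclideanSpace.proj i : Space d →L[ℝ] ℝ).hasFDerivAt
  have h1 := (hasFDerivAt_id x).add ((hp.const_sub t).smul_const (EuclideanSpace.single i (1 : ℝ)))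
  have h2 := (hψ.differentiable one_ne_zero
    (x + (t - x i) • EuclideanSpace.single i (1 : ℝ))).hasFDerivAt.comp x h1
  have h3 : HasFDerivAt (fun y : Space d => 1 - (1 - σ * y i) / δ) _ x :=
    ((((hp.const_mul σ).const_sub 1).mul_const δ⁻¹).const_sub 1)
  have h4 := (hasDerivAt_smoothTransition (1 - (1 - σ * x i) / δ)).comp_hasFDerivAt x h3
  have h5 := (h4.mul h2).fderiv
  unfold dx
  have hfun : faceTest i σ δ ψ t = (fun y => Real.smoothTransition (1 - (1 - σ * y i) / δ)) *
      (ψ ∘ (id + fun y : Space d => (t - y i) • EuclideanSpace.single i (1 : ℝ))) := by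
    funext y
    simp [faceTest, single_eq_smul i (t - y i)]
  rw [hfun]
  change fderiv ℝ ((Real.smoothTransition ∘ fun y : Space d => 1 - (1 - σ * y i) / δ) *
      (ψ ∘ (id + fun y : Space d => (t - y i) • EuclideanSpace.single i (1 : ℝ)))) x v = _
  rw [h5, single_eq_smul i (t - x i), single_eq_smul i (v i)]
  simp
  ring

theorem faceMap_snd_add (i : Fin d) (σ : ℝ) (p : ℝ × Space d) :
    (faceMap i σ p).2 + EuclideanSpace.single i ((faceMap i σ p).1 - (faceMap i σ p).2 i) = p.2 := by
  ext j
  by_cases h : j = i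
  · subst h; simp
  · simp [faceMap_snd_of_ne h, h]

theorem isFiniteMeasure_sideLayer (T : ℝ) (i : Fin d) (σ δ : ℝ) :
    IsFiniteMeasure (volume.restrict (sideLayer T i σ δ)) :=
  ⟨by
    rw [Measure.restrict_apply_univ]
    exact (measure_mono inter_subset_left).trans_lt (volume_cylinder_lt_top d T)⟩

variable {R M : ℝ} {ρ : ℝ × Space d → ℝ} {m : ℝ × Space d → Space d}

/-- Bounded solutions of the equation of continuity have weak normal trace zero. -/
theorem exists_abs_layer_le (hw : HasWeakContinuity T ρ m) (hρm : Measurable ρ) (hmm : Measurable m)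
    (hρ : ∀ z, |ρ z| ≤ R) (hm : ∀ z, ‖m z‖ ≤ M) (i : Fin d) (hσ : σ = 1 ∨ σ = -1)
    {ψ : Space d → ℝ} (hψ : ContDiff ℝ 1 ψ) (hψc : HasCompactSupport ψ)
    (hψs : tsupport ψ ⊆ faceSet T i) :
    ∃ K, ∀ δ, 0 < δ → δ ≤ 1 → |δ⁻¹ * ∫ s in Ioo 0 δ, ∫ y in faceSet T i,
      deriv Real.smoothTransition (1 - s / δ) * (m (faceMap i σ (s, y)) i * ψ y)| ≤ K * δ := by
  have hσ2 : σ * σ = 1 := by rcases hσ with rfl | rfl <;> norm_num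
  have hσ1 : |σ| = 1 := by rcases hσ with rfl | rfl <;> norm_num
  have hΦ := measurePreserving_faceMap i hσ2
  obtain ⟨B₀, hB₀⟩ := hψ.continuous.bounded_above_of_compact_support hψc
  obtain ⟨B, hB⟩ := (hψ.continuous_fderiv one_ne_zero).bounded_above_of_compact_support
    (hψc.fderiv (𝕜 := ℝ))
  obtain ⟨W, hW⟩ := isCompact_Icc.exists_bound_of_continuousOn (s := Icc (0 : ℝ) 1)
    continuous_deriv_smoothTransition.continuousOn
  have hB0 : 0 ≤ B := (norm_nonneg _).trans (hB 0)
  have hW0 : 0 ≤ W := (norm_nonneg _).trans (hW 0 (by simp))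
  have hM0 : 0 ≤ M := (norm_nonneg _).trans (hm 0)
  have hR0 : 0 ≤ R := (abs_nonneg _).trans (hρ 0)
  set K := R * B + B * (M + M)
  refine ⟨K * (volume (faceSet T i)).toReal, fun δ hδ hδ1 => ?_⟩
  set A := sideLayer T i σ δ
  have hA : MeasurableSet A := measurableSet_sideLayer T i σ δ
  have := isFiniteMeasure_sideLayer T i σ δ
  let s : ℝ × Space d → ℝ := fun z => 1 - (1 - σ * z.2 i) / δ
  let y : ℝ × Space d → Space d := fun z => z.2 + EuclideanSpace.single i (z.1 - z.2 i)
  let E : ℝ × Space d → ℝ := fun z => Real.smoothTransition (s z) *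
    (ρ z * fderiv ℝ ψ (y z) (EuclideanSpace.single i 1) +
      fderiv ℝ ψ (y z) (m z - EuclideanSpace.single i (m z i)))
  let G : ℝ × Space d → ℝ := fun z => deriv Real.smoothTransition (s z) * (m z i * ψ (y z))
  have hsc : Continuous s := by fun_prop
  have hyc : Continuous y := by
    have e : y = fun z => z.2 + (z.1 - z.2 i) • EuclideanSpace.single i (1 : ℝ) := by
      funext z; rw [← single_eq_smul i (z.1 - z.2 i)]
    rw [e]
    fun_prop
  have hDm : ∀ V : ℝ × Space d → Space d, Measurable V →
      Measurable fun z => fderiv ℝ ψ (y z) (V z) := fun V hV => by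
    have h1 : Measurable fun z => fderiv ℝ ψ (y z) :=
      ((hψ.continuous_fderiv one_ne_zero).comp hyc).measurable
    exact (isBoundedBilinearMap_apply (𝕜 := ℝ) (E := Space d) (F := ℝ)).continuous.measurable.comp
      (h1.prodMk hV)
  have hsing : Measurable fun z => m z - EuclideanSpace.single i (m z i) := by
    have e : (fun z => m z - EuclideanSpace.single i (m z i)) =
        fun z => m z - m z i • EuclideanSpace.single i (1 : ℝ) := by
      funext z; rw [← single_eq_smul i (m z i)]
    rw [e]
    exact hmm.sub ((measurable_apply hmm i).smul_const _)
  have hEm : Measurable E :=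
    (Real.smoothTransition.continuous.measurable.comp hsc.measurable).mul
      ((hρm.mul (hDm _ measurable_const)).add (hDm _ hsing))
  have hGm : Measurable G :=
    (continuous_deriv_smoothTransition.measurable.comp hsc.measurable).mul
      ((measurable_apply hmm i).mul (hψ.continuous.comp hyc).measurable)
  have hEb : ∀ z, |E z| ≤ K := fun z => by
    have h1 : |Real.smoothTransition (s z)| ≤ 1 := by
      rw [abs_of_nonneg (Real.smoothTransition.nonneg _)]; exact Real.smoothTransition.le_one _
    have h2 : |fderiv ℝ ψ (y z) (EuclideanSpace.single i 1)| ≤ B := by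
      refine ((fderiv ℝ ψ (y z)).le_opNorm _).trans ?_
      simpa using hB (y z)
    have h3 : |fderiv ℝ ψ (y z) (m z - EuclideanSpace.single i (m z i))| ≤ B * (M + M) := by
      refine ((fderiv ℝ ψ (y z)).le_opNorm _).trans ?_
      gcongr
      · exact hB _
      · refine (norm_sub_le _ _).trans (add_le_add (hm z) ?_)
        rw [PiLp.norm_single, Real.norm_eq_abs]
        exact (abs_apply_le_norm _ i).trans (hm z)
    calc |E z| ≤ 1 * (R * B + B * (M + M)) := by
          simp only [E]
          rw [abs_mul]
          gcongr
          refine (abs_add_le _ _).trans (add_le_add ?_ h3)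
          rw [abs_mul]
          exact mul_le_mul (hρ z) h2 (abs_nonneg _) hR0
      _ = K := one_mul _
  have hGb : ∀ z ∈ A, ‖G z‖ ≤ W * (M * B₀) := fun z hz => by
    have h1 : 1 - σ * z.2 i < δ := hz.2
    have h2 : 0 ≤ 1 - σ * z.2 i := by
      have hx := hz.1.2 i
      rcases hσ with rfl | rfl <;> linarith [hx.1, hx.2]
    have h3 : s z ∈ Icc (0 : ℝ) 1 := by
      refine ⟨?_, ?_⟩
      · have := (div_le_one hδ).2 h1.le
        simp only [s]; linarith
      · have := div_nonneg h2 hδ.le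
        simp only [s]; linarith
    simp only [G]
    rw [norm_mul, norm_mul]
    exact mul_le_mul (hW _ h3) (mul_le_mul ((abs_apply_le_norm _ i).trans (hm z)) (hB₀ _)
      (norm_nonneg _) hM0) (by positivity) hW0
  have hEi : IntegrableOn E A := integrable_of_abs_le hEm hEb
  have hGi : IntegrableOn G A := by
    refine Integrable.of_bound (C := W * (M * B₀)) hGm.aestronglyMeasurable ?_
    filter_upwards [ae_restrict_mem hA] with z hz using hGb z hz
  -- the equation of continuity with the test function concentrated in the layer
  have hzero : (∫ z in A, E z) + σ * δ⁻¹ * ∫ z in A, G z = 0 := by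
    have h0 := hw (faceTest i σ δ ψ) (contDiff_faceTest i σ δ hψ) (by
      obtain ⟨δ', hδ', hK⟩ := exists_subset_Ioo_of_isCompact (T := T)
        (hψc.isCompact.image (by fun_prop : Continuous fun x : Space d => x i))
        (by rintro _ ⟨x, hx, rfl⟩; exact (hψs hx).1)
      refine ⟨δ', hδ', fun t x ht => ?_⟩
      have : x + EuclideanSpace.single i (t - x i) ∉ tsupport ψ := fun hx => by
        refine ht (hK ⟨_, hx, ?_⟩)
        simp
      simp [faceTest, image_eq_zero_of_notMem_tsupport this])
    rw [← h0, ← integral_const_mul, ← integral_add hEi (hGi.const_mul _)]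
    have hrw : ∀ z, ρ z * dt (faceTest i σ δ ψ) z.1 z.2 + dx (faceTest i σ δ ψ) z.1 z.2 (m z) =
        E z + σ * δ⁻¹ * G z := fun z => by
      rw [dt_faceTest i σ δ hψ, dx_faceTest i σ δ hψ]
      simp only [E, G, s, y]
      ring
    simp only [hrw]
    symm
    refine setIntegral_eq_of_subset_of_forall_sdiff_eq_zero (measurableSet_cylinder d T)
      inter_subset_left fun z hz => ?_
    have hs : s z ≤ 0 := by
      have h1 : δ ≤ 1 - σ * z.2 i := not_lt.1 fun h => hz.2 ⟨hz.1, h⟩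
      have := (one_le_div hδ).2 h1
      simp only [s]; linarith
    simp only [E, G, Real.smoothTransition.zero_of_nonpos hs, deriv_smoothTransition_of_nonpos hs]
    ring
  have hGs : ∫ z in A, G z = ∫ s in Ioo 0 δ, ∫ y in faceSet T i,
      deriv Real.smoothTransition (1 - s / δ) * (m (faceMap i σ (s, y)) i * ψ y) := by
    have hmap : (volume.restrict (Ioo 0 δ ×ˢ faceSet T i)).map (faceMap i σ) =
        volume.restrict A := by
      rw [← faceMap_preimage i hσ (by linarith)]
      exact (hΦ.restrict_preimage hA).map_eq
    have hcomp : ∀ p, G (faceMap i σ p) =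
        deriv Real.smoothTransition (1 - p.1 / δ) * (m (faceMap i σ p) i * ψ p.2) := fun p => by
      have h1 : y (faceMap i σ p) = p.2 := faceMap_snd_add i σ p
      have h2 : s (faceMap i σ p) = 1 - p.1 / δ := by
        simp only [s, faceMap_snd_self]
        congr 2
        linear_combination -(1 - p.1) * hσ2
      simp only [G, h1, h2]
    have hGi' := hGi
    rw [IntegrableOn, ← hmap] at hGi'
    rw [← hmap, integral_map hΦ.measurable.aemeasurable hGm.aestronglyMeasurable,
      restrict_prod_faceSet, integral_prod]
    · simp only [hcomp]
    · have := hGi'.comp_measurable hΦ.measurable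
      rwa [restrict_prod_faceSet] at this
  rw [← hGs]
  have habs : |δ⁻¹ * ∫ z in A, G z| = |∫ z in A, E z| := by
    have : (∫ z in A, E z) = -(σ * (δ⁻¹ * ∫ z in A, G z)) := by linarith
    rw [this, abs_neg, abs_mul σ, hσ1, one_mul]
  rw [habs, ← Real.norm_eq_abs]
  refine (norm_integral_le_of_norm_le_const (.of_forall hEb)).trans (le_of_eq ?_)
  rw [Measure.real, Measure.restrict_apply_univ, volume_sideLayer i hσ (by linarith),
    ENNReal.toReal_mul, ENNReal.toReal_ofReal hδ.le]
  ring

/-- The normal component of the momentum vanishes at the faces in the mean. -/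
theorem tendsto_sideLayer (hw : HasWeakContinuity T ρ m) (hρm : Measurable ρ) (hmm : Measurable m)
    (hρ : ∀ z, |ρ z| ≤ R) (hm : ∀ z, ‖m z‖ ≤ M) (hα : 1 / 3 < α) (hinc : HasCubeIncr T α C m)
    (i : Fin d) (hσ : σ = 1 ∨ σ = -1) (hℓ : 0 < ℓ) (hℓ1 : ℓ ≤ 1) (hℓT : ℓ ≤ T / 2) :
    Tendsto (fun n : ℕ => (ℓ * (1 / 2) ^ n)⁻¹ * ∫ z in sideLayer T i σ (ℓ * (1 / 2) ^ n), |m z i|)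
      atTop (𝓝 0) := by
  have hσ2 : σ * σ = 1 := by rcases hσ with rfl | rfl <;> norm_num
  have hΦ := measurePreserving_faceMap i hσ2
  let e : ℕ → ℝ := fun n => ℓ * (1 / 2) ^ n
  have he : ∀ n, 0 < e n := fun n => by positivity
  have he1 : ∀ n, e n ≤ 1 := fun n =>
    (mul_le_of_le_one_right hℓ.le (pow_le_one₀ (by norm_num) (by norm_num))).trans hℓ1
  have helim : Tendsto e atTop (𝓝 0) := by
    have := (tendsto_pow_atTop_nhds_zero_of_lt_one (r := (1 / 2 : ℝ)) (by norm_num)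
      (by norm_num)).const_mul ℓ
    rwa [mul_zero] at this
  have hmi : Measurable fun z => m z i := measurable_apply hmm i
  have hmi1 : ∀ z, |m z i| ≤ M := fun z => (abs_apply_le_norm _ i).trans (hm z)
  have hinc' : HasCubeIncr T α C fun z => m z i := fun h hh => by
    refine le_trans (eLpNorm_mono fun z => ?_) (hinc h hh)
    exact abs_apply_le_norm (m (z + h) - m z) i
  have htr := hasTraceBound_face hinc' hmi hα i hσ hℓ hℓ1 hℓT
  have hfM : ∀ p : ℝ × Space d, |m (faceMap i σ p) i| ≤ M := fun p => hmi1 _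
  obtain ⟨g, hgm, hgi, hlim⟩ := htr.exists_trace hfM
  -- the trace vanishes
  have hg0 : ∀ᵐ y ∂(volume.restrict (faceSet T i)), g y = 0 := by
    rw [ae_restrict_iff' (isOpen_faceSet T i).measurableSet]
    refine (isOpen_faceSet T i).ae_eq_zero_of_integral_contDiff_smul_eq_zero
      (IntegrableOn.locallyIntegrableOn hgi) fun ψ hψ hψc hψs => ?_
    have hψ1 : ContDiff ℝ 1 ψ := hψ.of_le (by exact_mod_cast le_top)
    obtain ⟨B, hB⟩ := hψ.continuous.bounded_above_of_compact_support hψc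
    obtain ⟨W, hW⟩ := isCompact_Icc.exists_bound_of_continuousOn (s := Icc (0 : ℝ) 1)
      continuous_deriv_smoothTransition.continuousOn
    have h1 := tendsto_weighted_layerMean (e := e) he (hmi.comp hΦ.measurable) hfM hgi hlim
      hψ.continuous.measurable (B := B) hB (w := fun s => deriv Real.smoothTransition (1 - s))
      (by have := continuous_deriv_smoothTransition; fun_prop) (W := W)
      (fun s hs => hW _ ⟨by linarith [hs.2], by linarith [hs.1]⟩) integral_deriv_smoothTransition
    obtain ⟨K, hK⟩ := exists_abs_layer_le hw hρm hmm hρ hm i hσ hψ1 hψc hψs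
    have h2 : Tendsto (fun n => K * e n) atTop (𝓝 0) := by simpa using helim.const_mul K
    have h3 := squeeze_zero_norm (fun n => (Real.norm_eq_abs _).trans_le (hK (e n) (he n) (he1 n))) h2
    have h4 := tendsto_nhds_unique h1 h3
    have h5 : ∫ x, ψ x • g x = ∫ y in faceSet T i, g y * ψ y := by
      rw [← setIntegral_eq_integral_of_forall_compl_eq_zero (s := faceSet T i)]
      · simp only [smul_eq_mul, mul_comm]
      · intro x hx
        rw [image_eq_zero_of_notMem_tsupport fun h => hx (hψs h), zero_smul]
    rw [h5, h4]
  have hlim2 := (ENNReal.tendsto_toReal ENNReal.zero_ne_top).comp hlim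
  rw [ENNReal.toReal_zero] at hlim2
  refine hlim2.congr fun n => ?_
  have hen := he n
  simp only [Function.comp_apply]
  rw [integral_eq_lintegral_of_nonneg_ae (.of_forall fun z => abs_nonneg _)
    hmi.abs.aestronglyMeasurable, lintegral_sideLayer i hσ (by linarith [he1 n])
    (by fun_prop), ENNReal.toReal_mul, ENNReal.toReal_ofReal (inv_pos.2 hen).le]
  congr 2
  refine lintegral_congr fun s => lintegral_congr_ae ?_
  filter_upwards [hg0] with y hy
  rw [hy, sub_zero, Real.enorm_eq_ofReal_abs]

/-- The normal component of the velocity vanishes at the faces in the mean. -/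
theorem tendsto_faceLayer {r : ℝ} {u : ℝ × Space d → Space d} (h : IsBoundedState r R M ρ u)
    (hr : 0 < r) (hw : HasWeakContinuity T ρ fun z => ρ z • u z) (hα : 1 / 3 < α)
    (hinc : HasCubeIncr T α C fun z => ρ z • u z)
    (i : Fin d) (hℓ : 0 < ℓ) (hℓ1 : ℓ ≤ 1) (hℓT : ℓ ≤ T / 2) :
    Tendsto (fun n : ℕ => (ℓ * (1 / 2) ^ n)⁻¹ * ∫ z in faceLayer d T i (ℓ * (1 / 2) ^ n), |u z i|)
      atTop (𝓝 0) := by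
  have hmm : Measurable fun z => ρ z • u z := h.measurable_density.smul h.measurable_velocity
  have hρb : ∀ z, |ρ z| ≤ R := fun z => by
    rw [abs_of_nonneg (hr.le.trans (h.density_mem z).1)]; exact (h.density_mem z).2
  have hR : 0 ≤ R := (abs_nonneg _).trans (hρb 0)
  have hmb : ∀ z, ‖ρ z • u z‖ ≤ R * M := fun z => by
    rw [norm_smul]
    exact mul_le_mul (hρb z) (h.velocity_le z) (norm_nonneg _) hR
  have h1 := tendsto_sideLayer hw h.measurable_density hmm hρb hmb hα hinc i
    (Or.inl rfl : (1 : ℝ) = 1 ∨ (1 : ℝ) = -1) hℓ hℓ1 hℓT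
  have h2 := tendsto_sideLayer hw h.measurable_density hmm hρb hmb hα hinc i
    (Or.inr rfl : (-1 : ℝ) = 1 ∨ (-1 : ℝ) = -1) hℓ hℓ1 hℓT
  have hlim := (h1.add h2).const_mul r⁻¹
  rw [add_zero, mul_zero] at hlim
  refine squeeze_zero (fun n => by positivity) (fun n => ?_) hlim
  set δ := ℓ * (1 / 2) ^ n
  have hmi : Measurable fun z => (ρ z • u z) i := measurable_apply hmm i
  have hint : ∀ S, S ⊆ cylinder d T → IntegrableOn (fun z => |(ρ z • u z) i|) S := fun S hS => by
    have : Integrable (fun z => |(ρ z • u z) i|) (cylMeasure d T) :=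
      integrable_of_abs_le hmi.abs fun z => by
        rw [abs_abs]; exact (abs_apply_le_norm _ i).trans (hmb z)
    exact IntegrableOn.mono_set this hS
  have hsub : faceLayer d T i δ ⊆ sideLayer T i 1 δ ∪ sideLayer T i (-1) δ := fun z hz => by
    rcases lt_abs.1 (show 1 - δ < |z.2 i| from hz.2) with h3 | h3
    · exact Or.inl ⟨hz.1, by change 1 - 1 * z.2 i < δ; linarith⟩
    · exact Or.inr ⟨hz.1, by change 1 - -1 * z.2 i < δ; linarith⟩
  have hδ : 0 < δ := by positivity
  have hδ1 : δ ≤ 1 :=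
    (mul_le_of_le_one_right hℓ.le (pow_le_one₀ (by norm_num) (by norm_num))).trans hℓ1
  have hle : ∫ z in faceLayer d T i δ, |u z i| ≤ r⁻¹ * ((∫ z in sideLayer T i 1 δ,
      |(ρ z • u z) i|) + ∫ z in sideLayer T i (-1) δ, |(ρ z • u z) i|) := by
    calc ∫ z in faceLayer d T i δ, |u z i|
        ≤ ∫ z in faceLayer d T i δ, r⁻¹ * |(ρ z • u z) i| := by
          refine integral_mono ?_ ((hint _ inter_subset_left).const_mul _) fun z => ?_
          · have : Integrable (fun z => |u z i|) (cylMeasure d T) :=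
              integrable_of_abs_le (measurable_apply h.measurable_velocity i).abs fun z => by
                rw [abs_abs]; exact (abs_apply_le_norm _ i).trans (h.velocity_le z)
            exact IntegrableOn.mono_set this inter_subset_left
          · have h3 := (h.density_mem z).1
            simp only [PiLp.smul_apply, smul_eq_mul]
            rw [abs_mul, ← mul_assoc, abs_of_nonneg (hr.le.trans h3)]
            refine le_mul_of_one_le_left (abs_nonneg _) ?_
            rw [inv_mul_eq_div]; exact (one_le_div hr).2 h3
      _ = r⁻¹ * ∫ z in faceLayer d T i δ, |(ρ z • u z) i| := integral_const_mul _ _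
      _ ≤ r⁻¹ * ∫ z in sideLayer T i 1 δ ∪ sideLayer T i (-1) δ, |(ρ z • u z) i| := by
          refine mul_le_mul_of_nonneg_left (setIntegral_mono_set (hint _ (union_subset
            inter_subset_left inter_subset_left)) (.of_forall fun z => abs_nonneg _)
            hsub.eventuallyLE) (inv_pos.2 hr).le
      _ ≤ _ := by
          refine mul_le_mul_of_nonneg_left ?_ (inv_pos.2 hr).le
          have hdisj : Disjoint (sideLayer T i 1 δ) (sideLayer T i (-1) δ) := by
            refine disjoint_left.2 fun z h3 h4 => ?_
            have h5 : 1 - 1 * z.2 i < δ := h3.2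
            have h6 : 1 - -1 * z.2 i < δ := h4.2
            linarith
          rw [setIntegral_union hdisj (measurableSet_sideLayer T i _ _) (hint _ inter_subset_left)
            (hint _ inter_subset_left)]
  calc δ⁻¹ * ∫ z in faceLayer d T i δ, |u z i| ≤ δ⁻¹ * _ :=
        mul_le_mul_of_nonneg_left hle (inv_pos.2 hδ).le
    _ = _ := by ring

end Euler

namespace Euler

variable {d : ℕ} {T α ℓ M : ℝ} {C : ℝ≥0}

/-! ### The initial state -/

theorem tendsto_geometric (ℓ : ℝ) : Tendsto (fun n : ℕ => ℓ * (1 / 2) ^ n) atTop (𝓝 0) := by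
  have := (tendsto_pow_atTop_nhds_zero_of_lt_one (r := (1 / 2 : ℝ)) (by norm_num)
    (by norm_num)).const_mul ℓ
  rwa [mul_zero] at this

theorem ae_ae_of_ae_cylinder {p : ℝ → Space d → Prop}
    (h : ∀ᵐ z ∂(volume.restrict (cylinder d T)), p z.1 z.2) :
    ∀ᵐ t ∂(volume.restrict (Ioo 0 T)), ∀ᵐ x ∂(volume.restrict (cube d)), p t x := by
  rw [restrict_cylinder] at h
  exact Measure.ae_ae_of_ae_prod h

/-- Averages of a function over short intervals, at a point of continuity. -/
theorem tendsto_average {G F : ℝ → ℝ} (hG : ∀ᵐ t ∂(volume.restrict (Ioo 0 T)), G t = F t)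
    (hGi : IntegrableOn G (Ioo 0 T)) (hF : ContinuousWithinAt F (Icc 0 T) 0) (hT : 0 < T)
    {e : ℕ → ℝ} (he0 : ∀ n, 0 < e n) (he : Tendsto e atTop (𝓝 0)) :
    Tendsto (fun n => (e n)⁻¹ * ∫ s in Ioo 0 (e n), G s) atTop (𝓝 (F 0)) := by
  rw [Metric.tendsto_atTop']
  intro ε hε
  obtain ⟨η, hη, hηF⟩ := Metric.continuousWithinAt_iff.1 hF (ε / 2) (by positivity)
  have hev : ∀ᶠ n in atTop, e n < min η T := he.eventually_lt_const (lt_min hη hT)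
  obtain ⟨N, hN⟩ := eventually_atTop.1 hev
  refine ⟨N, fun n hn => ?_⟩
  have h1 := hN n hn.le
  have h2 := he0 n
  have hsub : Ioo 0 (e n) ⊆ Ioo 0 T := Ioo_subset_Ioo_right (h1.le.trans (min_le_right _ _))
  have hi : IntegrableOn G (Ioo 0 (e n)) := hGi.mono_set hsub
  have heq : (e n)⁻¹ * (∫ s in Ioo 0 (e n), G s) - F 0 =
      (e n)⁻¹ * ∫ s in Ioo 0 (e n), (G s - F 0) := by
    rw [integral_sub hi (by simp), setIntegral_const]
    simp [h2.le, mul_sub, h2.ne']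
  rw [Real.dist_eq, heq, abs_mul, abs_of_pos (inv_pos.2 h2)]
  have hb : ‖∫ s in Ioo 0 (e n), (G s - F 0)‖ ≤ ε / 2 * volume.real (Ioo 0 (e n)) := by
    refine norm_setIntegral_le_of_norm_le_const_ae' (by simp) ?_
    have hG' := (ae_restrict_iff' measurableSet_Ioo).1 hG
    filter_upwards [hG'] with s hs hs'
    rw [hs (hsub hs'), ← dist_eq_norm]
    refine (hηF ⟨hs'.1.le, (hsub hs').2.le⟩ ?_).le
    rw [Real.dist_eq, sub_zero, abs_of_pos hs'.1]
    exact (hs'.2.trans h1).trans_le (min_le_left _ _)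
  rw [Real.norm_eq_abs, Real.volume_real_Ioo_of_le h2.le, sub_zero] at hb
  calc (e n)⁻¹ * |∫ s in Ioo 0 (e n), (G s - F 0)| ≤ (e n)⁻¹ * (ε / 2 * e n) := by gcongr
    _ = ε / 2 := by field_simp
    _ < ε := by linarith

/-- Besov functions which are weakly continuous in time attain their initial values strongly in the
mean. -/
theorem tendsto_initial {f : ℝ → Space d → ℝ} {v : ℝ × Space d → ℝ}
    (hfv : ∀ᵐ z ∂(volume.restrict (cylinder d T)), f z.1 z.2 = v z) (hvm : Measurable v)
    (hvM : ∀ z, |v z| ≤ M) (hα : 1 / 3 < α) (hv : HasCubeIncr T α C v) (hT : 0 < T)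
    (hf0 : IntegrableOn (f 0) (cube d))
    (hcont : ∀ ψ : Space d → ℝ, Continuous ψ → HasCompactSupport ψ →
      ContinuousOn (fun t => ∫ x in cube d, f t x * ψ x) (Icc 0 T))
    (hℓ : 0 < ℓ) (hℓT : ℓ ≤ T) :
    Tendsto (fun n : ℕ => (ℓ * (1 / 2) ^ n)⁻¹ *
      ∫ s in Ioo 0 (ℓ * (1 / 2) ^ n), ∫ x in cube d, |v (s, x) - f 0 x|) atTop (𝓝 0) := by
  let e : ℕ → ℝ := fun n => ℓ * (1 / 2) ^ n
  have he : ∀ n, 0 < e n := fun n => by positivity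
  have helim : Tendsto e atTop (𝓝 0) := tendsto_geometric ℓ
  obtain ⟨g, hgm, hgi, hlim⟩ := (hasTraceBound_init hv hvm hα hℓ hℓT).exists_trace hvM
  have hg0 : ∀ᵐ x ∂(volume.restrict (cube d)), g x - f 0 x = 0 := by
    rw [ae_restrict_iff' (measurableSet_cube d)]
    refine (isOpen_cube d).ae_eq_zero_of_integral_contDiff_smul_eq_zero
      (IntegrableOn.locallyIntegrableOn (hgi.sub hf0)) fun ψ hψ hψc hψs => ?_
    obtain ⟨B, hB⟩ := hψ.continuous.bounded_above_of_compact_support hψc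
    have hB0 : 0 ≤ B := (norm_nonneg _).trans (hB 0)
    have h1 := tendsto_weighted_layerMean (e := e) he hvm hvM hgi hlim
      hψ.continuous.measurable (B := B) hB (w := fun _ => 1) continuous_const (W := 1)
      (by simp) (by simp)
    simp only [one_mul] at h1
    have hprod : Measurable fun z : ℝ × Space d => v z * ψ z.2 :=
      hvm.mul (hψ.continuous.measurable.comp measurable_snd)
    have h2 := tendsto_average (G := fun s => ∫ x in cube d, v (s, x) * ψ x)
      (F := fun t => ∫ x in cube d, f t x * ψ x) (T := T) ?_ ?_
      (hcont ψ hψ.continuous hψc 0 (by simp [hT.le])) hT he helim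
    · have h3 := tendsto_nhds_unique h1 h2
      have h5 : ∫ x, ψ x • (g x - f 0 x) = ∫ x in cube d, (g x * ψ x - f 0 x * ψ x) := by
        rw [← setIntegral_eq_integral_of_forall_compl_eq_zero (s := cube d)]
        · refine integral_congr_ae (.of_forall fun x => ?_)
          simp only [smul_eq_mul]; ring
        · intro x hx
          rw [image_eq_zero_of_notMem_tsupport fun h => hx (hψs h), zero_smul]
      change ∫ x, ψ x • (g x - f 0 x) = 0
      rw [h5, integral_sub, h3, sub_self]
      · exact hgi.mul_bdd (c := B) hψ.continuous.aestronglyMeasurable (.of_forall hB)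
      · exact hf0.mul_bdd (c := B) hψ.continuous.aestronglyMeasurable (.of_forall hB)
    · filter_upwards [ae_ae_of_ae_cylinder (p := fun t x => f t x = v (t, x)) hfv] with t ht
      refine integral_congr_ae ?_
      filter_upwards [ht] with x hx
      rw [hx]
    · have h3 : Integrable (fun z : ℝ × Space d => v z * ψ z.2)
          ((volume.restrict (Ioo 0 T)).prod (volume.restrict (cube d))) :=
        integrable_of_abs_le hprod (K := M * B) fun z => by
          rw [abs_mul]
          exact mul_le_mul (hvM z) (hB _) (abs_nonneg _) ((abs_nonneg _).trans (hvM z))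
      exact h3.integral_prod_left
  have hlim2 := (ENNReal.tendsto_toReal ENNReal.zero_ne_top).comp hlim
  rw [ENNReal.toReal_zero] at hlim2
  refine hlim2.congr fun n => ?_
  have hen := he n
  have hi : Integrable (fun z : ℝ × Space d => v z - g z.2)
      ((volume.restrict (Ioo 0 (e n))).prod (volume.restrict (cube d))) :=
    (integrable_of_abs_le hvm hvM).sub (hgi.comp_snd _)
  have e1 : ∫ s in Ioo 0 (e n), ∫ x in cube d, |v (s, x) - f 0 x| =
      ∫ s in Ioo 0 (e n), ∫ x in cube d, |v (s, x) - g x| := by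
    congr 1
    funext s
    refine integral_congr_ae ?_
    filter_upwards [hg0] with x hx
    rw [sub_eq_zero.1 hx]
  have e2 : ∫ s in Ioo 0 (e n), ∫ x in cube d, |v (s, x) - g x| =
      ∫ z, |v z - g z.2| ∂((volume.restrict (Ioo 0 (e n))).prod (volume.restrict (cube d))) :=
    (integral_prod _ hi.abs).symm
  simp only [Function.comp_apply]
  change _ = (e n)⁻¹ * _
  rw [e1, e2, integral_eq_lintegral_of_nonneg_ae (.of_forall fun z => abs_nonneg _)
    hi.abs.aestronglyMeasurable, ENNReal.toReal_mul, ENNReal.toReal_ofReal (inv_pos.2 hen).le,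
    lintegral_prod _ hi.abs.aestronglyMeasurable.aemeasurable.ennreal_ofReal]
  simp only [Real.enorm_eq_ofReal_abs]
  rfl

/-- Bounds pass to strong limits of averages. -/
theorem ae_mem_Icc_of_tendsto {v : ℝ × Space d → ℝ} {g : Space d → ℝ} {a b : ℝ} (hvm : Measurable v)
    (hv : ∀ z, v z ∈ Icc a b) (hg : IntegrableOn g (cube d)) {e : ℕ → ℝ} (he : ∀ n, 0 < e n)
    (hlim : Tendsto (fun n => (e n)⁻¹ * ∫ s in Ioo 0 (e n), ∫ x in cube d, |v (s, x) - g x|) atTop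
      (𝓝 0)) :
    ∀ᵐ x ∂(volume.restrict (cube d)), g x ∈ Icc a b := by
  let k : Space d → ℝ := fun x => max (a - g x) 0 + max (g x - b) 0
  have hvi : ∀ μ : Measure (ℝ × Space d), [IsFiniteMeasure μ] → Integrable v μ := fun μ _ =>
    integrable_of_abs_le hvm fun z => abs_le_max_abs_abs (hv z).1 (hv z).2
  have hvi' : ∀ s, IntegrableOn (fun x => v (s, x)) (cube d) := fun s =>
    integrable_of_abs_le (hvm.comp (by fun_prop : Measurable fun x : Space d => (s, x)))
      fun z => abs_le_max_abs_abs (hv _).1 (hv _).2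
  have hki : IntegrableOn k (cube d) := by
    have c1 : IntegrableOn (fun _ : Space d => a) (cube d) := integrable_const a
    have c2 : IntegrableOn (fun _ : Space d => b) (cube d) := integrable_const b
    exact (c1.sub hg).pos_part.add (hg.sub c2).pos_part
  have hk0 : ∀ x, 0 ≤ k x := fun x => add_nonneg (le_max_right _ _) (le_max_right _ _)
  have hle : ∀ s x, k x ≤ |v (s, x) - g x| := fun s x => by
    have h1 := (hv (s, x)).1
    have h2 := (hv (s, x)).2
    simp only [k]
    rcases le_total (a - g x) 0 with h3 | h3 <;> rcases le_total (g x - b) 0 with h4 | h4 <;>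
      simp only [max_eq_left, max_eq_right, h3, h4] <;>
      rcases abs_cases (v (s, x) - g x) with ⟨h5, h6⟩ | ⟨h5, h6⟩ <;> linarith
  have hint : ∫ x in cube d, k x ≤ 0 := by
    refine ge_of_tendsto' hlim fun n => ?_
    have hen := he n
    have h1 : ∫ _ in Ioo 0 (e n), ∫ x in cube d, k x = e n * ∫ x in cube d, k x := by
      simp [hen.le]
    calc ∫ x in cube d, k x = (e n)⁻¹ * ∫ _ in Ioo 0 (e n), ∫ x in cube d, k x := by
          rw [h1, inv_mul_cancel_left₀ hen.ne']
      _ ≤ _ := by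
          refine mul_le_mul_of_nonneg_left ?_ (inv_pos.2 hen).le
          refine integral_mono (by simp) ?_ fun s =>
            integral_mono hki ((hvi' s).sub hg).abs (hle s)
          have h3 : Integrable (fun z : ℝ × Space d => |v z - g z.2|)
              ((volume.restrict (Ioo 0 (e n))).prod (volume.restrict (cube d))) :=
            ((hvi _).sub (hg.comp_snd _)).abs
          exact h3.integral_prod_left
  have hzero := (integral_eq_zero_iff_of_nonneg hk0 hki).1
    (le_antisymm hint (integral_nonneg hk0))
  filter_upwards [hzero] with x hx
  have h1 : max (a - g x) 0 + max (g x - b) 0 = 0 := hx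
  have h2 := le_max_left (a - g x) 0
  have h3 := le_max_left (g x - b) 0
  have h4 := le_max_right (a - g x) 0
  have h5 := le_max_right (g x - b) 0
  constructor <;> linarith

end Euler

namespace Euler

variable {d : ℕ} {T δ ε η M : ℝ} {χ D : ℝ → ℝ} {u : ℝ × Space d → Space d}

/-! ### Cutoff next to the faces of the cube -/

theorem deriv_smoothTransition_of_one_le {x : ℝ} (hx : 1 ≤ x) :
    deriv Real.smoothTransition x = 0 :=
  IsLocalMax.deriv_eq_zero (.of_forall fun y => by
    rw [Real.smoothTransition.one_of_one_le hx]; exact Real.smoothTransition.le_one y)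

theorem exists_abs_deriv_smoothTransition_le :
    ∃ W, 0 ≤ W ∧ ∀ s, |deriv Real.smoothTransition s| ≤ W := by
  obtain ⟨W, hW⟩ := isCompact_Icc.exists_bound_of_continuousOn (s := Icc (0 : ℝ) 1)
    continuous_deriv_smoothTransition.continuousOn
  have hW0 : 0 ≤ W := (norm_nonneg _).trans (hW 0 (by simp))
  refine ⟨W, hW0, fun s => ?_⟩
  rcases le_total s 0 with h | h
  · rwa [deriv_smoothTransition_of_nonpos h, abs_zero]
  · rcases le_total s 1 with h1 | h1
    · exact hW s ⟨h, h1⟩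
    · rwa [deriv_smoothTransition_of_one_le h1, abs_zero]

/-- A cutoff of the interval `(-1,1)`: it vanishes for `1 - s² ≤ η` and is `1` for `2 η ≤ 1 - s²`. -/
noncomputable def edgeCut (η s : ℝ) : ℝ := Real.smoothTransition ((1 - s ^ 2) / η - 1)

/-- The derivative of `edgeCut`. -/
noncomputable def edgeCut' (η s : ℝ) : ℝ :=
  deriv Real.smoothTransition ((1 - s ^ 2) / η - 1) * (-(2 * s) / η)

theorem hasDerivAt_edgeCut (η s : ℝ) : HasDerivAt (edgeCut η) (edgeCut' η s) s := by
  have h1 : HasDerivAt (fun s : ℝ => (1 - s ^ 2) / η - 1) (-(2 * s) / η) s := by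
    have := (((hasDerivAt_pow 2 s).const_sub 1).div_const η).sub_const 1
    simpa using this
  exact (hasDerivAt_smoothTransition _).comp s h1

theorem contDiff_edgeCut (η : ℝ) : ContDiff ℝ 1 (edgeCut η) :=
  (Real.smoothTransition.contDiff (n := 1)).comp
    (((contDiff_const.sub (contDiff_id.pow 2)).div_const η).sub contDiff_const)

theorem edgeCut_mem (η s : ℝ) : edgeCut η s ∈ Icc (0 : ℝ) 1 :=
  ⟨Real.smoothTransition.nonneg _, Real.smoothTransition.le_one _⟩

theorem edgeCut_eq_zero (hη : 0 < η) {s : ℝ} (hs : 1 - s ^ 2 ≤ η) : edgeCut η s = 0 :=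
  Real.smoothTransition.zero_of_nonpos (by have := (div_le_one hη).2 hs; linarith)

theorem edgeCut_eq_one (hη : 0 < η) {s : ℝ} (hs : 2 * η ≤ 1 - s ^ 2) : edgeCut η s = 1 :=
  Real.smoothTransition.one_of_one_le (by have := (le_div_iff₀ hη).2 hs; linarith)

theorem edgeCut'_eq_zero (hη : 0 < η) {s : ℝ} (hs : 2 * η ≤ 1 - s ^ 2) : edgeCut' η s = 0 := by
  rw [edgeCut', deriv_smoothTransition_of_one_le, zero_mul]
  have := (le_div_iff₀ hη).2 hs; linarith

/-- The product cutoff of the cube. -/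
noncomputable def cubeCut (η : ℝ) (y : Space d) : ℝ := ∏ i, edgeCut η (y i)

/-- The `j`-th partial derivative of `cubeCut`. -/
noncomputable def cubeCut' (η : ℝ) (j : Fin d) (y : Space d) : ℝ :=
  edgeCut' η (y j) * ∏ i ∈ Finset.univ.erase j, edgeCut η (y i)

theorem hasFDerivAt_cubeCut (η : ℝ) (y : Space d) :
    HasFDerivAt (cubeCut η)
      (∑ j, cubeCut' η j y • (EuclideanSpace.proj j : Space d →L[ℝ] ℝ)) y := by
  have h : ∀ i ∈ (Finset.univ : Finset (Fin d)),
      HasFDerivAt (fun x : Space d => edgeCut η (x i))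
        (edgeCut' η (y i) • (EuclideanSpace.proj i : Space d →L[ℝ] ℝ)) y := fun i _ =>
    (hasDerivAt_edgeCut η _).comp_hasFDerivAt y
      (EuclideanSpace.proj i : Space d →L[ℝ] ℝ).hasFDerivAt
  refine (HasFDerivAt.finsetProd h).congr_fderiv ?_
  refine Finset.sum_congr rfl fun j _ => ?_
  rw [cubeCut', smul_smul, mul_comm]

theorem contDiff_cubeCut (η : ℝ) : ContDiff ℝ 1 (cubeCut η : Space d → ℝ) := by
  unfold cubeCut
  exact contDiff_prod fun i _ => (contDiff_edgeCut η).comp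
    (EuclideanSpace.proj i : Space d →L[ℝ] ℝ).contDiff

theorem cubeCut_mem (η : ℝ) (y : Space d) : cubeCut η y ∈ Icc (0 : ℝ) 1 :=
  ⟨Finset.prod_nonneg fun _ _ => (edgeCut_mem η _).1,
    Finset.prod_le_one (fun _ _ => (edgeCut_mem η _).1) fun _ _ => (edgeCut_mem η _).2⟩

theorem continuous_cubeCut' (η : ℝ) (j : Fin d) : Continuous (cubeCut' η j) := by
  have h1 := continuous_deriv_smoothTransition
  have h2 := (contDiff_edgeCut η).continuous
  unfold cubeCut' edgeCut'
  fun_prop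

theorem abs_cubeCut'_le {W : ℝ} (hW : ∀ s, |deriv Real.smoothTransition s| ≤ W) (hη : 0 < η)
    (j : Fin d) {y : Space d} (hy : |y j| ≤ 1) : |cubeCut' η j y| ≤ W * (2 * η⁻¹) := by
  have hW0 : 0 ≤ W := (abs_nonneg _).trans (hW 0)
  have h1 : |∏ i ∈ Finset.univ.erase j, edgeCut η (y i)| ≤ 1 := by
    rw [Finset.abs_prod]
    exact Finset.prod_le_one (fun i _ => abs_nonneg _) fun i _ => by
      rw [abs_of_nonneg (edgeCut_mem η _).1]; exact (edgeCut_mem η _).2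
  have h2 : |edgeCut' η (y j)| ≤ W * (2 * η⁻¹) := by
    rw [edgeCut', abs_mul]
    refine mul_le_mul (hW _) ?_ (abs_nonneg _) hW0
    rw [abs_div, abs_neg, abs_mul, abs_two, abs_of_pos hη, div_eq_mul_inv]
    gcongr
    linarith
  calc |cubeCut' η j y| ≤ W * (2 * η⁻¹) * 1 := by
        rw [cubeCut', abs_mul]
        exact mul_le_mul h2 h1 (abs_nonneg _) (by positivity)
    _ = _ := mul_one _

/-! ### The one-sided Lipschitz condition for the mollified velocity -/

/-- The one-sided Lipschitz condition in the form of an integral over the cylinder. -/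
def HasWeakOSL (T : ℝ) (u : ℝ × Space d → Space d) (D : ℝ → ℝ) : Prop :=
  ∀ ξ : Space d, ∀ φ : ℝ → Space d → ℝ, IsInteriorTest T φ → (∀ t x, 0 ≤ φ t x) →
    0 ≤ ∫ z in cylinder d T,
      (-(inner ℝ ξ (u z) * dx φ z.1 z.2 ξ) + D z.1 * ‖ξ‖ ^ 2 * φ z.1 z.2)

/-- The test function for the one-sided Lipschitz condition: the kernel of the mollification, as a
function of the second point, cut off next to the faces. -/
noncomputable def kernelTest (χ : ℝ → ℝ) (ε η t : ℝ) (x : Space d) (c : Fin d → Fin 3) (t' : ℝ)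
    (y : Space d) : ℝ := timeKer χ ε t t' * (spaceKer ε c x y * cubeCut η y)

theorem contDiff_moll (ε : ℝ) : ContDiff ℝ 1 (moll ε) := by
  rw [contDiff_one_iff_deriv]
  refine ⟨fun s => (hasDerivAt_moll ε s).differentiableAt, ?_⟩
  rw [show deriv (moll ε) = moll' ε from funext fun s => (hasDerivAt_moll ε s).deriv]
  exact continuous_moll' ε

theorem contDiff_spaceKer_right (ε : ℝ) (c : Fin d → Fin 3) (x : Space d) :
    ContDiff ℝ 1 fun y => spaceKer ε c x y := by
  simp only [fun y => (spaceKer_comm ε c x y).symm]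
  unfold spaceKer
  exact contDiff_prod fun i _ => (contDiff_moll ε).comp
    ((EuclideanSpace.proj i : Space d →L[ℝ] ℝ).contDiff.sub contDiff_const)

theorem isInteriorTest_kernelTest (hχ : IsTimeCutoff T δ χ) (hδ : 0 < δ) (hε0 : 0 < ε) (hε : ε ≤ δ)
    (hη : 0 < η) (t : ℝ) (x : Space d) (c : Fin d → Fin 3) :
    IsInteriorTest T (kernelTest χ ε η t x c) := by
  let K : Set (ℝ × Space d) := Icc δ (T - δ) ×ˢ {y | ∀ i, η ≤ 1 - y i ^ 2}
  have hyK : ∀ y : Space d, (∀ i, η ≤ 1 - y i ^ 2) → y ∈ cube d := fun y hy i => by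
    have h1 := hy i
    exact ⟨by nlinarith, by nlinarith⟩
  have hKc : IsCompact K := by
    refine isCompact_Icc.prod ((isCompact_closedCube d).of_isClosed_subset ?_
      fun y hy => cube_subset_closedCube d (hyK y hy))
    have : {y : Space d | ∀ i, η ≤ 1 - y i ^ 2} = ⋂ i, {y | η ≤ 1 - y i ^ 2} := by
      ext; simp
    rw [this]
    exact isClosed_iInter fun i => isClosed_le continuous_const (by fun_prop)
  have hzero : ∀ z, z ∉ K → Function.uncurry (kernelTest χ ε η t x c) z = 0 := fun z hz => by
    change timeKer χ ε t z.1 * (spaceKer ε c x z.2 * cubeCut η z.2) = 0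
    by_cases h1 : z.1 ∈ Ioo δ (T - δ)
    · have h2 : ∃ i, 1 - z.2 i ^ 2 < η := by
        by_contra! h3
        exact hz ⟨Ioo_subset_Icc_self h1, h3⟩
      obtain ⟨i, hi⟩ := h2
      rw [cubeCut, Finset.prod_eq_zero (Finset.mem_univ i) (edgeCut_eq_zero hη hi.le)]
      ring
    · rw [timeKer_eq_zero_right hχ hε0 hε t h1, zero_mul]
  have hsub : tsupport (Function.uncurry (kernelTest χ ε η t x c)) ⊆ K :=
    closure_minimal (fun z hz => by_contra fun h => hz (hzero z h)) hKc.isClosed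
  refine ⟨?_, hKc.of_isClosed_subset (isClosed_tsupport _) hsub, hsub.trans ?_⟩
  · have h1 : ContDiff ℝ 1 fun z : ℝ × Space d => timeKer χ ε t z.1 := by
      unfold timeKer
      refine (hχ.contDiff.comp ?_).mul ((contDiff_moll ε).comp (contDiff_const.sub contDiff_fst))
      exact (contDiff_const.add contDiff_fst).div_const 2
    exact h1.mul (((contDiff_spaceKer_right ε c x).mul (contDiff_cubeCut η)).comp contDiff_snd)
  · rintro z ⟨h1, h2⟩
    exact ⟨⟨hδ.trans_le h1.1, by linarith [h1.2]⟩, hyK _ h2⟩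

theorem dx_kernelTest (χ : ℝ → ℝ) (ε η t : ℝ) (x : Space d) (c : Fin d → Fin 3) (t' : ℝ)
    (y ξ : Space d) : dx (kernelTest χ ε η t x c) t' y (reflVec c ξ) =
      timeKer χ ε t t' * (-(cubeCut η y * ∑ j, ξ j * spaceKer' ε c j x y) +
        spaceKer ε c x y * ∑ j, flipSign (c j) * ξ j * cubeCut' η j y) := by
  have h := ((hasFDerivAt_spaceKer_right ε c x y).mul (hasFDerivAt_cubeCut η y)).const_mul
    (timeKer χ ε t t')
  have h2 : dx (kernelTest χ ε η t x c) t' y (reflVec c ξ) = _ :=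
    congrArg (fun L => L (reflVec c ξ)) h.fderiv
  rw [h2]
  have hp : ∀ j, (EuclideanSpace.proj j : Space d →L[ℝ] ℝ) (reflVec c ξ) =
      flipSign (c j) * ξ j := fun _ => rfl
  simp only [_root_.smul_apply, _root_.add_apply, _root_.sum_apply, hp, smul_eq_mul]
  have e1 : ∑ j, -flipSign (c j) * spaceKer' ε c j x y * (flipSign (c j) * ξ j) =
      -∑ j, ξ j * spaceKer' ε c j x y := by
    rw [← Finset.sum_neg_distrib]
    refine Finset.sum_congr rfl fun j _ => ?_
    linear_combination -(spaceKer' ε c j x y * ξ j) * flipSign_mul_self (c j)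
  have e2 : ∑ j, cubeCut' η j y * (flipSign (c j) * ξ j) =
      ∑ j, flipSign (c j) * ξ j * cubeCut' η j y :=
    Finset.sum_congr rfl fun j _ => by ring
  rw [e1, e2]
  ring

/-- The mollification of the velocity field, by reflections that change the sign of the normal
components at the faces. -/
noncomputable def mollVelocity (T : ℝ) (χ : ℝ → ℝ) (ε : ℝ) (u : ℝ × Space d → Space d) (i : Fin d)
    (z : ℝ × Space d) : ℝ :=
  reflMoll T χ ε (fun c => flipSign (c i)) (fun z => u z i) z

/-- The limit integrand of the one-sided Lipschitz condition, without cutoff. -/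
noncomputable def oslMain (χ : ℝ → ℝ) (ε : ℝ) (u : ℝ × Space d → Space d) (D : ℝ → ℝ) (t : ℝ)
    (x ξ : Space d) (z : ℝ × Space d) : ℝ :=
  (∑ c : Fin d → Fin 3, timeKer χ ε t z.1 * ((∑ i, flipSign (c i) * (ξ i * u z i)) *
    ∑ j, ξ j * spaceKer' ε c j x z.2)) +
    ‖ξ‖ ^ 2 * ∑ c : Fin d → Fin 3, timeKer χ ε t z.1 * D z.1 * spaceKer ε c x z.2

/-- The part of the integrand with the derivatives of the cutoff. -/
noncomputable def oslRem (χ : ℝ → ℝ) (ε η : ℝ) (u : ℝ × Space d → Space d) (t : ℝ)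
    (x ξ : Space d) (z : ℝ × Space d) : ℝ :=
  timeKer χ ε t z.1 * ∑ i, ∑ j, ξ i * ξ j * (u z i * cubeCut' η j z.2 *
    ∑ c : Fin d → Fin 3, flipSign (c i) * flipSign (c j) * spaceKer ε c x z.2)

/-- The one-sided Lipschitz condition, tested in the direction `reflVec c ξ` with the kernel of
the reflection `c` and summed over `c`, is the gradient of the mollified velocity up to the
derivatives of the cutoff. -/
theorem osl_integrand_eq (t : ℝ) (x ξ : Space d) (z : ℝ × Space d) :
    ∑ c : Fin d → Fin 3, (-(inner ℝ (reflVec c ξ) (u z) *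
      dx (kernelTest χ ε η t x c) z.1 z.2 (reflVec c ξ)) +
      D z.1 * ‖reflVec c ξ‖ ^ 2 * kernelTest χ ε η t x c z.1 z.2) =
      oslMain χ ε u D t x ξ z * cubeCut η z.2 - oslRem χ ε η u t x ξ z := by
  have e1 : oslRem χ ε η u t x ξ z = ∑ c : Fin d → Fin 3, timeKer χ ε t z.1 * (spaceKer ε c x z.2 *
      ((∑ i, flipSign (c i) * (ξ i * u z i)) *
        ∑ j, flipSign (c j) * ξ j * cubeCut' η j z.2)) := by
    simp only [oslRem, Finset.sum_mul_sum]
    simp only [Finset.mul_sum]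
    symm
    rw [Finset.sum_comm]
    refine Finset.sum_congr rfl fun i _ => ?_
    rw [Finset.sum_comm]
    refine Finset.sum_congr rfl fun j _ => Finset.sum_congr rfl fun c _ => ?_
    ring
  rw [e1, oslMain, add_mul, Finset.sum_mul, Finset.mul_sum, Finset.sum_mul, ← Finset.sum_add_distrib,
    ← Finset.sum_sub_distrib]
  refine Finset.sum_congr rfl fun c _ => ?_
  rw [dx_kernelTest, norm_reflVec, inner_eq_sum, kernelTest]
  simp only [reflVec_apply, mul_assoc]
  ring

end Euler

namespace Euler

variable {d : ℕ} {T δ ε η M : ℝ} {χ D : ℝ → ℝ} {u : ℝ × Space d → Space d}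

theorem integrableOn_mul_of_continuous {f g : ℝ × Space d → ℝ} (hf : IntegrableOn f (cylinder d T))
    (hg : Continuous g) : IntegrableOn (fun z => f z * g z) (cylinder d T) :=
  hf.mul_continuousOn_of_subset hg.continuousOn (measurableSet_cylinder d T)
    (isCompact_Icc.prod (isCompact_closedCube d))
    (prod_mono Ioo_subset_Icc_self (cube_subset_closedCube d))

theorem integrableOn_comp_fst (hD : IntegrableOn D (Ioo 0 T)) :
    IntegrableOn (fun z : ℝ × Space d => D z.1) (cylinder d T) := by
  rw [IntegrableOn, restrict_cylinder]
  exact hD.comp_fst _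

theorem integrableOn_apply (hu : Measurable u) (huM : ∀ z, ‖u z‖ ≤ M) (i : Fin d) :
    IntegrableOn (fun z => u z i) (cylinder d T) :=
  integrable_of_abs_le (measurable_apply hu i) fun z => (abs_apply_le_norm _ i).trans (huM z)

theorem continuous_timeKer_fst (hχ : ContDiff ℝ 1 χ) (ε t : ℝ) :
    Continuous fun z : ℝ × Space d => timeKer χ ε t z.1 := by
  have h : Continuous fun z : ℝ × Space d => (t, z.1) := by fun_prop
  exact (continuous_timeKer hχ ε).comp h

theorem continuous_spaceKer_snd (ε : ℝ) (x : Space d) (c : Fin d → Fin 3) :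
    Continuous fun z : ℝ × Space d => spaceKer ε c x z.2 := by
  have h : Continuous fun z : ℝ × Space d => (x, z.2) := by fun_prop
  have h' := (continuous_spaceKer ε c).comp h
  exact h'

theorem continuous_spaceKer'_snd (ε : ℝ) (x : Space d) (c : Fin d → Fin 3) (j : Fin d) :
    Continuous fun z : ℝ × Space d => spaceKer' ε c j x z.2 := by
  have h : Continuous fun z : ℝ × Space d => (x, z.2) := by fun_prop
  have h' := (continuous_spaceKer' ε c j).comp h
  exact h'

theorem integrableOn_oslMain (hχ : ContDiff ℝ 1 χ) (hD : IntegrableOn D (Ioo 0 T))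
    (hu : Measurable u) (huM : ∀ z, ‖u z‖ ≤ M) (t : ℝ) (x ξ : Space d) :
    IntegrableOn (oslMain χ ε u D t x ξ) (cylinder d T) := by
  have c1 := continuous_timeKer_fst (d := d) hχ ε t
  have c2 := continuous_spaceKer_snd ε x
  have c3 := continuous_spaceKer'_snd ε x
  refine (integrable_finsetSum _ fun c _ => ?_).add
    ((integrable_finsetSum _ fun c _ => ?_).const_mul _)
  · have h1 : IntegrableOn (fun z => ∑ i, flipSign (c i) * (ξ i * u z i)) (cylinder d T) :=
      integrable_finsetSum _ fun i _ => ((integrableOn_apply hu huM i).const_mul _).const_mul _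
    have h2 := integrableOn_mul_of_continuous h1 (g := fun z => timeKer χ ε t z.1 *
      ∑ j, ξ j * spaceKer' ε c j x z.2)
      (c1.mul (continuous_finsetSum _ fun j _ => continuous_const.mul (c3 c j)))
    refine h2.congr_fun (fun z _ => ?_) (measurableSet_cylinder d T)
    ring
  · have h2 := integrableOn_mul_of_continuous (integrableOn_comp_fst (d := d) hD)
      (g := fun z => timeKer χ ε t z.1 * spaceKer ε c x z.2) (c1.mul (c2 c))
    refine h2.congr_fun (fun z _ => ?_) (measurableSet_cylinder d T)
    ring

theorem integrableOn_oslRem (hχ : ContDiff ℝ 1 χ) (hu : Measurable u) (huM : ∀ z, ‖u z‖ ≤ M)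
    (η t : ℝ) (x ξ : Space d) : IntegrableOn (oslRem χ ε η u t x ξ) (cylinder d T) := by
  have c1 := continuous_timeKer_fst (d := d) hχ ε t
  have c2 := continuous_spaceKer_snd ε x
  have h : oslRem χ ε η u t x ξ = fun z => ∑ i, ∑ j, u z i * (timeKer χ ε t z.1 * (ξ i * ξ j *
      (cubeCut' η j z.2 *
        ∑ c : Fin d → Fin 3, flipSign (c i) * flipSign (c j) * spaceKer ε c x z.2))) := by
    funext z
    simp only [oslRem]
    rw [Finset.mul_sum]
    refine Finset.sum_congr rfl fun i _ => ?_
    rw [Finset.mul_sum]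
    refine Finset.sum_congr rfl fun j _ => ?_
    ring
  rw [h]
  refine integrable_finsetSum _ fun i _ => integrable_finsetSum _ fun j _ => ?_
  refine integrableOn_mul_of_continuous (integrableOn_apply hu huM i) (c1.mul
    (continuous_const.mul (((continuous_cubeCut' η j).comp continuous_snd).mul
      (continuous_finsetSum _ fun c _ => continuous_const.mul (c2 c)))))

theorem integrableOn_osl_integrand (hχ : ContDiff ℝ 1 χ) (hD : IntegrableOn D (Ioo 0 T))
    (hu : Measurable u) (huM : ∀ z, ‖u z‖ ≤ M) (η t : ℝ) (x ξ : Space d) (c : Fin d → Fin 3) :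
    IntegrableOn (fun z => -(inner ℝ (reflVec c ξ) (u z) *
      dx (kernelTest χ ε η t x c) z.1 z.2 (reflVec c ξ)) +
      D z.1 * ‖reflVec c ξ‖ ^ 2 * kernelTest χ ε η t x c z.1 z.2) (cylinder d T) := by
  have c1 := continuous_timeKer_fst (d := d) hχ ε t
  have c2 := continuous_spaceKer_snd ε x c
  have c3 := continuous_spaceKer'_snd ε x c
  have c4 : Continuous fun z : ℝ × Space d => cubeCut η z.2 :=
    (contDiff_cubeCut η).continuous.comp continuous_snd
  have c5 : ∀ j, Continuous fun z : ℝ × Space d => cubeCut' η j z.2 := fun j =>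
    (continuous_cubeCut' η j).comp continuous_snd
  have h1 : IntegrableOn (fun z => inner ℝ (reflVec c ξ) (u z)) (cylinder d T) := by
    simp only [inner_eq_sum]
    exact integrable_finsetSum _ fun i _ => (integrableOn_apply hu huM i).const_mul _
  refine Integrable.add (Integrable.neg ?_) ?_
  · simp only [dx_kernelTest]
    exact integrableOn_mul_of_continuous h1 (c1.mul ((c4.mul (continuous_finsetSum _ fun j _ =>
      continuous_const.mul (c3 j))).neg.add (c2.mul (continuous_finsetSum _ fun j _ =>
        continuous_const.mul (c5 j)))))
  · exact integrableOn_mul_of_continuous ((integrableOn_comp_fst (d := d) hD).mul_const _)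
      (c1.mul (c2.mul c4))

theorem volume_faceLayer_le (i : Fin d) (hη : η ≤ 2) :
    volume (faceLayer d T i η) ≤ 2 * (ENNReal.ofReal η * volume (faceSet T i)) := by
  have hsub : faceLayer d T i η ⊆ sideLayer T i 1 η ∪ sideLayer T i (-1) η := fun z hz => by
    rcases lt_abs.1 (show 1 - η < |z.2 i| from hz.2) with h3 | h3
    · exact Or.inl ⟨hz.1, by change 1 - 1 * z.2 i < η; linarith⟩
    · exact Or.inr ⟨hz.1, by change 1 - -1 * z.2 i < η; linarith⟩
  refine (measure_mono hsub).trans ((measure_union_le _ _).trans ?_)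
  rw [volume_sideLayer i (Or.inl rfl) hη, volume_sideLayer i (Or.inr rfl) hη, two_mul]

/-- The derivatives of the cutoff are of order `η⁻¹` next to the face `|z j| = 1`. They are
multiplied by the normal velocity `u z j`, or by a kernel which vanishes on that face. -/
theorem exists_abs_oslRem_le (hχ : IsTimeCutoff T δ χ) (hε0 : 0 < ε) (hε1 : ε ≤ 1)
    (huM : ∀ z, ‖u z‖ ≤ M) (t : ℝ) {x : Space d} (hx : x ∈ closedCube d) (ξ : Space d) :
    ∃ L, 0 ≤ L ∧ ∀ η, 0 < η → ∀ z ∈ cylinder d T, |oslRem χ ε η u t x ξ z| ≤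
      L * ∑ j, (faceLayer d T j (2 * η)).indicator (fun z => η⁻¹ * |u z j| + 1) z := by
  obtain ⟨W, hW0, hW⟩ := exists_abs_deriv_smoothTransition_le
  obtain ⟨Cχ, hC0, hC1, -⟩ := hχ.exists_bound
  have hB := bumpBound_nonneg
  have hM0 : 0 ≤ M := (norm_nonneg _).trans (huM 0)
  set K₁ : ℝ := 3 ^ d * (bumpBound * ε⁻¹) ^ d with hK₁
  set K₂ : ℝ := (3 * bumpBound * ε⁻¹) ^ d * ε⁻¹ with hK₂
  set K : ℝ := 2 * W * K₁ + 4 * M * W * K₂ with hK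
  have hK₁0 : 0 ≤ K₁ := by positivity
  have hK₂0 : 0 ≤ K₂ := by positivity
  set N : ℝ := Cχ * (bumpBound * ε⁻¹) with hN
  have hN0 : 0 ≤ N := by positivity
  refine ⟨N * (∑ i, |ξ i|) * ((∑ i, |ξ i|) * K), by positivity, fun η hη z hz => ?_⟩
  have hzc := cube_subset_closedCube d hz.2
  let b : Fin d → ℝ := fun j =>
    (faceLayer d T j (2 * η)).indicator (fun z => η⁻¹ * |u z j| + 1) z
  have hb0 : ∀ j, 0 ≤ b j := fun j => indicator_nonneg (fun _ _ => by positivity) _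
  have hterm : ∀ i j, |u z i * cubeCut' η j z.2 *
      ∑ c : Fin d → Fin 3, flipSign (c i) * flipSign (c j) * spaceKer ε c x z.2| ≤ K * b j := by
    intro i j
    by_cases hl : z ∈ faceLayer d T j (2 * η)
    · have hbj : b j = η⁻¹ * |u z j| + 1 := indicator_of_mem hl _
      have hcut := abs_cubeCut'_le hW hη j (abs_le.2 (hzc j))
      have hu0 : 0 ≤ η⁻¹ * |u z j| := by positivity
      rw [abs_mul, abs_mul, hbj]
      by_cases hij : i = j
      · subst hij
        have hsum : |∑ c : Fin d → Fin 3, flipSign (c i) * flipSign (c i) * spaceKer ε c x z.2| ≤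
            K₁ := by
          refine (Finset.abs_sum_le_sum_abs _ _).trans ?_
          calc _ ≤ ∑ c : Fin d → Fin 3, (bumpBound * ε⁻¹) ^ d := by
                refine Finset.sum_le_sum fun c _ => ?_
                rw [flipSign_mul_self, one_mul]
                exact abs_spaceKer_le hε0 c x z.2
            _ = K₁ := by simp [hK₁]
        calc _ ≤ |u z i| * (W * (2 * η⁻¹)) * K₁ := by gcongr
          _ = 2 * W * K₁ * (η⁻¹ * |u z i|) := by ring
          _ ≤ K * (η⁻¹ * |u z i| + 1) := by
            refine mul_le_mul ?_ (by linarith) hu0 (by positivity)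
            rw [hK]; linarith [show 0 ≤ 4 * M * W * K₂ by positivity]
      · have hdist : |(1 - |z.2 j|)| ≤ 2 * η := by
          have h1 : 1 - 2 * η < |z.2 j| := hl.2
          have h2 : |z.2 j| ≤ 1 := abs_le.2 (hzc j)
          rw [abs_of_nonneg (by linarith)]; linarith
        have hsum : |∑ c : Fin d → Fin 3, flipSign (c i) * flipSign (c j) * spaceKer ε c x z.2| ≤
            K₂ * (2 * η) := by
          have h1 := abs_sum_flipSign_flipSign_spaceKer_le hε0 hε1 z.2 (Ne.symm hij) hx
          have h2 : ∑ c : Fin d → Fin 3, flipSign (c i) * flipSign (c j) * spaceKer ε c x z.2 =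
              ∑ c : Fin d → Fin 3, flipSign (c j) * flipSign (c i) * spaceKer ε c x z.2 :=
            Finset.sum_congr rfl fun c _ => by ring
          rw [h2]
          exact h1.trans (by gcongr)
        calc _ ≤ M * (W * (2 * η⁻¹)) * (K₂ * (2 * η)) := by
              gcongr
              exact (abs_apply_le_norm _ i).trans (huM z)
          _ = 4 * M * W * K₂ * 1 := by field_simp; norm_num; ring
          _ ≤ K * (η⁻¹ * |u z j| + 1) := by
            refine mul_le_mul ?_ (by linarith) zero_le_one (by positivity)
            rw [hK]; linarith [show 0 ≤ 2 * W * K₁ by positivity]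
    · have hcut : cubeCut' η j z.2 = 0 := by
        rw [cubeCut', edgeCut'_eq_zero hη, zero_mul]
        have h1 : |z.2 j| ≤ 1 - 2 * η := not_lt.1 fun h => hl ⟨hz, h⟩
        have h2 := abs_nonneg (z.2 j)
        rw [← sq_abs]
        nlinarith
      rw [hcut]
      simpa using mul_nonneg (show 0 ≤ K by positivity) (hb0 j)
  have htime : |timeKer χ ε t z.1| ≤ N := abs_timeKer_le hC1 hε0 t z.1
  rw [oslRem, abs_mul]
  calc _ ≤ N * ∑ i, ∑ j, |ξ i| * (|ξ j| * (K * b j)) := by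
        refine mul_le_mul htime ?_ (abs_nonneg _) hN0
        refine (Finset.abs_sum_le_sum_abs _ _).trans (Finset.sum_le_sum fun i _ => ?_)
        refine (Finset.abs_sum_le_sum_abs _ _).trans (Finset.sum_le_sum fun j _ => ?_)
        rw [abs_mul, abs_mul, mul_assoc]
        exact mul_le_mul_of_nonneg_left (mul_le_mul_of_nonneg_left (hterm i j) (abs_nonneg _))
          (abs_nonneg _)
    _ ≤ N * ∑ i, ∑ j, |ξ i| * ((∑ k, |ξ k|) * (K * b j)) := by
        gcongr with i _ j _
        · exact mul_nonneg (show 0 ≤ K by positivity) (hb0 j)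
        · exact Finset.single_le_sum (f := fun k => |ξ k|) (fun _ _ => abs_nonneg _)
            (Finset.mem_univ j)
    _ = _ := by
        simp only [← Finset.mul_sum, ← Finset.sum_mul]
        ring

/-- The mollified velocity satisfies the one-sided Lipschitz condition up to the boundary. -/
theorem gradient_mollVelocity_ge (hosl : HasWeakOSL T u D) (hD : IntegrableOn D (Ioo 0 T))
    (hu : Measurable u) (huM : ∀ z, ‖u z‖ ≤ M) (hχ : IsTimeCutoff T δ χ) (hδ : 0 < δ)
    (hε0 : 0 < ε) (hε : ε ≤ δ) (hε1 : ε ≤ 1) {e : ℕ → ℝ} (he0 : ∀ n, 0 < e n)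
    (he : Tendsto e atTop (𝓝 0))
    (hface : ∀ i, Tendsto (fun n => (e n)⁻¹ * ∫ z in faceLayer d T i (e n), |u z i|) atTop (𝓝 0))
    (t : ℝ) {x : Space d} (hx : x ∈ closedCube d) (ξ : Space d) :
    0 ≤ (∑ i, ξ i * fderiv ℝ (fun x => mollVelocity T χ ε u i (t, x)) x ξ) +
      ‖ξ‖ ^ 2 * ∫ t' in Ioo 0 T, timeKer χ ε t t' * D t' := by
  have hχ1 := hχ.contDiff
  have hmain := integrableOn_oslMain (ε := ε) hχ1 hD hu huM t x ξ
  have hmainint : ∫ z in cylinder d T, oslMain χ ε u D t x ξ z =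
      (∑ i, ξ i * fderiv ℝ (fun x => mollVelocity T χ ε u i (t, x)) x ξ) +
      ‖ξ‖ ^ 2 * ∫ t' in Ioo 0 T, timeKer χ ε t t' * D t' := by
    have c1 := continuous_timeKer_fst (d := d) hχ1 ε t
    have c2 := continuous_spaceKer_snd ε x
    have c3 := continuous_spaceKer'_snd ε x
    have i1 : ∀ (c : Fin d → Fin 3) i, IntegrableOn (fun z => timeKer χ ε t z.1 *
        (∑ j, ξ j * spaceKer' ε c j x z.2) * u z i) (cylinder d T) := fun c i => by
      have h2 := integrableOn_mul_of_continuous (integrableOn_apply (T := T) hu huM i)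
        (g := fun z => timeKer χ ε t z.1 * ∑ j, ξ j * spaceKer' ε c j x z.2)
        (c1.mul (continuous_finsetSum _ fun j _ => continuous_const.mul (c3 c j)))
      refine h2.congr_fun (fun z _ => ?_) (measurableSet_cylinder d T)
      ring
    have i2 : ∀ c : Fin d → Fin 3, IntegrableOn (fun z => timeKer χ ε t z.1 * D z.1 *
        spaceKer ε c x z.2) (cylinder d T) := fun c => by
      have h2 := integrableOn_mul_of_continuous (integrableOn_comp_fst (d := d) hD)
        (g := fun z => timeKer χ ε t z.1 * spaceKer ε c x z.2) (c1.mul (c2 c))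
      refine h2.congr_fun (fun z _ => ?_) (measurableSet_cylinder d T)
      ring
    have e1 : oslMain χ ε u D t x ξ = fun z => (∑ i, ξ i * ∑ c : Fin d → Fin 3, flipSign (c i) *
        (timeKer χ ε t z.1 * (∑ j, ξ j * spaceKer' ε c j x z.2) * u z i)) +
        ‖ξ‖ ^ 2 * ∑ c : Fin d → Fin 3, timeKer χ ε t z.1 * D z.1 * spaceKer ε c x z.2 := by
      funext z
      simp only [oslMain]
      congr 1
      symm
      refine (Finset.sum_congr rfl fun i _ => Finset.mul_sum _ _ _).trans ?_
      rw [Finset.sum_comm]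
      refine Finset.sum_congr rfl fun c _ => ?_
      generalize ∑ j, ξ j * spaceKer' ε c j x z.2 = S
      rw [Finset.sum_mul, Finset.mul_sum]
      exact Finset.sum_congr rfl fun i _ => by ring
    rw [e1, integral_add, integral_const_mul, integral_finsetSum _ fun c _ => i2 c,
      integral_finsetSum]
    · congr 1
      · refine Finset.sum_congr rfl fun i _ => ?_
        rw [integral_const_mul, integral_finsetSum _ fun c _ => (i1 c i).const_mul _]
        congr 1
        have hmi : Measurable fun z => u z i := measurable_apply hu i
        have h := fderiv_reflMoll_space (T := T) hχ hε0 (fun c => flipSign (c i)) hmi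
          (M := M) (fun z => (abs_apply_le_norm _ i).trans (huM z)) t x ξ
        refine Eq.trans ?_ h.symm
        simp only [integral_const_mul]
      · congr 1
        have h1 : ∀ c : Fin d → Fin 3, ∫ z in cylinder d T, timeKer χ ε t z.1 * D z.1 *
            spaceKer ε c x z.2 =
            (∫ t' in Ioo 0 T, timeKer χ ε t t' * D t') * ∫ y in cube d, spaceKer ε c x y :=
          fun c => integral_cylMeasure_mul T (fun t' => timeKer χ ε t t' * D t') _
        simp only [h1]
        rw [← Finset.mul_sum, sum_integral_spaceKer hε0 hε1 hx, mul_one]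
    · exact fun i _ => (integrable_finsetSum _ fun c _ => (i1 c i).const_mul _).const_mul _
    · exact integrable_finsetSum _ fun i _ =>
        (integrable_finsetSum _ fun c _ => (i1 c i).const_mul _).const_mul _
    · exact (integrable_finsetSum _ fun c _ => i2 c).const_mul _
  rw [← hmainint]
  -- the inequality with cutoff
  have hcut : ∀ η, 0 < η → (∫ z in cylinder d T, oslRem χ ε η u t x ξ z) ≤
      ∫ z in cylinder d T, oslMain χ ε u D t x ξ z * cubeCut η z.2 := fun η hη => by
    have h1 : 0 ≤ ∑ c : Fin d → Fin 3, ∫ z in cylinder d T, (-(inner ℝ (reflVec c ξ) (u z) *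
        dx (kernelTest χ ε η t x c) z.1 z.2 (reflVec c ξ)) +
        D z.1 * ‖reflVec c ξ‖ ^ 2 * kernelTest χ ε η t x c z.1 z.2) :=
      Finset.sum_nonneg fun c _ => hosl _ _
        (isInteriorTest_kernelTest hχ hδ hε0 hε hη t x c) fun t' y =>
          mul_nonneg (timeKer_nonneg hχ hε0 _ _) (mul_nonneg (spaceKer_nonneg hε0 _ _ _)
            (cubeCut_mem η y).1)
    rw [← integral_finsetSum _ fun c _ => integrableOn_osl_integrand hχ1 hD hu huM η t x ξ c] at h1
    simp only [osl_integrand_eq] at h1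
    have c4 : Continuous fun z : ℝ × Space d => cubeCut η z.2 :=
      (contDiff_cubeCut η).continuous.comp continuous_snd
    rw [integral_sub (integrableOn_mul_of_continuous hmain c4)
      (integrableOn_oslRem hχ1 hu huM η t x ξ)] at h1
    linarith
  have hη : ∀ n, 0 < e n / 2 := fun n => half_pos (he0 n)
  have hηlim : Tendsto (fun n => e n / 2) atTop (𝓝 0) := by simpa using he.div_const 2
  refine le_of_tendsto_of_tendsto' (b := atTop) ?_ ?_ fun n => hcut (e n / 2) (hη n)
  · -- the derivatives of the cutoff do not contribute in the limit
    obtain ⟨L, hL, hLle⟩ := exists_abs_oslRem_le (T := T) hχ hε0 hε1 huM t hx ξ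
    have hvol : ∀ j, Tendsto (fun n => volume.real (faceLayer d T j (e n))) atTop (𝓝 0) := fun j => by
      have h1 : Tendsto (fun n => 2 * (e n * volume.real (faceSet T j))) atTop (𝓝 0) := by
        simpa using (he.mul_const (volume.real (faceSet T j))).const_mul 2
      refine tendsto_of_tendsto_of_tendsto_of_le_of_le' tendsto_const_nhds h1
        (.of_forall fun n => measureReal_nonneg) ?_
      filter_upwards [he.eventually_le_const two_pos] with n hn
      have h2 := ENNReal.toReal_mono (ENNReal.mul_ne_top ENNReal.ofNat_ne_top (ENNReal.mul_ne_top
        ENNReal.ofReal_ne_top (volume_faceSet_lt_top T j).ne)) (volume_faceLayer_le (T := T) j hn)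
      rwa [ENNReal.toReal_mul, ENNReal.toReal_mul, ENNReal.toReal_ofReal (he0 n).le] at h2
    have hlim : Tendsto (fun n => L * ∑ j, (2 * ((e n)⁻¹ * ∫ z in faceLayer d T j (e n), |u z j|) +
        volume.real (faceLayer d T j (e n)))) atTop (𝓝 0) := by
      have := (tendsto_finsetSum Finset.univ fun j _ =>
        ((hface j).const_mul 2).add (hvol j)).const_mul L
      simpa using this
    refine squeeze_zero_norm (fun n => ?_) hlim
    have hi : ∀ j, IntegrableOn (fun z => (e n / 2)⁻¹ * |u z j| + 1) (cylinder d T) := fun j =>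
      ((integrableOn_apply hu huM j).abs.const_mul _).add (integrable_const _)
    have hi2 : ∀ j, Integrable ((faceLayer d T j (e n)).indicator fun z =>
        (e n / 2)⁻¹ * |u z j| + 1) (volume.restrict (cylinder d T)) := fun j =>
      (hi j).indicator (measurableSet_faceLayer d T j _)
    calc ‖∫ z in cylinder d T, oslRem χ ε (e n / 2) u t x ξ z‖
        ≤ ∫ z in cylinder d T, L * ∑ j, (faceLayer d T j (e n)).indicator
          (fun z => (e n / 2)⁻¹ * |u z j| + 1) z := by
          refine norm_integral_le_of_norm_le
            ((integrable_finsetSum _ fun j _ => hi2 j).const_mul L) ?_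
          filter_upwards [ae_restrict_mem (measurableSet_cylinder d T)] with z hz
          have := hLle (e n / 2) (hη n) z hz
          rwa [mul_div_cancel₀ (e n) two_ne_zero] at this
      _ = L * ∑ j, ∫ z in faceLayer d T j (e n), ((e n / 2)⁻¹ * |u z j| + 1) := by
          rw [integral_const_mul, integral_finsetSum _ fun j _ => hi2 j]
          congr 1
          refine Finset.sum_congr rfl fun j _ => ?_
          rw [integral_indicator (measurableSet_faceLayer d T j _),
            Measure.restrict_restrict (measurableSet_faceLayer d T j _),
            inter_eq_self_of_subset_left (show faceLayer d T j (e n) ⊆ cylinder d T from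
              inter_subset_left)]
      _ = _ := by
          congr 1
          refine Finset.sum_congr rfl fun j _ => ?_
          have hsub : faceLayer d T j (e n) ⊆ cylinder d T := inter_subset_left
          have hfin : volume (faceLayer d T j (e n)) ≠ ⊤ :=
            ((measure_mono hsub).trans_lt (volume_cylinder_lt_top d T)).ne
          have h3 : IntegrableOn (fun z => (e n / 2)⁻¹ * |u z j|) (faceLayer d T j (e n)) :=
            ((integrableOn_apply (T := T) hu huM j).mono_set hsub).abs.const_mul _
          rw [integral_add h3
            (integrableOn_const hfin), integral_const_mul, setIntegral_const, smul_eq_mul, mul_one]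
          congr 1
          rw [inv_div]; ring
  · refine tendsto_integral_of_dominated_convergence (fun z => |oslMain χ ε u D t x ξ z|)
      (fun n => (integrableOn_mul_of_continuous hmain
        ((contDiff_cubeCut _).continuous.comp continuous_snd)).aestronglyMeasurable) hmain.abs
      (fun n => .of_forall fun z => ?_) ?_
    · rw [norm_mul, Real.norm_eq_abs, Real.norm_eq_abs, abs_of_nonneg (cubeCut_mem _ z.2).1]
      exact mul_le_of_le_one_right (abs_nonneg _) (cubeCut_mem _ z.2).2
    · filter_upwards [ae_restrict_mem (measurableSet_cylinder d T)] with z hz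
      have hev : ∀ᶠ n in atTop, cubeCut (e n / 2) z.2 = 1 := by
        have h1 : ∀ i, ∀ᶠ n in atTop, edgeCut (e n / 2) (z.2 i) = 1 := fun i => by
          have h2 : 0 < 1 - z.2 i ^ 2 := by
            have := hz.2 i
            nlinarith [this.1, this.2]
          filter_upwards [he.eventually_le_const h2] with n hn
          exact edgeCut_eq_one (hη n) (by linarith)
        filter_upwards [eventually_all.2 h1] with n hn
        exact Finset.prod_eq_one fun i _ => hn i
      refine tendsto_const_nhds.congr' ?_
      filter_upwards [hev] with n hn
      rw [hn, mul_one]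

end Euler

namespace Euler

/-! ### Matrices of measures -/

open scoped MatrixOrder in
/-- The contraction of a positive semi-definite matrix with a matrix whose quadratic form is
nonnegative is nonnegative. -/
theorem sum_mul_nonneg_of_posSemidef {ι : Type*} [Fintype ι] {S N : ι → ι → ℝ}
    (hS : ∀ i j, S i j = S j i) (hS0 : ∀ ξ : ι → ℝ, 0 ≤ ∑ i, ∑ j, ξ i * ξ j * S i j)
    (hN : ∀ ξ : ι → ℝ, 0 ≤ ∑ i, ∑ j, ξ i * ξ j * N i j) : 0 ≤ ∑ i, ∑ j, N i j * S i j := by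
  classical
  have hpsd : (Matrix.of S).PosSemidef := by
    refine Matrix.PosSemidef.of_dotProduct_mulVec_nonneg ?_ fun x => ?_
    · ext i j
      simp [Matrix.conjTranspose_apply, hS i j]
    · refine (hS0 x).trans (le_of_eq ?_)
      simp only [dotProduct, Matrix.mulVec, Pi.star_apply, star_trivial, Matrix.of_apply,
        Finset.mul_sum]
      exact Finset.sum_congr rfl fun i _ => Finset.sum_congr rfl fun j _ => by ring
  obtain ⟨B, hB⟩ := CStarAlgebra.nonneg_iff_eq_star_mul_self.1 hpsd.nonneg
  have hSB : ∀ i j, S i j = ∑ k, B k i * B k j := fun i j => by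
    have := congrFun (congrFun hB i) j
    simpa [Matrix.mul_apply, Matrix.star_apply] using this
  have e : ∑ i, ∑ j, N i j * S i j = ∑ k, ∑ i, ∑ j, B k i * B k j * N i j := by
    simp only [hSB, Finset.mul_sum]
    symm
    rw [Finset.sum_comm]
    refine Finset.sum_congr rfl fun i _ => ?_
    rw [Finset.sum_comm]
    exact Finset.sum_congr rfl fun j _ => Finset.sum_congr rfl fun k _ => by ring
  rw [e]
  exact Finset.sum_nonneg fun k _ => hN fun i => B k i

theorem integral_comp_simpleFunc {X : Type*} [MeasurableSpace X] (R : SignedMeasure X) [IsFiniteMeasure R.variation]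
    (s : SimpleFunc X X) (f : X → ℝ) :
    ∫ᵛ x, f (s x) ∂•R = ∑ y ∈ s.range, f y * R (s ⁻¹' {y}) := by
  classical
  have e : (fun x => f (s x)) = fun x => ∑ y ∈ s.range, (s ⁻¹' {y}).indicator (fun _ => f y) x := by
    funext x
    rw [Finset.sum_eq_single (s x)]
    · simp
    · exact fun y _ hy => by simp [hy.symm]
    · exact fun h => absurd (s.mem_range_self x) h
  rw [e, VectorMeasure.integral_finsetSum]
  · refine Finset.sum_congr rfl fun y _ => ?_
    rw [VectorMeasure.integral_indicator_const _ (s.measurableSet_preimage _)]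
    simp
  · exact fun y _ => (integrable_const (f y)).indicator (s.measurableSet_preimage _)

/-- A continuous matrix field with nonnegative quadratic form has a nonnegative integral with
respect to a matrix of measures with positive semi-definite values. -/
theorem sum_integral_nonneg {X : Type*} [PseudoEMetricSpace X] [CompactSpace X]
    [MeasurableSpace X] [BorelSpace X] [Nonempty X] {ι : Type*} [Fintype ι] {R : ι → ι → SignedMeasure X}
    (hfin : ∀ i j, IsFiniteMeasure (R i j).variation) (hR : ∀ i j, R i j = R j i)
    (hR0 : ∀ (ξ : ι → ℝ) (A : Set X), MeasurableSet A → 0 ≤ ∑ i, ∑ j, ξ i * ξ j * R i j A)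
    {N : ι → ι → X → ℝ} (hN : ∀ i j, Continuous (N i j))
    (hN0 : ∀ (ξ : ι → ℝ) x, 0 ≤ ∑ i, ∑ j, ξ i * ξ j * N i j x) :
    0 ≤ ∑ i, ∑ j, ∫ᵛ x, N i j x ∂•(R i j) := by
  let x₀ : X := Classical.arbitrary X
  let s : ℕ → SimpleFunc X X := SimpleFunc.approxOn id measurable_id univ x₀ (mem_univ _)
  have hlim : ∀ x, Tendsto (fun n => s n x) atTop (𝓝 x) := fun x =>
    SimpleFunc.tendsto_approxOn measurable_id _ (subset_closure (mem_univ _))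
  have h1 : ∀ i j, Tendsto (fun n => ∫ᵛ x, N i j (s n x) ∂•(R i j)) atTop
      (𝓝 (∫ᵛ x, N i j x ∂•(R i j))) := fun i j => by
    have := hfin i j
    obtain ⟨C, hC⟩ := (isCompact_range (hN i j)).isBounded.exists_norm_le
    exact VectorMeasure.tendsto_integral_of_dominated_convergence (fun _ => C)
      (fun n => ((hN i j).measurable.comp (s n).measurable).aestronglyMeasurable)
      (integrable_const _) (fun n => .of_forall fun x => hC _ (mem_range_self _))
      (.of_forall fun x => ((hN i j).tendsto x).comp (hlim x))
  refine ge_of_tendsto' (tendsto_finsetSum _ fun i _ => tendsto_finsetSum _ fun j _ => h1 i j)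
    fun n => ?_
  have e : ∑ i, ∑ j, ∫ᵛ x, N i j (s n x) ∂•(R i j) =
      ∑ y ∈ (s n).range, ∑ i, ∑ j, N i j y * R i j (s n ⁻¹' {y}) := by
    have h2 : ∀ i j, ∫ᵛ x, N i j (s n x) ∂•(R i j) =
        ∑ y ∈ (s n).range, N i j y * R i j (s n ⁻¹' {y}) := fun i j => by
      have := hfin i j
      exact integral_comp_simpleFunc _ _ _
    simp only [h2]
    symm
    rw [Finset.sum_comm]
    refine Finset.sum_congr rfl fun i _ => ?_
    rw [Finset.sum_comm]
  rw [e]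
  exact Finset.sum_nonneg fun y _ => sum_mul_nonneg_of_posSemidef
    (fun i j => by rw [hR i j]) (fun ξ => hR0 ξ _ ((s n).measurableSet_preimage _))
    fun ξ => hN0 ξ y

instance (d : ℕ) : CompactSpace (closedCube d) :=
  isCompact_iff_compactSpace.1 (isCompact_closedCube d)

instance (d : ℕ) : Nonempty (closedCube d) := ⟨⟨0, fun i => by simp⟩⟩

variable {d : ℕ} {a γ T κ : ℝ} {Rv : ℝ → Fin d → Fin d → SignedMeasure (closedCube d)}
  {Rp : ℝ → Measure (closedCube d)}

/-! ### The energy of the defect -/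

/-- The energy of the turbulent defect measures. -/
noncomputable def defectEnergy (γ : ℝ) (Rv : ℝ → Fin d → Fin d → SignedMeasure (closedCube d))
    (Rp : ℝ → Measure (closedCube d)) (t : ℝ) : ℝ :=
  1 / 2 * ∑ i, Rv t i i univ + 1 / (γ - 1) * (Rp t univ).toReal

/-- The properties at a fixed time of the turbulent defect measures. -/
structure IsDefect (Rv : Fin d → Fin d → SignedMeasure (closedCube d))
    (Rp : Measure (closedCube d)) : Prop where
  isFiniteMeasure_variation : ∀ i j, IsFiniteMeasure (Rv i j).variation
  isFiniteMeasure : IsFiniteMeasure Rp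
  symm : ∀ i j, Rv i j = Rv j i
  nonneg : ∀ (ξ : Fin d → ℝ) (A : Set (closedCube d)), MeasurableSet A →
    0 ≤ ∑ i, ∑ j, ξ i * ξ j * Rv i j A

theorem ae_isDefect (hv : MemLinftyPSDMeasure T Rv) (hp : MemLinftyMeasure T Rp) :
    ∀ᵐ t ∂volume.restrict (Ioo 0 T), IsDefect (Rv t) (Rp t) := by
  obtain ⟨C, hC⟩ := hv.bounded
  obtain ⟨C', hC'⟩ := hp.bounded
  filter_upwards [hC, hC', hv.symm, hv.nonneg] with t h1 h2 h3 h4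
  exact ⟨fun i j => ⟨(h1 i j).trans_lt ENNReal.coe_lt_top⟩, ⟨h2.trans_lt ENNReal.coe_lt_top⟩, h3,
    fun ξ A hA => h4 (WithLp.toLp 2 ξ) A hA⟩

theorem IsDefect.apply_nonneg {Rv : Fin d → Fin d → SignedMeasure (closedCube d)}
    {Rp : Measure (closedCube d)} (h : IsDefect Rv Rp) (i : Fin d) {A : Set (closedCube d)}
    (hA : MeasurableSet A) : 0 ≤ Rv i i A := by
  have := h.nonneg (Pi.single i 1) A hA
  simpa [Pi.single_apply, Finset.sum_ite_eq] using this

theorem defectEnergy_nonneg (hγ : 1 < γ) {t : ℝ} (h : IsDefect (Rv t) (Rp t)) :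
    0 ≤ defectEnergy γ Rv Rp t := by
  have h1 : 0 ≤ ∑ i, Rv t i i univ := Finset.sum_nonneg fun i _ => h.apply_nonneg i .univ
  have h2 : 0 ≤ 1 / (γ - 1) := one_div_nonneg.2 (by linarith)
  unfold defectEnergy
  positivity

/-- The trace controls a positive semi-definite matrix, so that the defect measures vanish together
with their energy. -/
theorem eq_zero_of_defectEnergy_eq_zero (hγ : 1 < γ) {t : ℝ} (h : IsDefect (Rv t) (Rp t))
    (h0 : defectEnergy γ Rv Rp t = 0) : Rv t = 0 ∧ Rp t = 0 := by
  have h1 : ∀ i, 0 ≤ Rv t i i univ := fun i => h.apply_nonneg i .univ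
  have h2 : 0 < 1 / (γ - 1) := one_div_pos.2 (by linarith)
  have hs := Finset.sum_nonneg fun i (_ : i ∈ Finset.univ) => h1 i
  have hp : 0 ≤ (Rp t univ).toReal := ENNReal.toReal_nonneg
  unfold defectEnergy at h0
  have hs0 : ∑ i, Rv t i i univ = 0 := by nlinarith [mul_nonneg h2.le hp]
  have hp0 : (Rp t univ).toReal = 0 := by
    rw [hs0] at h0
    have : 1 / (γ - 1) * (Rp t univ).toReal = 0 := by linarith
    exact (mul_eq_zero.1 this).resolve_left h2.ne'
  have hd : ∀ i, Rv t i i univ = 0 := fun i =>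
    (Finset.sum_eq_zero_iff_of_nonneg fun i _ => h1 i).1 hs0 i (Finset.mem_univ i)
  have hdA : ∀ i (A : Set (closedCube d)), MeasurableSet A → Rv t i i A = 0 := fun i A hA => by
    have h3 := h.apply_nonneg i hA
    have h4 := h.apply_nonneg i hA.compl
    have h5 := VectorMeasure.of_add_of_sdiff (v := Rv t i i) hA .univ (subset_univ A)
    rw [← compl_eq_univ_sdiff, hd i] at h5
    linarith
  constructor
  · funext i j
    refine VectorMeasure.ext fun A hA => ?_
    have hij : ∀ s : ℝ, 0 ≤ s * Rv t i j A := fun s => by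
      by_cases hij : i = j
      · subst hij; rw [hdA i A hA, mul_zero]
      have h3 := h.nonneg (Pi.single i 1 + Pi.single j (s / 2)) A hA
      have h4 : ∑ k, ∑ l, (Pi.single i 1 + Pi.single j (s / 2) : Fin d → ℝ) k *
          (Pi.single i 1 + Pi.single j (s / 2) : Fin d → ℝ) l * Rv t k l A =
          Rv t i i A + s / 2 * Rv t i j A + s / 2 * Rv t j i A + (s / 2) ^ 2 * Rv t j j A := by
        simp only [Pi.add_apply, add_mul, mul_add, Finset.sum_add_distrib, Pi.single_apply,
          ite_mul, mul_ite, one_mul, zero_mul, mul_zero, mul_one, Finset.sum_ite_eq',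
          Finset.mem_univ, if_true]
        ring
      rw [h4, hdA i A hA, hdA j A hA, h.symm j i] at h3
      linarith
    have := hij (-(Rv t i j A))
    change Rv t i j A = 0
    nlinarith [mul_self_nonneg (Rv t i j A)]
  · have := h.isFiniteMeasure
    exact Measure.measure_univ_eq_zero.1
      (((ENNReal.toReal_eq_zero_iff _).1 hp0).resolve_right (measure_ne_top _ _))

/-- If the gradient of the test function is bounded below by `-κ`, as a quadratic form, the defect
flux is bounded below by a multiple of the defect energy. -/
theorem defectFlux_ge (hγ : 1 < γ) {t : ℝ} (h : IsDefect (Rv t) (Rp t)) (hκ : 0 ≤ κ)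
    {φ : ℝ → Space d → Space d} (hφ : ∀ i j, Continuous (fun x => grad φ t x i j))
    (hφκ : ∀ x ∈ closedCube d, ∀ ξ : Space d,
      0 ≤ (∑ i, ∑ j, ξ i * ξ j * grad φ t x i j) + ‖ξ‖ ^ 2 * κ) :
    -(κ * max 2 (d * (γ - 1)) * defectEnergy γ Rv Rp t) ≤ defectFlux Rv Rp φ t := by
  have hγ0 : 0 < γ - 1 := by linarith
  have hfinp := h.isFiniteMeasure
  have hc : ∀ i j, Continuous fun x : closedCube d => grad φ t x i j := fun i j =>
    (hφ i j).comp continuous_subtype_val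
  have h1 := sum_integral_nonneg (R := Rv t) h.isFiniteMeasure_variation h.symm h.nonneg
    (N := fun i j (x : closedCube d) => grad φ t x i j + if i = j then κ else 0)
    (fun i j => (hc i j).add continuous_const) (fun ξ x => by
      refine (hφκ x x.2 (WithLp.toLp 2 ξ)).trans (le_of_eq ?_)
      simp only [mul_add, Finset.sum_add_distrib]
      congr 1
      rw [EuclideanSpace.norm_sq_eq, Finset.sum_mul]
      refine Finset.sum_congr rfl fun i _ => ?_
      simp [sq])
  have h2 : ∑ i, ∑ j, ∫ᵛ x : closedCube d, (grad φ t x i j + if i = j then κ else 0) ∂•(Rv t i j) =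
      (∑ i, ∑ j, ∫ᵛ x : closedCube d, grad φ t x i j ∂•(Rv t i j)) +
        κ * ∑ i, Rv t i i univ := by
    have h3 : ∀ i j, ∫ᵛ x : closedCube d, (grad φ t x i j + if i = j then κ else 0) ∂•(Rv t i j) =
        ∫ᵛ x : closedCube d, grad φ t x i j ∂•(Rv t i j) +
          if i = j then κ * Rv t i j univ else 0 := fun i j => by
      have := h.isFiniteMeasure_variation i j
      rw [VectorMeasure.integral_fun_add ((hc i j).integrable_of_hasCompactSupport
        (HasCompactSupport.of_compactSpace _)) (integrable_const _), VectorMeasure.integral_const]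
      split_ifs <;> simp
    simp only [h3, Finset.sum_add_distrib, Finset.sum_ite_eq, Finset.mem_univ, if_true,
      Finset.mul_sum]
  have h4 : -(κ * d * (Rp t univ).toReal) ≤ ∫ x : closedCube d, div φ t x ∂(Rp t) := by
    have h5 : ∀ x : closedCube d, -(κ * d) ≤ div φ t x := fun x => by
      have h6 : ∀ i, -κ ≤ grad φ t x i i := fun i => by
        have := hφκ x x.2 (EuclideanSpace.single i 1)
        simp at this
        linarith
      have h7 := Finset.sum_le_sum fun i (_ : i ∈ Finset.univ) => h6 i
      simp at h7
      rw [div]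
      linarith
    have h6 : Integrable (fun x : closedCube d => div φ t x) (Rp t) :=
      (continuous_finsetSum _ fun i _ => hc i i).integrable_of_hasCompactSupport
        (HasCompactSupport.of_compactSpace _)
    have h7 := integral_mono (integrable_const (μ := Rp t) (-(κ * d))) h6 h5
    rw [integral_const, smul_eq_mul] at h7
    refine le_trans (le_of_eq ?_) h7
    rw [Measure.real]; ring
  have hs : 0 ≤ ∑ i, Rv t i i univ := Finset.sum_nonneg fun i _ => h.apply_nonneg i .univ
  have hp : 0 ≤ (Rp t univ).toReal := ENNReal.toReal_nonneg
  rw [h2] at h1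
  have e : κ * max 2 (d * (γ - 1)) * defectEnergy γ Rv Rp t =
      κ * (max 2 (d * (γ - 1)) / 2 * ∑ i, Rv t i i univ +
        max 2 (d * (γ - 1)) / (γ - 1) * (Rp t univ).toReal) := by
    unfold defectEnergy; ring
  have h8 : (1 : ℝ) ≤ max 2 (d * (γ - 1)) / 2 := by
    rw [le_div_iff₀ two_pos, one_mul]; exact le_max_left _ _
  have h9 : (d : ℝ) ≤ max 2 (d * (γ - 1)) / (γ - 1) := by
    rw [le_div_iff₀ hγ0]; exact le_max_right _ _
  have h10 := mul_le_mul_of_nonneg_left (add_le_add (mul_le_mul_of_nonneg_right h8 hs)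
    (mul_le_mul_of_nonneg_right h9 hp)) hκ
  rw [e, defectFlux]
  linarith

end Euler

namespace Euler

variable {d : ℕ} {T δ ε : ℝ} {χ : ℝ → ℝ} {P P' : ℝ → ℝ} {r R C M : ℝ}
  {ρ : ℝ × Space d → ℝ} {u : ℝ × Space d → Space d}
  {Rv : ℝ → Fin d → Fin d → SignedMeasure (closedCube d)} {Rp : ℝ → Measure (closedCube d)}

/-! ### The flux identity -/

/-- The weak form of the momentum equation with defect, for test functions that vanish near the
initial and the final time, in terms of the density and the velocity. -/
def HasWeakMomentum (T : ℝ) (P P' : ℝ → ℝ) (ρ : ℝ × Space d → ℝ) (u : ℝ × Space d → Space d)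
    (Rv : ℝ → Fin d → Fin d → SignedMeasure (closedCube d)) (Rp : ℝ → Measure (closedCube d)) :
    Prop :=
  ∀ φ : ℝ → Space d → Space d, ContDiff ℝ 1 (Function.uncurry φ) →
    (∃ δ > 0, ∀ t x, t ∉ Ioo δ (T - δ) → φ t x = 0) →
    (∀ t, ∀ x : Space d, ∀ i, |x i| = 1 → φ t x i = 0) →
    (∫ z in cylinder d T, ((∑ i, ρ z * u z i * deriv (fun s => φ s z.2 i) z.1) +
      (∑ i, ∑ j, ρ z * u z i * u z j * grad φ z.1 z.2 i j) +
      (ρ z * P' (ρ z) - P (ρ z)) * div φ z.1 z.2)) + ∫ t in Ioo 0 T, defectFlux Rv Rp φ t = 0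

/-- The mollified velocity field. -/
noncomputable def mollField (T : ℝ) (χ : ℝ → ℝ) (ε : ℝ) (u : ℝ × Space d → Space d) (t : ℝ)
    (x : Space d) : Space d :=
  WithLp.toLp 2 fun i => mollVelocity T χ ε u i (t, x)

/-- The entropy variable dual to the density. -/
noncomputable def entropyVar (P' : ℝ → ℝ) (ρ : ℝ × Space d → ℝ) (u : ℝ × Space d → Space d)
    (z : ℝ × Space d) : ℝ := P' (ρ z) - ‖u z‖ ^ 2 / 2

/-- The mollification of the entropy variable dual to the density. -/
noncomputable def mollEntropy (T : ℝ) (χ : ℝ → ℝ) (ε : ℝ) (P' : ℝ → ℝ) (ρ : ℝ × Space d → ℝ)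
    (u : ℝ × Space d → Space d) (t : ℝ) (x : Space d) : ℝ :=
  reflMoll T χ ε (fun _ => 1) (entropyVar P' ρ u) (t, x)

theorem measurable_entropyVar (hP : PotentialBounds P P' r R C) (h : IsBoundedState r R M ρ u) :
    Measurable (entropyVar P' ρ u) := by
  have h1 := hP.measurable'.comp h.measurable_density
  have h2 := h.measurable_velocity
  exact h1.sub ((h2.norm.pow_const 2).div_const 2)

theorem abs_entropyVar_le (hP : PotentialBounds P P' r R C) (h : IsBoundedState r R M ρ u)
    (z : ℝ × Space d) : |entropyVar P' ρ u z| ≤ C + M ^ 2 / 2 := by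
  have h1 := hP.bound' _ (h.density_mem z)
  have h2 : ‖u z‖ ^ 2 ≤ M ^ 2 := by have := h.velocity_le z; gcongr
  refine (abs_sub _ _).trans (add_le_add h1 ?_)
  rw [abs_of_nonneg (by positivity)]
  linarith

theorem integral_pairing_mul (hP : PotentialBounds P P' r R C) (h : IsBoundedState r R M ρ u)
    (c : Fin d → Fin 3) (z : ℝ × Space d) {k : ℝ × Space d → ℝ} (hk : Continuous k) :
    ∫ z' in cylinder d T, pairing P' (ρ z) (u z) (ρ z') (reflVec c (u z')) * k z' =
      (∑ i, ρ z * u z i * (flipSign (c i) * ∫ z' in cylinder d T, k z' * u z' i)) +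
      ρ z * ∫ z' in cylinder d T, k z' * entropyVar P' ρ u z' := by
  have i1 : ∀ i, IntegrableOn (fun z' => k z' * u z' i) (cylinder d T) := fun i =>
    (integrableOn_mul_of_continuous (integrableOn_apply h.measurable_velocity h.velocity_le i)
      hk).congr_fun (fun z' _ => mul_comm _ _) (measurableSet_cylinder d T)
  have i2 : IntegrableOn (fun z' => k z' * entropyVar P' ρ u z') (cylinder d T) :=
    (integrableOn_mul_of_continuous (integrable_of_abs_le (measurable_entropyVar hP h)
      (abs_entropyVar_le hP h)) hk).congr_fun (fun z' _ => mul_comm _ _)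
      (measurableSet_cylinder d T)
  have e : ∀ z', pairing P' (ρ z) (u z) (ρ z') (reflVec c (u z')) * k z' =
      (∑ i, ρ z * u z i * (flipSign (c i) * (k z' * u z' i))) +
        ρ z * (k z' * entropyVar P' ρ u z') := fun z' => by
    rw [pairing, norm_reflVec, inner_eq_sum, entropyVar, add_mul, Finset.mul_sum, Finset.sum_mul]
    congr 1
    · exact Finset.sum_congr rfl fun i _ => by rw [reflVec_apply]; ring
    · ring
  simp only [e]
  rw [integral_add (integrable_finsetSum _ fun i _ => ((i1 i).const_mul _).const_mul _)
    (i2.const_mul _), integral_finsetSum _ fun i _ => ((i1 i).const_mul _).const_mul _]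
  simp only [integral_const_mul]

theorem integral_fluxPairing_mul (hP : PotentialBounds P P' r R C) (h : IsBoundedState r R M ρ u)
    (c : Fin d → Fin 3) (j : Fin d) (z : ℝ × Space d) {k : ℝ × Space d → ℝ} (hk : Continuous k) :
    ∫ z' in cylinder d T, fluxPairing P P' j (ρ z) (u z) (ρ z') (reflVec c (u z')) * k z' =
      (∑ i, ρ z * u z i * u z j * (flipSign (c i) * ∫ z' in cylinder d T, k z' * u z' i)) +
      (ρ z * P' (ρ z) - P (ρ z)) * (flipSign (c j) * ∫ z' in cylinder d T, k z' * u z' j) +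
      ρ z * u z j * ∫ z' in cylinder d T, k z' * entropyVar P' ρ u z' := by
  have i1 : ∀ i, IntegrableOn (fun z' => k z' * u z' i) (cylinder d T) := fun i =>
    (integrableOn_mul_of_continuous (integrableOn_apply h.measurable_velocity h.velocity_le i)
      hk).congr_fun (fun z' _ => mul_comm _ _) (measurableSet_cylinder d T)
  have i2 : IntegrableOn (fun z' => k z' * entropyVar P' ρ u z') (cylinder d T) :=
    (integrableOn_mul_of_continuous (integrable_of_abs_le (measurable_entropyVar hP h)
      (abs_entropyVar_le hP h)) hk).congr_fun (fun z' _ => mul_comm _ _)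
      (measurableSet_cylinder d T)
  have e : ∀ z', fluxPairing P P' j (ρ z) (u z) (ρ z') (reflVec c (u z')) * k z' =
      (∑ i, ρ z * u z i * u z j * (flipSign (c i) * (k z' * u z' i))) +
        (ρ z * P' (ρ z) - P (ρ z)) * (flipSign (c j) * (k z' * u z' j)) +
        ρ z * u z j * (k z' * entropyVar P' ρ u z') := fun z' => by
    rw [fluxPairing, norm_reflVec, inner_eq_sum, entropyVar, add_mul, add_mul, Finset.mul_sum,
      Finset.sum_mul, reflVec_apply]
    congr 1
    · congr 1
      · exact Finset.sum_congr rfl fun i _ => by rw [reflVec_apply]; ring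
      · ring
    · ring
  have i3 : Integrable (fun z' => ∑ i, ρ z * u z i * u z j * (flipSign (c i) * (k z' * u z' i)))
      (volume.restrict (cylinder d T)) :=
    integrable_finsetSum _ fun i _ => ((i1 i).const_mul _).const_mul _
  have i4 : Integrable (fun z' => (∑ i, ρ z * u z i * u z j * (flipSign (c i) * (k z' * u z' i))) +
      (ρ z * P' (ρ z) - P (ρ z)) * (flipSign (c j) * (k z' * u z' j)))
      (volume.restrict (cylinder d T)) := i3.add (((i1 j).const_mul _).const_mul _)
  simp only [e]
  rw [integral_add i4 (i2.const_mul _), integral_add i3 (((i1 j).const_mul _).const_mul _),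
    integral_finsetSum _ fun i _ => ((i1 i).const_mul _).const_mul _]
  simp only [integral_const_mul]

/-- The double integral, arranged as an integral of the state at `z` against mollifications of
the state at `z'`. -/
theorem totalFlux_eq_integral (hP : PotentialBounds P P' r R C) (hr : 0 ≤ r)
    (h : IsBoundedState r R M ρ u) (hχ : IsTimeCutoff T δ χ) (hε0 : 0 < ε) :
    totalFlux T χ ε P P' ρ u = ∫ z in cylinder d T, ∑ c : Fin d → Fin 3,
      ((∫ z' in cylinder d T, pairing P' (ρ z) (u z) (ρ z') (reflVec c (u z')) *
        ((timeKerAnti χ ε z.1 z'.1 + timeKerSymm χ ε z.1 z'.1) * spaceKer ε c z.2 z'.2)) +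
      ∑ j, ∫ z' in cylinder d T, fluxPairing P P' j (ρ z) (u z) (ρ z') (reflVec c (u z')) *
        (timeKer χ ε z.1 z'.1 * spaceKer' ε c j z.2 z'.2)) := by
  obtain ⟨Cχ, -, hC1, hC2⟩ := hχ.exists_bound
  have j1 : ∀ c : Fin d → Fin 3, Integrable (fun q : (ℝ × Space d) × (ℝ × Space d) =>
      pairing P' (ρ q.1) (u q.1) (ρ q.2) (reflVec c (u q.2)) *
        (timeKerAnti χ ε q.1.1 q.2.1 * spaceKer ε c q.1.2 q.2.2))
      ((cylMeasure d T).prod (cylMeasure d T)) := fun c =>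
    (integrable_of_abs_le (measurable_pairing hP h c) fun q => abs_pairing_le hP hr
      (h.density_mem _) (h.density_mem _) (h.velocity_le _)
      ((norm_reflVec _ _).trans_le (h.velocity_le _))).mul_bdd
      (measurable_prodKer (continuous_timeKerAnti hχ.contDiff ε)
        (continuous_spaceKer ε c)).aestronglyMeasurable
      (.of_forall (abs_prodKer_le (abs_timeKerAnti_le hC1 hε0) (abs_spaceKer_le hε0 c)))
  have j2 : ∀ c : Fin d → Fin 3, Integrable (fun q : (ℝ × Space d) × (ℝ × Space d) =>
      pairing P' (ρ q.1) (u q.1) (ρ q.2) (reflVec c (u q.2)) *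
        (timeKerSymm χ ε q.1.1 q.2.1 * spaceKer ε c q.1.2 q.2.2))
      ((cylMeasure d T).prod (cylMeasure d T)) := fun c =>
    (integrable_of_abs_le (measurable_pairing hP h c) fun q => abs_pairing_le hP hr
      (h.density_mem _) (h.density_mem _) (h.velocity_le _)
      ((norm_reflVec _ _).trans_le (h.velocity_le _))).mul_bdd
      (measurable_prodKer (continuous_timeKerSymm hχ.contDiff ε)
        (continuous_spaceKer ε c)).aestronglyMeasurable
      (.of_forall (abs_prodKer_le (abs_timeKerSymm_le hC2 hε0) (abs_spaceKer_le hε0 c)))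
  have j3 : ∀ (c : Fin d → Fin 3) j, Integrable (fun q : (ℝ × Space d) × (ℝ × Space d) =>
      fluxPairing P P' j (ρ q.1) (u q.1) (ρ q.2) (reflVec c (u q.2)) *
        (timeKer χ ε q.1.1 q.2.1 * spaceKer' ε c j q.1.2 q.2.2))
      ((cylMeasure d T).prod (cylMeasure d T)) := fun c j =>
    (integrable_of_abs_le (measurable_fluxPairing hP h j c) fun q => abs_fluxPairing_le hP hr j
      (h.density_mem _) (h.density_mem _) (h.velocity_le _)
      ((norm_reflVec _ _).trans_le (h.velocity_le _))).mul_bdd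
      (measurable_prodKer (continuous_timeKer hχ.contDiff ε)
        (continuous_spaceKer' ε c j)).aestronglyMeasurable
      (.of_forall (abs_prodKer_le (abs_timeKer_le hC1 hε0) (abs_spaceKer'_le hε0 c j)))
  have j12 : ∀ c : Fin d → Fin 3, Integrable (fun q : (ℝ × Space d) × (ℝ × Space d) =>
      pairing P' (ρ q.1) (u q.1) (ρ q.2) (reflVec c (u q.2)) *
        ((timeKerAnti χ ε q.1.1 q.2.1 + timeKerSymm χ ε q.1.1 q.2.1) *
          spaceKer ε c q.1.2 q.2.2))
      ((cylMeasure d T).prod (cylMeasure d T)) := fun c =>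
    ((j1 c).add (j2 c)).congr (.of_forall fun q => by simp only [Pi.add_apply]; ring)
  rw [totalFlux, integral_finsetSum]
  · refine Finset.sum_congr rfl fun c _ => ?_
    rw [integral_add (j12 c).integral_prod_left
      (integrable_finsetSum _ fun j _ => (j3 c j).integral_prod_left),
      integral_finsetSum _ fun j _ => (j3 c j).integral_prod_left, ← integral_add (j1 c) (j2 c)]
    congr 1
    · rw [← integral_prod _ (j12 c)]
      exact integral_congr_ae (.of_forall fun q => by ring)
    · exact Finset.sum_congr rfl fun j _ => integral_prod _ (j3 c j)
  · exact fun c _ => (j12 c).integral_prod_left.add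
      (integrable_finsetSum _ fun j _ => (j3 c j).integral_prod_left)

theorem IsBoundedState.integrableOn_density (h : IsBoundedState r R M ρ u) :
    IntegrableOn ρ (cylinder d T) :=
  integrable_of_abs_le h.measurable_density (K := max |r| |R|) fun z =>
    abs_le_max_abs_abs (h.density_mem z).1 (h.density_mem z).2

theorem IsBoundedState.integrableOn_momentum (h : IsBoundedState r R M ρ u) (i : Fin d) :
    IntegrableOn (fun z => ρ z * u z i) (cylinder d T) :=
  h.integrableOn_density.mul_bdd (measurable_apply h.measurable_velocity i).aestronglyMeasurable
    (.of_forall fun z => (abs_apply_le_norm _ i).trans (h.velocity_le z))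

theorem continuous_dt {φ : ℝ → Space d → ℝ} (hφ : ContDiff ℝ 1 (Function.uncurry φ)) :
    Continuous fun z : ℝ × Space d => dt φ z.1 z.2 := by
  have h1 := hφ.continuous_fderiv one_ne_zero
  have h2 : (fun z : ℝ × Space d => dt φ z.1 z.2) =
      fun z => fderiv ℝ (Function.uncurry φ) z (1, 0) := by
    funext z
    have h3 : HasDerivAt (fun t : ℝ => (t, z.2)) ((1 : ℝ), (0 : Space d)) z.1 :=
      (hasDerivAt_id z.1).prodMk (hasDerivAt_const z.1 z.2)
    exact ((hφ.differentiable one_ne_zero (z.1, z.2)).hasFDerivAt.comp_hasDerivAt z.1 h3).deriv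
  rw [h2]
  exact h1.clm_apply continuous_const

theorem continuous_dx {φ : ℝ → Space d → ℝ} (hφ : ContDiff ℝ 1 (Function.uncurry φ))
    (w : Space d) : Continuous fun z : ℝ × Space d => dx φ z.1 z.2 w := by
  have h1 := hφ.continuous_fderiv one_ne_zero
  have h2 : (fun z : ℝ × Space d => dx φ z.1 z.2 w) =
      fun z => fderiv ℝ (Function.uncurry φ) z (0, w) := by
    funext z
    have h3 := (hφ.differentiable one_ne_zero (z.1, z.2)).hasFDerivAt.comp z.2
      (hasFDerivAt_prodMk_right z.1 z.2)
    have h4 : dx φ z.1 z.2 w = (fderiv ℝ (Function.uncurry φ) (z.1, z.2)).comp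
        (ContinuousLinearMap.inr ℝ ℝ (Space d)) w := by
      rw [← h3.fderiv]; rfl
    rw [h4, ContinuousLinearMap.comp_apply, ContinuousLinearMap.inr_apply]
  rw [h2]
  exact h1.clm_apply continuous_const

theorem contDiff_apply_test {φ : ℝ → Space d → Space d} (hφ : ContDiff ℝ 1 (Function.uncurry φ))
    (i : Fin d) : ContDiff ℝ 1 (Function.uncurry fun t x => φ t x i) :=
  contDiff_euclidean.1 hφ i

theorem continuous_grad {φ : ℝ → Space d → Space d} (hφ : ContDiff ℝ 1 (Function.uncurry φ))
    (i j : Fin d) : Continuous fun z : ℝ × Space d => grad φ z.1 z.2 i j :=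
  continuous_dx (contDiff_apply_test hφ i) _

theorem dx_eq_sum (φ : ℝ → Space d → ℝ) (t : ℝ) (x w : Space d) :
    dx φ t x w = ∑ j, w j * dx φ t x (EuclideanSpace.single j 1) := by
  have hw : w = ∑ j, w j • EuclideanSpace.single j (1 : ℝ) := by
    ext i
    simp [Finset.sum_apply, Pi.single_apply]
  conv_lhs => rw [hw]
  simp only [dx, map_sum, map_smul, smul_eq_mul]

theorem integrableOn_continuity (h : IsBoundedState r R M ρ u) {φ : ℝ → Space d → ℝ}
    (hφ : ContDiff ℝ 1 (Function.uncurry φ)) : IntegrableOn (fun z =>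
      ρ z * dt φ z.1 z.2 + dx φ z.1 z.2 (ρ z • u z)) (cylinder d T) := by
  have h1 : IntegrableOn ρ (cylinder d T) := h.integrableOn_density
  have h2 := fun i => h.integrableOn_momentum (T := T) i
  refine (integrableOn_mul_of_continuous h1 (continuous_dt hφ)).add ?_
  simp only [dx_eq_sum φ _ _ (_ • _)]
  exact integrable_finsetSum _ fun j _ => integrableOn_mul_of_continuous (h2 j) (continuous_dx hφ _)

theorem integrableOn_momentum (hP : PotentialBounds P P' r R C)
    (h : IsBoundedState r R M ρ u) {φ : ℝ → Space d → Space d}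
    (hφ : ContDiff ℝ 1 (Function.uncurry φ)) : IntegrableOn (fun z =>
      (∑ i, ρ z * u z i * deriv (fun s => φ s z.2 i) z.1) +
      (∑ i, ∑ j, ρ z * u z i * u z j * grad φ z.1 z.2 i j) +
      (ρ z * P' (ρ z) - P (ρ z)) * div φ z.1 z.2) (cylinder d T) := by
  have h2 := fun i => h.integrableOn_momentum (T := T) i
  have hp : IntegrableOn (fun z => ρ z * P' (ρ z) - P (ρ z)) (cylinder d T) :=
    ((h.integrableOn_density (T := T)).mul_bdd
      (hP.measurable'.comp h.measurable_density).aestronglyMeasurable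
      (.of_forall fun z => hP.bound' _ (h.density_mem z))).sub
      (integrable_of_abs_le (hP.measurable.comp h.measurable_density)
        fun z => hP.bound _ (h.density_mem z))
  have h3 : ∀ i j, IntegrableOn (fun z => ρ z * u z i * u z j) (cylinder d T) := fun i j =>
    (h2 i).mul_bdd (measurable_apply h.measurable_velocity j).aestronglyMeasurable
      (.of_forall fun z => (abs_apply_le_norm _ j).trans (h.velocity_le z))
  refine ((integrable_finsetSum _ fun i _ => ?_).add (integrable_finsetSum _ fun i _ =>
    integrable_finsetSum _ fun j _ => ?_)).add ?_
  · exact integrableOn_mul_of_continuous (h2 i) (continuous_dt (contDiff_apply_test hφ i))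
  · exact integrableOn_mul_of_continuous (h3 i j) (continuous_grad hφ i j)
  · exact integrableOn_mul_of_continuous hp (continuous_finsetSum _ fun i _ => continuous_grad hφ i i)

theorem contDiff_mollField (hχ : IsTimeCutoff T δ χ) (hε0 : 0 < ε)
    (h : IsBoundedState r R M ρ u) : ContDiff ℝ 1 (Function.uncurry (mollField T χ ε u)) := by
  refine contDiff_euclidean.2 fun i => ?_
  exact contDiff_reflMoll hχ hε0 _ (measurable_apply h.measurable_velocity i) fun z =>
    (abs_apply_le_norm _ i).trans (h.velocity_le z)

theorem contDiff_mollEntropy (hP : PotentialBounds P P' r R C) (h : IsBoundedState r R M ρ u)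
    (hχ : IsTimeCutoff T δ χ) (hε0 : 0 < ε) :
    ContDiff ℝ 1 (Function.uncurry (mollEntropy T χ ε P' ρ u)) :=
  contDiff_reflMoll hχ hε0 _ (measurable_entropyVar hP h) (abs_entropyVar_le hP h)

theorem grad_mollField (hχ : IsTimeCutoff T δ χ) (hε0 : 0 < ε) (h : IsBoundedState r R M ρ u)
    (t : ℝ) (x : Space d) (i j : Fin d) :
    grad (mollField T χ ε u) t x i j = ∑ c : Fin d → Fin 3, flipSign (c i) *
      ∫ z' in cylinder d T, timeKer χ ε t z'.1 * spaceKer' ε c j x z'.2 * u z' i := by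
  have h1 := fderiv_reflMoll_space (T := T) hχ hε0 (fun c => flipSign (c i))
    (measurable_apply h.measurable_velocity i)
    (fun z => (abs_apply_le_norm _ i).trans (h.velocity_le z)) t x (EuclideanSpace.single j 1)
  refine Eq.trans h1 ?_
  simp

theorem deriv_mollField (hχ : IsTimeCutoff T δ χ) (hε0 : 0 < ε) (h : IsBoundedState r R M ρ u)
    (t : ℝ) (x : Space d) (i : Fin d) :
    deriv (fun s => mollField T χ ε u s x i) t = ∑ c : Fin d → Fin 3, flipSign (c i) *
      ∫ z' in cylinder d T, (timeKerAnti χ ε t z'.1 + timeKerSymm χ ε t z'.1) *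
        spaceKer ε c x z'.2 * u z' i :=
  deriv_reflMoll hχ hε0 _ (measurable_apply h.measurable_velocity i)
    (fun z => (abs_apply_le_norm _ i).trans (h.velocity_le z)) t x

theorem dt_mollEntropy (hP : PotentialBounds P P' r R C) (h : IsBoundedState r R M ρ u)
    (hχ : IsTimeCutoff T δ χ) (hε0 : 0 < ε) (t : ℝ) (x : Space d) :
    dt (mollEntropy T χ ε P' ρ u) t x = ∑ c : Fin d → Fin 3,
      ∫ z' in cylinder d T, (timeKerAnti χ ε t z'.1 + timeKerSymm χ ε t z'.1) *
        spaceKer ε c x z'.2 * entropyVar P' ρ u z' := by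
  refine (deriv_reflMoll hχ hε0 _ (measurable_entropyVar hP h) (abs_entropyVar_le hP h) t x).trans ?_
  simp only [one_mul]

theorem dx_mollEntropy (hP : PotentialBounds P P' r R C) (h : IsBoundedState r R M ρ u)
    (hχ : IsTimeCutoff T δ χ) (hε0 : 0 < ε) (t : ℝ) (x w : Space d) :
    dx (mollEntropy T χ ε P' ρ u) t x w = ∑ j, w j * ∑ c : Fin d → Fin 3,
      ∫ z' in cylinder d T, timeKer χ ε t z'.1 * spaceKer' ε c j x z'.2 * entropyVar P' ρ u z' := by
  have e : ∀ w, dx (mollEntropy T χ ε P' ρ u) t x w = ∑ c : Fin d → Fin 3,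
      1 * ∫ z' in cylinder d T, timeKer χ ε t z'.1 *
        (∑ j, w j * spaceKer' ε c j x z'.2) * entropyVar P' ρ u z' := fun w =>
    fderiv_reflMoll_space hχ hε0 _ (measurable_entropyVar hP h) (abs_entropyVar_le hP h) t x w
  rw [dx_eq_sum]
  refine Finset.sum_congr rfl fun j _ => ?_
  rw [e]
  simp

/-- The weak formulations, tested with the mollified entropy variables, express the total flux
in terms of the defect. -/
theorem totalFlux_eq_defect (hP : PotentialBounds P P' r R C) (hr : 0 ≤ r)
    (h : IsBoundedState r R M ρ u) (hw : HasWeakContinuity T ρ fun z => ρ z • u z)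
    (hm : HasWeakMomentum T P P' ρ u Rv Rp) (hχ : IsTimeCutoff T δ χ) (hδ : 0 < δ) (hε0 : 0 < ε)
    (hε : ε ≤ δ) (hε1 : ε ≤ 1) :
    totalFlux T χ ε P P' ρ u = -∫ t in Ioo 0 T, defectFlux Rv Rp (mollField T χ ε u) t := by
  have h1 := hw _ (contDiff_mollEntropy (T := T) hP h hχ hε0)
    ⟨δ, hδ, fun t x ht => reflMoll_eq_zero hχ hε0 hε _ _ ht x⟩
  have h2 := hm _ (contDiff_mollField hχ hε0 h)
    ⟨δ, hδ, fun t x ht => by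
      ext i
      exact reflMoll_eq_zero hχ hε0 hε _ _ ht x⟩
    fun t x i hx => reflMoll_face_eq_zero hχ hε0 hε1 (measurable_apply h.measurable_velocity i)
      (fun z => (abs_apply_le_norm _ i).trans (h.velocity_le z)) t hx
  refine Eq.trans ?_ (eq_neg_of_add_eq_zero_left h2)
  refine Eq.trans ?_ ((congrArg (_ + ·) h1).trans (add_zero _))
  rw [totalFlux_eq_integral hP hr h hχ hε0, ← integral_add
      (integrableOn_momentum hP h (contDiff_mollField hχ hε0 h))
      (integrableOn_continuity h (contDiff_mollEntropy hP h hχ hε0))]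
  refine integral_congr_ae (.of_forall fun z => ?_)
  have c1 : ∀ c, Continuous fun z' : ℝ × Space d =>
      (timeKerAnti χ ε z.1 z'.1 + timeKerSymm χ ε z.1 z'.1) * spaceKer ε c z.2 z'.2 := fun c => by
    have k1 := continuous_timeKerAnti hχ.contDiff ε
    have k2 := continuous_timeKerSymm hχ.contDiff ε
    have k3 : Continuous fun z' : ℝ × Space d => (z.1, z'.1) := by fun_prop
    exact ((k1.comp k3).add (k2.comp k3)).mul (continuous_spaceKer_snd ε z.2 c)
  have c2 : ∀ c j, Continuous fun z' : ℝ × Space d =>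
      timeKer χ ε z.1 z'.1 * spaceKer' ε c j z.2 z'.2 := fun c j =>
    (continuous_timeKer_fst hχ.contDiff ε z.1).mul (continuous_spaceKer'_snd ε z.2 c j)
  simp only [integral_pairing_mul hP h _ z (c1 _), integral_fluxPairing_mul hP h _ _ z (c2 _ _),
    div, grad_mollField hχ hε0 h, deriv_mollField hχ hε0 h, dt_mollEntropy hP h hχ hε0,
    dx_mollEntropy hP h hχ hε0, PiLp.smul_apply, smul_eq_mul]
  simp only [Finset.mul_sum, Finset.sum_add_distrib]
  have s1 : ∀ f : (Fin d → Fin 3) → Fin d → ℝ, ∑ c, ∑ i, f c i = ∑ i, ∑ c, f c i :=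
    fun f => Finset.sum_comm
  have s2 : ∀ f : (Fin d → Fin 3) → Fin d → Fin d → ℝ,
      ∑ c, ∑ j, ∑ i, f c j i = ∑ i, ∑ j, ∑ c, f c j i := fun f => by
    rw [Finset.sum_comm, Finset.sum_congr rfl fun j _ => Finset.sum_comm, Finset.sum_comm]
  rw [s1, s2, s1, s1]
  ring

end Euler

namespace Euler

section Time

variable {T δ ε B K : ℝ} {χ g h N : ℝ → ℝ}

/-! ### The decrease of the fluid energy -/

theorem integral_timeKer_le (hχ : IsTimeCutoff T δ χ) (hB : ∀ t, χ t ≤ B) (hε0 : 0 < ε) (t' : ℝ) :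
    ∫ t in Ioo 0 T, timeKer χ ε t t' ≤ B := by
  have hB0 : 0 ≤ B := (hχ.nonneg 0).trans (hB 0)
  have i1 : Integrable fun t => moll ε (t - t') := (Integrable.of_integral_ne_zero
    (by rw [integral_moll hε0]; exact one_ne_zero)).comp_sub_right t'
  calc ∫ t in Ioo 0 T, timeKer χ ε t t' ≤ ∫ t in Ioo 0 T, B * moll ε (t - t') := by
        refine integral_mono_of_nonneg (.of_forall fun t => timeKer_nonneg hχ hε0 t t')
          (i1.integrableOn.const_mul B) (.of_forall fun t => ?_)
        exact mul_le_mul_of_nonneg_right (hB _) (moll_nonneg hε0 _)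
    _ = B * ∫ t in Ioo 0 T, moll ε (t - t') := integral_const_mul _ _
    _ ≤ B * ∫ t, moll ε (t - t') := mul_le_mul_of_nonneg_left
        (setIntegral_le_integral i1 (.of_forall fun t => moll_nonneg hε0 _)) hB0
    _ = B := by rw [integral_sub_right_eq_self (moll ε), integral_moll hε0, mul_one]

/-- The time mollification of an integrable function `h`, integrated against a bounded function,
is controlled in the limit by a continuous function `g` up to the distance of `h` and `g` in `L¹`. -/
theorem exists_integral_timeKer_mul_le (hχ : IsTimeCutoff T δ χ) (hδ : 0 < δ) (hT : 0 < T)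
    (hB : ∀ t, χ t ≤ B) (hh : IntegrableOn h (Ioo 0 T)) (hg : Continuous g) (hN : Measurable N)
    (hN0 : ∀ t, 0 ≤ N t) (hNK : ∀ t, N t ≤ K) {η : ℝ} (hη : 0 < η) :
    ∃ ε₀ > 0, ∀ ε, 0 < ε → ε ≤ ε₀ →
      ∫ t in Ioo 0 T, (∫ t' in Ioo 0 T, timeKer χ ε t t' * h t') * N t ≤
        (∫ t in Ioo 0 T, χ t * g t * N t) + B * K * (∫ t in Ioo 0 T, |h t - g t|) + η := by
  have hB0 : 0 ≤ B := (hχ.nonneg 0).trans (hB 0)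
  have hK0 : 0 ≤ K := (hN0 0).trans (hNK 0)
  have hden : 0 < K * T + 1 := by positivity
  have hχc := hχ.contDiff.continuous
  obtain ⟨ε₀, hε₀, happ⟩ := exists_integral_mul_moll_approx (T := T) hδ
    (F := fun t t' => χ ((t + t') / 2) * g t') (by fun_prop)
    (fun t t' ht => by rw [hχ.eq_zero _ ht, zero_mul]) (div_pos hη hden)
  refine ⟨ε₀, hε₀, fun ε hε0 hε => ?_⟩
  set μ : Measure ℝ := volume.restrict (Ioo 0 T) with hμ
  obtain ⟨Cχ, hC0, hC1, -⟩ := hχ.exists_bound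
  have hNabs : ∀ t, |N t| ≤ K := fun t => by rw [abs_of_nonneg (hN0 t)]; exact hNK t
  have hNi : Integrable N μ := integrable_of_abs_le hN hNabs
  have hgi : Integrable g μ := (hg.integrableOn_Icc (a := 0) (b := T)).mono_set Ioo_subset_Icc_self
  have hi : ∀ f, Integrable f μ → Integrable
      (fun q : ℝ × ℝ => timeKer χ ε q.1 q.2 * (N q.1 * f q.2)) (μ.prod μ) := fun f hf =>
    (hNi.mul_prod hf).bdd_mul (continuous_timeKer hχ.contDiff ε).aestronglyMeasurable
      (.of_forall fun q => abs_timeKer_le hC1 hε0 q.1 q.2)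
  have hdi : Integrable (fun t => |h t - g t|) μ := (hh.sub hgi).abs
  have e : ∀ f, Integrable f μ → ∫ t, (∫ t', timeKer χ ε t t' * f t' ∂μ) * N t ∂μ =
      ∫ q, timeKer χ ε q.1 q.2 * (N q.1 * f q.2) ∂(μ.prod μ) := fun f hf => by
    rw [integral_prod _ (hi f hf)]
    refine integral_congr_ae (.of_forall fun t => ?_)
    simp only
    rw [← integral_mul_const]
    exact integral_congr_ae (.of_forall fun t' => by simp only; ring)
  have s1 : ∫ q, timeKer χ ε q.1 q.2 * (N q.1 * h q.2) ∂(μ.prod μ) ≤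
      (∫ q, timeKer χ ε q.1 q.2 * (N q.1 * g q.2) ∂(μ.prod μ)) +
        ∫ q, timeKer χ ε q.1 q.2 * (N q.1 * |h q.2 - g q.2|) ∂(μ.prod μ) := by
    rw [← integral_add (hi g hgi) (hi _ hdi)]
    refine integral_mono (hi h hh) ((hi g hgi).add (hi _ hdi)) fun q => ?_
    have h1 := timeKer_nonneg hχ hε0 q.1 q.2
    have h2 : h q.2 ≤ g q.2 + |h q.2 - g q.2| := by linarith [le_abs_self (h q.2 - g q.2)]
    have h3 := mul_le_mul_of_nonneg_left (mul_le_mul_of_nonneg_left h2 (hN0 q.1)) h1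
    refine h3.trans (le_of_eq ?_)
    ring
  have s2 : ∫ q, timeKer χ ε q.1 q.2 * (N q.1 * g q.2) ∂(μ.prod μ) ≤
      (∫ t, χ t * g t * N t ∂μ) + η := by
    have i1 : Integrable (fun t => χ t * g t * N t) μ :=
      (((hχc.mul hg).integrableOn_Icc (a := 0) (b := T)).mono_set Ioo_subset_Icc_self).mul_bdd
        hN.aestronglyMeasurable (.of_forall hNabs)
    rw [← e g hgi]
    have i2 : Integrable (fun t => (∫ t', timeKer χ ε t t' * g t' ∂μ) * N t) μ :=
      (hi g hgi).integral_prod_left.congr (.of_forall fun t => by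
        simp only
        rw [← integral_mul_const]
        exact integral_congr_ae (.of_forall fun t' => by simp only; ring))
    calc _ ≤ ∫ t, (χ t * g t * N t + η / (K * T + 1) * K) ∂μ := by
          refine integral_mono_ae i2 (i1.add (integrable_const _)) ?_
          filter_upwards [ae_restrict_mem measurableSet_Ioo] with t ht
          have h1 := (abs_le.1 (happ ε hε0 hε t ht)).2
          have h2 : ∫ t', timeKer χ ε t t' * g t' ∂μ =
              ∫ t' in Ioo 0 T, χ ((t + t') / 2) * g t' * moll ε (t - t') :=
            integral_congr_ae (.of_forall fun t' => by simp only [timeKer]; ring)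
          have h3 : (t + t) / 2 = t := by ring
          rw [h3] at h1
          rw [h2]
          have h4 : ∫ t' in Ioo 0 T, χ ((t + t') / 2) * g t' * moll ε (t - t') ≤
            χ t * g t + η / (K * T + 1) := by linarith
          refine (mul_le_mul_of_nonneg_right h4 (hN0 t)).trans ?_
          rw [add_mul]
          have h5 : 0 ≤ η / (K * T + 1) := by positivity
          have := mul_le_mul_of_nonneg_left (hNK t) h5
          linarith
      _ = (∫ t, χ t * g t * N t ∂μ) + T * (η / (K * T + 1) * K) := by
          rw [integral_add i1 (integrable_const _), integral_const, smul_eq_mul]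
          simp [hμ, hT.le]
      _ ≤ _ := by
          have h1 : T * (η / (K * T + 1) * K) = η * (K * T / (K * T + 1)) := by ring
          have h2 : K * T / (K * T + 1) ≤ 1 := by rw [div_le_one hden]; linarith
          have h3 := mul_le_mul_of_nonneg_left h2 hη.le
          linarith
  have s3 : ∫ q, timeKer χ ε q.1 q.2 * (N q.1 * |h q.2 - g q.2|) ∂(μ.prod μ) ≤
      B * K * ∫ t, |h t - g t| ∂μ := by
    rw [integral_prod_symm _ (hi _ hdi), ← integral_const_mul]
    refine integral_mono (hi _ hdi).integral_prod_right (hdi.const_mul _) fun t' => ?_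
    have i3 : Integrable (fun t => timeKer χ ε t t') μ := by
      have hc : Continuous fun t : ℝ => (t, t') := by fun_prop
      have := ((continuous_timeKer hχ.contDiff ε).comp hc)
      exact (this.integrableOn_Icc (a := 0) (b := T)).mono_set Ioo_subset_Icc_self
    calc ∫ t, timeKer χ ε t t' * (N t * |h t' - g t'|) ∂μ
        ≤ ∫ t, K * |h t' - g t'| * timeKer χ ε t t' ∂μ := by
          refine integral_mono_of_nonneg (.of_forall fun t => ?_) (i3.const_mul _)
            (.of_forall fun t => ?_)
          · exact mul_nonneg (timeKer_nonneg hχ hε0 _ _) (mul_nonneg (hN0 t) (abs_nonneg _))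
          · have := mul_le_mul_of_nonneg_left (mul_le_mul_of_nonneg_right (hNK t)
              (abs_nonneg (h t' - g t'))) (timeKer_nonneg hχ hε0 t t')
            refine this.trans (le_of_eq ?_)
            ring
      _ = K * |h t' - g t'| * ∫ t, timeKer χ ε t t' ∂μ := integral_const_mul _ _
      _ ≤ K * |h t' - g t'| * B := mul_le_mul_of_nonneg_left (integral_timeKer_le hχ hB hε0 t')
          (by positivity)
      _ = _ := by ring
  rw [e h hh]
  linarith

end Time

section

variable {d : ℕ} {T δ ε B K : ℝ} {χ D g N : ℝ → ℝ} {P P' : ℝ → ℝ} {r R C M α γ : ℝ}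
  {ρ : ℝ × Space d → ℝ} {u : ℝ × Space d → Space d}
  {Rv : ℝ → Fin d → Fin d → SignedMeasure (closedCube d)} {Rp : ℝ → Measure (closedCube d)}

/-- The defect flux of the mollified velocity field is bounded below by the defect energy. -/
theorem neg_integral_defectFlux_le (hγ : 1 < γ) (h : IsBoundedState r R M ρ u)
    (hosl : HasWeakOSL T u D) (hD : IntegrableOn D (Ioo 0 T))
    (hdef : ∀ᵐ t ∂volume.restrict (Ioo 0 T), IsDefect (Rv t) (Rp t))
    (hN : Measurable N) (hN0 : ∀ t, 0 ≤ N t) (hNK : ∀ t, N t ≤ K)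
    (hNe : ∀ᵐ t ∂volume.restrict (Ioo 0 T), defectEnergy γ Rv Rp t = N t)
    (hχ : IsTimeCutoff T δ χ) (hδ : 0 < δ) (hε0 : 0 < ε) (hε : ε ≤ δ) (hε1 : ε ≤ 1)
    {e : ℕ → ℝ} (he0 : ∀ n, 0 < e n) (he : Tendsto e atTop (𝓝 0))
    (hface : ∀ i, Tendsto (fun n => (e n)⁻¹ * ∫ z in faceLayer d T i (e n), |u z i|) atTop (𝓝 0)) :
    -∫ t in Ioo 0 T, defectFlux Rv Rp (mollField T χ ε u) t ≤ max 2 (d * (γ - 1)) *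
      ∫ t in Ioo 0 T, (∫ t' in Ioo 0 T, timeKer χ ε t t' * |D t'|) * N t := by
  set c : ℝ := max 2 (d * (γ - 1)) with hc
  have hc0 : 0 ≤ c := two_pos.le.trans (le_max_left _ _)
  obtain ⟨Cχ, hC0, hC1, -⟩ := hχ.exists_bound
  have hDabs : IntegrableOn (fun t => |D t|) (Ioo 0 T) := hD.abs
  let κ : ℝ → ℝ := fun t => ∫ t' in Ioo 0 T, timeKer χ ε t t' * |D t'|
  have hκ0 : ∀ t, 0 ≤ κ t := fun t =>
    integral_nonneg fun t' => mul_nonneg (timeKer_nonneg hχ hε0 _ _) (abs_nonneg _)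
  have hik : ∀ (t : ℝ) (f : ℝ → ℝ), IntegrableOn f (Ioo 0 T) →
      IntegrableOn (fun t' => timeKer χ ε t t' * f t') (Ioo 0 T) := fun t f hf => by
    have h1 : Continuous fun t' : ℝ => (t, t') := by fun_prop
    exact hf.bdd_mul ((continuous_timeKer hχ.contDiff ε).comp h1).aestronglyMeasurable
      (.of_forall fun t' => abs_timeKer_le hC1 hε0 t t')
  have hge : ∀ᵐ t ∂volume.restrict (Ioo 0 T),
      -(c * (κ t * N t)) ≤ defectFlux Rv Rp (mollField T χ ε u) t := by
    filter_upwards [hdef, hNe] with t ht hNt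
    have hcont := contDiff_mollField (T := T) hχ hε0 h
    have h1 := defectFlux_ge (κ := κ t) hγ ht (hκ0 t) (φ := mollField T χ ε u)
      (fun i j => by
        have h2 : Continuous fun x : Space d => (t, x) := by fun_prop
        have h3 := (continuous_grad hcont i j).comp h2
        exact h3)
      (fun x hx ξ => by
        have h2 := gradient_mollVelocity_ge hosl hD h.measurable_velocity h.velocity_le hχ hδ hε0
          hε hε1 he0 he hface t hx ξ
        have h3 : ∫ t' in Ioo 0 T, timeKer χ ε t t' * D t' ≤ κ t :=
          integral_mono (hik t D hD) (hik t _ hDabs) fun t' =>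
            mul_le_mul_of_nonneg_left (le_abs_self _) (timeKer_nonneg hχ hε0 _ _)
        have h4 : ∑ i, ξ i * fderiv ℝ (fun x => mollVelocity T χ ε u i (t, x)) x ξ =
            ∑ i, ∑ j, ξ i * ξ j * grad (mollField T χ ε u) t x i j := by
          refine Finset.sum_congr rfl fun i _ => ?_
          have h5 := dx_eq_sum (fun t x => mollVelocity T χ ε u i (t, x)) t x ξ
          rw [dx] at h5
          rw [h5, Finset.mul_sum]
          exact Finset.sum_congr rfl fun j _ => (mul_assoc _ _ _).symm
        rw [h4] at h2
        refine h2.trans ?_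
        gcongr)
    rw [hNt] at h1
    refine le_trans (le_of_eq ?_) h1
    ring
  have hi : IntegrableOn (fun t => κ t * N t) (Ioo 0 T) := by
    have h1 : Integrable (fun q : ℝ × ℝ => timeKer χ ε q.1 q.2 * (N q.1 * |D q.2|))
        ((volume.restrict (Ioo 0 T)).prod (volume.restrict (Ioo 0 T))) :=
      (Integrable.mul_prod (integrable_of_abs_le hN (K := K) fun t => by
        rw [abs_of_nonneg (hN0 t)]; exact hNK t) hDabs).bdd_mul
        (continuous_timeKer hχ.contDiff ε).aestronglyMeasurable
        (.of_forall fun q => abs_timeKer_le hC1 hε0 q.1 q.2)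
    refine h1.integral_prod_left.congr (.of_forall fun t => ?_)
    simp only [κ]
    rw [← integral_mul_const]
    exact integral_congr_ae (.of_forall fun t' => by simp only; ring)
  by_cases hfl : IntegrableOn (defectFlux Rv Rp (mollField T χ ε u)) (Ioo 0 T)
  · have h1 := integral_mono_ae (hi.const_mul c).neg hfl hge
    simp only [Pi.neg_apply] at h1
    rw [integral_neg, integral_const_mul] at h1
    linarith
  · rw [integral_undef hfl, neg_zero]
    exact mul_nonneg hc0 (integral_nonneg fun t => mul_nonneg (hκ0 t) (hN0 t))

/-- The localized inequality for the energy of the fluid: energy is lost, at most, at a rate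
controlled by the energy of the defect. -/
theorem integral_deriv_mul_energy_le (hγ : 1 < γ) (hP : PotentialBounds P P' r R C) (hr : 0 < r)
    (h : IsBoundedState r R M ρ u) (hw : HasWeakContinuity T ρ fun z => ρ z • u z)
    (hm : HasWeakMomentum T P P' ρ u Rv Rp) (hT : 0 < T) (hα : 1 / 3 < α) {C₁ C₂ C₃ : ℝ≥0}
    (hincρ : HasCubeIncr T α C₁ ρ) (hincu : HasCubeIncr T α C₂ u)
    (hincm : HasCubeIncr T α C₃ fun z => ρ z • u z)
    (hosl : HasWeakOSL T u D) (hD : IntegrableOn D (Ioo 0 T))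
    (hdef : ∀ᵐ t ∂volume.restrict (Ioo 0 T), IsDefect (Rv t) (Rp t))
    (hN : Measurable N) (hN0 : ∀ t, 0 ≤ N t) (hNK : ∀ t, N t ≤ K)
    (hNe : ∀ᵐ t ∂volume.restrict (Ioo 0 T), defectEnergy γ Rv Rp t = N t)
    (hg : Continuous g) (hχ : IsTimeCutoff T δ χ) (hδ : 0 < δ) (hB : ∀ t, χ t ≤ B) :
    ∫ z in cylinder d T, deriv χ z.1 * (ρ z * ‖u z‖ ^ 2 / 2 + P (ρ z)) ≤
      max 2 (d * (γ - 1)) * ((∫ t in Ioo 0 T, χ t * g t * N t) +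
        B * K * ∫ t in Ioo 0 T, |(|D t| - g t)|) := by
  set c : ℝ := max 2 (d * (γ - 1)) with hc
  have hc0 : 0 < c := two_pos.trans_le (le_max_left _ _)
  have hM : 0 ≤ M := (norm_nonneg _).trans (h.velocity_le 0)
  let ℓ : ℝ := min (min 1 (T / 2)) δ
  have hℓ : 0 < ℓ := lt_min (lt_min one_pos (half_pos hT)) hδ
  have hℓ1 : ℓ ≤ 1 := (min_le_left _ _).trans (min_le_left _ _)
  have hℓT : ℓ ≤ T / 2 := (min_le_left _ _).trans (min_le_right _ _)
  have hℓδ : ℓ ≤ δ := min_le_right _ _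
  let e : ℕ → ℝ := fun n => ℓ * (1 / 2) ^ n
  have he : Tendsto e atTop (𝓝 0) := tendsto_geometric ℓ
  have he0 : ∀ n, 0 < e n := fun n => by positivity
  have hele : ∀ n, e n ≤ ℓ := fun n =>
    mul_le_of_le_one_right hℓ.le (pow_le_one₀ (by norm_num) (by norm_num))
  have hface := fun i => tendsto_faceLayer h hr hw hα hincm i hℓ hℓ1 hℓT
  have hlim := tendsto_totalFlux hP hr.le hM h hχ hT hδ he0 he fun c =>
    tendsto_cubicDefect h hT hα hincρ hincu he0 he hface c
  refine le_of_forall_pos_le_add fun η hη => ?_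
  obtain ⟨ε₀, hε₀, happ⟩ := exists_integral_timeKer_mul_le hχ hδ hT hB hD.abs hg hN hN0 hNK
    (div_pos hη hc0)
  refine le_of_tendsto hlim ?_
  filter_upwards [he.eventually_le_const hε₀] with n hn
  rw [totalFlux_eq_defect hP hr.le h hw hm hχ hδ (he0 n) ((hele n).trans hℓδ) ((hele n).trans hℓ1)]
  refine (neg_integral_defectFlux_le hγ h hosl hD hdef hN hN0 hNK hNe hχ hδ (he0 n)
    ((hele n).trans hℓδ) ((hele n).trans hℓ1) he0 he hface).trans ?_
  refine (mul_le_mul_of_nonneg_left (happ _ (he0 n) hn) hc0.le).trans (le_of_eq ?_)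
  rw [mul_add _ _ (η / c), mul_div_cancel₀ _ hc0.ne']

end

end Euler

namespace Euler

variable {d : ℕ} {a γ T r R C M : ℝ} {ρ : ℝ → Space d → ℝ} {m : ℝ → Space d → Space d}
  {v : ℝ × Space d → ℝ} {w : ℝ × Space d → Space d}

/-! ### Bounded measurable versions of the state -/

theorem exists_ae_norm_le_of_memLp_top {α F : Type*} [MeasurableSpace α] [NormedAddCommGroup F]
    {μ : Measure α} {f : α → F} (hf : MemLp f ⊤ μ) : ∃ K, ∀ᵐ x ∂μ, ‖f x‖ ≤ K := by
  refine ⟨(eLpNorm f ⊤ μ).toReal, ?_⟩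
  have h := ae_le_eLpNormEssSup (f := f) (μ := μ)
  filter_upwards [h] with x hx
  rw [← toReal_enorm]
  exact ENNReal.toReal_mono hf.eLpNorm_lt_top.ne (by rwa [eLpNorm_exponent_top])

/-- Borel representatives of `ρ` and `u` that satisfy the bounds everywhere. -/
theorem exists_isBoundedState (hρ : MemLp (Function.uncurry ρ) ⊤ (volume.restrict (cylinder d T)))
    (hpos : ∃ r > 0, ∀ᵐ z ∂(volume.restrict (cylinder d T)), r ≤ ρ z.1 z.2)
    (hm : MemLp (Function.uncurry m) ⊤ (volume.restrict (cylinder d T))) :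
    ∃ (r R M : ℝ) (v : ℝ × Space d → ℝ) (w : ℝ × Space d → Space d), 0 < r ∧
      IsBoundedState r R M v w ∧ (∀ᵐ z ∂(volume.restrict (cylinder d T)), ρ z.1 z.2 = v z) ∧
      ∀ᵐ z ∂(volume.restrict (cylinder d T)), velocity ρ m z.1 z.2 = w z := by
  obtain ⟨r, hr, hρr⟩ := hpos
  obtain ⟨R₀, hR₀⟩ := exists_ae_norm_le_of_memLp_top hρ
  obtain ⟨A₀, hA₀⟩ := exists_ae_norm_le_of_memLp_top hm
  let R := max r R₀
  let M := r⁻¹ * |A₀|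
  have hM : 0 ≤ M := by positivity
  have hu : AEStronglyMeasurable (fun z : ℝ × Space d => velocity ρ m z.1 z.2)
      (volume.restrict (cylinder d T)) :=
    (hρ.1.aemeasurable.inv.smul hm.1.aemeasurable).aestronglyMeasurable
  let v₀ := hρ.1.mk
  let w₀ := hu.mk
  have hv₀ : Measurable v₀ := hρ.1.stronglyMeasurable_mk.measurable
  have hw₀ : Measurable w₀ := hu.stronglyMeasurable_mk.measurable
  refine ⟨r, R, M, fun z => max r (min R (v₀ z)), fun z => if ‖w₀ z‖ ≤ M then w₀ z else 0, hr,
    ⟨measurable_const.max (measurable_const.min hv₀),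
      Measurable.ite (measurableSet_le hw₀.norm measurable_const) hw₀ measurable_const,
      fun z => ⟨le_max_left _ _, max_le (le_max_left _ _) (min_le_left _ _)⟩, fun z => ?_⟩, ?_, ?_⟩
  · split_ifs with h
    · exact h
    · simpa using hM
  · filter_upwards [hρ.1.ae_eq_mk, hρr, hR₀] with z h1 h2 h3
    have h4 : v₀ z = ρ z.1 z.2 := h1.symm
    have h5 : ρ z.1 z.2 ≤ R := (le_abs_self _).trans (h3.trans (le_max_right _ _))
    rw [h4, min_eq_right h5, max_eq_right h2]
  · filter_upwards [hu.ae_eq_mk, hρr, hA₀] with z h1 h2 h3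
    have h4 : w₀ z = velocity ρ m z.1 z.2 := h1.symm
    have h5 : ‖velocity ρ m z.1 z.2‖ ≤ M := by
      rw [velocity, norm_smul, norm_inv, Real.norm_of_nonneg (hr.le.trans h2)]
      exact mul_le_mul (inv_anti₀ hr h2) (h3.trans (le_abs_self _)) (norm_nonneg _)
        (inv_nonneg.2 hr.le)
    rw [h4, if_pos h5]

/-! ### Weak formulations over the cylinder -/

theorem integral_cylinder_eq {F : ℝ × Space d → ℝ} (hF : IntegrableOn F (cylinder d T)) :
    ∫ z in cylinder d T, F z = ∫ t in Ioo 0 T, ∫ x in cube d, F (t, x) := by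
  rw [restrict_cylinder]
  rw [IntegrableOn, restrict_cylinder] at hF
  exact integral_prod _ hF

theorem intervalIntegral_eq_of_eq_zero {τ : ℝ} (hτ : τ ∈ Ioo 0 T) {f : ℝ → ℝ}
    (hf : ∀ t, τ ≤ t → f t = 0) : ∫ t in (0 : ℝ)..τ, f t = ∫ t in Ioo 0 T, f t := by
  rw [← setIntegral_Ioo_eq hτ.1.le]
  exact (setIntegral_eq_of_subset_of_forall_sdiff_eq_zero measurableSet_Ioo
    (Ioo_subset_Ioo_right hτ.2.le) fun t ht => hf t (by
      by_contra! h
      exact ht.2 ⟨ht.1.1, h⟩)).symm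

/-- A time before the final time, after which a function supported in `[δ, T - δ]` vanishes with its
derivatives. -/
theorem exists_time {δ : ℝ} (hT : 0 < T) (hδ : 0 < δ) : ∃ τ ∈ Ioo 0 T, T - δ < τ := by
  have h1 := min_le_left δ T
  have h2 := min_le_right δ T
  have h3 : 0 < min δ T := lt_min hδ hT
  exact ⟨T - min δ T / 2, ⟨by linarith, by linarith⟩, by linarith⟩

theorem hasWeakContinuity (hT : 0 < T) (hc : ContinuityEq T ρ m) (h : IsBoundedState r R M v w)
    (hρ : ∀ᵐ z ∂(volume.restrict (cylinder d T)), ρ z.1 z.2 = v z)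
    (hm : ∀ᵐ z ∂(volume.restrict (cylinder d T)), m z.1 z.2 = v z • w z) :
    HasWeakContinuity T v fun z => v z • w z := by
  rintro φ hφ ⟨δ, hδ, hφ0⟩
  obtain ⟨τ, hτ, hτδ⟩ := exists_time hT hδ
  have hz : ∀ t, T - δ ≤ t → ∀ x, φ t x = 0 := fun t ht x =>
    hφ0 t x fun h => absurd h.2 (not_lt.2 ht)
  have h1 := hc τ hτ φ ⟨hφ, T - δ, by linarith, fun t _ ht x _ => hz t ht x⟩
  have h2 : ∀ x, φ τ x = 0 := hz τ hτδ.le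
  have h3 : ∀ x, φ 0 x = 0 := fun x => hφ0 0 x fun h => absurd h.1 (not_lt.2 hδ.le)
  simp only [h2, h3, mul_zero, integral_zero, sub_zero] at h1
  rw [integral_cylinder_eq (integrableOn_continuity h hφ)]
  refine Eq.trans ?_ h1.symm
  rw [intervalIntegral_eq_of_eq_zero hτ fun t ht => ?_]
  · refine integral_congr_ae ?_
    filter_upwards [ae_ae_of_ae_cylinder (p := fun t x => ρ t x = v (t, x)) hρ,
      ae_ae_of_ae_cylinder (p := fun t x => m t x = v (t, x) • w (t, x)) hm] with t ht1 ht2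
    refine integral_congr_ae ?_
    filter_upwards [ht1, ht2] with x hx1 hx2
    rw [hx1, hx2]
  · refine integral_eq_zero_of_ae (.of_forall fun x => ?_)
    have e1 : dt φ t x = 0 := by
      refine ((EventuallyEq.deriv_eq (f := fun _ : ℝ => (0 : ℝ)) ?_).trans (deriv_const _ _))
      filter_upwards [lt_mem_nhds (hτδ.trans_le ht)] with s hs using hz s hs.le x
    have e2 : φ t = fun _ => 0 := funext (hz t (hτδ.le.trans ht))
    simp [e1, dx, e2]

theorem hasWeakOSL {D : ℝ → ℝ} (hT : 0 < T) (ho : OneSidedLipschitz T (velocity ρ m) D)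
    (h : IsBoundedState r R M v w) (hD : IntegrableOn D (Ioo 0 T))
    (hu : ∀ᵐ z ∂(volume.restrict (cylinder d T)), velocity ρ m z.1 z.2 = w z) :
    HasWeakOSL T w D := by
  intro ξ φ hφ hφ0
  have h1 := ho ξ φ hφ hφ0
  have hc : Continuous fun z : ℝ × Space d => φ z.1 z.2 := hφ.contDiff.continuous
  have hi : IntegrableOn (fun z => -(inner ℝ ξ (w z) * dx φ z.1 z.2 ξ) +
      D z.1 * ‖ξ‖ ^ 2 * φ z.1 z.2) (cylinder d T) := by
    have h2 : IntegrableOn (fun z => inner ℝ ξ (w z)) (cylinder d T) := by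
      simp only [inner_eq_sum]
      exact integrable_finsetSum _ fun i _ =>
        (integrableOn_apply h.measurable_velocity h.velocity_le i).const_mul _
    exact (integrableOn_mul_of_continuous h2 (continuous_dx hφ.contDiff ξ)).neg.add
      (integrableOn_mul_of_continuous ((integrableOn_comp_fst (d := d) hD).mul_const _) hc)
  rw [integral_cylinder_eq hi]
  refine h1.trans (le_of_eq ?_)
  rw [← setIntegral_Ioo_eq hT.le]
  refine integral_congr_ae ?_
  filter_upwards [ae_ae_of_ae_cylinder (p := fun t x => velocity ρ m t x = w (t, x)) hu] with t ht
  refine integral_congr_ae ?_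
  filter_upwards [ht] with x hx
  rw [hx]

theorem dt_apply {φ : ℝ → Space d → Space d} (hφ : ContDiff ℝ 1 (Function.uncurry φ)) (t : ℝ)
    (x : Space d) (i : Fin d) : dt φ t x i = deriv (fun s => φ s x i) t := by
  have h1 : ContDiff ℝ 1 fun s : ℝ => φ s x := by
    have h2 : ContDiff ℝ 1 fun s : ℝ => (s, x) := by fun_prop
    exact hφ.comp h2
  have h3 := (h1.differentiable one_ne_zero t).hasDerivAt
  have h4 := (EuclideanSpace.proj i : Space d →L[ℝ] ℝ).hasFDerivAt.comp_hasDerivAt t h3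
  exact h4.deriv.symm

/-- The momentum equation in the form `HasWeakMomentum`: with a time `τ` after the support of
the test function, the terms at `0` and `τ` vanish. -/
theorem hasWeakMomentum {Rv : ℝ → Fin d → Fin d → SignedMeasure (closedCube d)}
    {Rp : ℝ → Measure (closedCube d)} (hγ : 1 < γ) (hT : 0 < T)
    (hc : DefectMomentumEq a γ T ρ m Rv Rp) (hr : 0 < r)
    (hP : PotentialBounds (pressurePotential a γ) (potential' a γ) r R C)
    (h : IsBoundedState r R M v w)
    (hρ : ∀ᵐ z ∂(volume.restrict (cylinder d T)), ρ z.1 z.2 = v z)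
    (hm : ∀ᵐ z ∂(volume.restrict (cylinder d T)), m z.1 z.2 = v z • w z) :
    HasWeakMomentum T (pressurePotential a γ) (potential' a γ) v w Rv Rp := by
  rintro φ hφ ⟨δ, hδ, hφ0⟩ hn
  obtain ⟨τ, hτ, hτδ⟩ := exists_time hT hδ
  have hz : ∀ t, T - δ ≤ t → ∀ x, φ t x = 0 := fun t ht x =>
    hφ0 t x fun h => absurd h.2 (not_lt.2 ht)
  have h1 := hc τ hτ φ ⟨hφ, T - δ, by linarith, fun t _ ht x _ => hz t ht x⟩
    fun t _ x _ i hi => hn t x i hi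
  have h2 : ∀ x, φ τ x = 0 := hz τ hτδ.le
  have h3 : ∀ x, φ 0 x = 0 := fun x => hφ0 0 x fun h => absurd h.1 (not_lt.2 hδ.le)
  simp only [h2, h3, inner_zero_right, integral_zero, sub_zero] at h1
  have e2 : ∀ t, τ ≤ t → ∀ x i j, grad φ t x i j = 0 := fun t ht x i j => by
    have e3 : (fun y => φ t y i) = fun _ => 0 := funext fun y => by
      rw [hz t (hτδ.le.trans ht) y]; rfl
    simp [grad, e3]
  rw [integral_cylinder_eq (integrableOn_momentum hP h hφ)]
  refine Eq.trans ?_ h1.symm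
  rw [intervalIntegral_eq_of_eq_zero hτ fun t ht => ?_, intervalIntegral_eq_of_eq_zero hτ fun t ht => ?_]
  · congr 1
    refine integral_congr_ae ?_
    filter_upwards [ae_ae_of_ae_cylinder (p := fun t x => ρ t x = v (t, x)) hρ,
      ae_ae_of_ae_cylinder (p := fun t x => m t x = v (t, x) • w (t, x)) hm] with t ht1 ht2
    refine integral_congr_ae ?_
    filter_upwards [ht1, ht2] with x hx1 hx2
    have hv := hr.trans_le (h.density_mem (t, x)).1
    rw [hx1, hx2, pressure_eq hγ hv, inner_eq_sum]
    congr 1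
    congr 1
    · refine Finset.sum_congr rfl fun i _ => ?_
      rw [dt_apply hφ]
      rfl
    · refine Finset.sum_congr rfl fun i _ => Finset.sum_congr rfl fun j _ => ?_
      simp only [PiLp.smul_apply, smul_eq_mul]
      field_simp
  · simp [defectFlux, div, e2 t ht]
  · refine integral_eq_zero_of_ae (.of_forall fun x => ?_)
    have e1 : dt φ t x = 0 := by
      refine ((EventuallyEq.deriv_eq (f := fun _ : ℝ => (0 : Space d)) ?_).trans (deriv_const _ _))
      filter_upwards [lt_mem_nhds (hτδ.trans_le ht)] with s hs using hz s hs.le x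
    simp [e1, div, e2 t ht]

/-! ### The energy and its initial value -/

theorem kineticDensity_of_pos {s : ℝ} (hs : 0 < s) (y : Space d) :
    kineticDensity s y = ENNReal.ofReal (‖y‖ ^ 2 / (2 * s)) := by
  rw [kineticDensity]
  split_ifs with h
  · simp [h]
  · rfl

theorem pressurePotential_nonneg (ha : 0 < a) (hγ : 1 < γ) {s : ℝ} (hs : 0 ≤ s) :
    0 ≤ pressurePotential a γ s :=
  mul_nonneg (div_nonneg ha.le (by linarith)) (Real.rpow_nonneg hs _)

theorem toReal_fluidEnergy (ha : 0 < a) (hγ : 1 < γ) {n : Space d → ℝ} {k : Space d → Space d}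
    (hn : AEMeasurable n (volume.restrict (cube d))) (hk : AEMeasurable k (volume.restrict (cube d)))
    (hn0 : ∀ᵐ x ∂(volume.restrict (cube d)), 0 < n x) :
    (fluidEnergy a γ n k).toReal =
      ∫ x in cube d, (‖k x‖ ^ 2 / (2 * n x) + pressurePotential a γ (n x)) := by
  rw [integral_eq_lintegral_of_nonneg_ae, fluidEnergy]
  · congr 1
    refine lintegral_congr_ae ?_
    filter_upwards [hn0] with x hx
    rw [kineticDensity_of_pos hx, ENNReal.ofReal_add (by positivity)
      (pressurePotential_nonneg ha hγ hx.le)]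
  · filter_upwards [hn0] with x hx
    exact add_nonneg (by positivity) (pressurePotential_nonneg ha hγ hx.le)
  · unfold pressurePotential
    exact (((hk.norm.pow_const 2).div (hn.const_mul 2)).add
      ((hn.pow_const γ).const_mul _)).aestronglyMeasurable

end Euler

namespace Euler

variable {d : ℕ} {a γ T r R C M α ℓ : ℝ} {ρ : ℝ → Space d → ℝ} {m : ℝ → Space d → Space d}
  {v : ℝ × Space d → ℝ} {w : ℝ × Space d → Space d} {P P' : ℝ → ℝ}

theorem HasCubeIncr.apply {C : ℝ≥0} {f : ℝ × Space d → Space d} (h : HasCubeIncr T α C f)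
    (i : Fin d) : HasCubeIncr T α C fun z => f z i := fun k hk => by
  refine (eLpNorm_mono fun z => ?_).trans (h k hk)
  rw [← PiLp.sub_apply]
  exact abs_apply_le_norm _ i

theorem integrableOn_of_memLp_ofReal {F : Type*} [NormedAddCommGroup F] {f : Space d → F} {p : ℝ}
    (hp : 1 ≤ p) (hf : MemLp f (ENNReal.ofReal p) (volume.restrict (cube d))) :
    IntegrableOn f (cube d) :=
  hf.integrable (ENNReal.one_le_ofReal.2 hp)

theorem MemCWeak.continuousOn_integral_mul {p : ℝ} (h : MemCWeak p T ρ) {ψ : Space d → ℝ}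
    (hψ : Continuous ψ) (hψc : HasCompactSupport ψ) :
    ContinuousOn (fun t => ∫ x in cube d, ρ t x * ψ x) (Icc 0 T) := by
  have h1 := h.continuousOn ψ (hψ.memLp_of_hasCompactSupport hψc)
  refine h1.congr fun t _ => integral_congr_ae (.of_forall fun x => ?_)
  simp [mul_comm]

theorem MemCWeak.continuousOn_integral_apply_mul {p : ℝ} (h : MemCWeak p T m) {ψ : Space d → ℝ}
    (hψ : Continuous ψ) (hψc : HasCompactSupport ψ) (i : Fin d) :
    ContinuousOn (fun t => ∫ x in cube d, m t x i * ψ x) (Icc 0 T) := by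
  have hs : Continuous fun x => EuclideanSpace.single i (ψ x) := by
    have h2 : (fun x => EuclideanSpace.single i (ψ x)) =
        fun x => ψ x • EuclideanSpace.single i (1 : ℝ) := funext fun x => single_eq_smul i _
    rw [h2]
    exact hψ.smul continuous_const
  have hsc : HasCompactSupport fun x => EuclideanSpace.single i (ψ x) :=
    hψc.comp_left (g := fun y : ℝ => EuclideanSpace.single i y) (by simp)
  have h1 := h.continuousOn _ (hs.memLp_of_hasCompactSupport hsc)
  refine h1.congr fun t _ => integral_congr_ae (.of_forall fun x => ?_)
  simp only
  rw [EuclideanSpace.inner_single_right, conj_trivial, mul_comm]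

/-- The energy density `|m|² / (2 ρ) + P(ρ)` is Lipschitz in `(ρ, m)` on bounded sets without
vacuum. -/
theorem abs_energy_sub_le (hP : PotentialBounds P P' r R C) (hr : 0 < r) {A s n : ℝ}
    (hs : s ∈ Icc r R) (hn : n ∈ Icc r R) {y k : Space d} (hy : ∀ i, |y i| ≤ A)
    (hk : ∀ i, |k i| ≤ A) :
    |(‖y‖ ^ 2 / (2 * s) + P s) - (‖k‖ ^ 2 / (2 * n) + P n)| ≤
      (C + d * A ^ 2 / (2 * r ^ 2) + |A| / r) * (|s - n| + ∑ i, |y i - k i|) := by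
  have hs0 := hr.trans_le hs.1
  have hn0 := hr.trans_le hn.1
  have hC := hP.nonneg
  have e : (‖y‖ ^ 2 / (2 * s) + P s) - (‖k‖ ^ 2 / (2 * n) + P n) =
      (∑ i, (y i + k i) * (y i - k i)) / (2 * s) + ‖k‖ ^ 2 / (2 * (s * n)) * (n - s) +
        (P s - P n) := by
    have h1 : ∑ i, (y i + k i) * (y i - k i) = ‖y‖ ^ 2 - ‖k‖ ^ 2 := by
      simp only [EuclideanSpace.norm_sq_eq, Real.norm_eq_abs, sq_abs, ← Finset.sum_sub_distrib]
      exact Finset.sum_congr rfl fun i _ => by ring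
    rw [h1]
    field_simp
    ring
  have b1 : |(∑ i, (y i + k i) * (y i - k i)) / (2 * s)| ≤ |A| / r * ∑ i, |y i - k i| := by
    rw [abs_div, abs_of_pos (by positivity : 0 < 2 * s), div_le_iff₀ (by positivity)]
    have h1 : |∑ i, (y i + k i) * (y i - k i)| ≤ 2 * |A| * ∑ i, |y i - k i| := by
      rw [Finset.mul_sum]
      refine (Finset.abs_sum_le_sum_abs _ _).trans (Finset.sum_le_sum fun i _ => ?_)
      rw [abs_mul]
      refine mul_le_mul_of_nonneg_right ?_ (abs_nonneg _)
      have := abs_add_le (y i) (k i)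
      linarith [hy i, hk i, le_abs_self A]
    refine h1.trans ?_
    have h2 : 0 ≤ ∑ i, |y i - k i| := Finset.sum_nonneg fun i _ => abs_nonneg _
    have h3 : |A| / r * (∑ i, |y i - k i|) * (2 * s) = 2 * |A| * (∑ i, |y i - k i|) * (s / r) := by
      ring
    rw [h3]
    exact le_mul_of_one_le_right (by positivity) ((one_le_div hr).2 hs.1)
  have b2 : |‖k‖ ^ 2 / (2 * (s * n)) * (n - s)| ≤ d * A ^ 2 / (2 * r ^ 2) * |s - n| := by
    rw [abs_mul, abs_sub_comm n s, abs_of_nonneg (by positivity)]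
    refine mul_le_mul_of_nonneg_right ?_ (abs_nonneg _)
    have h1 : ‖k‖ ^ 2 ≤ d * A ^ 2 := by
      rw [EuclideanSpace.norm_sq_eq]
      refine (Finset.sum_le_sum fun i _ =>
        pow_le_pow_left₀ (norm_nonneg _) (hk i) 2).trans (le_of_eq (by simp))
    have h2 : r ^ 2 ≤ s * n := by
      rw [sq]; exact mul_le_mul hs.1 hn.1 hr.le hs0.le
    gcongr
  have b3 := hP.lipschitz s hs n hn
  have h2 : 0 ≤ ∑ i, |y i - k i| := Finset.sum_nonneg fun i _ => abs_nonneg _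
  have h3 := abs_nonneg (s - n)
  have h4 : 0 ≤ d * A ^ 2 / (2 * r ^ 2) := by positivity
  have h5 : 0 ≤ |A| / r := by positivity
  rw [e]
  refine (abs_add_le _ _).trans ((add_le_add ((abs_add_le _ _).trans (add_le_add b1 b2)) b3).trans ?_)
  nlinarith [mul_nonneg hC h2, mul_nonneg h4 h2, mul_nonneg h5 h3]

theorem IsBoundedState.measurable_energy (h : IsBoundedState r R M v w)
    (hP : PotentialBounds P P' r R C) : Measurable fun z => v z * ‖w z‖ ^ 2 / 2 + P (v z) :=
  ((h.measurable_density.mul (h.measurable_velocity.norm.pow_const 2)).div_const 2).add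
    (hP.measurable.comp h.measurable_density)

theorem IsBoundedState.abs_energy_le (h : IsBoundedState r R M v w)
    (hP : PotentialBounds P P' r R C) (hr : 0 ≤ r) (z : ℝ × Space d) :
    |v z * ‖w z‖ ^ 2 / 2 + P (v z)| ≤ R * M ^ 2 / 2 + C := by
  have h1 := hr.trans (h.density_mem z).1
  refine (abs_add_le _ _).trans (add_le_add ?_ (hP.bound _ (h.density_mem z)))
  rw [abs_of_nonneg (by positivity)]
  have h2 := h.velocity_le z
  have h3 := (h.density_mem z).2
  have h4 : 0 ≤ R := h1.trans h3
  gcongr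

/-- The energy of the fluid attains its initial value in the mean. -/
theorem tendsto_average_energy (hγ : 1 < γ) (hT : 0 < T) (hs : IsState a γ T ρ m) (hr : 0 < r)
    (hP : PotentialBounds P P' r R C) (h : IsBoundedState r R M v w)
    (hρ : ∀ᵐ z ∂(volume.restrict (cylinder d T)), ρ z.1 z.2 = v z)
    (hm : ∀ᵐ z ∂(volume.restrict (cylinder d T)), m z.1 z.2 = v z • w z) (hα : 1 / 3 < α)
    {C₁ C₃ : ℝ≥0} (hincρ : HasCubeIncr T α C₁ v) (hincm : HasCubeIncr T α C₃ fun z => v z • w z)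
    (hℓ : 0 < ℓ) (hℓT : ℓ ≤ T) :
    (∀ᵐ x ∂(volume.restrict (cube d)), 0 < ρ 0 x) ∧
    Tendsto (fun n : ℕ => (ℓ * (1 / 2) ^ n)⁻¹ * ∫ s in Ioo 0 (ℓ * (1 / 2) ^ n),
      |(∫ x in cube d, (v (s, x) * ‖w (s, x)‖ ^ 2 / 2 + P (v (s, x)))) -
        ∫ x in cube d, (‖m 0 x‖ ^ 2 / (2 * ρ 0 x) + P (ρ 0 x))|) atTop (𝓝 0) := by
  have h0 : (0 : ℝ) ∈ Icc 0 T := ⟨le_rfl, hT.le⟩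
  have hq : 1 ≤ 2 * γ / (γ + 1) := by rw [le_div_iff₀ (by linarith)]; linarith
  have iρ : IntegrableOn (ρ 0) (cube d) :=
    integrableOn_of_memLp_ofReal hγ.le (hs.density.memLp 0 h0)
  have im : IntegrableOn (m 0) (cube d) :=
    integrableOn_of_memLp_ofReal hq (hs.momentum.memLp 0 h0)
  have imi : ∀ i, IntegrableOn (fun x => m 0 x i) (cube d) := fun i =>
    (EuclideanSpace.proj i : Space d →L[ℝ] ℝ).integrable_comp im
  have hR : 0 < R := hr.trans_le ((h.density_mem 0).1.trans (h.density_mem 0).2)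
  have hM : 0 ≤ M := (norm_nonneg _).trans (h.velocity_le 0)
  have hmi : ∀ i, Measurable fun z => (v z • w z) i := fun i =>
    measurable_apply (h.measurable_density.smul h.measurable_velocity) i
  have hmb : ∀ i z, |(v z • w z) i| ≤ R * M := fun i z => by
    refine (abs_apply_le_norm _ i).trans ?_
    rw [norm_smul, Real.norm_of_nonneg (hr.le.trans (h.density_mem z).1)]
    exact mul_le_mul (h.density_mem z).2 (h.velocity_le z) (norm_nonneg _) hR.le
  set e : ℕ → ℝ := fun n => ℓ * (1 / 2) ^ n with hedef
  have he0 : ∀ n, 0 < e n := fun n => by positivity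
  have hvb : ∀ z, |v z| ≤ R := fun z => by
    rw [abs_of_nonneg (hr.le.trans (h.density_mem z).1)]; exact (h.density_mem z).2
  have l1 := tendsto_initial (f := ρ) hρ h.measurable_density hvb hα hincρ hT
    iρ (fun ψ hψ hψc => hs.density.continuousOn_integral_mul hψ hψc) hℓ hℓT
  have l2 := fun i => tendsto_initial (f := fun t x => m t x i) (v := fun z => (v z • w z) i)
    (by filter_upwards [hm] with z hz; rw [hz]) (hmi i) (hmb i) hα (hincm.apply i) hT (imi i)
    (fun ψ hψ hψc => hs.momentum.continuousOn_integral_apply_mul hψ hψc i) hℓ hℓT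
  have a1 := ae_mem_Icc_of_tendsto h.measurable_density h.density_mem iρ he0 l1
  have a2 := fun i => ae_mem_Icc_of_tendsto (hmi i) (a := -(R * M)) (b := R * M)
    (fun z => abs_le.1 (hmb i z)) (imi i) he0 (l2 i)
  refine ⟨a1.mono fun x hx => hr.trans_le hx.1, ?_⟩
  set L : ℝ := C + d * (R * M) ^ 2 / (2 * r ^ 2) + |R * M| / r with hL
  have hL0 : 0 ≤ L := by have := hP.nonneg; positivity
  have hlim : Tendsto (fun n => L * ((e n)⁻¹ * (∫ s in Ioo 0 (e n), ∫ x in cube d,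
      |v (s, x) - ρ 0 x|) + ∑ i, (e n)⁻¹ * ∫ s in Ioo 0 (e n), ∫ x in cube d,
      |(v (s, x) • w (s, x)) i - m 0 x i|)) atTop (𝓝 0) := by
    have := (l1.add (tendsto_finsetSum Finset.univ fun i _ => l2 i)).const_mul L
    rw [Finset.sum_const_zero, add_zero, mul_zero] at this
    exact this
  refine squeeze_zero (fun n => mul_nonneg (inv_nonneg.2 (he0 n).le)
    (integral_nonneg fun s => abs_nonneg _)) (fun n => ?_) hlim
  -- integrability of the increments
  set ν : Measure ℝ := volume.restrict (Ioo 0 (e n)) with hν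
  set κ : Measure (Space d) := volume.restrict (cube d) with hκ
  have iv : Integrable v (ν.prod κ) := integrable_of_abs_le h.measurable_density hvb
  have j1 : Integrable (fun s => ∫ x, |v (s, x) - ρ 0 x| ∂κ) ν :=
    (iv.sub (iρ.comp_snd ν)).abs.integral_prod_left
  have j2 : ∀ i, Integrable (fun s => ∫ x, |(v (s, x) • w (s, x)) i - m 0 x i| ∂κ) ν := fun i =>
    ((integrable_of_abs_le (hmi i) (hmb i)).sub ((imi i).comp_snd ν)).abs.integral_prod_left
  have hkey : ∀ s, |(∫ x, (v (s, x) * ‖w (s, x)‖ ^ 2 / 2 + P (v (s, x))) ∂κ) -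
      ∫ x, (‖m 0 x‖ ^ 2 / (2 * ρ 0 x) + P (ρ 0 x)) ∂κ| ≤
      L * ((∫ x, |v (s, x) - ρ 0 x| ∂κ) +
        ∑ i, ∫ x, |(v (s, x) • w (s, x)) i - m 0 x i| ∂κ) := fun s => by
    have hsx : Measurable fun x : Space d => (s, x) := measurable_prodMk_left
    have k1 : Integrable (fun x => |v (s, x) - ρ 0 x|) κ :=
      ((integrable_of_abs_le (h.measurable_density.comp hsx) fun x => hvb (s, x)).sub iρ).abs
    have k2 : ∀ i, Integrable (fun x => |(v (s, x) • w (s, x)) i - m 0 x i|) κ := fun i =>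
      ((integrable_of_abs_le ((hmi i).comp hsx) fun x => hmb i (s, x)).sub (imi i)).abs
    have k3 : Integrable (fun x => v (s, x) * ‖w (s, x)‖ ^ 2 / 2 + P (v (s, x))) κ :=
      integrable_of_abs_le ((h.measurable_energy hP).comp hsx) fun x => h.abs_energy_le hP hr.le (s, x)
    have k4 : Integrable (fun x => L * (|v (s, x) - ρ 0 x| +
        ∑ i, |(v (s, x) • w (s, x)) i - m 0 x i|)) κ :=
      (k1.add (integrable_finsetSum _ fun i _ => k2 i)).const_mul L
    have hb : ∀ᵐ x ∂κ, ‖(v (s, x) * ‖w (s, x)‖ ^ 2 / 2 + P (v (s, x))) -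
        (‖m 0 x‖ ^ 2 / (2 * ρ 0 x) + P (ρ 0 x))‖ ≤ L * (|v (s, x) - ρ 0 x| +
        ∑ i, |(v (s, x) • w (s, x)) i - m 0 x i|) := by
      filter_upwards [a1, ae_all_iff.2 a2] with x hx1 hx2
      have h1 := h.density_mem (s, x)
      have h2 := hr.trans_le h1.1
      have h3 := abs_energy_sub_le hP hr h1 hx1 (fun i => hmb i (s, x)) fun i => abs_le.2 (hx2 i)
      have h4 : ‖v (s, x) • w (s, x)‖ ^ 2 / (2 * v (s, x)) = v (s, x) * ‖w (s, x)‖ ^ 2 / 2 := by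
        rw [norm_smul, Real.norm_of_nonneg h2.le]
        field_simp
      rw [h4] at h3
      exact h3
    have k5 : Integrable (fun x => (v (s, x) * ‖w (s, x)‖ ^ 2 / 2 + P (v (s, x))) -
        (‖m 0 x‖ ^ 2 / (2 * ρ 0 x) + P (ρ 0 x))) κ := by
      refine k4.mono' ?_ hb
      refine k3.aestronglyMeasurable.sub (AEMeasurable.aestronglyMeasurable ?_)
      exact ((im.aestronglyMeasurable.aemeasurable.norm.pow_const 2).div
        (iρ.aestronglyMeasurable.aemeasurable.const_mul 2)).add
        (hP.measurable.comp_aemeasurable iρ.aestronglyMeasurable.aemeasurable)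
    have k6 : Integrable (fun x => ‖m 0 x‖ ^ 2 / (2 * ρ 0 x) + P (ρ 0 x)) κ :=
      (k3.sub k5).congr (.of_forall fun x => by simp)
    rw [← integral_sub k3 k6, ← Real.norm_eq_abs]
    refine (norm_integral_le_of_norm_le k4 hb).trans (le_of_eq ?_)
    rw [integral_const_mul, integral_add k1 (integrable_finsetSum _ fun i _ => k2 i),
      integral_finsetSum _ fun i _ => k2 i]
  have j3 : Integrable (fun s => L * ((∫ x, |v (s, x) - ρ 0 x| ∂κ) +
        ∑ i, ∫ x, |(v (s, x) • w (s, x)) i - m 0 x i| ∂κ)) ν :=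
    (j1.add (integrable_finsetSum _ fun i _ => j2 i)).const_mul L
  have hfin := integral_mono_of_nonneg (.of_forall fun s => abs_nonneg _) j3 (.of_forall hkey)
  refine (mul_le_mul_of_nonneg_left hfin (inv_nonneg.2 (he0 n).le)).trans (le_of_eq ?_)
  rw [integral_const_mul, integral_add j1 (integrable_finsetSum _ fun i _ => j2 i),
    integral_finsetSum _ fun i _ => j2 i, ← Finset.mul_sum]
  ring

end Euler

namespace Euler

/-! ### The Gronwall argument -/

variable {T T' K ℓ E₀ X e : ℝ} {E ψ : ℝ → ℝ}

/-- An approximation of the Dirac measure at `0`, supported in `[e / 2, e]`. -/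
theorem integral_initialKernel (he : 0 < e) (heT : e ≤ T) :
    ∫ t in Ioo 0 T, 2 / e * deriv Real.smoothTransition (2 * t / e - 1) = 1 := by
  have hd : ∀ t, HasDerivAt (fun t : ℝ => Real.smoothTransition (2 * t / e - 1))
      (2 / e * deriv Real.smoothTransition (2 * t / e - 1)) t := fun t => by
    have h1 : HasDerivAt (fun t : ℝ => 2 * t / e - 1) (2 / e) t := by
      have := (((hasDerivAt_id t).const_mul 2).div_const e).sub_const 1
      simpa using this
    have h2 := (hasDerivAt_smoothTransition (2 * t / e - 1)).comp t h1
    rw [mul_comm]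
    exact h2
  have hc := continuous_deriv_smoothTransition
  rw [← integral_Ioc_eq_integral_Ioo, ← intervalIntegral.integral_of_le (he.le.trans heT),
    intervalIntegral.integral_eq_sub_of_hasDerivAt (fun t _ => hd t)
      (Continuous.intervalIntegrable (by fun_prop) _ _),
    Real.smoothTransition.one_of_one_le, Real.smoothTransition.zero_of_nonpos]
  · simp
  · simp
  · rw [le_sub_iff_add_le, le_div_iff₀ he]
    linarith

theorem abs_integral_initialKernel_mul_sub_le (hE : Measurable E) (hEK : ∀ t, |E t| ≤ K)
    (hψ : Continuous ψ) {L W : ℝ} (hL : ∀ t ∈ Icc 0 T, |ψ t - ψ 0| ≤ L * t)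
    (hW : ∀ x, |deriv Real.smoothTransition x| ≤ W) (he : 0 < e) (heT : e ≤ T) :
    |(∫ t in Ioo 0 T, ψ t * (2 / e * deriv Real.smoothTransition (2 * t / e - 1)) * E t) -
      ψ 0 * E₀| ≤ 2 * W * (|L| * K * e + |ψ 0| * (e⁻¹ * ∫ t in Ioo 0 e, |E t - E₀|)) := by
  set k : ℝ → ℝ := fun t => 2 / e * deriv Real.smoothTransition (2 * t / e - 1) with hk
  have hc := continuous_deriv_smoothTransition
  have hkc : Continuous k := by fun_prop
  have hW0 : 0 ≤ W := (abs_nonneg _).trans (hW 0)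
  have hK0 : 0 ≤ K := (abs_nonneg _).trans (hEK 0)
  have hkW : ∀ t, |k t| ≤ 2 / e * W := fun t => by
    rw [hk, abs_mul, abs_of_pos (by positivity)]
    gcongr
    exact hW _
  have hk0 : ∀ t, e ≤ t → k t = 0 := fun t ht => by
    simp only [hk]
    rw [deriv_smoothTransition_of_one_le, mul_zero]
    rw [le_sub_iff_add_le, le_div_iff₀ he]
    linarith
  have hEi : ∀ s, IntegrableOn E (Ioo 0 s) := fun s =>
    integrable_of_abs_le hE hEK
  have i1 : IntegrableOn (fun t => ψ t * k t * E t) (Ioo 0 T) :=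
    ((((hψ.mul hkc).continuousOn (s := Icc 0 T)).integrableOn_Icc.mono_set Ioo_subset_Icc_self)).mul_bdd
      hE.aestronglyMeasurable (.of_forall hEK)
  have i2 : IntegrableOn k (Ioo 0 T) :=
    (hkc.continuousOn (s := Icc 0 T)).integrableOn_Icc.mono_set Ioo_subset_Icc_self
  have h1 : (∫ t in Ioo 0 T, ψ t * k t * E t) - ψ 0 * E₀ =
      ∫ t in Ioo 0 T, k t * (ψ t * E t - ψ 0 * E₀) := by
    have h2 : ∫ t in Ioo 0 T, k t * (ψ 0 * E₀) = ψ 0 * E₀ := by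
      rw [integral_mul_const, integral_initialKernel he heT, one_mul]
    refine Eq.trans ?_ ((integral_sub i1 (i2.mul_const (ψ 0 * E₀))).symm.trans
      (integral_congr_ae (.of_forall fun t => ?_)))
    · rw [h2]
    · simp only
      ring
  have h3 : ∫ t in Ioo 0 T, k t * (ψ t * E t - ψ 0 * E₀) =
      ∫ t in Ioo 0 e, k t * (ψ t * E t - ψ 0 * E₀) := by
    refine setIntegral_eq_of_subset_of_forall_sdiff_eq_zero measurableSet_Ioo
      (Ioo_subset_Ioo_right heT) fun t ht => ?_
    have : e ≤ t := by
      by_contra hcon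
      exact ht.2 ⟨ht.1.1, not_le.1 hcon⟩
    simp [hk0 t this]
  have i3 : IntegrableOn (fun t => |E t - E₀|) (Ioo 0 e) :=
    ((hEi e).sub (integrable_const E₀)).abs
  have i4 : IntegrableOn (fun t => 2 / e * W * (|L| * e * K + |ψ 0| * |E t - E₀|)) (Ioo 0 e) :=
    ((integrable_const _).add (i3.const_mul _)).const_mul _
  rw [h1, h3, ← Real.norm_eq_abs]
  refine (norm_integral_le_of_norm_le i4 ?_).trans (le_of_eq ?_)
  · refine (ae_restrict_iff' measurableSet_Ioo).2 (.of_forall fun t ht => ?_)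
    rw [norm_mul, Real.norm_eq_abs, Real.norm_eq_abs]
    refine mul_le_mul (hkW t) ?_ (abs_nonneg _) (by positivity)
    have h4 : ψ t * E t - ψ 0 * E₀ = (ψ t - ψ 0) * E t + ψ 0 * (E t - E₀) := by ring
    rw [h4]
    refine (abs_add_le _ _).trans (add_le_add ?_ (abs_mul _ _).le)
    rw [abs_mul]
    refine mul_le_mul ?_ (hEK t) (abs_nonneg _) (by positivity)
    refine (hL t ⟨ht.1.le, ht.2.le.trans heT⟩).trans ?_
    exact mul_le_mul (le_abs_self L) ht.2.le ht.1.le (abs_nonneg _)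
  · rw [integral_const_mul, integral_add (integrable_const _) (i3.const_mul _), setIntegral_const,
      integral_const_mul]
    simp only [measureReal_def, Real.volume_Ioo, sub_zero, ENNReal.toReal_ofReal he.le, smul_eq_mul]
    field_simp

/-- Passage from time cutoffs with compact support in `(0,T)` to cutoffs which do not vanish at
`0`, for a function `E` which attains the initial value `E₀` in the mean. -/
theorem initial_add_integral_deriv_mul_le (hE : Measurable E) (hEK : ∀ t, |E t| ≤ K)
    (hℓ : 0 < ℓ) (hℓT : ℓ ≤ T)
    (hini : Tendsto (fun n : ℕ => (ℓ * (1 / 2) ^ n)⁻¹ * ∫ s in Ioo 0 (ℓ * (1 / 2) ^ n),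
      |E s - E₀|) atTop (𝓝 0))
    (hψ : ContDiff ℝ 1 ψ) (hψ0 : ∀ t, 0 ≤ ψ t) (hT' : T' < T) (hψT : ∀ t, T' ≤ t → ψ t = 0)
    (hX : ∀ δ > 0, ∀ χ : ℝ → ℝ, IsTimeCutoff T δ χ → (∀ t, χ t ≤ ψ t) →
      ∫ t in Ioo 0 T, deriv χ t * E t ≤ X) :
    ψ 0 * E₀ + ∫ t in Ioo 0 T, deriv ψ t * E t ≤ X := by
  obtain ⟨W, hW⟩ := exists_abs_deriv_smoothTransition_le
  have hT : 0 < T := hℓ.trans_le hℓT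
  have hψd := hψ.continuous_deriv le_rfl
  obtain ⟨L, hL⟩ := isCompact_Icc.exists_bound_of_continuousOn (s := Icc 0 T) hψd.continuousOn
  have hL' : ∀ t ∈ Icc 0 T, |ψ t - ψ 0| ≤ L * t := fun t ht => by
    have := (convex_Icc 0 T).norm_image_sub_le_of_norm_deriv_le (f := ψ) (C := L)
      (fun x _ => hψ.differentiable one_ne_zero x) hL ⟨le_rfl, hT.le⟩ ht
    simpa [Real.norm_eq_abs, abs_of_nonneg ht.1] using this
  let e : ℕ → ℝ := fun n => ℓ * (1 / 2) ^ n
  have he : Tendsto e atTop (𝓝 0) := tendsto_geometric ℓ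
  have he0 : ∀ n, 0 < e n := fun n => by positivity
  have heT : ∀ n, e n ≤ T := fun n =>
    (mul_le_of_le_one_right hℓ.le (pow_le_one₀ (by norm_num) (by norm_num))).trans hℓT
  let S : ℕ → ℝ → ℝ := fun n t => Real.smoothTransition (2 * t / e n - 1)
  let k : ℕ → ℝ → ℝ := fun n t => 2 / e n * deriv Real.smoothTransition (2 * t / e n - 1)
  have hSd : ∀ n t, HasDerivAt (S n) (k n t) t := fun n t => by
    have h1 : HasDerivAt (fun t : ℝ => 2 * t / e n - 1) (2 / e n) t := by
      have := (((hasDerivAt_id t).const_mul 2).div_const (e n)).sub_const 1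
      simpa using this
    have h2 := (hasDerivAt_smoothTransition (2 * t / e n - 1)).comp t h1
    simp only [k]
    rw [mul_comm]
    exact h2
  have hSc : ∀ n, ContDiff ℝ 1 (S n) := fun n => by
    have h1 : ContDiff ℝ 1 fun t : ℝ => 2 * t / e n - 1 := by fun_prop
    exact (Real.smoothTransition.contDiff (n := 1)).comp h1
  have hc := continuous_deriv_smoothTransition
  have hkc : ∀ n, Continuous (k n) := fun n => by
    have := hc
    fun_prop
  have hS0 : ∀ n t, 0 ≤ S n t := fun n t => Real.smoothTransition.nonneg _
  have hS1 : ∀ n t, S n t ≤ 1 := fun n t => Real.smoothTransition.le_one _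
  have hcut : ∀ n, IsTimeCutoff T (min (e n / 4) ((T - T') / 2)) fun t => ψ t * S n t := fun n =>
    { contDiff := hψ.mul (hSc n)
      nonneg := fun t => mul_nonneg (hψ0 t) (hS0 n t)
      eq_zero := fun t ht => by
        simp only [mem_Ioo, not_and_or, not_lt] at ht
        rcases ht with ht | ht
        · have h1 : t ≤ e n / 2 := by linarith [min_le_left (e n / 4) ((T - T') / 2)]
          have h2 : S n t = 0 := Real.smoothTransition.zero_of_nonpos (by
            rw [sub_nonpos, div_le_iff₀ (he0 n)]; linarith)
          rw [h2, mul_zero]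
        · have h1 : T' ≤ t := by linarith [min_le_right (e n / 4) ((T - T') / 2)]
          rw [hψT t h1, zero_mul] }
  have hEi : IntegrableOn E (Ioo 0 T) := integrable_of_abs_le hE hEK
  have hmul : ∀ f : ℝ → ℝ, Continuous f → IntegrableOn (fun t => f t * E t) (Ioo 0 T) :=
    fun f hf => ((hf.continuousOn (s := Icc 0 T)).integrableOn_Icc.mono_set
      Ioo_subset_Icc_self).mul_bdd hE.aestronglyMeasurable (.of_forall hEK)
  have hle : ∀ n, (∫ t in Ioo 0 T, deriv ψ t * S n t * E t) +
      ∫ t in Ioo 0 T, ψ t * k n t * E t ≤ X := fun n => by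
    have h1 := hX _ (lt_min (div_pos (he0 n) four_pos) (half_pos (sub_pos.2 hT'))) _ (hcut n)
      fun t => mul_le_of_le_one_right (hψ0 t) (hS1 n t)
    have j1 : IntegrableOn (fun t => deriv ψ t * S n t * E t) (Ioo 0 T) :=
      hmul _ (hψd.mul (hSc n).continuous)
    have j2 : IntegrableOn (fun t => ψ t * k n t * E t) (Ioo 0 T) :=
      hmul _ (hψ.continuous.mul (hkc n))
    rw [← integral_add j1 j2]
    refine le_trans (le_of_eq (integral_congr_ae (.of_forall fun t => ?_))) h1
    have h2 := ((hψ.differentiable one_ne_zero t).hasDerivAt.mul (hSd n t)).deriv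
    have h3 : deriv (fun t => ψ t * S n t) t = deriv ψ t * S n t + ψ t * k n t := h2
    simp only [h3]
    ring
  have l1 : Tendsto (fun n => ∫ t in Ioo 0 T, deriv ψ t * S n t * E t) atTop
      (𝓝 (∫ t in Ioo 0 T, deriv ψ t * E t)) := by
    refine tendsto_integral_of_dominated_convergence (fun t => |deriv ψ t * E t|)
      (fun n => (hmul _ (hψd.mul (hSc n).continuous)).aestronglyMeasurable)
      (hmul _ hψd).abs (fun n => .of_forall fun t => ?_) ?_
    · rw [Real.norm_eq_abs, mul_right_comm, abs_mul, abs_of_nonneg (hS0 n t)]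
      exact mul_le_of_le_one_right (abs_nonneg _) (hS1 n t)
    · refine (ae_restrict_iff' measurableSet_Ioo).2 (.of_forall fun t ht => ?_)
      refine tendsto_const_nhds.congr' ?_
      filter_upwards [he.eventually (gt_mem_nhds ht.1)] with n hn
      have : S n t = 1 := Real.smoothTransition.one_of_one_le (by
        rw [le_sub_iff_add_le, le_div_iff₀ (he0 n)]; linarith)
      rw [this, mul_one]
  have l2 : Tendsto (fun n => ∫ t in Ioo 0 T, ψ t * k n t * E t) atTop (𝓝 (ψ 0 * E₀)) := by
    rw [tendsto_iff_dist_tendsto_zero]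
    refine squeeze_zero (fun n => dist_nonneg) (fun n =>
      abs_integral_initialKernel_mul_sub_le hE hEK hψ.continuous hL' hW.2 (he0 n) (heT n)) ?_
    have := ((he.const_mul (|L| * K)).add (hini.const_mul |ψ 0|)).const_mul (2 * W)
    simp only [mul_zero, add_zero] at this
    exact this
  have := le_of_tendsto' (l1.add l2) hle
  linarith

end Euler

namespace Euler

variable {T c K : ℝ} {N D : ℝ → ℝ}

theorem exists_continuous_nonneg_approx (hD : IntegrableOn D (Ioo 0 T)) {η : ℝ} (hη : 0 < η) :
    ∃ g : ℝ → ℝ, Continuous g ∧ (∀ t, 0 ≤ g t) ∧ ∫ t in Ioo 0 T, |(|D t| - g t)| ≤ η := by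
  obtain ⟨g, -, hg, hgc, hgi⟩ := ((integrable_indicator_iff measurableSet_Ioo).2
    hD.abs).exists_hasCompactSupport_integral_sub_le hη
  have hi : Integrable (fun t => ‖(Ioo 0 T).indicator (fun t => |D t|) t - g t‖) :=
    (((integrable_indicator_iff measurableSet_Ioo).2 hD.abs).sub hgi).norm
  refine ⟨fun t => max 0 (g t), continuous_const.max hgc, fun t => le_max_left _ _, ?_⟩
  refine le_trans (integral_mono_of_nonneg (.of_forall fun t => abs_nonneg _) hi.integrableOn
    ((ae_restrict_iff' measurableSet_Ioo).2 (.of_forall fun t ht => ?_)))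
    ((setIntegral_le_integral hi (.of_forall fun t => norm_nonneg _)).trans hg)
  simp only [indicator_of_mem ht, Real.norm_eq_abs]
  rcases le_total 0 (g t) with h | h
  · rw [max_eq_right h]
  · rw [max_eq_left h, sub_zero, abs_abs,
      abs_of_nonneg (a := |D t| - g t) (by linarith [abs_nonneg (D t)])]
    linarith

/-- The solution `ψ` of the backward equation `ψ' = - c g ψ - q`, `ψ(T') = 0`, with
`q(t) = (T' - t)⁺`, by the variation of constants formula. -/
noncomputable def backwardWeight (c T' : ℝ) (g : ℝ → ℝ) (t : ℝ) : ℝ :=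
  Real.exp (-(c * ∫ s in (0 : ℝ)..t, g s)) *
    ∫ s in t..T', Real.exp (c * ∫ r in (0 : ℝ)..s, g r) * max 0 (T' - s)

variable {T' : ℝ} {g : ℝ → ℝ}

theorem hasDerivAt_backwardWeight (hg : Continuous g) (t : ℝ) :
    HasDerivAt (backwardWeight c T' g)
      (-(c * g t * backwardWeight c T' g t) - max 0 (T' - t)) t := by
  have h1 : ∀ t, HasDerivAt (fun t => ∫ s in (0 : ℝ)..t, g s) (g t) t := fun t =>
    intervalIntegral.integral_hasDerivAt_right (hg.intervalIntegrable _ _)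
      (hg.stronglyMeasurableAtFilter _ _) hg.continuousAt
  have hG : Continuous fun t => ∫ s in (0 : ℝ)..t, g s :=
    continuous_iff_continuousAt.2 fun t => (h1 t).continuousAt
  have hf : Continuous fun s => Real.exp (c * ∫ r in (0 : ℝ)..s, g r) * max 0 (T' - s) := by
    fun_prop
  have h2 := intervalIntegral.integral_hasDerivAt_left (hf.intervalIntegrable t T')
      (hf.stronglyMeasurableAtFilter _ _) hf.continuousAt
  have h3 := ((h1 t).const_mul c).neg.exp.mul h2
  refine h3.congr_deriv ?_
  have h4 : Real.exp (-(c * ∫ s in (0 : ℝ)..t, g s)) * Real.exp (c * ∫ s in (0 : ℝ)..t, g s) = 1 := by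
    rw [← Real.exp_add, neg_add_cancel, Real.exp_zero]
  simp only [backwardWeight, Pi.neg_apply]
  linear_combination (-max 0 (T' - t)) * h4

theorem contDiff_backwardWeight (hg : Continuous g) : ContDiff ℝ 1 (backwardWeight c T' g) := by
  have h := hasDerivAt_backwardWeight (c := c) (T' := T') hg
  have hd : deriv (backwardWeight c T' g) =
      fun t => -(c * g t * backwardWeight c T' g t) - max 0 (T' - t) := funext fun t => (h t).deriv
  have hc : Continuous (backwardWeight c T' g) :=
    continuous_iff_continuousAt.2 fun t => (h t).continuousAt
  refine contDiff_one_iff_deriv.2 ⟨fun t => (h t).differentiableAt, ?_⟩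
  rw [hd]
  fun_prop

theorem backwardWeight_eq_zero {t : ℝ} (ht : T' ≤ t) : backwardWeight c T' g t = 0 := by
  rw [backwardWeight, intervalIntegral.integral_symm T' t, intervalIntegral.integral_of_le ht,
    setIntegral_eq_zero_of_forall_eq_zero, neg_zero, mul_zero]
  intro s hs
  rw [max_eq_left (by linarith [hs.1]), mul_zero]

theorem backwardWeight_nonneg (t : ℝ) : 0 ≤ backwardWeight c T' g t := by
  rcases le_total T' t with h | h
  · exact (backwardWeight_eq_zero h).ge
  · exact mul_nonneg (Real.exp_nonneg _) (intervalIntegral.integral_nonneg h fun s _ =>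
      mul_nonneg (Real.exp_nonneg _) (le_max_left _ _))

/-- Since `g ≥ 0`, the weight is bounded in terms of the integral of `g` alone. -/
theorem backwardWeight_le (hc : 0 ≤ c) (hg : Continuous g) (hg0 : ∀ t, 0 ≤ g t) {A : ℝ}
    (hA : ∫ s in (0 : ℝ)..T', g s ≤ A) {t : ℝ} (ht : 0 ≤ t) :
    backwardWeight c T' g t ≤ Real.exp (c * A) * (|T'| * |T'|) := by
  rcases le_total T' t with h | h
  · rw [backwardWeight_eq_zero h]
    positivity
  have hT : 0 ≤ T' := ht.trans h
  have h1 : Real.exp (-(c * ∫ s in (0 : ℝ)..t, g s)) ≤ 1 := by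
    rw [Real.exp_le_one_iff, neg_nonpos]
    exact mul_nonneg hc (intervalIntegral.integral_nonneg ht fun s _ => hg0 s)
  have h2 : |∫ s in t..T', Real.exp (c * ∫ r in (0 : ℝ)..s, g r) * max 0 (T' - s)| ≤
      Real.exp (c * A) * |T'| * |T' - t| := by
    rw [← Real.norm_eq_abs]
    refine intervalIntegral.norm_integral_le_of_norm_le_const fun s hs => ?_
    rw [uIoc_of_le h] at hs
    rw [norm_mul, Real.norm_eq_abs, Real.abs_exp, Real.norm_eq_abs]
    refine mul_le_mul (Real.exp_le_exp.2 (mul_le_mul_of_nonneg_left (le_trans ?_ hA) hc)) ?_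
      (abs_nonneg _) (Real.exp_nonneg _)
    · exact intervalIntegral.integral_mono_interval le_rfl (ht.trans hs.1.le) hs.2
        (.of_forall hg0) (hg.intervalIntegrable _ _)
    · rw [max_eq_right (by linarith [hs.2]), abs_of_nonneg (by linarith [hs.2]), abs_of_nonneg hT]
      linarith [hs.1]
  have h3 : |T' - t| ≤ |T'| := by
    rw [abs_of_nonneg (by linarith), abs_of_nonneg hT]
    linarith
  refine (mul_le_of_le_one_left (intervalIntegral.integral_nonneg h fun s _ =>
      mul_nonneg (Real.exp_nonneg _) (le_max_left _ _)) h1).trans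
    ((le_abs_self _).trans (h2.trans ?_))
  rw [mul_assoc]
  gcongr

/-- A Gronwall lemma in weak form. The coefficient `|D|` is only integrable, and is replaced by
a continuous function `g`, up to an error in `L¹`. -/
theorem ae_eq_zero_of_gronwall (hN : Measurable N) (hN0 : ∀ t, 0 ≤ N t) (hNK : ∀ t, N t ≤ K)
    (hD : IntegrableOn D (Ioo 0 T)) (hc : 0 ≤ c)
    (H : ∀ g : ℝ → ℝ, Continuous g → (∀ t, 0 ≤ g t) → ∀ ψ : ℝ → ℝ, ContDiff ℝ 1 ψ →
      (∀ t, 0 ≤ ψ t) → ∀ T' ∈ Ioo 0 T, (∀ t, T' ≤ t → ψ t = 0) → ∀ B : ℝ,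
      (∀ t, 0 ≤ t → ψ t ≤ B) →
      0 ≤ (∫ t in Ioo 0 T, deriv ψ t * N t) + c * ((∫ t in Ioo 0 T, ψ t * g t * N t) +
        B * K * ∫ t in Ioo 0 T, |(|D t| - g t)|)) :
    ∀ᵐ t ∂(volume.restrict (Ioo 0 T)), N t = 0 := by
  have hNb : ∀ t, |N t| ≤ K := fun t => by rw [abs_of_nonneg (hN0 t)]; exact hNK t
  have hK0 : 0 ≤ K := (hN0 0).trans (hNK 0)
  have hmul : ∀ f : ℝ → ℝ, Continuous f → IntegrableOn (fun t => f t * N t) (Ioo 0 T) :=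
    fun f hf => ((hf.continuousOn (s := Icc 0 T)).integrableOn_Icc.mono_set
      Ioo_subset_Icc_self).mul_bdd hN.aestronglyMeasurable (.of_forall hNb)
  have key : ∀ T' ∈ Ioo 0 T, ∀ᵐ t ∂(volume.restrict (Ioo 0 T)), max 0 (T' - t) * N t = 0 := by
    intro T' hT'
    have hqN : IntegrableOn (fun t => max 0 (T' - t) * N t) (Ioo 0 T) := hmul _ (by fun_prop)
    have hq0 : 0 ≤ᵐ[volume.restrict (Ioo 0 T)] fun t => max 0 (T' - t) * N t :=
      .of_forall fun t => mul_nonneg (le_max_left _ _) (hN0 t)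
    refine (integral_eq_zero_iff_of_nonneg_ae hq0 hqN).1 (le_antisymm ?_ (integral_nonneg_of_ae hq0))
    set A : ℝ := (∫ t in Ioo 0 T, |D t|) + 1 with hA
    set B : ℝ := Real.exp (c * A) * (|T'| * |T'|) with hB
    have hbound : ∀ η ∈ Ioc (0 : ℝ) 1,
        ∫ t in Ioo 0 T, max 0 (T' - t) * N t ≤ c * (B * K) * η := by
      intro η hη
      obtain ⟨g, hg, hg0, hgη⟩ := exists_continuous_nonneg_approx hD hη.1
      have hgi : IntegrableOn g (Ioo 0 T) :=
        (hg.continuousOn (s := Icc 0 T)).integrableOn_Icc.mono_set Ioo_subset_Icc_self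
      have hgA : ∫ s in (0 : ℝ)..T', g s ≤ A := by
        rw [intervalIntegral.integral_of_le hT'.1.le, integral_Ioc_eq_integral_Ioo]
        have h1 : ∫ t in Ioo 0 T', g t ≤ ∫ t in Ioo 0 T, g t :=
          setIntegral_mono_set hgi (.of_forall hg0)
            (Ioo_subset_Ioo_right hT'.2.le).eventuallyLE
        have h2 : ∫ t in Ioo 0 T, g t ≤ ∫ t in Ioo 0 T, (|D t| + |(|D t| - g t)|) :=
          integral_mono hgi (hD.abs.add (hD.abs.sub hgi).abs) fun t => by
            have := neg_abs_le (|D t| - g t)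
            simp only
            linarith
        have h3 : ∫ t in Ioo 0 T, (|D t| + |(|D t| - g t)|) =
            (∫ t in Ioo 0 T, |D t|) + ∫ t in Ioo 0 T, |(|D t| - g t)| :=
          integral_add hD.abs (hD.abs.sub hgi).abs
        linarith [hη.2]
      -- the backward equation for `ψ` absorbs the term `c ψ g N`, and only `q N` is left
      set ψ := backwardWeight c T' g with hψ
      have hψc := contDiff_backwardWeight (c := c) (T' := T') hg
      have h1 := H g hg hg0 ψ hψc backwardWeight_nonneg T' hT' (fun t => backwardWeight_eq_zero) B
        fun t => backwardWeight_le hc hg hg0 hgA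
      have h2 : ∫ t in Ioo 0 T, deriv ψ t * N t =
          -(c * ∫ t in Ioo 0 T, ψ t * g t * N t) - ∫ t in Ioo 0 T, max 0 (T' - t) * N t := by
        have i1 : IntegrableOn (fun t => -(c * (ψ t * g t * N t))) (Ioo 0 T) :=
          ((hmul _ (hψc.continuous.mul hg)).const_mul c).neg
        rw [← integral_const_mul, ← integral_neg, ← integral_sub i1 hqN]
        refine integral_congr_ae (.of_forall fun t => ?_)
        simp only
        rw [(hasDerivAt_backwardWeight hg t).deriv]
        ring
      have h3 : c * (B * K * ∫ t in Ioo 0 T, |(|D t| - g t)|) ≤ c * (B * K * η) := by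
        gcongr
      rw [h2] at h1
      linarith
    have hlim : Tendsto (fun η => c * (B * K) * η) (𝓝[>] 0) (𝓝 0) := by
      have h1 : Continuous fun η : ℝ => c * (B * K) * η := by fun_prop
      have h2 := h1.tendsto 0
      simp only [mul_zero] at h2
      exact h2.mono_left nhdsWithin_le_nhds
    exact ge_of_tendsto hlim (by
      filter_upwards [Ioc_mem_nhdsGT (zero_lt_one' ℝ)] with η hη using hbound η hη)
  have hseq : ∀ᵐ t ∂(volume.restrict (Ioo 0 T)), ∀ n : ℕ, T - T / (n + 2) ∈ Ioo 0 T →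
      max 0 (T - T / (n + 2) - t) * N t = 0 := by
    refine ae_all_iff.2 fun n => ?_
    by_cases h : T - T / (n + 2) ∈ Ioo 0 T
    · filter_upwards [key _ h] with t ht _ using ht
    · exact .of_forall fun t ht => absurd ht h
  filter_upwards [hseq, ae_restrict_mem measurableSet_Ioo] with t ht htT
  have hT : 0 < T := htT.1.trans htT.2
  obtain ⟨n, hn⟩ := exists_nat_gt (T / (T - t))
  have h0 : 0 < T - t := sub_pos.2 htT.2
  have hn2 : (0 : ℝ) < n + 2 := by positivity
  have h1 : T / (n + 2) < T - t := by
    rw [div_lt_iff₀ h0] at hn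
    rw [div_lt_iff₀ hn2]
    nlinarith
  have h2 := ht n ⟨by linarith [htT.1], by linarith [div_pos hT hn2]⟩
  exact (mul_eq_zero.1 h2).resolve_left (by rw [max_eq_right (by linarith)]; linarith)

end Euler

namespace Euler

/-! ### The defect measures vanish -/

variable {d : ℕ} {a γ T r R C M α : ℝ} {ρ : ℝ → Space d → ℝ} {m : ℝ → Space d → Space d}
  {v : ℝ × Space d → ℝ} {w : ℝ × Space d → Space d} {D : ℝ → ℝ}
  {Rv : ℝ → Fin d → Fin d → SignedMeasure (closedCube d)} {Rp : ℝ → Measure (closedCube d)}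

/-- The energy of the defect is represented by a bounded Borel function of time. -/
theorem exists_measurable_defectEnergy (hγ : 1 < γ) (hv : MemLinftyPSDMeasure T Rv)
    (hp : MemLinftyMeasure T Rp) :
    ∃ (N : ℝ → ℝ) (K : ℝ), Measurable N ∧ (∀ t, 0 ≤ N t) ∧ (∀ t, N t ≤ K) ∧
      ∀ᵐ t ∂(volume.restrict (Ioo 0 T)), defectEnergy γ Rv Rp t = N t := by
  have hdef := ae_isDefect hv hp
  obtain ⟨C, hC⟩ := hv.bounded
  obtain ⟨C', hC'⟩ := hp.bounded
  have m1 : ∀ i, AEMeasurable (fun t => Rv t i i univ) (volume.restrict (Ioo 0 T)) := fun i => by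
    refine (hv.aemeasurable i i 1).congr ?_
    filter_upwards [hdef] with t ht
    have := ht.isFiniteMeasure_variation i i
    simp only [ContinuousMap.one_apply]
    rw [VectorMeasure.integral_const]
    simp
  have m2 : AEMeasurable (fun t => (Rp t univ).toReal) (volume.restrict (Ioo 0 T)) := by
    refine (hp.aemeasurable 1).congr (.of_forall fun t => ?_)
    simp [measureReal_def]
  have m3 : AEMeasurable (defectEnergy γ Rv Rp) (volume.restrict (Ioo 0 T)) :=
    ((Finset.aemeasurable_fun_sum Finset.univ fun i _ => m1 i).const_mul (1 / 2)).add
      (m2.const_mul (1 / (γ - 1)))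
  set K : ℝ := 1 / 2 * (d * C) + 1 / (γ - 1) * C' with hK
  have hγ' : 0 < γ - 1 := sub_pos.2 hγ
  have hK0 : 0 ≤ K := by positivity
  have hle : ∀ᵐ t ∂(volume.restrict (Ioo 0 T)), defectEnergy γ Rv Rp t ≤ K := by
    filter_upwards [hC, hC'] with t h1 h2
    have h3 : ∑ i, Rv t i i univ ≤ d * C := by
      refine (Finset.sum_le_card_nsmul _ _ (C : ℝ) fun i _ => ?_).trans (by simp)
      have h4 : ‖Rv t i i univ‖ₑ ≤ C := (VectorMeasure.enorm_measure_le_variation _ _).trans (h1 i i)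
      have h5 : ‖Rv t i i univ‖₊ ≤ C := by exact_mod_cast h4
      exact (le_abs_self _).trans (by exact_mod_cast h5)
    have h4 : (Rp t univ).toReal ≤ C' := ENNReal.toReal_le_coe_of_le_coe h2
    unfold defectEnergy
    rw [hK]
    gcongr
  refine ⟨fun t => max 0 (min K (m3.mk _ t)), K,
    measurable_const.max (measurable_const.min m3.measurable_mk), fun t => le_max_left _ _,
    fun t => max_le hK0 (min_le_left _ _), ?_⟩
  filter_upwards [hdef, hle, m3.ae_eq_mk] with t h1 h2 h3
  rw [← h3, min_eq_right h2, max_eq_right (defectEnergy_nonneg hγ h1)]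

/-- The energy inequality on `[0, T']`, for a weight which vanishes for `t ≥ T'`, in terms of
representatives `E` and `N` of the energies of the fluid and of the defect. -/
theorem EnergyInequality.neg_initial_le (h : EnergyInequality a γ T ρ m Rv Rp) {E N ψ : ℝ → ℝ}
    (hE : ∀ᵐ t ∂(volume.restrict (Ioo 0 T)), (fluidEnergy a γ (ρ t) (m t)).toReal = E t)
    (hN : ∀ᵐ t ∂(volume.restrict (Ioo 0 T)), defectEnergy γ Rv Rp t = N t)
    (hψ : ContDiff ℝ 1 ψ) (hψ0 : ∀ t, 0 ≤ ψ t) {T' : ℝ} (hT' : T' ∈ Ioo 0 T)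
    (hψT : ∀ t, T' ≤ t → ψ t = 0) :
    -(ψ 0 * (fluidEnergy a γ (ρ 0) (m 0)).toReal) ≤ ∫ t in Ioo 0 T, deriv ψ t * (E t + N t) := by
  obtain ⟨Em, Ep, h0, -, -, h1⟩ := h
  have h2 := h1 0 T' le_rfl hT'.1.le hT'.2 ψ hψ ⟨T', hT'.2, fun t _ ht => hψT t ht⟩
    fun t _ => hψ0 t
  rw [hψT T' le_rfl, zero_mul, zero_sub, h0] at h2
  refine h2.trans (le_of_eq ?_)
  have hd : ∀ t, T' ≤ t → deriv ψ t = 0 := fun t ht => by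
    have h3 : IsLocalMin ψ t := .of_forall fun x => by
      rw [hψT t ht]; exact hψ0 x
    exact h3.deriv_eq_zero
  rw [intervalIntegral.integral_of_le hT'.1.le, integral_Ioc_eq_integral_Ioo]
  have h3 : ∫ t in Ioo 0 T', deriv ψ t * totalEnergy a γ ρ m Rv Rp t =
      ∫ t in Ioo 0 T, deriv ψ t * totalEnergy a γ ρ m Rv Rp t := by
    symm
    refine setIntegral_eq_of_subset_of_forall_sdiff_eq_zero measurableSet_Ioo
      (Ioo_subset_Ioo_right hT'.2.le) fun t ht => ?_
    rw [hd t (by by_contra hcon; exact ht.2 ⟨ht.1.1, not_le.1 hcon⟩), zero_mul]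
  rw [h3]
  refine integral_congr_ae ?_
  filter_upwards [hE, hN] with t ht1 ht2
  have h4 : totalEnergy a γ ρ m Rv Rp t =
      (fluidEnergy a γ (ρ t) (m t)).toReal + defectEnergy γ Rv Rp t := by
    unfold totalEnergy defectEnergy
    ring
  rw [h4, ht1, ht2]

theorem ae_toReal_fluidEnergy_eq (ha : 0 < a) (hγ : 1 < γ) (hr : 0 < r)
    (h : IsBoundedState r R M v w)
    (hρ : ∀ᵐ z ∂(volume.restrict (cylinder d T)), ρ z.1 z.2 = v z)
    (hm : ∀ᵐ z ∂(volume.restrict (cylinder d T)), m z.1 z.2 = v z • w z) :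
    ∀ᵐ t ∂(volume.restrict (Ioo 0 T)), (fluidEnergy a γ (ρ t) (m t)).toReal =
      ∫ x in cube d, (v (t, x) * ‖w (t, x)‖ ^ 2 / 2 + pressurePotential a γ (v (t, x))) := by
  filter_upwards [ae_ae_of_ae_cylinder (p := fun t x => ρ t x = v (t, x)) hρ,
    ae_ae_of_ae_cylinder (p := fun t x => m t x = v (t, x) • w (t, x)) hm] with t h1 h2
  have hx : Measurable fun x : Space d => (t, x) := measurable_prodMk_left
  have m1 : AEMeasurable (ρ t) (volume.restrict (cube d)) :=
    (h.measurable_density.comp hx).aemeasurable.congr (by filter_upwards [h1] with x hx using hx.symm)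
  have m2 : AEMeasurable (m t) (volume.restrict (cube d)) :=
    ((h.measurable_density.smul h.measurable_velocity).comp hx).aemeasurable.congr
      (by filter_upwards [h2] with x hx using hx.symm)
  rw [toReal_fluidEnergy ha hγ m1 m2 (by
    filter_upwards [h1] with x hx
    rw [hx]
    exact hr.trans_le (h.density_mem _).1)]
  refine integral_congr_ae ?_
  filter_upwards [h1, h2] with x hx1 hx2
  have h0 : 0 < v (t, x) := hr.trans_le (h.density_mem _).1
  rw [hx1, hx2, norm_smul, Real.norm_of_nonneg h0.le]
  congr 1
  field_simp

/-- The energy inequality bounds the decrease of the fluid energy from below and the one-sided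
Lipschitz condition bounds it from above; the fluid energy cancels and leaves a Gronwall inequality
for the energy of the defect. -/
theorem IsDissipativeSolutionWith.ae_defectEnergy_eq_zero (ha : 0 < a) (hγ : 1 < γ) (hT : 0 < T)
    (hsol : IsDissipativeSolutionWith a γ T ρ m Rv Rp) (hreg : InRegularityClass T ρ m)
    (hD : IntegrableOn D (Ioo 0 T)) (hlip : OneSidedLipschitz T (velocity ρ m) D) :
    ∀ᵐ t ∂(volume.restrict (Ioo 0 T)), defectEnergy γ Rv Rp t = 0 := by
  obtain ⟨r, R, M, v, w, hr, h, hρ, hu⟩ :=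
    exists_isBoundedState hreg.density_bounded hreg.density_pos hreg.momentum_bounded
  have hm : ∀ᵐ z ∂(volume.restrict (cylinder d T)), m z.1 z.2 = v z • w z := by
    filter_upwards [hρ, hu] with z h1 h2
    have h0 : v z ≠ 0 := (hr.trans_le (h.density_mem z).1).ne'
    rw [← h2, velocity, h1, smul_inv_smul₀ h0]
  obtain ⟨α, hα, hbρ, hbm, hbu⟩ := hreg.besov
  obtain ⟨C₁, hincρ⟩ := hasCubeIncr_of_memBesov hbρ hρ
  obtain ⟨C₂, hincu⟩ := hasCubeIncr_of_memBesov hbu hu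
  obtain ⟨C₃, hincm⟩ := hasCubeIncr_of_memBesov hbm hm
  obtain ⟨C, hP⟩ := exists_potentialBounds a γ hr R
  obtain ⟨N, K, hN, hN0, hNK, hNe⟩ :=
    exists_measurable_defectEnergy hγ hsol.convectiveDefect hsol.pressureDefect
  set P := pressurePotential a γ with hPdef
  set c : ℝ := max 2 (d * (γ - 1)) with hc
  have hc0 : 0 ≤ c := zero_le_two.trans (le_max_left _ _)
  have hK0 : 0 ≤ K := (hN0 0).trans (hNK 0)
  -- the energy of the fluid
  set F : ℝ × Space d → ℝ := fun z => v z * ‖w z‖ ^ 2 / 2 + P (v z) with hF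
  have hFm : Measurable F := h.measurable_energy hP
  have hFb : ∀ z, |F z| ≤ R * M ^ 2 / 2 + C := fun z => h.abs_energy_le hP hr.le z
  set E : ℝ → ℝ := fun t => ∫ x in cube d, F (t, x) with hE
  have hEm : Measurable E := hFm.stronglyMeasurable.integral_prod_right.measurable
  have hEb : ∀ t, |E t| ≤ (R * M ^ 2 / 2 + C) * volume.real (cube d) := fun t => by
    rw [← Real.norm_eq_abs]
    exact norm_setIntegral_le_of_norm_le_const (volume_cube_lt_top d) fun x _ => hFb (t, x)
  obtain ⟨hρ0, hini⟩ := tendsto_average_energy hγ hT hsol.state hr hP h hρ hm hα hincρ hincm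
    hT le_rfl
  have hq : 1 ≤ 2 * γ / (γ + 1) := by rw [le_div_iff₀ (by linarith)]; linarith
  have h00 : (0 : ℝ) ∈ Icc 0 T := ⟨le_rfl, hT.le⟩
  have hE0 : (fluidEnergy a γ (ρ 0) (m 0)).toReal =
      ∫ x in cube d, (‖m 0 x‖ ^ 2 / (2 * ρ 0 x) + P (ρ 0 x)) :=
    toReal_fluidEnergy ha hγ
      (integrableOn_of_memLp_ofReal hγ.le (hsol.state.density.memLp 0 h00)).aestronglyMeasurable.aemeasurable
      (integrableOn_of_memLp_ofReal hq (hsol.state.momentum.memLp 0 h00)).aestronglyMeasurable.aemeasurable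
      hρ0
  have hNe0 : ∀ᵐ t ∂(volume.restrict (Ioo 0 T)), N t = 0 := by
    refine ae_eq_zero_of_gronwall hN hN0 hNK hD hc0
      fun g hg hg0 ψ hψ hψ0 T' hT' hψT B hB => ?_
    have hB0 : 0 ≤ B := (hψ0 0).trans (hB 0 le_rfl)
    have hmul : ∀ f : ℝ → ℝ, Continuous f → ∀ {G : ℝ → ℝ} {L : ℝ}, Measurable G →
        (∀ t, |G t| ≤ L) → IntegrableOn (fun t => f t * G t) (Ioo 0 T) :=
      fun f hf _ _ hG hGb => ((hf.continuousOn (s := Icc 0 T)).integrableOn_Icc.mono_set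
        Ioo_subset_Icc_self).mul_bdd hG.aestronglyMeasurable (.of_forall hGb)
    have hNb : ∀ t, |N t| ≤ K := fun t => by rw [abs_of_nonneg (hN0 t)]; exact hNK t
    -- the fluid energy loses at most a multiple of the energy of the defect
    have h1 := initial_add_integral_deriv_mul_le hEm hEb hT le_rfl hini hψ hψ0 hT'.2 hψT
      (X := c * ((∫ t in Ioo 0 T, ψ t * g t * N t) + B * K * ∫ t in Ioo 0 T, |(|D t| - g t)|))
      fun δ hδ χ hχ hχψ => by
        have hχB : ∀ t, χ t ≤ B := fun t => by
          rcases le_total 0 t with ht | ht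
          · exact (hχψ t).trans (hB t ht)
          · rw [hχ.eq_zero t fun hcon => by linarith [hcon.1]]
            exact hB0
        have h2 := integral_deriv_mul_energy_le hγ hP hr h
          (hasWeakContinuity hT hsol.continuityEq h hρ hm)
          (hasWeakMomentum hγ hT hsol.momentumEq hr hP h hρ hm) hT hα hincρ hincu hincm
          (hasWeakOSL hT hlip h hD hu) hD (ae_isDefect hsol.convectiveDefect hsol.pressureDefect)
          hN hN0 hNK hNe hg hχ hδ hχB
        have hχd := hχ.contDiff.continuous_deriv le_rfl
        have hint : IntegrableOn (fun z : ℝ × Space d => deriv χ z.1 * F z) (cylinder d T) := by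
          rw [IntegrableOn, restrict_cylinder]
          have h3 : Integrable (deriv χ) (volume.restrict (Ioo 0 T)) :=
            (hχd.continuousOn (s := Icc 0 T)).integrableOn_Icc.mono_set Ioo_subset_Icc_self
          exact (h3.comp_fst _).mul_bdd hFm.aestronglyMeasurable (.of_forall hFb)
        have h4 : ∫ t in Ioo 0 T, deriv χ t * E t =
            ∫ z in cylinder d T, deriv χ z.1 * F z := by
          rw [integral_cylinder_eq hint]
          refine integral_congr_ae (.of_forall fun t => ?_)
          simp only [hE]
          rw [integral_const_mul]
        rw [h4]
        refine h2.trans (mul_le_mul_of_nonneg_left (add_le_add ?_ le_rfl) hc0)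
        exact integral_mono (hmul _ (hχ.contDiff.continuous.mul hg) hN hNb)
          (hmul _ (hψ.continuous.mul hg) hN hNb) fun t =>
            mul_le_mul_of_nonneg_right (mul_le_mul_of_nonneg_right (hχψ t) (hg0 t)) (hN0 t)
    -- the total energy does not increase, and the initial energy carries no defect
    have h2 := hsol.energyInequality.neg_initial_le (ae_toReal_fluidEnergy_eq ha hγ hr h hρ hm) hNe
      hψ hψ0 hT' hψT
    have hψd := hψ.continuous_deriv le_rfl
    have h3 : ∫ t in Ioo 0 T, deriv ψ t * (E t + N t) =
        (∫ t in Ioo 0 T, deriv ψ t * E t) + ∫ t in Ioo 0 T, deriv ψ t * N t := by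
      rw [← integral_add (hmul _ hψd hEm hEb) (hmul _ hψd hN hNb)]
      exact integral_congr_ae (.of_forall fun t => mul_add _ _ _)
    rw [hE0] at h2
    have h4 := h2.trans_eq h3
    linarith
  filter_upwards [hNe, hNe0] with t h1 h2
  rw [h1, h2]

theorem defectFlux_eq_zero {t : ℝ} (hv : Rv t = 0) (hp : Rp t = 0) (φ : ℝ → Space d → Space d) :
    defectFlux Rv Rp φ t = 0 := by
  simp [defectFlux, hv, hp]

end Euler

theorem theorem4p2 {d : ℕ} (hd : 1 ≤ d) (a γ T : ℝ) (ha : 0 < a) (hγ : 1 < γ) (hT : 0 < T)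
    (ρ : ℝ → Euler.Space d → ℝ) (m : ℝ → Euler.Space d → Euler.Space d)
    (hsol : Euler.IsDissipativeSolution a γ T ρ m)
    (hreg : Euler.InRegularityClass T ρ m)
    (D : ℝ → ℝ) (hD : MeasureTheory.IntegrableOn D (Set.Ioo 0 T))
    (hlip : Euler.OneSidedLipschitz T (Euler.velocity ρ m) D) :
    (∀ Rv Rp, Euler.IsDissipativeSolutionWith a γ T ρ m Rv Rp →
      ∀ᵐ t ∂(MeasureTheory.volume.restrict (Set.Ioo 0 T)), Rv t = 0 ∧ Rp t = 0) ∧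
    Euler.IsWeakSolution a γ T ρ m := by
  have key : ∀ Rv Rp, Euler.IsDissipativeSolutionWith a γ T ρ m Rv Rp →
      ∀ᵐ t ∂(volume.restrict (Ioo 0 T)), Rv t = 0 ∧ Rp t = 0 := fun Rv Rp h => by
    filter_upwards [h.ae_defectEnergy_eq_zero ha hγ hT hreg hD hlip,
      Euler.ae_isDefect h.convectiveDefect h.pressureDefect] with t h0 ht
    exact Euler.eq_zero_of_defectEnergy_eq_zero hγ ht h0
  refine ⟨key, ?_⟩
  obtain ⟨Rv, Rp, h⟩ := hsol
  refine ⟨h.state, h.continuityEq, fun τ hτ φ hφ hn => ?_⟩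
  rw [h.momentumEq τ hτ φ hφ hn, add_eq_left, intervalIntegral.integral_of_le hτ.1.le,
    integral_Ioc_eq_integral_Ioo]
  refine integral_eq_zero_of_ae ?_
  filter_upwards [ae_restrict_of_ae_restrict_of_subset (Ioo_subset_Ioo_right hτ.2.le)
    (key Rv Rp h)] with t ht
  exact Euler.defectFlux_eq_zero ht.1 ht.2 φ
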